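/- **Setting.** Let $K$ be the number of views, $C$ the number of classes, $d$ the latent dimension, and $n\ge 10$. Samples are $Z=(X,Y)$ with $X=(X_1,\dots,X_K)\in\mathcal X_1\times\cdots\times\mathcal X_K$ and $Y\in[C]$, with law $\mu$. The training set $S=(X_i,Y_i)_{i\in[n]}\sim\mu^{\otimes n}$ and the ghost (test) set $S'=(X'_i,Y'_i)_{i\in[n]}\sim\mu^{\otimes n}$ are given. A stochastic learning algorithm $P_{W|S}$ maps $S$ to a model $W=(W_e,W_d)$, made of $K$ encoders $W_e=(W_{e,1},\dots,W_{e,K})$ and a decoder $W_d$. The stochastic encoders produce the latent variable $U=(U_1,\dots,U_K)\in(\mathbb R^d)^K$ of an input with law $P_{U|X,W_e}=\bigotimes_{k}P_{U_k|X_k,W_{e,k}}$, and the prediction is $\hat Y\sim P_{\hat Y|U,W_d}$ on $[C]$. Bold letters denote the $n$-vectors of the training set, and primed bold letters those of the ghost set; encoding and decoding act independently on the $2n$ samples, so that $$(S',S,W,\mathbf U,\mathbf U',\hat{\mathbf Y},\hat{\mathbf Y}')\sim P_{S'}\,P_{S,W}\,P_{\mathbf U,\mathbf U'|\mathbf X,\mathbf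 X',W_e}\,P_{\hat{\mathbf Y},\hat{\mathbf Y}'|\mathbf U,\mathbf U',W_d}.$$ **Definitions.** All logarithms, including those in the relative entropy $D_{KL}$, are to base $2$. Let $\hat{\mathcal L}(\mathbf y,\hat{\mathbf y})=\frac1n\sum_{i}\mathbf 1\{\hat y_i\ne y_i\}$, let $\hat p_{\mathbf y}$ be the empirical distribution of $\mathbf y$ on $[C]$, and let $$h_b(x)=-x\log x-(1-x)\log(1-x),\qquad h_D(x_1,x_2)=2h_b\Big(\tfrac{x_1+x_2}2\Big)-h_b(x_1)-h_b(x_2),$$ $$h_C(x_1,x_2;\epsilon)=\max_{0\le\epsilon'\le\min(\epsilon,\,(b-a)/2)}\big\{h_b(a+\epsilon')-h_b(a)+h_b(b-\epsilon')-h_b(b)\big\},\quad a=\min(x_1,x_2),\ b=\max(x_1,x_2).$$ A conditional prior $\mathbf Q(\mathbf U,\mathbf U'|\mathbf Y,\mathbf Y',\mathbf X,\mathbf X',W_e)$ on the $2n$ latent variables is *symmetric* if it is invariant under every permutation of the $2n$ latent variables by a permutation $\pi$ of the $2n$ indices that preserves all labels, i.e. such that the $i$-th and the $\pi(i)$-th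 labels coincide for all $i$. Let $$\mathrm{MDL}(\mathbf Q)=\mathbb E_{S,S',W_e}\big[D_{KL}\big(P_{\mathbf U,\mathbf U'|\mathbf X,\mathbf X',W_e}\,\big\|\,\mathbf Q\big)\big]\in[0,\infty].$$ **Theorem.** For every such $\mu$, learning algorithm, encoders and decoder, every symmetric conditional prior $\mathbf Q$, and every $n\ge 10$, $$\mathbb E\Big[h_D\big(\hat{\mathcal L}(\mathbf Y',\hat{\mathbf Y}'),\hat{\mathcal L}(\mathbf Y,\hat{\mathbf Y})\big)\Big]\le\frac{\mathrm{MDL}(\mathbf Q)+\log n}{n}+\mathbb E\Big[h_C\Big(\hat{\mathcal L}(\mathbf Y,\hat{\mathbf Y}),\hat{\mathcal L}(\mathbf Y',\hat{\mathbf Y}');\tfrac12\big\|\hat p_{\mathbf Y}-\hat p_{\mathbf Y'}\big\|_1\Big)\Big].$$ -/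

import Mathlib

open MeasureTheory ProbabilityTheory InformationTheory
open scoped ENNReal

noncomputable section

namespace MultiView

/-! ### Products of Markov kernels -/

lemma measurable_measure_pi {ι : Type*} [Fintype ι] {α : Type*} [MeasurableSpace α]
    {β : ι → Type*} [∀ i, MeasurableSpace (β i)] (κ : ∀ i, Kernel α (β i))
    [∀ i, IsMarkovKernel (κ i)] :
    Measurable fun a => Measure.pi fun i => κ i a := by
  refine Measurable.measure_of_isPiSystem_of_isProbabilityMeasure
    generateFrom_pi.symm isPiSystem_pi ?_
  rintro _ ⟨t, ht, rfl⟩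
  simp only [Set.mem_univ_pi, Set.mem_ofPred_eq] at ht
  simp only [Measure.pi_pi]
  exact Finset.measurable_fun_prod _ fun i _ => (κ i).measurable_coe (ht i)

/-- The product kernel `a ↦ ⨂ i, κ i a`. -/
def piKernel {ι : Type*} [Fintype ι] {α : Type*} [MeasurableSpace α]
    {β : ι → Type*} [∀ i, MeasurableSpace (β i)] (κ : ∀ i, Kernel α (β i))
    [∀ i, IsMarkovKernel (κ i)] : Kernel α (∀ i, β i) where
  toFun a := Measure.pi fun i => κ i a
  measurable' := measurable_measure_pi κ

instance {ι : Type*} [Fintype ι] {α : Type*} [MeasurableSpace α]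
    {β : ι → Type*} [∀ i, MeasurableSpace (β i)] (κ : ∀ i, Kernel α (β i))
    [∀ i, IsMarkovKernel (κ i)] : IsMarkovKernel (piKernel κ) :=
  ⟨fun a => inferInstanceAs (IsProbabilityMeasure (Measure.pi fun i => κ i a))⟩

/-- Independent application of a parametrised kernel to each entry of a family `(x i)`:
`((x i), θ) ↦ ⨂ i, κ (x i, θ)`. -/
def samplewise (I : Type*) [Fintype I] {α β θ : Type*} [MeasurableSpace α] [MeasurableSpace β]
    [MeasurableSpace θ] (κ : Kernel (α × θ) β) [IsMarkovKernel κ] :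
    Kernel ((I → α) × θ) (I → β) :=
  piKernel fun i => κ.comap (fun z : (I → α) × θ => (z.1 i, z.2)) (by fun_prop)

instance (I : Type*) [Fintype I] {α β θ : Type*} [MeasurableSpace α] [MeasurableSpace β]
    [MeasurableSpace θ] (κ : Kernel (α × θ) β) [IsMarkovKernel κ] :
    IsMarkovKernel (samplewise I κ) := by
  unfold samplewise; infer_instance

/-! ### The functions `h_b`, `h_D`, `h_C`, in bits -/

/-- The binary Shannon entropy, in bits. -/
def hb (x : ℝ) : ℝ := -x * Real.logb 2 x - (1 - x) * Real.logb 2 (1 - x)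

def hD (x₁ x₂ : ℝ) : ℝ := 2 * hb ((x₁ + x₂) / 2) - hb x₁ - hb x₂

/-- The supremum is that of a continuous function on a compact interval, hence a maximum. -/
def hC (x₁ x₂ ε : ℝ) : ℝ :=
  sSup ((fun ε' : ℝ =>
      hb (min x₁ x₂ + ε') - hb (min x₁ x₂) + hb (max x₁ x₂ - ε') - hb (max x₁ x₂)) ''
    Set.Icc 0 (min ε ((max x₁ x₂ - min x₁ x₂) / 2)))

/-! ### Empirical quantities -/

/-- The fraction of wrong predictions, `(1/n) ∑ i, 1{ŷ i ≠ y i}`. -/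
def empRisk {n C : ℕ} (y yhat : Fin n → Fin C) : ℝ :=
  (1 / (n : ℝ)) * ∑ i, if yhat i ≠ y i then (1 : ℝ) else 0

/-- The empirical distribution of a label vector. -/
def empDist {n C : ℕ} (y : Fin n → Fin C) (c : Fin C) : ℝ :=
  (1 / (n : ℝ)) * ∑ i, if y i = c then (1 : ℝ) else 0

/-- The `L¹` distance of the empirical label distributions. -/
def empDistL1 {n C : ℕ} (y y' : Fin n → Fin C) : ℝ :=
  ∑ c, |empDist y c - empDist y' c|

/-! ### The learning setup

A sample is `z = (x, y)` with `x = (x_1, …, x_K)` and `y ∈ Fin C`. The `2 n` samples of the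
training set (`Sum.inl`) and of the ghost set (`Sum.inr`) are indexed by `Fin n ⊕ Fin n`. -/

/-- The latent variables `(U_1, …, U_K)` of one sample, each in `ℝ^d`. -/
abbrev Latent (K d : ℕ) : Type := Fin K → EuclideanSpace ℝ (Fin d)

/-- A data set of `n` samples. -/
abbrev Dataset {K : ℕ} (𝒳 : Fin K → Type*) (C n : ℕ) := Fin n → (∀ k, 𝒳 k) × Fin C

/-- `Z^{2n} = (S, S')`: training samples first, ghost samples second. -/
def pool {n : ℕ} {α : Type*} (s s' : Fin n → α) : Fin n ⊕ Fin n → α := Sum.elim s s'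

lemma measurable_pool {n : ℕ} {Ω α : Type*} [MeasurableSpace Ω] [MeasurableSpace α]
    {f g : Ω → Fin n → α} (hf : Measurable f) (hg : Measurable g) :
    Measurable fun ω => pool (f ω) (g ω) := by
  refine measurable_pi_lambda _ ?_
  rintro (i | i)
  · exact (measurable_pi_apply i).comp hf
  · exact (measurable_pi_apply i).comp hg

section Setup

variable {K C n d : ℕ} {𝒳 : Fin K → Type*} [∀ k, MeasurableSpace (𝒳 k)]
  {𝒲e : Fin K → Type*} [∀ k, MeasurableSpace (𝒲e k)] {𝒲d : Type*} [MeasurableSpace 𝒲d]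

/-- `P_{U|X,W_e} = ⨂ k, P_{U_k|X_k,W_{e,k}}`: each client encodes its own view. -/
def encoder (enc : ∀ k, Kernel (𝒳 k × 𝒲e k) (EuclideanSpace ℝ (Fin d)))
    [∀ k, IsMarkovKernel (enc k)] : Kernel ((∀ k, 𝒳 k) × (∀ k, 𝒲e k)) (Latent K d) :=
  piKernel fun k => (enc k).comap
    (fun z : (∀ k, 𝒳 k) × (∀ k, 𝒲e k) => (z.1 k, z.2 k)) (by fun_prop)

instance (enc : ∀ k, Kernel (𝒳 k × 𝒲e k) (EuclideanSpace ℝ (Fin d)))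
    [∀ k, IsMarkovKernel (enc k)] : IsMarkovKernel (encoder enc) := by
  unfold encoder; infer_instance

/-- The law `P_{S'} P_{S,W}` of the ghost set, the training set and the model
`W = (W_e, W_d)`, where `S, S' ∼ μ^{⊗ n}` and `W ∼ P_{W|S}`. -/
def dataModelLaw (μ : Measure ((∀ k, 𝒳 k) × Fin C))
    (algo : Kernel (Dataset 𝒳 C n) ((∀ k, 𝒲e k) × 𝒲d)) :
    Measure (Dataset 𝒳 C n × Dataset 𝒳 C n × (∀ k, 𝒲e k) × 𝒲d) :=
  (Measure.pi fun _ : Fin n => μ).prod ((Measure.pi fun _ : Fin n => μ) ⊗ₘ algo)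

/-- `P_{U,U'|X,X',W_e}` as a kernel from the values of `(S', S, W)`. -/
def latentKernel (enc : ∀ k, Kernel (𝒳 k × 𝒲e k) (EuclideanSpace ℝ (Fin d)))
    [∀ k, IsMarkovKernel (enc k)] :
    Kernel (Dataset 𝒳 C n × Dataset 𝒳 C n × (∀ k, 𝒲e k) × 𝒲d)
      (Fin n ⊕ Fin n → Latent K d) :=
  (samplewise (Fin n ⊕ Fin n) (encoder enc)).comap
    (fun ω => (fun i => (pool ω.2.1 ω.1 i).1, ω.2.2.1)) (by
      have h := measurable_pool (n := n)
        (Ω := Dataset 𝒳 C n × Dataset 𝒳 C n × (∀ k, 𝒲e k) × 𝒲d)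
        (f := fun ω => ω.2.1) (g := fun ω => ω.1) (by fun_prop) (by fun_prop)
      exact (measurable_pi_lambda _ fun i => ((measurable_pi_apply i).comp h).fst).prodMk
        (by fun_prop))

/-- The joint law `P_{S'} P_{S,W} P_{U,U'|X,X',W_e} P_{Ŷ,Ŷ'|U,U',W_d}` of
`(((S', S, W), (U, U')), (Ŷ, Ŷ'))`. -/
def jointLaw (μ : Measure ((∀ k, 𝒳 k) × Fin C))
    (algo : Kernel (Dataset 𝒳 C n) ((∀ k, 𝒲e k) × 𝒲d))
    (enc : ∀ k, Kernel (𝒳 k × 𝒲e k) (EuclideanSpace ℝ (Fin d)))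
    [∀ k, IsMarkovKernel (enc k)]
    (dec : Kernel (Latent K d × 𝒲d) (Fin C)) [IsMarkovKernel dec] :
    Measure (((Dataset 𝒳 C n × Dataset 𝒳 C n × (∀ k, 𝒲e k) × 𝒲d) ×
      (Fin n ⊕ Fin n → Latent K d)) × (Fin n ⊕ Fin n → Fin C)) :=
  (dataModelLaw μ algo ⊗ₘ latentKernel enc) ⊗ₘ
    (samplewise (Fin n ⊕ Fin n) dec).comap (fun ω => (ω.2, ω.1.2.2.2)) (by fun_prop)

/-- The label vector of a data set. -/
def labels (s : Dataset 𝒳 C n) : Fin n → Fin C := fun i => (s i).2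

/-- A conditional prior `Q(U^{2n} | Y^{2n}, X^{2n}, W_e)` is symmetric if permuting the latent
variables by a permutation which preserves the labels leaves it unchanged. -/
def IsSymmetricPrior
    (Q : Kernel ((Fin n ⊕ Fin n → Fin C) × (Fin n ⊕ Fin n → ∀ k, 𝒳 k) × (∀ k, 𝒲e k))
      (Fin n ⊕ Fin n → Latent K d)) : Prop :=
  ∀ (y : Fin n ⊕ Fin n → Fin C) (x : Fin n ⊕ Fin n → ∀ k, 𝒳 k) (we : ∀ k, 𝒲e k)
    (π : Equiv.Perm (Fin n ⊕ Fin n)), (∀ i, y i = y (π i)) →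
    (Q (y, x, we)).map (fun u i => u (π i)) = Q (y, x, we)

/-- The minimum description length
`E_{S,S',W_e} [D_KL (P_{U,U'|X,X',W_e} ‖ Q(· | Y, Y', X, X', W_e))]`, in bits
(`klDiv` is the relative entropy in nats, `∞` when it is not finite). -/
def MDL (μ : Measure ((∀ k, 𝒳 k) × Fin C))
    (algo : Kernel (Dataset 𝒳 C n) ((∀ k, 𝒲e k) × 𝒲d))
    (enc : ∀ k, Kernel (𝒳 k × 𝒲e k) (EuclideanSpace ℝ (Fin d)))
    [∀ k, IsMarkovKernel (enc k)]
    (Q : Kernel ((Fin n ⊕ Fin n → Fin C) × (Fin n ⊕ Fin n → ∀ k, 𝒳 k) × (∀ k, 𝒲e k))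
      (Fin n ⊕ Fin n → Latent K d)) : ℝ≥0∞ :=
  ∫⁻ ω, klDiv (latentKernel enc ω)
      (Q (fun i => (pool ω.2.1 ω.1 i).2, fun i => (pool ω.2.1 ω.1 i).1, ω.2.2.1)) /
    ENNReal.ofReal (Real.log 2) ∂(dataModelLaw μ algo)

end Setup

end MultiView

end

/-! The argument fixes the labels of the pool of all `2 n` samples and measures how far `h_D - h_C`
can exceed the relative entropy. The *regret* of a labelling of the two halves (`HasRegret`,
`regret`) is the least `M`, in nats, such that `E[n (h_D - h_C)] ≤ KL(P ‖ q) + M` for every law `P` of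
independent error bits and every law `q` of error bits which is exchangeable among samples with equal
labels. Passing from latent variables to error bits is a data processing step: the decoder turns a
symmetric prior into such a law `q`, and lowers the relative entropy (`HasRegret.integral_le`). As the
labels are independent and identically distributed, the division of the pool into two halves is
uniform given the labels of the pool. So it suffices that the mean of the regret over the
`2 n choose n` splits of the pool is at most `log n` (`mean_regret_le`, `integral_regret_le`). No bound
by `log n` for a single split is used: a split which halves many classes at once may have a large
regret, but such splits are rare.

There are two bounds of the regret of a given split. The first, `hasRegret_tilt`, pairs training and
ghost samples of equal label as far as possible. The transport allowed by `h_C` mixes the bits of the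
unmatched pairs fully and of the matched ones partially (`hD_sub_hC_le`). Replacing the two error
rates by their means costs at most twice the entropy defect of a binomial law, which is at most `0.66`
by Hoeffding's comparison with binomial variables (`entropy_defect_fin`). At the means, `h_D` is the
mean logarithm of a product tilt of the matched samples (`exists_tilt`), with a gain from the
unmatched ones. The variational inequality (`sum_mul_log_le`) then leaves the expectation of the tilt
under an exchangeable law, which is bounded by averages over the arrangements within each class
(`sum_mul_prod_blocks_le`, `coeff_quadratic_pow_le`). The second bound, `hasRegret_balanced`, is for
splits which halve every class: by joint convexity `h_D` is a sum over the classes, and the error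
bits of a class are compared with the uniform law given their number of ones.

For the mean over the splits, the exponent of the first bound is controlled by a *score*: the odd
harmonic sums of the numbers of matched pairs, minus the imbalance of the class counts. Its
exponential moment over the splits is bounded class by class (`sum_exp_score_le`). If some class has
odd size, every split is unbalanced and this is enough (`sum_regret_le_of_odd`). Otherwise the
halving splits are treated apart; their proportion decreases with the number of classes, which leads
to the cases `meanRegretLe_one` to `meanRegretLe_five`. -/

open MeasureTheory ProbabilityTheory InformationTheory
open scoped ENNReal
noncomputable section
namespace MultiView
open Real

/-! ### Entropy and transport -/

lemma hb_eq (x : ℝ) : hb x = binEntropy x / log 2 := by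
  simp only [hb, logb, binEntropy, log_inv]; ring

/-- The function `h_D` in nats. -/
def hDn (x y : ℝ) : ℝ := 2 * binEntropy ((x + y) / 2) - binEntropy x - binEntropy y

lemma hDn_comm (x y : ℝ) : hDn x y = hDn y x := by
  simp only [hDn, add_comm x y]; ring

lemma continuous_hb : Continuous hb := by
  have : hb = fun x => binEntropy x / log 2 := funext hb_eq
  rw [this]; exact binEntropy_continuous.div_const _

/-- A concave function is larger at the inner pair of two pairs with the same midpoint. -/
lemma binEntropy_add_le {a b a' b' : ℝ} (ha : 0 ≤ a) (hb : b ≤ 1) (h1 : a ≤ a')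
    (h2 : a' ≤ b') (h : a + b = a' + b') :
    binEntropy a + binEntropy b ≤ binEntropy a' + binEntropy b' := by
  rcases eq_or_lt_of_le (show a ≤ b by linarith) with hab | hab
  · have e1 : a' = a := by linarith
    have e2 : b' = b := by linarith
    rw [e1, e2]
  have hc := strictConcave_binEntropy.concaveOn
  have hb' : b' ≤ b := by linarith
  have mA : a ∈ Set.Icc (0 : ℝ) 1 := ⟨ha, by linarith⟩
  have mB : b ∈ Set.Icc (0 : ℝ) 1 := ⟨by linarith, hb⟩
  set t := (a' - a) / (b - a) with ht
  have hba : 0 < b - a := by linarith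
  have t0 : 0 ≤ t := div_nonneg (by linarith) hba.le
  have t1 : t ≤ 1 := by rw [ht, div_le_one hba]; linarith
  have hta : t * (b - a) = a' - a := by rw [ht]; field_simp
  have k1 := hc.2 mA mB (sub_nonneg.2 t1) t0 (by ring)
  have k2 := hc.2 mB mA (sub_nonneg.2 t1) t0 (by ring)
  simp only [smul_eq_mul] at k1 k2
  rw [show (1 - t) * a + t * b = a' by linarith] at k1
  rw [show (1 - t) * b + t * a = b' by linarith] at k2
  linarith

/-- Transporting mass `s`, with `|s| ≤ ε`, from one argument of `h_D` to the other lowers it by at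
most `h_C`. -/
lemma hD_sub_hC_le {a b ε s : ℝ} (ha : a ∈ Set.Icc (0 : ℝ) 1) (hb : b ∈ Set.Icc (0 : ℝ) 1)
    (hs : |s| ≤ ε) (h1 : a + s ∈ Set.Icc (0 : ℝ) 1) (h2 : b - s ∈ Set.Icc (0 : ℝ) 1) :
    (hD b a - hC a b ε) * log 2 ≤ hDn (a + s) (b - s) := by
  have l2 : 0 < log 2 := log_pos (by norm_num)
  have hε : 0 ≤ ε := (abs_nonneg s).trans hs
  set lo := min a b
  set hi := max a b
  have hlh : lo ≤ hi := min_le_max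
  have hsum : lo + hi = a + b := min_add_max a b
  have hlo : 0 ≤ lo := le_min ha.1 hb.1
  have hhi : hi ≤ 1 := max_le ha.2 hb.2
  set m := min ε ((hi - lo) / 2)
  have hm : 0 ≤ m := le_min hε (by linarith)
  have hle : MultiView.hb (lo + m) - MultiView.hb lo + MultiView.hb (hi - m) - MultiView.hb hi
      ≤ hC a b ε := by
    refine le_csSup ?_ ⟨m, ⟨hm, le_rfl⟩, rfl⟩
    refine (isCompact_Icc.image ?_).bddAbove
    have := continuous_hb
    fun_prop
  have hpair : MultiView.hb lo + MultiView.hb hi = MultiView.hb a + MultiView.hb b := by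
    rcases le_total a b with h | h
    · simp only [lo, hi, min_eq_left h, max_eq_right h]
    · simp only [lo, hi, min_eq_right h, max_eq_left h]; ring
  have key : binEntropy (a + s) + binEntropy (b - s) ≤
      binEntropy (lo + m) + binEntropy (hi - m) := by
    have hs' := abs_le.1 hs
    have hord : lo + m ≤ hi - m := by
      have : m ≤ (hi - lo) / 2 := min_le_right _ _
      linarith
    have hcase : m = ε ∨ m = (hi - lo) / 2 := min_choice _ _
    have hlohi : (lo = a ∧ hi = b) ∨ (lo = b ∧ hi = a) := by
      rcases le_total a b with h | h
      · left; simp only [lo, hi, min_eq_left h, max_eq_right h, and_self]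
      · right; simp only [lo, hi, min_eq_right h, max_eq_left h, and_self]
    rcases le_total (a + s) (b - s) with h | h
    · refine binEntropy_add_le h1.1 h2.2 ?_ hord (by linarith)
      rcases hcase with hc | hc <;> rcases hlohi with ⟨e1, e2⟩ | ⟨e1, e2⟩ <;> linarith
    · rw [add_comm (binEntropy (a + s))]
      refine binEntropy_add_le h2.1 h1.2 ?_ hord (by linarith)
      rcases hcase with hc | hc <;> rcases hlohi with ⟨e1, e2⟩ | ⟨e1, e2⟩ <;> linarith
  have hle' : (hD b a - hC a b ε) ≤ (2 * MultiView.hb ((b + a) / 2)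
      - MultiView.hb (lo + m) - MultiView.hb (hi - m)) := by
    simp only [hD]; linarith
  refine (mul_le_mul_of_nonneg_right hle' l2.le).trans ?_
  simp only [hb_eq, hDn]
  rw [show a + s + (b - s) = b + a by ring]
  field_simp
  linarith

/-! ### Sums of independent Bernoulli variables -/

/-- The weight `p` or `1 - p` that a Bernoulli variable of parameter `p` gives to a bit. -/
def bw (p : ℝ) (b : Bool) : ℝ := if b then p else 1 - p

@[simp] lemma bw_true (p : ℝ) : bw p true = p := rfl
@[simp] lemma bw_false (p : ℝ) : bw p false = 1 - p := rfl

lemma bw_nonneg {p : ℝ} (h0 : 0 ≤ p) (h1 : p ≤ 1) (b : Bool) : 0 ≤ bw p b := by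
  cases b <;> simp [h0, h1]

/-- The law on bit vectors under which the bits are independent, of parameters `p i`. -/
def bprod {ι : Type*} [Fintype ι] (p : ι → ℝ) (e : ι → Bool) : ℝ := ∏ i, bw (p i) (e i)

/-- The number of ones of a bit vector. -/
def ones {ι : Type*} [Fintype ι] (e : ι → Bool) : ℕ := ∑ i, (e i).toNat

lemma bprod_nonneg {ι : Type*} [Fintype ι] {p : ι → ℝ} (hp : ∀ i, p i ∈ Set.Icc (0 : ℝ) 1)
    (e : ι → Bool) : 0 ≤ bprod p e :=
  Finset.prod_nonneg fun i _ => bw_nonneg (hp i).1 (hp i).2 _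

lemma sum_prod_bool {ι : Type*} [Fintype ι] [DecidableEq ι] (f : ι → Bool → ℝ) :
    ∑ e : ι → Bool, ∏ i, f i (e i) = ∏ i, (f i true + f i false) := by
  rw [← Fintype.prod_sum]
  simp

lemma sum_bprod {ι : Type*} [Fintype ι] [DecidableEq ι] (p : ι → ℝ) :
    ∑ e : ι → Bool, bprod p e = 1 := by
  unfold bprod
  rw [sum_prod_bool fun i => bw (p i)]
  simp

/-- The expectation of `g` at the number of successes of independent Bernoulli trials whose
parameters are the entries of the list. -/
def trialE : List ℝ → (ℕ → ℝ) → ℝ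
  | [], g => g 0
  | p :: l, g => (1 - p) * trialE l g + p * trialE l (fun k => g (k + 1))

lemma trialE_mono {l : List ℝ} (hl : ∀ p ∈ l, p ∈ Set.Icc (0 : ℝ) 1) {g g' : ℕ → ℝ}
    (h : ∀ k ≤ l.length, g k ≤ g' k) : trialE l g ≤ trialE l g' := by
  induction l generalizing g g' with
  | nil => exact h 0 le_rfl
  | cons p l ih =>
    have hp := hl p (by simp)
    have h1 := ih (fun r hr => hl r (by simp [hr])) (g := g) (g' := g')
      (fun k hk => h k (by simp; omega))
    have h2 := ih (fun r hr => hl r (by simp [hr])) (g := fun k => g (k + 1))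
      (g' := fun k => g' (k + 1)) (fun k hk => h (k + 1) (by simp; omega))
    simp only [trialE]
    have := mul_le_mul_of_nonneg_left h1 (sub_nonneg.2 hp.2)
    have := mul_le_mul_of_nonneg_left h2 hp.1
    linarith

lemma trialE_add (l : List ℝ) (g g' : ℕ → ℝ) :
    trialE l (fun k => g k + g' k) = trialE l g + trialE l g' := by
  induction l generalizing g g' with
  | nil => rfl
  | cons p l ih => simp only [trialE, ih]; ring

lemma trialE_mul (l : List ℝ) (c : ℝ) (g : ℕ → ℝ) :
    trialE l (fun k => c * g k) = c * trialE l g := by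
  induction l generalizing g with
  | nil => rfl
  | cons p l ih => simp only [trialE, ih]; ring

lemma trialE_sub (l : List ℝ) (g g' : ℕ → ℝ) :
    trialE l (fun k => g k - g' k) = trialE l g - trialE l g' := by
  induction l generalizing g g' with
  | nil => rfl
  | cons p l ih => simp only [trialE, ih]; ring

lemma trialE_const (l : List ℝ) (c : ℝ) : trialE l (fun _ => c) = c := by
  induction l with
  | nil => rfl
  | cons p l ih => simp only [trialE, ih]; ring

lemma trialE_perm {l l' : List ℝ} (h : l.Perm l') (g : ℕ → ℝ) : trialE l g = trialE l' g := by
  induction h generalizing g with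
  | nil => rfl
  | cons p _ ih => simp only [trialE, ih]
  | swap p r l => simp only [trialE]; ring
  | trans _ _ ih1 ih2 => rw [ih1, ih2]

/-- Moving two parameters towards each other, with fixed sum, spreads the number of successes. -/
lemma trialE_smooth {p r p' r' : ℝ} {l : List ℝ} (hl : ∀ x ∈ l, x ∈ Set.Icc (0 : ℝ) 1)
    (hs : p + r = p' + r') (hpr : p * r ≤ p' * r') {g : ℕ → ℝ}
    (hg : ∀ k, k + 2 ≤ l.length + 2 → 2 * g (k + 1) ≤ g k + g (k + 2)) :
    trialE (p :: r :: l) g ≤ trialE (p' :: r' :: l) g := by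
  have key : 0 ≤ trialE l (fun k => g k + g (k + 2) - 2 * g (k + 1)) := by
    rw [← trialE_const l 0]
    exact trialE_mono hl fun k hk => by have := hg k (by omega); linarith
  rw [trialE_sub, trialE_add, trialE_mul] at key
  simp only [trialE, add_assoc, Nat.reduceAdd]
  have hr : r' = p + r - p' := by linarith
  subst hr
  have := mul_nonneg (sub_nonneg.2 hpr) key
  nlinarith [this]

/-- Hoeffding: for a convex function, independent Bernoulli trials are dominated by
a binomial variable of the same mean. -/
lemma trialE_le_replicate (μ : ℝ) (l : List ℝ) (hl : ∀ x ∈ l, x ∈ Set.Icc (0 : ℝ) 1)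
    (hμ : l.sum = l.length * μ) {g : ℕ → ℝ}
    (hg : ∀ k, k + 2 ≤ l.length → 2 * g (k + 1) ≤ g k + g (k + 2)) :
    trialE l g ≤ trialE (List.replicate l.length μ) g := by
  classical
  suffices H : ∀ m, ∀ l : List ℝ, (∀ x ∈ l, x ∈ Set.Icc (0 : ℝ) 1) →
      l.sum = l.length * μ → (l.countP (· ≠ μ)) ≤ m →
      (∀ k, k + 2 ≤ l.length → 2 * g (k + 1) ≤ g k + g (k + 2)) →
      trialE l g ≤ trialE (List.replicate l.length μ) g from H _ l hl hμ le_rfl hg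
  intro m
  induction m with
  | zero =>
    intro l _ _ hc _
    have : ∀ x ∈ l, x = μ := by
      have := List.countP_eq_zero.1 (Nat.le_zero.1 hc)
      intro x hx; simpa using this x hx
    rw [← List.eq_replicate_iff.2 ⟨rfl, this⟩]
  | succ m ih =>
    intro l hl hμ hc hg
    by_cases hall : ∀ x ∈ l, x = μ
    · rw [← List.eq_replicate_iff.2 ⟨rfl, hall⟩]
    -- a list with a wrong entry has one below and one above the mean
    have hlow : ∃ p ∈ l, p < μ := by
      by_contra hcon
      push Not at hcon hall
      obtain ⟨x, hx, hne⟩ := hall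
      have hxl : μ < x := lt_of_le_of_ne (hcon x hx) hne.symm
      have := List.sum_lt_sum (f := fun _ : ℝ => μ) (g := fun x => x) (l := l)
        (fun i hi => hcon i hi) ⟨x, hx, hxl⟩
      simp at this; linarith
    have hhigh : ∃ p ∈ l, μ < p := by
      by_contra hcon
      push Not at hcon hall
      obtain ⟨x, hx, hne⟩ := hall
      have hxl : x < μ := lt_of_le_of_ne (hcon x hx) hne
      have := List.sum_lt_sum (f := fun x : ℝ => x) (g := fun _ => μ) (l := l)
        (fun i hi => hcon i hi) ⟨x, hx, hxl⟩
      simp at this; linarith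
    obtain ⟨p, hp, hpμ⟩ := hlow
    obtain ⟨r, hr, hrμ⟩ := hhigh
    have hr' : r ∈ l.erase p := (List.mem_erase_of_ne (ne_of_gt (hpμ.trans hrμ))).2 hr
    set l' := (l.erase p).erase r with hl'
    have hperm : l.Perm (p :: r :: l') :=
      (List.perm_cons_erase hp).trans ((List.perm_cons_erase hr').cons p)
    have hlen : l.length = l'.length + 2 := by simpa using hperm.length_eq
    have hl'm : ∀ x ∈ l', x ∈ Set.Icc (0 : ℝ) 1 := fun x hx =>
      hl x (hperm.mem_iff.2 (by simp [hx]))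
    have hp01 := hl p hp
    have hr01 := hl r hr
    have hsum : p + (r + l'.sum) = l.length * μ := by
      rw [← hμ, hperm.sum_eq]; simp
    have hcount : l.countP (· ≠ μ) = 2 + l'.countP (· ≠ μ) := by
      rw [hperm.countP_eq]
      rw [List.countP_cons_of_pos (by simpa using hpμ.ne),
        List.countP_cons_of_pos (by simpa using hrμ.ne')]; omega
    rw [trialE_perm hperm]
    refine (trialE_smooth (p' := μ) (r' := p + r - μ) hl'm (by ring) ?_ ?_).trans ?_
    · nlinarith
    · intro k hk; exact hg k (by omega)
    · have hlen2 : (μ :: (p + r - μ) :: l').length = l.length := by simp [hlen]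
      rw [← hlen2]
      refine ih _ ?_ ?_ ?_ ?_
      · intro x hx
        simp only [List.mem_cons] at hx
        rcases hx with rfl | rfl | hx
        · exact ⟨hp01.1.trans hpμ.le, hrμ.le.trans hr01.2⟩
        · exact ⟨by linarith [hp01.1], by linarith [hr01.2]⟩
        · exact hl'm x hx
      · rw [hlen2]; simp; linarith
      · rw [List.countP_cons_of_neg (by simp)]
        have := List.countP_cons (p := fun x => decide (x ≠ μ)) (a := p + r - μ) (l := l')
        rw [this]; split_ifs <;> omega
      · rw [hlen2]; exact hg

lemma ones_cons {n : ℕ} (b : Bool) (e : Fin n → Bool) :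
    ones (Fin.cons b e : Fin (n + 1) → Bool) = b.toNat + ones e := by
  simp [ones, Fin.sum_univ_succ]

lemma sum_bprod_ones {n : ℕ} (p : Fin n → ℝ) (g : ℕ → ℝ) :
    ∑ e : Fin n → Bool, bprod p e * g (ones e) = trialE (List.ofFn p) g := by
  induction n generalizing g with
  | zero => simp [bprod, ones, trialE]
  | succ n ih =>
    rw [← (Fin.consEquiv fun _ : Fin (n + 1) => Bool).sum_comp, Fintype.sum_prod_type]
    simp only [Fin.consEquiv, Equiv.coe_fn_mk, ones_cons, List.ofFn_succ, trialE]
    rw [← ih (fun i => p i.succ) g, ← ih (fun i => p i.succ) (fun k => g (k + 1))]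
    simp only [Fintype.sum_bool, bprod, Fin.prod_univ_succ, Fin.cons_zero, Fin.cons_succ, bw_true,
      bw_false, Finset.mul_sum, Bool.toNat_true, Bool.toNat_false, zero_add]
    rw [add_comm]
    congr 1
    · exact Finset.sum_congr rfl fun e _ => by ring
    · exact Finset.sum_congr rfl fun e _ => by rw [add_comm 1]; ring

/-! ### The entropy defect of the binomial law -/

/-- A third-order Taylor bound of the logarithm. -/
lemma log_le_cubic {u : ℝ} (hu : 0 < u) :
    log u ≤ (u - 1) - (u - 1) ^ 2 / 2 + (u - 1) ^ 3 / 3 := by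
  set f : ℝ → ℝ := fun u => (u - 1) - (u - 1) ^ 2 / 2 + (u - 1) ^ 3 / 3 - log u with hf
  have hd : ∀ x : ℝ, 0 < x → HasDerivAt f ((x - 1) ^ 3 / x) x := by
    intro x hx
    have h1 : HasDerivAt (fun u : ℝ => u - 1) 1 x := (hasDerivAt_id x).sub_const 1
    have := ((h1.sub ((h1.pow 2).div_const 2)).add ((h1.pow 3).div_const 3)).sub
      (hasDerivAt_log hx.ne')
    refine this.congr_deriv ?_
    field_simp
    ring
  have h1 : f 1 = 0 := by simp [hf]
  suffices 0 ≤ f u by simp only [hf] at this; linarith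
  rw [← h1]
  rcases le_total 1 u with h | h
  · refine monotoneOn_of_deriv_nonneg (convex_Ici 1) (fun x hx => ?_) (fun x hx => ?_)
      (fun x hx => ?_) (Set.mem_Ici.2 le_rfl) (Set.mem_Ici.2 h) h
    · exact (hd x (by linarith [Set.mem_Ici.1 hx])).continuousAt.continuousWithinAt
    · rw [interior_Ici] at hx
      exact (hd x (by linarith [Set.mem_Ioi.1 hx])).differentiableAt.differentiableWithinAt
    · rw [interior_Ici] at hx
      have hx1 : 1 < x := hx
      rw [(hd x (by linarith)).deriv]
      exact div_nonneg (pow_nonneg (by linarith) 3) (by linarith)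
  · refine antitoneOn_of_deriv_nonpos (convex_Ioc 0 1) (fun x hx => ?_) (fun x hx => ?_)
      (fun x hx => ?_) ⟨hu, h⟩ (⟨one_pos, le_rfl⟩ : (1 : ℝ) ∈ Set.Ioc (0 : ℝ) 1) h
    · exact (hd x hx.1).continuousAt.continuousWithinAt
    · rw [interior_Ioc] at hx
      exact (hd x hx.1).differentiableAt.differentiableWithinAt
    · rw [interior_Ioc] at hx
      rw [(hd x hx.1).deriv]
      refine div_nonpos_of_nonpos_of_nonneg ?_ hx.1.le
      have : 0 ≤ (1 - x) ^ 3 := pow_nonneg (by linarith [hx.2]) 3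
      nlinarith

/-- A Padé bound of the logarithm. -/
lemma log_one_add_le {x : ℝ} (hx : 0 ≤ x) : log (1 + x) ≤ x * (6 + x) / (6 + 4 * x) := by
  set f : ℝ → ℝ := fun x => x * (6 + x) / (6 + 4 * x) - log (1 + x) with hf
  have hd : ∀ x : ℝ, 0 ≤ x → HasDerivAt f (4 * x ^ 3 / ((6 + 4 * x) ^ 2 * (1 + x))) x := by
    intro x hx
    have hid := hasDerivAt_id x
    have h1 : HasDerivAt (fun x : ℝ => 6 + x) 1 x := hid.const_add 6
    have h2 : HasDerivAt (fun x : ℝ => 6 + 4 * x) (4 * 1) x := (hid.const_mul 4).const_add 6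
    have h3 : HasDerivAt (fun x : ℝ => 1 + x) 1 x := hid.const_add 1
    have := ((hid.mul h1).div h2 (by positivity)).sub (h3.log (by positivity))
    refine this.congr_deriv ?_
    simp only [id, Pi.mul_apply]
    field_simp
    ring
  suffices f 0 ≤ f x by simp [hf] at this; linarith
  refine monotoneOn_of_deriv_nonneg (convex_Ici 0) (fun x hx => ?_) (fun x hx => ?_)
      (fun x hx => ?_) (Set.mem_Ici.2 le_rfl) (Set.mem_Ici.2 hx) hx
  · exact (hd x hx).continuousAt.continuousWithinAt
  · rw [interior_Ici] at hx
    exact (hd x (le_of_lt hx)).differentiableAt.differentiableWithinAt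
  · rw [interior_Ici] at hx
    have hx1 : 0 < x := hx
    rw [(hd x hx1.le).deriv]
    positivity

lemma trialE_congr {l : List ℝ} {g g' : ℕ → ℝ}
    (h : ∀ k ≤ l.length, g k = g' k) : trialE l g = trialE l g' := by
  induction l generalizing g g' with
  | nil => exact h 0 le_rfl
  | cons p l ih =>
    simp only [trialE]
    rw [ih (g := g) (g' := g') (fun k hk => h k (by simp; omega)),
      ih (g := fun k => g (k + 1)) (g' := fun k => g' (k + 1))
        (fun k hk => h (k + 1) (by simp; omega))]

/-- The expectation of `g` under the binomial law of parameters `n` and `p`. -/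
def binE (n : ℕ) (p : ℝ) (g : ℕ → ℝ) : ℝ := trialE (List.replicate n p) g

lemma binE_zero (p : ℝ) (g : ℕ → ℝ) : binE 0 p g = g 0 := rfl

lemma binE_succ (n : ℕ) (p : ℝ) (g : ℕ → ℝ) :
    binE (n + 1) p g = (1 - p) * binE n p g + p * binE n p (fun k => g (k + 1)) := rfl

lemma binE_mono {n : ℕ} {p : ℝ} (hp : p ∈ Set.Icc (0 : ℝ) 1) {g g' : ℕ → ℝ}
    (h : ∀ k ≤ n, g k ≤ g' k) : binE n p g ≤ binE n p g' :=
  trialE_mono (fun r hr => by rw [List.eq_of_mem_replicate hr]; exact hp)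
    (by simpa using h)

/-- Size biasing of the binomial law. -/
lemma binE_size_bias (n : ℕ) (p : ℝ) (f : ℕ → ℝ) :
    binE (n + 1) p (fun k => k * f k) = (n + 1) * p * binE n p (fun k => f (k + 1)) := by
  induction n generalizing f with
  | zero => simp [binE_succ, binE_zero]
  | succ n ih =>
    rw [binE_succ, ih f]
    have h1 : binE (n + 1) p (fun k => ((k + 1 : ℕ) : ℝ) * f (k + 1)) =
        binE (n + 1) p (fun k => (k : ℝ) * f (k + 1)) + binE (n + 1) p (fun k => f (k + 1)) := by
      unfold binE
      rw [← trialE_add]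
      congr 1; funext k; push_cast; ring
    rw [h1, ih (fun k => f (k + 1)), binE_succ n p (fun k => f (k + 1))]
    push_cast
    ring

lemma binE_reflect (n : ℕ) (p : ℝ) (g : ℕ → ℝ) :
    binE n p g = binE n (1 - p) (fun k => g (n - k)) := by
  induction n generalizing g with
  | zero => rfl
  | succ n ih =>
    rw [binE_succ, binE_succ, ih g, ih fun k => g (k + 1)]
    have h1 : binE n (1 - p) (fun k => g (n - k + 1)) = binE n (1 - p) (fun k => g (n + 1 - k)) :=
      trialE_congr fun k hk => by
        simp only [List.length_replicate] at hk
        rw [Nat.succ_sub hk]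
    simp only [Nat.add_sub_add_right]
    rw [h1]; ring

lemma binE_moment_one (n : ℕ) (p a : ℝ) : binE n p (fun k => (k + a)) = n * p + a := by
  induction n generalizing a with
  | zero => simp [binE_zero]
  | succ n ih =>
    rw [binE_succ, ih]
    have := ih (a + 1)
    simp only [Nat.cast_add, Nat.cast_one]
    simp only [add_assoc, add_comm 1 a]
    rw [this]; ring

lemma binE_moment_two (n : ℕ) (p a : ℝ) :
    binE n p (fun k => (k + a) ^ 2) = (n * p + a) ^ 2 + n * p * (1 - p) := by
  induction n generalizing a with
  | zero => simp [binE_zero]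
  | succ n ih =>
    rw [binE_succ, ih]
    have := ih (a + 1)
    simp only [Nat.cast_add, Nat.cast_one]
    simp only [add_assoc, add_comm 1 a]
    rw [this]; ring

lemma binE_moment_three (n : ℕ) (p a : ℝ) :
    binE n p (fun k => (k + a) ^ 3) =
      (n * p + a) ^ 3 + 3 * (n * p + a) * (n * p * (1 - p)) + n * p * (1 - p) * (1 - 2 * p) := by
  induction n generalizing a with
  | zero => simp [binE_zero]
  | succ n ih =>
    rw [binE_succ, ih]
    have := ih (a + 1)
    simp only [Nat.cast_add, Nat.cast_one]
    simp only [add_assoc, add_comm 1 a]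
    rw [this]; ring

/-- The expected third-order expansion of `log ((k + 1) / (n p))`, with `N = n - 1` trials. -/
lemma binE_log_succ_le (N : ℕ) {p : ℝ} (h0 : 0 < p) (h1 : p ≤ 1) :
    binE N p (fun k => log ((k + 1) / ((N + 1) * p))) ≤
      log ((N * p + 1) / ((N + 1) * p)) - N * p * (1 - p) / (2 * (N * p + 1) ^ 2)
        + N * p * (1 - p) * (1 - 2 * p) / (3 * (N * p + 1) ^ 3) := by
  have hc : (0 : ℝ) < N * p + 1 := by positivity
  have hl : (0 : ℝ) < (N + 1) * p := by positivity
  set c : ℝ := N * p + 1 with hcdef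
  have hpt : ∀ k ≤ N, log (((k : ℝ) + 1) / ((N + 1) * p)) ≤
      log (c / ((N + 1) * p)) + ((1 / c) * (k + (1 - c)) + ((-1 / (2 * c ^ 2)) * (k + (1 - c)) ^ 2
        + (1 / (3 * c ^ 3)) * (k + (1 - c)) ^ 3)) := by
    intro k _
    have hk : (0 : ℝ) < k + 1 := by positivity
    have := log_le_cubic (div_pos hk hc)
    rw [show ((k : ℝ) + 1) / ((N + 1) * p) = (c / ((N + 1) * p)) * ((k + 1) / c) by
      field_simp, log_mul (by positivity) (by positivity)]
    refine add_le_add le_rfl (this.trans (le_of_eq ?_))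
    field_simp
    ring
  refine (binE_mono ⟨h0.le, h1⟩ hpt).trans (le_of_eq ?_)
  have e1 := binE_moment_one N p (1 - c)
  have e2 := binE_moment_two N p (1 - c)
  have e3 := binE_moment_three N p (1 - c)
  have z : N * p + (1 - c) = 0 := by rw [hcdef]; ring
  rw [z] at e1 e2 e3
  unfold binE at *
  rw [trialE_add, trialE_const, trialE_add, trialE_add, trialE_mul, trialE_mul, trialE_mul,
    e1, e2, e3]
  field_simp
  ring

/-- The contribution of the ones to the entropy defect of the binomial law. Here `κ` is a lower bound
of `(n - 1) / n` for `n = N + 1` trials, which enters the negative third-order term, and `r` stands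
for `n p / (1 - p)`. -/
lemma binE_mul_log_le {N : ℕ} {p κ J : ℝ} (h0 : 0 < p) (h1 : p < 1)
    (hκ0 : 0 ≤ κ) (hκ : κ * (N + 1) ≤ N)
    (hJ : ∀ r : ℝ, 0 ≤ r → (6 * r + 1) * (r + 1) ^ 3 ≤
      J * ((6 * r + 4) * (r + 1) ^ 3) + κ * (r ^ 2 * (r / 2 + 1 / 6) * (6 * r + 4))) :
    binE (N + 1) p (fun k => k * log (k / ((N + 1) * p))) ≤ (1 - p) * J := by
  have hb := binE_log_succ_le N h0 h1.le
  have hs := binE_size_bias N p (fun k => log (k / ((N + 1) * p)))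
  rw [hs]
  push_cast
  set y : ℝ := (N + 1) * p with hy
  have hy0 : 0 < y := by positivity
  set m : ℝ := 1 - p with hm
  have hm0 : 0 < m := by linarith
  have hc : (N : ℝ) * p + 1 = y + m := by rw [hy, hm]; ring
  refine (mul_le_mul_of_nonneg_left hb hy0.le).trans ?_
  rw [hc]
  have hlog : log ((y + m) / y) ≤ (m / y) * (6 + m / y) / (6 + 4 * (m / y)) := by
    rw [show (y + m) / y = 1 + m / y by field_simp]
    exact log_one_add_le (by positivity)
  have e1 : y * ((m / y) * (6 + m / y) / (6 + 4 * (m / y))) = m * ((6 * y + m) / (6 * y + 4 * m)) := by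
    field_simp
  have hNp : κ * y ≤ N * p := by rw [hy]; nlinarith
  have e2 : y * (-(N * p * m / (2 * (y + m) ^ 2)) + N * p * m * (1 - 2 * p) / (3 * (y + m) ^ 3)) ≤
      - (m * (κ * (y ^ 2 * (y / 2 + m / 6) / (y + m) ^ 3))) := by
    have : y * (-(N * p * m / (2 * (y + m) ^ 2)) + N * p * m * (1 - 2 * p) / (3 * (y + m) ^ 3)) =
      - ((N * p) * (m * (y * ((y + m) / 2 - (1 - 2 * p) / 3) / (y + m) ^ 3))) := by
      field_simp; ring
    rw [this, neg_le_neg_iff]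
    have hin : y / 2 + m / 6 ≤ (y + m) / 2 - (1 - 2 * p) / 3 := by rw [hm]; linarith
    calc m * (κ * (y ^ 2 * (y / 2 + m / 6) / (y + m) ^ 3))
        = (κ * y) * (m * (y * (y / 2 + m / 6) / (y + m) ^ 3)) := by ring
      _ ≤ (N * p) * (m * (y * (y / 2 + m / 6) / (y + m) ^ 3)) := by gcongr
      _ ≤ _ := by gcongr
  have hr := hJ (y / m) (by positivity)
  have e3 : (6 * y + m) / (6 * y + 4 * m) ≤ J + κ * (y ^ 2 * (y / 2 + m / 6) / (y + m) ^ 3) := by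
    have hr' : (6 * y + m) * (y + m) ^ 3 ≤
        J * ((6 * y + 4 * m) * (y + m) ^ 3) + κ * (y ^ 2 * (y / 2 + m / 6) * (6 * y + 4 * m)) := by
      have := mul_le_mul_of_nonneg_right hr (show 0 ≤ m ^ 4 by positivity)
      have a1 : (6 * (y / m) + 1) * (y / m + 1) ^ 3 * m ^ 4 = (6 * y + m) * (y + m) ^ 3 := by
        field_simp
      have a2 : (J * ((6 * (y / m) + 4) * (y / m + 1) ^ 3) +
        κ * ((y / m) ^ 2 * (y / m / 2 + 1 / 6) * (6 * (y / m) + 4))) * m ^ 4 =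
        J * ((6 * y + 4 * m) * (y + m) ^ 3) + κ * (y ^ 2 * (y / 2 + m / 6) * (6 * y + 4 * m)) := by
        field_simp
      rwa [a1, a2] at this
    rw [div_le_iff₀ (by positivity)]
    have : (J + κ * (y ^ 2 * (y / 2 + m / 6) / (y + m) ^ 3)) * (6 * y + 4 * m) =
      (J * ((6 * y + 4 * m) * (y + m) ^ 3) + κ * (y ^ 2 * (y / 2 + m / 6) * (6 * y + 4 * m)))
        / (y + m) ^ 3 := by field_simp
    rw [this, le_div_iff₀ (by positivity)]
    exact hr'
  have e4 := mul_le_mul_of_nonneg_left e3 hm0.le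
  have e5 := mul_le_mul_of_nonneg_left hlog hy0.le
  rw [e1] at e5
  linarith

lemma mul_binEntropy_div {n k : ℕ} (hn : n ≠ 0) (hk : k ≤ n) {p : ℝ} (h0 : 0 < p) (h1 : p < 1) :
    n * binEntropy ((k : ℝ) / n) = - (k * log (k / (n * p))) -
      (((n - k : ℕ) : ℝ) * log (((n - k : ℕ) : ℝ) / (n * (1 - p)))) - k * log p
        - ((n - k : ℕ) : ℝ) * log (1 - p) := by
  have hn0 : (n : ℝ) ≠ 0 := by exact_mod_cast hn
  have aux : ∀ (j : ℕ) (p : ℝ), 0 < p → (j : ℝ) * log (j / (n * p)) =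
      j * log ((j : ℝ) / n) - j * log p := by
    intro j p hp
    rcases Nat.eq_zero_or_pos j with rfl | hj
    · simp
    have : (0 : ℝ) < j := by exact_mod_cast hj
    rw [← div_div, log_div (by positivity) hp.ne']; ring
  rw [aux k p h0, aux (n - k) (1 - p) (by linarith)]
  have : (1 : ℝ) - k / n = ((n - k : ℕ) : ℝ) / n := by
    rw [Nat.cast_sub hk]; field_simp
  simp only [binEntropy, this, log_inv]
  field_simp
  ring

lemma binE_entropy_defect {N : ℕ} {p κ J : ℝ} (hp : p ∈ Set.Icc (0 : ℝ) 1)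
    (hκ0 : 0 ≤ κ) (hκ : κ * (N + 1) ≤ N) (hJ0 : 0 ≤ J)
    (hJ : ∀ r : ℝ, 0 ≤ r → (6 * r + 1) * (r + 1) ^ 3 ≤
      J * ((6 * r + 4) * (r + 1) ^ 3) + κ * (r ^ 2 * (r / 2 + 1 / 6) * (6 * r + 4))) :
    ((N + 1 : ℕ) : ℝ) * binEntropy p -
      binE (N + 1) p (fun k => ((N + 1 : ℕ) : ℝ) * binEntropy ((k : ℝ) / (N + 1 : ℕ))) ≤ J := by
  have hentpos : ∀ k ≤ N + 1, (0 : ℝ) ≤ ((N + 1 : ℕ) : ℝ) * binEntropy ((k : ℝ) / (N + 1 : ℕ)) := by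
    intro k hk
    refine mul_nonneg (by positivity) (binEntropy_nonneg (by positivity) ?_)
    rw [div_le_one (by positivity)]; exact_mod_cast hk
  have h00 : binE (N + 1) p (fun _ => 0) = 0 := trialE_const _ _
  have hpos := binE_mono hp hentpos
  rw [h00] at hpos
  rcases eq_or_lt_of_le hp.1 with h0 | h0
  · rw [← h0] at hpos ⊢; simp only [binEntropy_zero, mul_zero]; linarith
  rcases eq_or_lt_of_le hp.2 with h1 | h1
  · rw [h1] at hpos ⊢; simp only [binEntropy_one, mul_zero]; linarith
  have e1 := binE_mul_log_le h0 h1 hκ0 hκ hJ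
  have e2 := binE_mul_log_le (p := 1 - p) (by linarith) (by linarith) hκ0 hκ hJ
  have hE : binE (N + 1) p (fun k => ((N + 1 : ℕ) : ℝ) * binEntropy ((k : ℝ) / (N + 1 : ℕ))) =
      -1 * binE (N + 1) p (fun k => k * log (k / ((N + 1) * p))) -
      binE (N + 1) (1 - p) (fun k => k * log (k / ((N + 1) * (1 - p)))) +
      (-log p * binE (N + 1) p (fun k => k + 0) -
        log (1 - p) * binE (N + 1) (1 - p) (fun k => k + 0)) := by
    rw [binE_reflect (N + 1) p (fun k => (k : ℝ) + 0),
      binE_reflect (N + 1) p (fun k => (k : ℝ) * log (k / ((N + 1) * p))),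
      binE_reflect (N + 1) p (fun k => ((N + 1 : ℕ) : ℝ) * binEntropy ((k : ℝ) / (N + 1 : ℕ)))]
    unfold binE
    rw [← trialE_mul, ← trialE_mul, ← trialE_mul, ← trialE_sub, ← trialE_sub, ← trialE_add]
    refine trialE_congr fun k hk => ?_
    simp only [List.length_replicate] at hk
    rw [mul_binEntropy_div (Nat.succ_ne_zero N) (Nat.sub_le _ _) h0 h1, Nat.sub_sub_self hk]
    push_cast
    ring
  rw [hE, binE_moment_one, binE_moment_one]
  have hen : binEntropy p = -(p * log p) - (1 - p) * log (1 - p) := by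
    simp only [binEntropy, log_inv]; ring
  rw [hen]
  push_cast
  linarith

/-- An upper bound, for `n ≥ 3`, of the entropy defect `n h(p) - E[n h(X / n)]` of the binomial
laws with `n` trials, in nats. -/
def defect (n : ℕ) : ℝ := if 10 ≤ n then 0.66 else 0.71

lemma binE_defect_le {n : ℕ} (hn : 3 ≤ n) {p : ℝ} (hp : p ∈ Set.Icc (0 : ℝ) 1) :
    n * binEntropy p - binE n p (fun k => n * binEntropy ((k : ℝ) / n)) ≤ defect n := by
  obtain ⟨N, rfl⟩ : ∃ N, n = N + 1 := ⟨n - 1, by omega⟩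
  unfold defect
  split_ifs with h
  -- `0.9 ≤ (n - 1) / n` for `n ≥ 10`
  · refine binE_entropy_defect (κ := 0.9) hp (by norm_num) ?_ (by norm_num) fun r hr => ?_
    · have : (9 : ℝ) ≤ N := by exact_mod_cast (by omega : 9 ≤ N)
      linarith
    · nlinarith [sq_nonneg (r ^ 2 - 1.35 * r - 1), mul_nonneg hr (sq_nonneg (r - 2)), sq_nonneg (r - 2),
        sq_nonneg (r * (r - 2)), pow_nonneg hr 3]
  -- `2 / 3 ≤ (n - 1) / n` for `n ≥ 3`
  · refine binE_entropy_defect (κ := 2 / 3) hp (by norm_num) ?_ (by norm_num) fun r hr => ?_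
    · have : (2 : ℝ) ≤ N := by exact_mod_cast (by omega : 2 ≤ N)
      linarith
    · nlinarith [sq_nonneg (r ^ 2 - 2.65 * r - 1), mul_nonneg hr (sq_nonneg (r - 3)), sq_nonneg (r - 3),
        sq_nonneg (r * (r - 3)), pow_nonneg hr 3]

lemma trialE_id (l : List ℝ) : trialE l (fun k => (k : ℝ)) = l.sum := by
  induction l with
  | nil => simp [trialE]
  | cons p l ih =>
    simp only [trialE, Nat.cast_add, Nat.cast_one, trialE_add, trialE_const, ih, List.sum_cons]
    ring

lemma mean_ones {n : ℕ} (p : Fin n → ℝ) : ∑ e : Fin n → Bool, bprod p e * (ones e : ℝ) = ∑ i, p i := by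
  rw [sum_bprod_ones p (fun k => (k : ℝ)), trialE_id, List.sum_ofFn]

lemma ones_le {n : ℕ} (e : Fin n → Bool) : ones e ≤ n := by
  refine (Finset.sum_le_card_nsmul Finset.univ _ 1 fun i _ => Bool.toNat_le _).trans ?_
  simp

lemma div_mem_Icc {k n : ℕ} (h : k ≤ n) : (k : ℝ) / n ∈ Set.Icc (0 : ℝ) 1 :=
  ⟨by positivity, div_le_one_of_le₀ (by exact_mod_cast h) (by positivity)⟩

lemma trialE_defect_le {l : List ℝ} (hl : ∀ x ∈ l, x ∈ Set.Icc (0 : ℝ) 1) (hn : 3 ≤ l.length) :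
    l.length * binEntropy (l.sum / l.length) -
      trialE l (fun k => l.length * binEntropy ((k : ℝ) / l.length)) ≤ defect l.length := by
  set n := l.length with hndef
  have hn0 : (0 : ℝ) < n := by exact_mod_cast (by omega : 0 < n)
  have hs0 : 0 ≤ l.sum := List.sum_nonneg fun x hx => (hl x hx).1
  have hs1 : l.sum ≤ n := by
    have := List.sum_le_card_nsmul l 1 fun x hx => (hl x hx).2
    simpa using this
  refine le_trans ?_ (binE_defect_le hn (p := l.sum / n)
    ⟨by positivity, (div_le_one hn0).2 hs1⟩)
  have := trialE_le_replicate (l.sum / n) l hl (by rw [← hndef]; field_simp)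
    (g := fun k => -1 * (n * binEntropy ((k : ℝ) / n))) (fun k hk => by
      have h1 := div_mem_Icc (n := n) (k := k) (by omega)
      have h2 := div_mem_Icc (n := n) (k := k + 2) (by omega)
      have := binEntropy_add_le (a := (k : ℝ) / n) (b := ((k + 2 : ℕ) : ℝ) / n)
        (a' := ((k + 1 : ℕ) : ℝ) / n) (b' := ((k + 1 : ℕ) : ℝ) / n) h1.1 h2.2
        (by gcongr; simp) le_rfl (by push_cast; ring)
      nlinarith)
  rw [trialE_mul l (-1), trialE_mul _ (-1), ← hndef] at this
  unfold binE
  linarith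

/-- The entropy of the mean of independent `[0, 1]`-valued variables exceeds the mean entropy of
their average by at most `defect n / n`. -/
lemma entropy_defect_fin {n : ℕ} (hn : 3 ≤ n) {α : Type*} [Fintype α] (ν ξ : Fin n → α → ℝ)
    (hν : ∀ j a, 0 ≤ ν j a) (hν1 : ∀ j, ∑ a, ν j a = 1) (hξ : ∀ j a, ξ j a ∈ Set.Icc (0 : ℝ) 1) :
    n * binEntropy ((∑ j, ∑ a, ν j a * ξ j a) / n) -
      ∑ ω : Fin n → α, (∏ j, ν j (ω j)) * (n * binEntropy ((∑ j, ξ j (ω j)) / n)) ≤ defect n := by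
  have hn0 : (0 : ℝ) < n := by exact_mod_cast (by omega : 0 < n)
  set p : Fin n → ℝ := fun j => ∑ a, ν j a * ξ j a with hp
  have hpm : ∀ j, p j ∈ Set.Icc (0 : ℝ) 1 := fun j => by
    refine ⟨Finset.sum_nonneg fun a _ => mul_nonneg (hν j a) (hξ j a).1, ?_⟩
    rw [← hν1 j]
    exact Finset.sum_le_sum fun a _ => mul_le_of_le_one_right (hν j a) (hξ j a).2
  have h1 := trialE_defect_le (l := List.ofFn p) (by
    intro x hx
    obtain ⟨j, rfl⟩ := (List.mem_ofFn' p x).1 hx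
    exact hpm j) (by simpa using hn)
  rw [← sum_bprod_ones, List.sum_ofFn, List.length_ofFn] at h1
  refine le_trans (sub_le_sub_left ?_ _) h1
  -- Jensen, for a random rounding of each variable to `0` or `1`
  have jensen : ∀ ω : Fin n → α,
      ∑ S : Fin n → Bool, bprod (fun j => ξ j (ω j)) S * (n * binEntropy ((ones S : ℝ) / n)) ≤
        n * binEntropy ((∑ j, ξ j (ω j)) / n) := by
    intro ω
    have := strictConcave_binEntropy.concaveOn.le_map_sum (t := Finset.univ)
      (w := fun S => bprod (fun j => ξ j (ω j)) S) (p := fun S : Fin n → Bool => (ones S : ℝ) / n)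
      (fun S _ => bprod_nonneg (fun j => hξ j (ω j)) S) (sum_bprod _)
      (fun S _ => div_mem_Icc (ones_le S))
    simp only [smul_eq_mul] at this
    have e : ∑ S : Fin n → Bool, bprod (fun j => ξ j (ω j)) S * ((ones S : ℝ) / n) =
        (∑ j, ξ j (ω j)) / n := by
      rw [← mean_ones, Finset.sum_div]
      exact Finset.sum_congr rfl fun _ _ => by ring
    rw [e] at this
    refine le_trans (le_of_eq ?_) (mul_le_mul_of_nonneg_left this hn0.le)
    rw [Finset.mul_sum]
    exact Finset.sum_congr rfl fun _ _ => by ring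
  calc ∑ S : Fin n → Bool, bprod p S * (n * binEntropy ((ones S : ℝ) / n))
      = ∑ ω : Fin n → α, (∏ j, ν j (ω j)) *
        ∑ S : Fin n → Bool, bprod (fun j => ξ j (ω j)) S * (n * binEntropy ((ones S : ℝ) / n)) := by
        simp only [Finset.mul_sum]
        rw [Finset.sum_comm]
        refine Finset.sum_congr rfl fun S _ => ?_
        have : bprod p S = ∑ ω : Fin n → α, ∏ j, (ν j (ω j) * bw (ξ j (ω j)) (S j)) := by
          rw [← Fintype.prod_sum fun j a => ν j a * bw (ξ j a) (S j)]
          refine Finset.prod_congr rfl fun j _ => ?_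
          cases S j
          · simp only [bw_false, hp, mul_sub, mul_one, Finset.sum_sub_distrib, hν1]
          · simp only [bw_true, hp]
        rw [this, Finset.sum_mul]
        refine Finset.sum_congr rfl fun ω _ => ?_
        rw [Finset.prod_mul_distrib]
        simp only [bprod]; ring
    _ ≤ _ := Finset.sum_le_sum fun ω _ =>
        mul_le_mul_of_nonneg_left (jensen ω) (Finset.prod_nonneg fun j _ => hν j _)

lemma entropy_defect {ι : Type*} [Fintype ι] [DecidableEq ι] (hn : 3 ≤ Fintype.card ι)
    {α : Type*} [Fintype α] (ν ξ : ι → α → ℝ)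
    (hν : ∀ j a, 0 ≤ ν j a) (hν1 : ∀ j, ∑ a, ν j a = 1) (hξ : ∀ j a, ξ j a ∈ Set.Icc (0 : ℝ) 1) :
    Fintype.card ι * binEntropy ((∑ j, ∑ a, ν j a * ξ j a) / Fintype.card ι) -
      ∑ ω : ι → α, (∏ j, ν j (ω j)) *
        (Fintype.card ι * binEntropy ((∑ j, ξ j (ω j)) / Fintype.card ι))
      ≤ defect (Fintype.card ι) := by
  set f := Fintype.equivFin ι
  have := entropy_defect_fin hn (fun j => ν (f.symm j)) (fun j => ξ (f.symm j))
    (fun j => hν _) (fun j => hν1 _) (fun j => hξ _)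
  rw [f.symm.sum_comp (fun j => ∑ a, ν j a * ξ j a)] at this
  rw [← (f.arrowCongr (Equiv.refl α)).symm.sum_comp]
  refine le_trans (sub_le_sub_left (le_of_eq ?_) _) this
  refine Finset.sum_congr rfl fun ω _ => ?_
  rw [← f.symm.prod_comp, ← f.symm.sum_comp]
  simp [Equiv.arrowCongr]

/-! ### Exchangeable laws and the variational inequality -/

/-- Two bit vectors with the same number of ones differ by a permutation. -/
lemma exists_perm_of_ones_eq {ι : Type*} [Fintype ι] [DecidableEq ι] {x y : ι → Bool}
    (h : ones x = ones y) : ∃ σ : Equiv.Perm ι, x ∘ σ = y := by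
  have hc : ∀ z : ι → Bool, ones z = Fintype.card {i // z i = true} := by
    intro z
    rw [Fintype.card_subtype, Finset.card_filter]
    refine Finset.sum_congr rfl fun i _ => ?_
    cases z i <;> simp
  have e : {i // y i = true} ≃ {i // x i = true} :=
    Fintype.equivOfCardEq (by rw [← hc, ← hc, h])
  refine ⟨e.extendSubtype, funext fun i => ?_⟩
  cases hy : y i
  · have := e.extendSubtype_not_mem i (by simp [hy])
    simpa using this
  · exact e.extendSubtype_mem i hy

/-- Averaging a function over the bits in one exchangeable block. -/
lemma sum_mul_le_of_level {ι : Type*} [Fintype ι] [DecidableEq ι] {q G : (ι → Bool) → ℝ} {B : ℝ}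
    (hq : ∀ e, 0 ≤ q e) (hinv : ∀ (σ : Equiv.Perm ι) e, q (e ∘ σ) = q e)
    (hG : ∀ m, ∑ x with ones x = m, G x ≤ B * (Finset.univ.filter fun x : ι → Bool => ones x = m).card) :
    ∑ e, q e * G e ≤ B * ∑ e, q e := by
  have hmaps : ∀ x ∈ (Finset.univ : Finset (ι → Bool)), ones x ∈ Finset.univ.image (ones (ι := ι)) :=
    fun x _ => Finset.mem_image_of_mem _ (Finset.mem_univ x)
  rw [← Finset.sum_fiberwise_of_maps_to hmaps (fun e => q e * G e),
    ← Finset.sum_fiberwise_of_maps_to hmaps q, Finset.mul_sum]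
  refine Finset.sum_le_sum fun m hm => ?_
  obtain ⟨x₀, -, rfl⟩ := Finset.mem_image.1 hm
  have hconst : ∀ x ∈ Finset.univ.filter (fun x : ι → Bool => ones x = ones x₀), q x = q x₀ := by
    intro x hx
    obtain ⟨σ, hσ⟩ := exists_perm_of_ones_eq (Finset.mem_filter.1 hx).2.symm
    rw [← hσ, hinv]
  rw [Finset.sum_congr rfl fun x hx => by rw [hconst x hx], ← Finset.mul_sum,
    Finset.sum_congr rfl hconst, Finset.sum_const, nsmul_eq_mul]
  have := mul_le_mul_of_nonneg_left (hG (ones x₀)) (hq x₀)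
  linarith

/-- One block of `sum_mul_prod_blocks_le`: for each choice of the bits outside of the block, the bits
inside of it are exchangeable. -/
lemma sum_mul_block_le {ι : Type*} [Fintype ι] [DecidableEq ι] (p : ι → Prop) [DecidablePred p]
    {q R : (ι → Bool) → ℝ} {G : ({i // p i} → Bool) → ℝ} {B : ℝ}
    (hq : ∀ e, 0 ≤ q e) (hR : ∀ e, 0 ≤ R e)
    (hinv : ∀ τ : Equiv.Perm ι, (∀ i, p (τ i) ↔ p i) → (∀ i, ¬ p i → τ i = i) →
      ∀ e, q (e ∘ τ) = q e)
    (hRp : ∀ e e' : ι → Bool, (∀ i, ¬ p i → e i = e' i) → R e = R e')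
    (hG : ∀ m, ∑ x with ones x = m, G x ≤
      B * (Finset.univ.filter fun x : {i // p i} → Bool => ones x = m).card) :
    ∑ e, q e * (G (fun i => e i) * R e) ≤ B * ∑ e, q e * R e := by
  set E := Equiv.piEquivPiSubtypeProd p (fun _ => Bool)
  rw [← E.symm.sum_comp, ← E.symm.sum_comp, Fintype.sum_prod_type_right, Fintype.sum_prod_type_right,
    Finset.mul_sum]
  refine Finset.sum_le_sum fun y _ => ?_
  have hval : ∀ x, (fun i : {i // p i} => E.symm (x, y) i) = x := by
    intro x; funext i
    simp [E, Equiv.piEquivPiSubtypeProd, i.2]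
  have := sum_mul_le_of_level (q := fun x => q (E.symm (x, y)) * R (E.symm (x, y))) (G := G)
    (B := B) (fun x => mul_nonneg (hq _) (hR _)) ?_ hG
  · refine le_trans (le_of_eq ?_) this
    refine Finset.sum_congr rfl fun x _ => ?_
    rw [hval x]; ring
  · intro σ x
    have h1 : E.symm (x ∘ σ, y) = E.symm (x, y) ∘ (Equiv.Perm.ofSubtype σ) := by
      funext i
      by_cases hi : p i
      · simp [E, Equiv.piEquivPiSubtypeProd, hi, Equiv.Perm.ofSubtype_apply_of_mem σ hi]
        exact fun h => absurd (σ ⟨i, hi⟩).2 h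
      · simp [E, Equiv.piEquivPiSubtypeProd, hi, Equiv.Perm.ofSubtype_apply_of_not_mem σ hi]
    have h2 : R (E.symm (x ∘ σ, y)) = R (E.symm (x, y)) := hRp _ _ fun i hi => by
      simp [E, Equiv.piEquivPiSubtypeProd, hi]
    show q (E.symm (x ∘ σ, y)) * R (E.symm (x ∘ σ, y)) = _
    rw [h2, h1, hinv]
    · intro i
      exact Equiv.Perm.ofSubtype_apply_mem_iff_mem σ i
    · intro i hi
      exact Equiv.Perm.ofSubtype_apply_of_not_mem σ hi

/-- For a law which is exchangeable within disjoint blocks, the expectation of a product of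
functions of the blocks is at most the product of bounds on their averages at a given number
of ones. -/
lemma sum_mul_prod_blocks_le {ι κ : Type*} [Fintype ι] [DecidableEq ι] [DecidableEq κ]
    (p : κ → ι → Prop) [∀ c, DecidablePred (p c)] (hdisj : ∀ c c' i, p c i → p c' i → c = c')
    {q : (ι → Bool) → ℝ} (G : ∀ c, ({i // p c i} → Bool) → ℝ) {B : κ → ℝ}
    (hq : ∀ e, 0 ≤ q e) (hGn : ∀ c x, 0 ≤ G c x) (hB : ∀ c, 0 ≤ B c)
    (hinv : ∀ τ : Equiv.Perm ι, (∀ c i, p c (τ i) ↔ p c i) → (∀ i, (∀ c, ¬ p c i) → τ i = i) →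
      ∀ e, q (e ∘ τ) = q e)
    (hG : ∀ c m, ∑ x with ones x = m, G c x ≤
      B c * (Finset.univ.filter fun x : {i // p c i} → Bool => ones x = m).card) (s : Finset κ) :
    ∑ e, q e * ∏ c ∈ s, G c (fun i => e i) ≤ (∏ c ∈ s, B c) * ∑ e, q e := by
  induction s using Finset.induction_on with
  | empty => simp
  | insert c s hc ih =>
    simp only [Finset.prod_insert hc]
    have := sum_mul_block_le (p c) (q := q) (R := fun e => ∏ c ∈ s, G c (fun i => e i)) (G := G c)
      (B := B c) hq (fun e => Finset.prod_nonneg fun c _ => hGn c _) ?_ ?_ (hG c)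
    · refine this.trans ?_
      rw [mul_assoc]
      exact mul_le_mul_of_nonneg_left ih (hB c)
    · intro τ h1 h2
      refine hinv τ (fun c' i => ?_) (fun i hi => h2 i (hi c))
      by_cases hi : p c i
      · by_cases hcc : c' = c
        · subst hcc; exact h1 i
        · exact ⟨fun h => absurd (hdisj _ _ _ h ((h1 i).2 hi)) hcc,
            fun h => absurd (hdisj _ _ _ h hi) hcc⟩
      · rw [h2 i hi]
    · intro e e' h
      refine Finset.prod_congr rfl fun c' hc' => ?_
      congr 1
      funext i
      exact h i fun hi => hc (by rw [← hdisj _ _ _ i.2 hi]; exact hc')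

/-- The variational inequality of the relative entropy. -/
lemma sum_mul_log_le {Ω : Type*} [Fintype Ω] {P q G : Ω → ℝ} {B : ℝ} (hP : ∀ e, 0 ≤ P e)
    (hP1 : ∑ e, P e = 1) (hq : ∀ e, 0 ≤ q e) (hac : ∀ e, q e = 0 → P e = 0) (hG : ∀ e, 0 ≤ G e)
    (hGP : ∀ e, P e ≠ 0 → G e ≠ 0) (hB : 0 < B) (h : ∑ e, q e * G e ≤ B) :
    ∑ e, P e * log (G e) ≤ ∑ e, P e * log (P e / q e) + log B := by
  have hpt : ∀ e, P e * log (G e) - P e * log (P e / q e) - P e * log B ≤ q e * G e / B - P e := by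
    intro e
    rcases eq_or_lt_of_le (hP e) with h0 | h0
    · rw [← h0]
      have := mul_nonneg (hq e) (hG e)
      simp; positivity
    have hq0 : 0 < q e := lt_of_le_of_ne (hq e) fun h' => h0.ne' (hac e h'.symm)
    have hG0 : 0 < G e := lt_of_le_of_ne (hG e) (hGP e h0.ne').symm
    have hl := log_le_sub_one_of_pos (show 0 < q e * G e / (P e * B) by positivity)
    rw [log_div (by positivity) (by positivity), log_mul hq0.ne' hG0.ne', log_mul h0.ne' hB.ne'] at hl
    rw [log_div h0.ne' hq0.ne']
    have := mul_le_mul_of_nonneg_left hl h0.le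
    have e2 : P e * (q e * G e / (P e * B) - 1) = q e * G e / B - P e := by field_simp
    rw [e2] at this
    linarith
  have := Finset.sum_le_sum fun e (_ : e ∈ Finset.univ) => hpt e
  simp only [Finset.sum_sub_distrib, ← Finset.sum_mul, hP1, ← Finset.sum_div] at this
  have hle : (∑ e, q e * G e) / B ≤ 1 := (div_le_one hB).2 h
  linarith

/-! ### Averages of product tilts over the arrangements of a class -/

open Polynomial in
/-- The sum of a product over the arrangements with `m` ones is a coefficient of the generating
polynomial. -/
lemma sum_level_prod {ι : Type*} [Fintype ι] [DecidableEq ι] (g : ι → Bool → ℝ) (m : ℕ) :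
    ∑ x : ι → Bool with ones x = m, ∏ i, g i (x i) =
      (∏ i, (C (g i false) + C (g i true) * X : ℝ[X])).coeff m := by
  have : (∏ i, (C (g i false) + C (g i true) * X : ℝ[X])) =
      ∑ x : ι → Bool, C (∏ i, g i (x i)) * X ^ ones x := by
    have h1 : ∀ i, (C (g i false) + C (g i true) * X : ℝ[X]) =
        ∑ b : Bool, C (g i b) * X ^ b.toNat := by
      intro i; simp [add_comm]
    simp_rw [h1]
    rw [Fintype.prod_sum]
    refine Finset.sum_congr rfl fun x _ => ?_
    rw [Finset.prod_mul_distrib, Finset.prod_pow_eq_pow_sum, map_prod]; rfl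
  rw [this, finsetSum_coeff, Finset.sum_filter]
  refine Finset.sum_congr rfl fun x _ => ?_
  rw [coeff_C_mul, coeff_X_pow]
  by_cases h : ones x = m
  · simp [h]
  · simp [h, Ne.symm h]

open Polynomial in
lemma card_level {ι : Type*} [Fintype ι] [DecidableEq ι] (m : ℕ) :
    ((Finset.univ.filter fun x : ι → Bool => ones x = m).card : ℝ) = (Fintype.card ι).choose m := by
  have := sum_level_prod (fun (_ : ι) _ => (1 : ℝ)) m
  simp only [Finset.prod_const_one, Finset.sum_const, nsmul_eq_mul, mul_one] at this
  rw [this]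
  simp only [map_one, one_mul, Finset.prod_const, Finset.card_univ]
  rw [coeff_one_add_X_pow]

/-- The product `∏ i < t, (1 + q / (2 i + 1))`. It bounds the average of a product tilt of strength
`q` over the arrangements of a class of `2 t` samples; for `q = 1` it equals
`4 ^ t / (2 t choose t)`. -/
def tiltBound (t : ℕ) (q : ℝ) : ℝ := ∏ i ∈ Finset.range t, (1 + q / (2 * i + 1))

lemma one_le_tiltBound (t : ℕ) {q : ℝ} (hq : 0 ≤ q) : 1 ≤ tiltBound t q :=
  Finset.prod_induction _ (fun x => 1 ≤ x) (fun _ _ h h' => one_le_mul_of_one_le_of_one_le h h')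
    le_rfl fun i _ => by
      have : 0 ≤ q / (2 * i + 1) := by positivity
      linarith

lemma choose_mul_of_succ (N k : ℕ) :
    ((N : ℝ) + 1) * N.choose k = (N + 1 - k) * (N + 1).choose k := by
  rcases le_or_gt k (N + 1) with h | h
  · have := Nat.choose_mul_succ_eq N k
    have h2 : ((N.choose k * (N + 1) : ℕ) : ℝ) = (((N + 1).choose k * (N + 1 - k) : ℕ) : ℝ) := by
      rw [this]
    rw [Nat.cast_mul, Nat.cast_mul, Nat.cast_sub h] at h2
    push_cast at h2
    linarith
  · rw [Nat.choose_eq_zero_of_lt h, Nat.choose_eq_zero_of_lt (by omega)]; simp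

lemma choose_mul_of_succ_succ (N k : ℕ) :
    ((N : ℝ) + 1) * N.choose k = (k + 1) * (N + 1).choose (k + 1) := by
  have := Nat.add_one_mul_choose_eq N k
  have h2 : (((N + 1) * N.choose k : ℕ) : ℝ) = (((N + 1).choose (k + 1) * (k + 1) : ℕ) : ℝ) := by
    rw [this]
  push_cast at h2
  linarith

open Polynomial in
/-- The coefficients of a power of a quadratic polynomial, compared with binomial coefficients.
The two recursions in the proof come from removing a one or a zero of the arrangement. -/
lemma coeff_quadratic_pow_le {κ₁ κ₀ : ℝ} (h1 : 0 ≤ κ₁) (h1' : κ₁ ≤ 1) (h0 : 0 ≤ κ₀) (h0' : κ₀ ≤ 1)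
    (t m : ℕ) :
    ((C (1 - κ₀ ^ 2) + C (2 * (1 + κ₀ * κ₁)) * X + C (1 - κ₁ ^ 2) * X ^ 2 : ℝ[X]) ^ t).coeff m ≤
      tiltBound t (κ₀ * κ₁) * (2 * t).choose m := by
  set q := κ₀ * κ₁ with hq
  have hq0 : 0 ≤ q := mul_nonneg h0 h1
  have hA : 0 ≤ 1 - κ₀ ^ 2 := by nlinarith
  have hC : 0 ≤ 1 - κ₁ ^ 2 := by nlinarith
  set A := 1 - κ₀ ^ 2 with hAd
  set D := 1 - κ₁ ^ 2 with hDd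
  set p : ℝ[X] := C A + C (2 * (1 + q)) * X + C D * X ^ 2 with hp
  have hder : derivative p = C (2 * (1 + q)) + C (2 * D) * X := by
    simp only [hp, derivative_add, derivative_C, derivative_mul, derivative_X, derivative_X_pow,
      map_mul, Nat.cast_ofNat, map_ofNat]
    simp; ring
  induction t generalizing m with
  | zero =>
    simp only [pow_zero, tiltBound, Finset.range_zero, Finset.prod_empty, one_mul, mul_zero]
    rcases m with _ | m
    · simp
    · simp [coeff_one]
  | succ t ih =>
    have hb1 := one_le_tiltBound t hq0
    set b := tiltBound t q with hb
    have hbs : tiltBound (t + 1) q = b * (1 + q / (2 * t + 1)) := by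
      rw [tiltBound, Finset.prod_range_succ]; rfl
    rw [hbs]
    have ht1 : (0 : ℝ) < 2 * t + 1 := by positivity
    have hN : ((2 * t : ℕ) : ℝ) = 2 * t := by push_cast; ring
    have h22 : 2 * (t + 1) = 2 * t + 1 + 1 := by ring
    rw [h22]
    -- there are two recursions from the power `t`; the case decides which of them keeps the factor
    -- below `1 + q / (2 t + 1)`
    by_cases hcase : 1 ≤ m ∧ (2 * t + 1 - m : ℝ) * κ₀ ≤ (m - 1) * κ₁
    · obtain ⟨hm, hcrit⟩ := hcase
      obtain ⟨k, rfl⟩ : ∃ k, m = k + 1 := ⟨m - 1, by omega⟩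
      push_cast at hcrit
      -- compare coefficients in the derivative of `p ^ (t + 1)`
      have hrec : (k + 1 : ℝ) * (p ^ (t + 1)).coeff (k + 1) =
          (t + 1) * (2 * (1 + q) * (p ^ t).coeff k +
            2 * D * (if k = 0 then 0 else (p ^ t).coeff (k - 1))) := by
        have e1 : (derivative (p ^ (t + 1))).coeff k = (p ^ (t + 1)).coeff (k + 1) * (k + 1) :=
          coeff_derivative _ _
        rw [derivative_pow_succ, hder] at e1
        rw [mul_comm, ← e1]
        have : C ((t : ℝ) + 1) * p ^ t * (C (2 * (1 + q)) + C (2 * D) * X) =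
          C ((t + 1) * (2 * (1 + q))) * p ^ t + C ((t + 1) * (2 * D)) * (p ^ t * X) := by
          simp only [C_mul]; ring
        rw [this, coeff_add, coeff_C_mul, coeff_C_mul]
        rcases k with _ | k
        · simp; ring
        · simp [coeff_mul_X]; ring
      have c1 := choose_mul_of_succ (2 * t) k
      have c2 : ((2 * t : ℕ) + 1 : ℝ) * (if k = 0 then 0 else ((2 * t).choose (k - 1) : ℝ)) =
          k * (2 * t + 1).choose k := by
        rcases k with _ | k
        · simp
        · have := choose_mul_of_succ_succ (2 * t) k
          simp only [Nat.add_eq_zero_iff, one_ne_zero, and_false, if_false, Nat.add_sub_cancel]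
          rw [this]; push_cast; ring
      have c3 := choose_mul_of_succ_succ (2 * t + 1) k
      rw [hN] at c1 c2
      push_cast at c3
      set Y : ℝ := ((2 * t + 1).choose k : ℝ) with hY
      have hY0 : 0 ≤ Y := by positivity
      have i1 := ih k
      have i2 : (if k = 0 then 0 else (p ^ t).coeff (k - 1)) ≤
          b * (if k = 0 then 0 else ((2 * t).choose (k - 1) : ℝ)) := by
        split_ifs
        · simp
        · exact ih _
      set a1 := (p ^ t).coeff k
      set a2 := (if k = 0 then 0 else (p ^ t).coeff (k - 1))
      set d1 : ℝ := ((2 * t).choose k : ℝ)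
      set d2 : ℝ := (if k = 0 then 0 else ((2 * t).choose (k - 1) : ℝ))
      have hd1 : d1 = (2 * t + 1 - k) * Y / (2 * t + 1) := by rw [← c1]; field_simp
      have hd2 : d2 = k * Y / (2 * t + 1) := by rw [← c2]; field_simp
      have hk1 : (0 : ℝ) < k + 1 := by positivity
      refine le_of_mul_le_mul_left ?_ hk1
      rw [hrec]
      have hfin : (1 + q) * (2 * t + 1 - k) + D * k ≤ 2 * t + 1 + q := by
        have := mul_le_mul_of_nonneg_right hcrit h1
        rw [hDd, hq]; nlinarith
      calc ((t : ℝ) + 1) * (2 * (1 + q) * a1 + 2 * D * a2)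
          ≤ (t + 1) * (2 * (1 + q) * (b * d1) + 2 * D * (b * d2)) := by gcongr
        _ = (2 * (t + 1) * b * Y / (2 * t + 1)) * ((1 + q) * (2 * t + 1 - k) + D * k) := by
            rw [hd1, hd2]; field_simp
        _ ≤ (2 * (t + 1) * b * Y / (2 * t + 1)) * (2 * t + 1 + q) := by gcongr
        _ = b * (1 + q / (2 * t + 1)) * ((2 * t + 1 + 1) * Y) := by field_simp; ring
        _ = _ := by rw [c3]; ring
    · have hm : m ≤ 2 * t + 1 ∨ 2 * t + 2 ≤ m := by omega
      rcases hm with hm | hm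
      swap
      · exfalso
        apply hcase
        have : (2 * t + 2 : ℝ) ≤ m := by exact_mod_cast hm
        exact ⟨by omega, by nlinarith⟩
      have hmR : (m : ℝ) ≤ 2 * t + 1 := by exact_mod_cast hm
      have hcrit : (m - 1 : ℝ) * κ₁ ≤ (2 * t + 1 - m) * κ₀ := by
        rcases Nat.eq_zero_or_pos m with h | h
        · subst h
          push_cast
          nlinarith
        · by_contra hcon
          exact hcase ⟨h, (not_le.1 hcon).le⟩
      -- the mirror image: `2 (t + 1) p ^ (t + 1)` minus `X` times the derivative
      have hrec : (2 * t + 2 - m : ℝ) * (p ^ (t + 1)).coeff m =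
          (t + 1) * (2 * A * (p ^ t).coeff m +
            2 * (1 + q) * (if m = 0 then 0 else (p ^ t).coeff (m - 1))) := by
        have e0 : C (2 * (t + 1) : ℝ) * p ^ (t + 1) - X * derivative (p ^ (t + 1)) =
            C ((t + 1) * (2 * A)) * p ^ t + C ((t + 1) * (2 * (1 + q))) * (p ^ t * X) := by
          rw [derivative_pow_succ, hder, pow_succ]
          simp only [C_mul, C_add, C_1, map_ofNat, hp]
          ring
        have e1 := congrArg (fun f => f.coeff m) e0
        simp only [coeff_add, coeff_sub, coeff_C_mul] at e1
        rcases m with _ | m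
        · simp only [coeff_X_mul_zero, coeff_mul_X_zero] at e1
          simp; linarith
        · rw [coeff_X_mul, coeff_derivative, coeff_mul_X] at e1
          simp; linarith
      have c1 := choose_mul_of_succ (2 * t) m
      have c2 : ((2 * t : ℕ) + 1 : ℝ) * (if m = 0 then 0 else ((2 * t).choose (m - 1) : ℝ)) =
          m * (2 * t + 1).choose m := by
        rcases m with _ | k
        · simp
        · have := choose_mul_of_succ_succ (2 * t) k
          simp only [Nat.add_eq_zero_iff, one_ne_zero, and_false, if_false, Nat.add_sub_cancel]
          rw [this]; push_cast; ring
      have c3 := choose_mul_of_succ (2 * t + 1) m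
      rw [hN] at c1 c2
      push_cast at c3
      set Y : ℝ := ((2 * t + 1).choose m : ℝ) with hY
      have hY0 : 0 ≤ Y := by positivity
      have i1 := ih m
      have i2 : (if m = 0 then 0 else (p ^ t).coeff (m - 1)) ≤
          b * (if m = 0 then 0 else ((2 * t).choose (m - 1) : ℝ)) := by
        split_ifs
        · simp
        · exact ih _
      set a1 := (p ^ t).coeff m
      set a2 := (if m = 0 then 0 else (p ^ t).coeff (m - 1))
      set d1 : ℝ := ((2 * t).choose m : ℝ)
      set d2 : ℝ := (if m = 0 then 0 else ((2 * t).choose (m - 1) : ℝ))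
      have hd1 : d1 = (2 * t + 1 - m) * Y / (2 * t + 1) := by rw [← c1]; field_simp
      have hd2 : d2 = m * Y / (2 * t + 1) := by rw [← c2]; field_simp
      have hk1 : (0 : ℝ) < 2 * t + 2 - m := by linarith
      refine le_of_mul_le_mul_left ?_ hk1
      rw [hrec]
      have hfin : A * (2 * t + 1 - m) + (1 + q) * m ≤ 2 * t + 1 + q := by
        have := mul_le_mul_of_nonneg_right hcrit h0
        rw [hAd, hq]; nlinarith
      calc ((t : ℝ) + 1) * (2 * A * a1 + 2 * (1 + q) * a2)
          ≤ (t + 1) * (2 * A * (b * d1) + 2 * (1 + q) * (b * d2)) := by gcongr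
        _ = (2 * (t + 1) * b * Y / (2 * t + 1)) * (A * (2 * t + 1 - m) + (1 + q) * m) := by
            rw [hd1, hd2]; field_simp
        _ ≤ (2 * (t + 1) * b * Y / (2 * t + 1)) * (2 * t + 1 + q) := by gcongr
        _ = b * (1 + q / (2 * t + 1)) * ((2 * t + 1 + 1) * Y) := by field_simp; ring
        _ = _ := by rw [c3]; ring

/-! ### The gain of the tilt -/

lemma log_ratio_ge {x : ℝ} (h0 : 0 ≤ x) (h1 : x < 1) :
    2 * x + 2 * x ^ 3 / 3 + 2 * x ^ 5 / 5 ≤ log (1 + x) - log (1 - x) := by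
  have h := hasSum_log_sub_log_of_abs_lt_one (x := x) (by rwa [abs_of_nonneg h0])
  have := sum_le_hasSum (Finset.range 3) (fun i _ => by positivity) h
  refine le_trans (le_of_eq ?_) this
  simp only [Finset.sum_range_succ, Finset.sum_range_zero]
  push_cast
  ring

lemma neg_log_one_sub_sq_ge {x : ℝ} (h0 : 0 ≤ x) (h1 : x < 1) :
    x ^ 2 + x ^ 4 / 2 ≤ - log (1 - x ^ 2) := by
  have hx : x ^ 2 < 1 := by nlinarith
  have h := hasSum_pow_div_log_of_abs_lt_one (x := x ^ 2) (by rwa [abs_of_nonneg (by positivity)])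
  have := sum_le_hasSum (Finset.range 2) (fun i _ => by positivity) h
  refine le_trans (le_of_eq ?_) this
  simp only [Finset.sum_range_succ, Finset.sum_range_zero]
  push_cast
  ring

/-- The polynomial inequality behind `gain_bound_aux`, for `s = x ^ 2` and `ρ = y / x`. -/
lemma gain_polynomial {s ρ : ℝ} (hs0 : 0 ≤ s) (hs1 : s ≤ 1) (hρ0 : 0 ≤ ρ) (hρ1 : ρ ≤ 1) :
    2.38 * s * ρ ≤ 2 / 3 * s * (1 - ρ + ρ ^ 2)
      + 2 / 5 * s ^ 2 * (1 - ρ + ρ ^ 2 - ρ ^ 3 + ρ ^ 4) + ρ + s * ρ ^ 3 / 2 := by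
  have hE : 0 ≤ 1 - ρ + ρ ^ 2 - ρ ^ 3 + ρ ^ 4 := by
    have : 0 ≤ (1 - ρ) * (1 + ρ ^ 2) := mul_nonneg (by linarith) (by positivity)
    have : 0 ≤ ρ ^ 4 := by positivity
    nlinarith
  rcases le_total ρ (8 / 25) with h | h
  · have h1 : 0 ≤ 2 / 3 * (1 - ρ + ρ ^ 2) + ρ ^ 3 / 2 - 1.38 * ρ := by
      have : 0 ≤ ρ ^ 3 := by positivity
      nlinarith
    have h2 : 0 ≤ 2 / 5 * s ^ 2 * (1 - ρ + ρ ^ 2 - ρ ^ 3 + ρ ^ 4) := by positivity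
    have h3 := mul_nonneg hs0 h1
    have h4 : 0 ≤ ρ * (1 - s) := mul_nonneg hρ0 (by linarith)
    nlinarith
  · -- convexity in `s`: replace `s ^ 2` by its tangent at `1`, then compare the end points
    have h1 : 0 ≤ 2 / 3 * (1 - ρ + ρ ^ 2) + 2 / 5 * (1 - ρ + ρ ^ 2 - ρ ^ 3 + ρ ^ 4) + ρ ^ 3 / 2
        - 1.38 * ρ := by
      nlinarith [sq_nonneg (ρ - 3 / 4), sq_nonneg (ρ ^ 2 - 9 / 16),
        mul_nonneg hρ0 (sq_nonneg (ρ - 3 / 4))]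
    have h2 : 0 ≤ ρ - 2 / 5 * (1 - ρ + ρ ^ 2 - ρ ^ 3 + ρ ^ 4) := by
      have : 0 ≤ ρ ^ 3 * (1 - ρ) := mul_nonneg (by positivity) (by linarith)
      nlinarith
    have h3 := mul_nonneg hs0 h1
    have h4 := mul_nonneg (sub_nonneg.2 hs1) h2
    have h5 := mul_nonneg (mul_nonneg (by norm_num : (0 : ℝ) ≤ 2 / 5) hE) (sq_nonneg (1 - s))
    nlinarith

lemma gain_bound_aux {x y w : ℝ} (hy : 0 ≤ y) (hyx : y ≤ x) (hx : x < 1)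
    (hw : w * (x + y) = 2 * (x * y)) :
    2 * (x * y) + 2.38 * (x * y) ^ 2 ≤
      w / 2 * ((log (1 + x) - log (1 - x)) + (log (1 + y) - log (1 - y)))
        + (y ^ 2 + y ^ 4 / 2) := by
  have hx0 : 0 ≤ x := hy.trans hyx
  rcases eq_or_lt_of_le hy with h0 | h0
  · subst h0
    rcases eq_or_lt_of_le hx0 with hx' | hx'
    · rw [← hx']; simp
    · have : w = 0 := by
        have h : w * x = 0 := by linarith
        exact (mul_eq_zero.1 h).resolve_right hx'.ne'
      rw [this]; simp
  have hxp : 0 < x := h0.trans_le hyx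
  have hwe : w = 2 * (x * y) / (x + y) := by field_simp; linarith
  have hw0 : 0 ≤ w := by rw [hwe]; positivity
  have hL := mul_le_mul_of_nonneg_left
    (add_le_add (log_ratio_ge hx0 hx) (log_ratio_ge hy (hyx.trans_lt hx))) (half_pos
      (by rw [hwe]; positivity : 0 < w)).le
  refine le_trans ?_ (add_le_add hL le_rfl)
  have e : w / 2 * (2 * x + 2 * x ^ 3 / 3 + 2 * x ^ 5 / 5 + (2 * y + 2 * y ^ 3 / 3 + 2 * y ^ 5 / 5)) =
      x * y * (2 + 2 / 3 * (x ^ 2 - x * y + y ^ 2)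
        + 2 / 5 * (x ^ 4 - x ^ 3 * y + x ^ 2 * y ^ 2 - x * y ^ 3 + y ^ 4)) := by
    rw [hwe]; field_simp; ring
  rw [e]
  have hpoly := gain_polynomial (s := x ^ 2) (ρ := y / x) (by positivity) (by nlinarith)
    (by positivity) ((div_le_one hxp).2 hyx)
  have := mul_le_mul_of_nonneg_right hpoly (show 0 ≤ x ^ 2 * (y / x) by positivity)
  set ρ := y / x with hρ
  have hyρ : y = ρ * x := by rw [hρ]; field_simp
  rw [hyρ]
  nlinarith

/-- The gain per unmatched pair in the exponent of the tilt. -/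
lemma gain_bound {x y w v : ℝ} (hx0 : 0 ≤ x) (hx : x < 1) (hy0 : 0 ≤ y) (hy : y < 1)
    (hw : w * (x + y) = 2 * (x * y)) (hv0 : 0 ≤ v) (hv1 : v ≤ 1) :
    2 * (x * y) + 2.38 * (x * y) ^ 2 ≤
      w / 2 * ((log (1 + x) - log (1 - x)) + (log (1 + y) - log (1 - y)))
        - v * log (1 - x ^ 2) - (1 - v) * log (1 - y ^ 2) := by
  have h1 := neg_log_one_sub_sq_ge hx0 hx
  have h2 := neg_log_one_sub_sq_ge hy0 hy
  have h1' := mul_le_mul_of_nonneg_left h1 hv0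
  have h2' := mul_le_mul_of_nonneg_left h2 (sub_nonneg.2 hv1)
  rcases le_total y x with h | h
  · have k := gain_bound_aux hy0 h hx hw
    have e : y ^ 2 + y ^ 4 / 2 ≤ x ^ 2 + x ^ 4 / 2 := by gcongr
    have := mul_le_mul_of_nonneg_left e hv0
    nlinarith
  · have k := gain_bound_aux hx0 h hy (w := w) (by linarith)
    have e : x ^ 2 + x ^ 4 / 2 ≤ y ^ 2 + y ^ 4 / 2 := by gcongr
    have := mul_le_mul_of_nonneg_left e (sub_nonneg.2 hv1)
    nlinarith

/-- Entropy is at most cross entropy. -/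
lemma binEntropy_le_cross {x y : ℝ} (hx : x ∈ Set.Icc (0 : ℝ) 1) (hy0 : 0 < y) (hy1 : y < 1) :
    binEntropy x ≤ -x * log y - (1 - x) * log (1 - y) := by
  have aux : ∀ x y : ℝ, 0 ≤ x → 0 < y → -x * log x ≤ -x * log y + (y - x) := by
    intro x y hx hy
    rcases eq_or_lt_of_le hx with h | h
    · rw [← h]; simp; exact hy.le
    · have := log_le_sub_one_of_pos (div_pos hy h)
      rw [log_div hy.ne' h.ne'] at this
      have := mul_le_mul_of_nonneg_left this hx
      have e : x * (y / x - 1) = y - x := by field_simp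
      rw [e] at this
      linarith
  have h1 := aux x y hx.1 hy0
  have h2 := aux (1 - x) (1 - y) (by linarith [hx.2]) (by linarith)
  simp only [binEntropy, log_inv]
  linarith

/-- Moving `x` slightly towards `1 / 2` costs little in the relative entropy. -/
lemma cross_smooth_le {x η : ℝ} (hx : x ∈ Set.Icc (0 : ℝ) 1) (hη0 : 0 < η) (hη1 : η < 1) :
    - binEntropy x ≤ x * log ((1 - η) * x + η / 2) + (1 - x) * log (1 - ((1 - η) * x + η / 2))
      - log (1 - η) := by
  have aux : ∀ x : ℝ, 0 ≤ x → x * log x ≤ x * log ((1 - η) * x + η / 2) - x * log (1 - η) := by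
    intro x hx
    rcases eq_or_lt_of_le hx with h | h
    · rw [← h]; simp
    · have h1 : log ((1 - η) * x) ≤ log ((1 - η) * x + η / 2) :=
        log_le_log (mul_pos (by linarith) h) (by linarith)
      rw [log_mul (by linarith) h.ne'] at h1
      nlinarith
  have h1 := aux x hx.1
  have h2 := aux (1 - x) (by linarith [hx.2])
  rw [show (1 - η) * (1 - x) + η / 2 = 1 - ((1 - η) * x + η / 2) by ring] at h2
  simp only [binEntropy, log_inv]
  linarith

lemma tilt_gain_of_nonneg {u V δ κ₁ κ₀ w : ℝ} (hu : 0 < u) (hV : V ∈ Set.Icc 0 u)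
    (h1 : κ₁ < 1) (h0 : κ₀ < 1) (hw : w * (κ₁ + κ₀) = 2 * (κ₁ * κ₀))
    (a1 : 0 ≤ κ₁) (a0 : 0 ≤ κ₀) (hwδ : w ≤ δ) :
    2 * u * (κ₀ * κ₁) + 2.38 * u * (κ₀ * κ₁) ^ 2 ≤
      u / 2 * δ * ((log (1 + κ₁) - log (1 - κ₁)) + (log (1 + κ₀) - log (1 - κ₀)))
        - V * (log (1 - κ₁) + log (1 + κ₁)) - (u - V) * (log (1 - κ₀) + log (1 + κ₀)) := by
  have hv : V / u ∈ Set.Icc (0 : ℝ) 1 := ⟨div_nonneg hV.1 hu.le, (div_le_one hu).2 hV.2⟩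
  have g := gain_bound a1 h1 a0 h0 hw hv.1 hv.2
  rw [show 1 - κ₁ ^ 2 = (1 - κ₁) * (1 + κ₁) by ring, log_mul (by linarith) (by linarith),
    show 1 - κ₀ ^ 2 = (1 - κ₀) * (1 + κ₀) by ring, log_mul (by linarith) (by linarith)] at g
  have l1 := log_ratio_ge a1 h1
  have l0 := log_ratio_ge a0 h0
  have p1 : 0 ≤ 2 * κ₁ + 2 * κ₁ ^ 3 / 3 + 2 * κ₁ ^ 5 / 5 := by positivity
  have p0 : 0 ≤ 2 * κ₀ + 2 * κ₀ ^ 3 / 3 + 2 * κ₀ ^ 5 / 5 := by positivity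
  set lm1 := log (1 - κ₁)
  set lp1 := log (1 + κ₁)
  set lp0 := log (1 + κ₀)
  set lm0 := log (1 - κ₀)
  have hLL : 0 ≤ (lp1 - lm1) + (lp0 - lm0) := by linarith
  have g2 := mul_le_mul_of_nonneg_right hwδ hLL
  have g3 := mul_le_mul_of_nonneg_left g hu.le
  have g4 := mul_le_mul_of_nonneg_left g2 hu.le
  have hVu : u * (V / u) = V := by field_simp
  have hVu' : u * (1 - V / u) = u - V := by rw [mul_sub, hVu]; ring
  have : u * ((w / 2 * (lp1 - lm1 + (lp0 - lm0))) - V / u * (lm1 + lp1)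
      - (1 - V / u) * (lm0 + lp0)) = u * (w * (lp1 - lm1 + (lp0 - lm0))) / 2
      - (u * (V / u)) * (lm1 + lp1) - (u * (1 - V / u)) * (lm0 + lp0) := by ring
  rw [this, hVu, hVu'] at g3
  linarith

/-- The gain in the exponent of the tilt from the unmatched pairs. The case of negative signs follows
by symmetry. -/
lemma tilt_gain {u V δ κ₁ κ₀ w : ℝ} (hu : 0 < u) (hV : V ∈ Set.Icc 0 u)
    (h1 : |κ₁| < 1) (h0 : |κ₀| < 1) (hw : w * (κ₁ + κ₀) = 2 * (κ₁ * κ₀))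
    (hsign : (0 ≤ κ₁ ∧ 0 ≤ κ₀ ∧ w ≤ δ) ∨ (κ₁ ≤ 0 ∧ κ₀ ≤ 0 ∧ δ ≤ w)) :
    2 * u * (κ₀ * κ₁) + 2.38 * u * (κ₀ * κ₁) ^ 2 ≤
      u / 2 * δ * ((log (1 + κ₁) - log (1 - κ₁)) + (log (1 + κ₀) - log (1 - κ₀)))
        - V * (log (1 - κ₁) + log (1 + κ₁)) - (u - V) * (log (1 - κ₀) + log (1 + κ₀)) := by
  rw [abs_lt] at h1 h0
  rcases hsign with ⟨a1, a0, a2⟩ | ⟨a1, a0, a2⟩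
  · exact tilt_gain_of_nonneg hu hV h1.2 h0.2 hw a1 a0 a2
  · have := tilt_gain_of_nonneg (κ₁ := -κ₁) (κ₀ := -κ₀) (w := -w) (δ := -δ) hu hV (by linarith)
      (by linarith) (by linarith) (by linarith) (by linarith) (by linarith)
    simp only [neg_mul_neg, sub_neg_eq_add, ← sub_eq_add_neg] at this
    linarith

lemma transported_mean_mem {t u A B V : ℝ} (hu : 0 ≤ u) (hut : u < t) (hA : A ∈ Set.Icc 0 t)
    (hB : B ∈ Set.Icc 0 t) (hV : V ∈ Set.Icc 0 u) :
    (A + u / 2 * ((B - A) / t) + V) / (t + u) ∈ Set.Icc (0 : ℝ) 1 := by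
  have ht : 0 < t := by linarith
  have hγ : u / t < 1 := (div_lt_one ht).2 hut
  have hγ0 : 0 ≤ u / t := by positivity
  have c1 : A + u / 2 * ((B - A) / t) = (1 - u / t / 2) * A + u / t / 2 * B := by field_simp; ring
  have d1 : 0 ≤ 1 - u / t / 2 := by linarith
  have d2 : 0 ≤ u / t / 2 := by linarith
  rw [c1]
  refine ⟨div_nonneg ?_ (by linarith), (div_le_one (by linarith)).2 ?_⟩
  · have := mul_nonneg d1 hA.1
    have := mul_nonneg d2 hB.1
    linarith [hV.1]
  · have := mul_le_mul_of_nonneg_left hA.2 d1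
    have := mul_le_mul_of_nonneg_left hB.2 d2
    linarith [hV.2]

/-- The divergence `h_D` of two numbers as a mean of the logarithm of a tilt. The numbers are first
moved slightly towards `1 / 2`, so that the tilt is positive. -/
lemma hDn_le_tilt {μ₁ μ₂ η : ℝ} (m1 : μ₁ ∈ Set.Icc (0 : ℝ) 1) (m2 : μ₂ ∈ Set.Icc (0 : ℝ) 1)
    (hη0 : 0 < η) (hη1 : η < 1) :
    ∃ κ₁ κ₀ : ℝ, |κ₁| < 1 ∧ |κ₀| < 1 ∧ 0 ≤ κ₀ * κ₁ ∧
      (1 - η) * (μ₂ - μ₁) * (κ₁ + κ₀) = 2 * (κ₁ * κ₀) ∧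
      (μ₁ ≤ μ₂ → 0 ≤ κ₁ ∧ 0 ≤ κ₀) ∧ (μ₂ ≤ μ₁ → κ₁ ≤ 0 ∧ κ₀ ≤ 0) ∧
      hDn μ₁ μ₂ ≤ μ₁ * log (1 - κ₁) + μ₂ * log (1 + κ₁) + (1 - μ₁) * log (1 + κ₀)
        + (1 - μ₂) * log (1 - κ₀) - 2 * log (1 - η) := by
  set ν₁ := (1 - η) * μ₁ + η / 2 with hν₁
  set ν₂ := (1 - η) * μ₂ + η / 2 with hν₂
  have p1 : 0 < ν₁ := by have := mul_nonneg (by linarith : 0 ≤ 1 - η) m1.1; linarith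
  have p2 : 0 < ν₂ := by have := mul_nonneg (by linarith : 0 ≤ 1 - η) m2.1; linarith
  have p1' : ν₁ < 1 := by
    have := mul_le_mul_of_nonneg_left m1.2 (by linarith : 0 ≤ 1 - η); linarith
  have p2' : ν₂ < 1 := by
    have := mul_le_mul_of_nonneg_left m2.2 (by linarith : 0 ≤ 1 - η); linarith
  set m := (ν₁ + ν₂) / 2 with hm
  have hm0 : 0 < m := by rw [hm]; linarith
  have hm1 : m < 1 := by rw [hm]; linarith
  have hm1' : 0 < 1 - m := by linarith
  -- `1 ∓ κ₁` and `1 ± κ₀` are the ratios of `ν₁`, `ν₂` and of their complements to the means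
  set κ₁ := (ν₂ - ν₁) / (2 * m) with hκ₁
  set κ₀ := (ν₂ - ν₁) / (2 * (1 - m)) with hκ₀
  have r1 : 1 - κ₁ = ν₁ / m := by rw [hκ₁]; field_simp; rw [hm]; ring
  have r2 : 1 + κ₁ = ν₂ / m := by rw [hκ₁]; field_simp; rw [hm]; ring
  have r3 : 1 + κ₀ = (1 - ν₁) / (1 - m) := by rw [hκ₀]; field_simp; rw [hm]; ring
  have r4 : 1 - κ₀ = (1 - ν₂) / (1 - m) := by rw [hκ₀]; field_simp; rw [hm]; ring
  have s1 : 0 < 1 - κ₁ := by rw [r1]; positivity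
  have s2 : 0 < 1 + κ₁ := by rw [r2]; positivity
  have s3 : 0 < 1 + κ₀ := by rw [r3]; exact div_pos (by linarith) hm1'
  have s4 : 0 < 1 - κ₀ := by rw [r4]; exact div_pos (by linarith) hm1'
  have hk1 : |κ₁| < 1 := abs_lt.2 ⟨by linarith, by linarith⟩
  have hk0 : |κ₀| < 1 := abs_lt.2 ⟨by linarith, by linarith⟩
  have hκκ : κ₀ * κ₁ = (ν₂ - ν₁) ^ 2 / (2 * m * (2 * (1 - m))) := by
    rw [hκ₁, hκ₀]; field_simp
  have hκκ0 : 0 ≤ κ₀ * κ₁ := by rw [hκκ]; positivity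
  have hνμ : ν₂ - ν₁ = (1 - η) * (μ₂ - μ₁) := by rw [hν₁, hν₂]; ring
  refine ⟨κ₁, κ₀, hk1, hk0, hκκ0, ?_, fun h => ?_, fun h => ?_, ?_⟩
  · rw [← hνμ, hκ₁, hκ₀]; field_simp; ring
  · have hnn : 0 ≤ ν₂ - ν₁ := by rw [hνμ]; exact mul_nonneg (by linarith) (by linarith)
    exact ⟨by rw [hκ₁]; positivity, by rw [hκ₀]; positivity⟩
  · have hnn : ν₂ - ν₁ ≤ 0 := by
      rw [hνμ]; exact mul_nonpos_of_nonneg_of_nonpos (by linarith) (by linarith)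
    exact ⟨by rw [hκ₁]; exact div_nonpos_of_nonpos_of_nonneg hnn (by positivity),
      by rw [hκ₀]; exact div_nonpos_of_nonpos_of_nonneg hnn (by positivity)⟩
  · have hmm : (μ₁ + μ₂) / 2 ∈ Set.Icc (0 : ℝ) 1 :=
      ⟨by linarith [m1.1, m2.1], by linarith [m1.2, m2.2]⟩
    have k1 := binEntropy_le_cross hmm hm0 hm1
    have k2 := cross_smooth_le m1 hη0 hη1
    have k3 := cross_smooth_le m2 hη0 hη1
    rw [← hν₁] at k2
    rw [← hν₂] at k3
    rw [r1, r2, r3, r4, log_div p1.ne' hm0.ne', log_div p2.ne' hm0.ne',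
      log_div (by linarith) hm1'.ne', log_div (by linarith) hm1'.ne']
    simp only [hDn]
    linarith

/-- The divergence `h_D` of the means after transport is at most the mean of the logarithm of a
tilt of the matched samples, minus a gain proportional to the number `u` of unmatched pairs.
Here `A` and `B` are the expected numbers of matched ones in the two halves, and `V` is half that
of unmatched ones. -/
lemma exists_tilt {t u A B V η : ℝ} (hu : 0 ≤ u) (hut : u < t) (hA : A ∈ Set.Icc 0 t)
    (hB : B ∈ Set.Icc 0 t) (hV : V ∈ Set.Icc 0 u) (hη0 : 0 < η) (hη1 : η < 1) :
    ∃ κ₁ κ₀ : ℝ, |κ₁| < 1 ∧ |κ₀| < 1 ∧ 0 ≤ κ₀ * κ₁ ∧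
      (t + u) * hDn ((A + u / 2 * ((B - A) / t) + V) / (t + u))
          ((B - u / 2 * ((B - A) / t) + V) / (t + u)) ≤
        A * log (1 - κ₁) + (t - A) * log (1 + κ₀) + B * log (1 + κ₁) + (t - B) * log (1 - κ₀)
          - (2 * u * (κ₀ * κ₁) + 2.38 * u * (κ₀ * κ₁) ^ 2) - 2 * (t + u) * log (1 - η) := by
  have ht : 0 < t := by linarith
  have hn : 0 < t + u := by linarith
  set δ := (B - A) / t with hδ
  have hδt : δ * t = B - A := by rw [hδ]; field_simp
  set μ₁ := (A + u / 2 * δ + V) / (t + u) with hμ₁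
  set μ₂ := (B - u / 2 * δ + V) / (t + u) with hμ₂
  have e1 : μ₁ * (t + u) = A + u / 2 * δ + V := by rw [hμ₁]; field_simp
  have e2 : μ₂ * (t + u) = B - u / 2 * δ + V := by rw [hμ₂]; field_simp
  have m1 : μ₁ ∈ Set.Icc (0 : ℝ) 1 := transported_mean_mem hu hut hA hB hV
  have m2 : μ₂ ∈ Set.Icc (0 : ℝ) 1 := by
    have := transported_mean_mem hu hut hB hA hV
    rwa [show B + u / 2 * ((A - B) / t) + V = B - u / 2 * δ + V by rw [hδ]; ring] at this
  clear_value μ₁ μ₂ δ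
  obtain ⟨κ₁, κ₀, hk1, hk0, hκκ0, hw, hs1, hs2, hdiv⟩ := hDn_le_tilt m1 m2 hη0 hη1
  refine ⟨κ₁, κ₀, hk1, hk0, hκκ0, ?_⟩
  have hdiv' := mul_le_mul_of_nonneg_left hdiv hn.le
  have hμδ : (μ₂ - μ₁) * (t + u) = (t - u) * δ := by
    have : (μ₂ - μ₁) * (t + u) = μ₂ * (t + u) - μ₁ * (t + u) := by ring
    rw [this, e1, e2]; linarith
  have hgain : 2 * u * (κ₀ * κ₁) + 2.38 * u * (κ₀ * κ₁) ^ 2 ≤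
      u / 2 * δ * ((log (1 + κ₁) - log (1 - κ₁)) + (log (1 + κ₀) - log (1 - κ₀)))
        - V * (log (1 - κ₁) + log (1 + κ₁)) - (u - V) * (log (1 - κ₀) + log (1 + κ₀)) := by
    rcases eq_or_lt_of_le hu with h | hup
    · have hV0 : V = 0 := le_antisymm (by rw [h]; exact hV.2) hV.1
      rw [← h, hV0]; simp
    have hμd : μ₂ - μ₁ = (t - u) / (t + u) * δ := by
      rw [div_mul_eq_mul_div, ← hμδ]; field_simp
    have c0 : 0 ≤ (t - u) / (t + u) := div_nonneg (by linarith) hn.le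
    have c1 : (t - u) / (t + u) ≤ 1 := (div_le_one hn).2 (by linarith)
    -- `δ`, `μ₂ - μ₁`, `κ₁` and `κ₀` have the same sign
    have c2 : 0 ≤ (1 - η) * ((t - u) / (t + u)) := mul_nonneg (by linarith) c0
    have c3 : (1 - η) * ((t - u) / (t + u)) ≤ 1 := by nlinarith
    refine tilt_gain hup hV hk1 hk0 hw ?_
    rw [hμd, ← mul_assoc]
    rcases le_total 0 δ with hpos | hneg
    · have := hs1 (by have := mul_nonneg c0 hpos; linarith)
      exact Or.inl ⟨this.1, this.2, by nlinarith⟩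
    · have := hs2 (by have := mul_nonpos_of_nonneg_of_nonpos c0 hneg; linarith)
      exact Or.inr ⟨this.1, this.2, by nlinarith⟩
  set lm1 := log (1 - κ₁)
  set lp1 := log (1 + κ₁)
  set lp0 := log (1 + κ₀)
  set lm0 := log (1 - κ₀)
  have expand : (t + u) * (μ₁ * lm1 + μ₂ * lp1 + (1 - μ₁) * lp0 + (1 - μ₂) * lm0 - 2 * log (1 - η)) =
      (μ₁ * (t + u)) * lm1 + (μ₂ * (t + u)) * lp1 + ((t + u) - μ₁ * (t + u)) * lp0
        + ((t + u) - μ₂ * (t + u)) * lm0 - 2 * (t + u) * log (1 - η) := by ring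
  rw [expand, e1, e2] at hdiv'
  linarith

/-! ### The regret for matched labels -/

/-- The fraction of ones among the training bits. -/
def trainErr {n : ℕ} (e : Fin n ⊕ Fin n → Bool) : ℝ := (∑ j, ((e (Sum.inl j)).toNat : ℝ)) / n

/-- The fraction of ones among the ghost bits. -/
def testErr {n : ℕ} (e : Fin n ⊕ Fin n → Bool) : ℝ := (∑ j, ((e (Sum.inr j)).toNat : ℝ)) / n

/-- Half the `L¹` distance of the empirical distributions of the labels of the two halves. -/
def labelShift {n C : ℕ} (w : Fin n ⊕ Fin n → Fin C) : ℝ :=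
  1 / 2 * empDistL1 (fun j => w (Sum.inl j)) (fun j => w (Sum.inr j))

/-- The difference `h_D - h_C`, in bits, at error bits `e` and labels `w`. -/
def gap {n C : ℕ} (w : Fin n ⊕ Fin n → Fin C) (e : Fin n ⊕ Fin n → Bool) : ℝ :=
  hD (testErr e) (trainErr e) - hC (trainErr e) (testErr e) (labelShift w)

/-- Invariance under the permutations which preserve the labels. -/
def LabelExchangeable {ι κ : Type*} (w : ι → κ) (q : (ι → Bool) → ℝ) : Prop :=
  ∀ τ : Equiv.Perm ι, (∀ i, w (τ i) = w i) → ∀ e, q (e ∘ τ) = q e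

/-- For labels `w`, the expectation of `n (h_D - h_C)` (in nats) under independent error bits
exceeds the relative entropy to any label-exchangeable law by at most `M`. -/
def HasRegret {n C : ℕ} (w : Fin n ⊕ Fin n → Fin C) (M : ℝ) : Prop :=
  ∀ (p : Fin n ⊕ Fin n → ℝ) (q : (Fin n ⊕ Fin n → Bool) → ℝ), (∀ i, p i ∈ Set.Icc (0 : ℝ) 1) →
    (∀ e, 0 ≤ q e) → ∑ e, q e = 1 → LabelExchangeable w q → (∀ e, q e = 0 → bprod p e = 0) →
    ∑ e, bprod p e * (n * (gap w e * log 2)) ≤ ∑ e, bprod p e * log (bprod p e / q e) + M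

lemma sum_bprod_eval {ι : Type*} [Fintype ι] [DecidableEq ι] (p : ι → ℝ) (i : ι) (f : Bool → ℝ) :
    ∑ e : ι → Bool, bprod p e * f (e i) = (1 - p i) * f false + p i * f true := by
  have : ∀ e : ι → Bool, bprod p e * f (e i) =
      ∏ k, (bw (p k) (e k) * if k = i then f (e k) else 1) := by
    intro e
    rw [Finset.prod_mul_distrib, bprod, Finset.prod_ite_eq' Finset.univ i fun k => f (e k)]
    simp
  simp_rw [this]
  rw [sum_prod_bool fun k b => bw (p k) b * if k = i then f b else 1]
  rw [Finset.prod_eq_single i]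
  · simp; ring
  · intro k _ hk; simp [hk]
  · simp

lemma trainErr_mem {n : ℕ} (e : Fin n ⊕ Fin n → Bool) : trainErr e ∈ Set.Icc (0 : ℝ) 1 := by
  unfold trainErr
  have : ∑ j, ((e (Sum.inl j)).toNat : ℝ) ≤ n := by
    refine (Finset.sum_le_card_nsmul Finset.univ _ 1 fun j _ => ?_).trans (by simp)
    exact_mod_cast Bool.toNat_le _
  exact ⟨by positivity, div_le_one_of_le₀ this (by positivity)⟩

lemma testErr_mem {n : ℕ} (e : Fin n ⊕ Fin n → Bool) : testErr e ∈ Set.Icc (0 : ℝ) 1 := by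
  unfold testErr
  have : ∑ j, ((e (Sum.inr j)).toNat : ℝ) ≤ n := by
    refine (Finset.sum_le_card_nsmul Finset.univ _ 1 fun j _ => ?_).trans (by simp)
    exact_mod_cast Bool.toNat_le _
  exact ⟨by positivity, div_le_one_of_le₀ this (by positivity)⟩

lemma relEntropy_nonneg {ι : Type*} [Fintype ι] [DecidableEq ι] {p : ι → ℝ} {q : (ι → Bool) → ℝ}
    (hp : ∀ i, p i ∈ Set.Icc (0 : ℝ) 1) (hq : ∀ e, 0 ≤ q e) (hq1 : ∑ e, q e = 1)
    (hac : ∀ e, q e = 0 → bprod p e = 0) :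
    0 ≤ ∑ e, bprod p e * log (bprod p e / q e) := by
  have := sum_mul_log_le (P := bprod p) (q := q) (G := fun _ => 1) (B := 1)
    (bprod_nonneg hp) (sum_bprod p) hq hac (by simp) (by simp) one_pos (by simp [hq1])
  simpa using this

/-- Mixing the two bits of each pair with weights `1 - η j` and `η j`. -/
def mixErr {n : ℕ} (η : Fin n → ℝ) (e : Fin n ⊕ Fin n → Bool) : ℝ :=
  (∑ j, ((1 - η j) * ((e (Sum.inl j)).toNat : ℝ) + η j * ((e (Sum.inr j)).toNat : ℝ))) / n

lemma mixErr_mem {n : ℕ} {η : Fin n → ℝ} (hη : ∀ j, η j ∈ Set.Icc (0 : ℝ) 1)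
    (e : Fin n ⊕ Fin n → Bool) : mixErr η e ∈ Set.Icc (0 : ℝ) 1 := by
  unfold mixErr
  have h0 : ∀ j, 0 ≤ (1 - η j) * ((e (Sum.inl j)).toNat : ℝ) + η j * ((e (Sum.inr j)).toNat : ℝ) :=
    fun j => add_nonneg (mul_nonneg (by linarith [(hη j).2]) (by positivity))
      (mul_nonneg (hη j).1 (by positivity))
  have h1 : ∑ j, ((1 - η j) * ((e (Sum.inl j)).toNat : ℝ) + η j * ((e (Sum.inr j)).toNat : ℝ)) ≤ n := by
    refine (Finset.sum_le_card_nsmul Finset.univ _ 1 fun j _ => ?_).trans (by simp)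
    have a : ((e (Sum.inl j)).toNat : ℝ) ≤ 1 := by exact_mod_cast Bool.toNat_le _
    have b : ((e (Sum.inr j)).toNat : ℝ) ≤ 1 := by exact_mod_cast Bool.toNat_le _
    nlinarith [(hη j).1, (hη j).2]
  exact ⟨div_nonneg (Finset.sum_nonneg fun j _ => h0 j) (by positivity),
    div_le_one_of_le₀ h1 (by positivity)⟩

lemma mean_mixErr {n : ℕ} (η : Fin n → ℝ) (p : Fin n ⊕ Fin n → ℝ) :
    ∑ e, bprod p e * mixErr η e =
      (∑ j, ((1 - η j) * p (Sum.inl j) + η j * p (Sum.inr j))) / n := by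
  have h1 : ∀ i, ∑ e : Fin n ⊕ Fin n → Bool, bprod p e * ((e i).toNat : ℝ) = p i := by
    intro i
    rw [sum_bprod_eval p i fun b => (b.toNat : ℝ)]; simp
  simp only [mixErr, Finset.mul_sum, Finset.sum_div, mul_div_assoc']
  rw [Finset.sum_comm]
  refine Finset.sum_congr rfl fun j _ => ?_
  rw [← Finset.sum_div]
  congr 1
  rw [← h1 (Sum.inl j), ← h1 (Sum.inr j), Finset.mul_sum, Finset.mul_sum, ← Finset.sum_add_distrib]
  exact Finset.sum_congr rfl fun e _ => by ring

/-- The bits of the two halves as a family of pairs. -/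
def pairEquiv (n : ℕ) : (Fin n ⊕ Fin n → Bool) ≃ (Fin n → Bool × Bool) :=
  (Equiv.sumArrowEquivProdArrow _ _ _).trans (Equiv.arrowProdEquivProdArrow _ _ _).symm

/-- The entropy of the mean of a mixed error rate is close to its mean entropy. -/
lemma mixErr_defect {n : ℕ} (hn : 10 ≤ n) {η : Fin n → ℝ} (hη : ∀ j, η j ∈ Set.Icc (0 : ℝ) 1)
    {p : Fin n ⊕ Fin n → ℝ} (hp : ∀ i, p i ∈ Set.Icc (0 : ℝ) 1) :
    n * binEntropy ((∑ j, ((1 - η j) * p (Sum.inl j) + η j * p (Sum.inr j))) / n) -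
      ∑ e, bprod p e * (n * binEntropy (mixErr η e)) ≤ 0.66 := by
  have := entropy_defect_fin (n := n) (by omega) (α := Bool × Bool)
    (fun j a => bw (p (Sum.inl j)) a.1 * bw (p (Sum.inr j)) a.2)
    (fun j a => (1 - η j) * (a.1.toNat : ℝ) + η j * (a.2.toNat : ℝ))
    (fun j a => mul_nonneg (bw_nonneg (hp _).1 (hp _).2 _) (bw_nonneg (hp _).1 (hp _).2 _))
    (fun j => by simp [Fintype.sum_prod_type]; ring)
    (fun j a => by
      have h := hη j
      rcases a with ⟨a, b⟩
      cases a <;> cases b <;> simp [h.1, h.2])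
  rw [defect, if_pos hn, ← (pairEquiv n).sum_comp] at this
  refine le_trans (le_of_eq ?_) this
  congr 1
  · congr 3
    refine Finset.sum_congr rfl fun j _ => ?_
    simp [Fintype.sum_prod_type]; ring
  · refine Finset.sum_congr rfl fun e _ => ?_
    congr 1
    rw [bprod, Fintype.prod_sum_type, ← Finset.prod_mul_distrib]
    rfl

/-- The mean of `h_D` after transport is close to its value at the means. -/
lemma mean_hDn_mixErr_le {n : ℕ} (hn : 10 ≤ n) {η : Fin n → ℝ}
    (hη : ∀ j, η j ∈ Set.Icc (0 : ℝ) 1) {p : Fin n ⊕ Fin n → ℝ}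
    (hp : ∀ i, p i ∈ Set.Icc (0 : ℝ) 1) :
    ∑ e, bprod p e * (n * hDn (mixErr η e) (mixErr (fun j => 1 - η j) e)) ≤
      n * hDn ((∑ j, ((1 - η j) * p (Sum.inl j) + η j * p (Sum.inr j))) / n)
        ((∑ j, (η j * p (Sum.inl j) + (1 - η j) * p (Sum.inr j))) / n) + 1.32 := by
  have hη' : ∀ j, 1 - η j ∈ Set.Icc (0 : ℝ) 1 := fun j =>
    ⟨by linarith [(hη j).2], by linarith [(hη j).1]⟩
  have d1 := mixErr_defect hn hη hp
  have d2 := mixErr_defect hn hη' hp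
  have e2 := mean_mixErr (fun j => 1 - η j) p
  simp only [sub_sub_cancel] at d2 e2
  have e1 := mean_mixErr η p
  set μ₁ := (∑ j, ((1 - η j) * p (Sum.inl j) + η j * p (Sum.inr j))) / n
  set μ₂ := (∑ j, (η j * p (Sum.inl j) + (1 - η j) * p (Sum.inr j))) / n
  have jensen := strictConcave_binEntropy.concaveOn.le_map_sum (t := Finset.univ)
    (w := bprod p) (p := fun e => (mixErr η e + mixErr (fun j => 1 - η j) e) / 2)
    (fun e _ => bprod_nonneg hp e) (sum_bprod p) (fun e _ => by
      have a := mixErr_mem hη e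
      have b := mixErr_mem hη' e
      exact ⟨by linarith [a.1, b.1], by linarith [a.2, b.2]⟩)
  simp only [smul_eq_mul] at jensen
  have hmid : ∑ e, bprod p e * ((mixErr η e + mixErr (fun j => 1 - η j) e) / 2) = (μ₁ + μ₂) / 2 := by
    rw [← e1, ← e2, ← Finset.sum_add_distrib, Finset.sum_div]
    exact Finset.sum_congr rfl fun e _ => by ring
  rw [hmid] at jensen
  have hn0 : (0 : ℝ) ≤ n := by positivity
  have jensen' := mul_le_mul_of_nonneg_left jensen hn0
  have expand : ∑ e, bprod p e * (n * hDn (mixErr η e) (mixErr (fun j => 1 - η j) e)) =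
      2 * (n * ∑ e, bprod p e * binEntropy ((mixErr η e + mixErr (fun j => 1 - η j) e) / 2))
      - ∑ e, bprod p e * (n * binEntropy (mixErr η e))
      - ∑ e, bprod p e * (n * binEntropy (mixErr (fun j => 1 - η j) e)) := by
    rw [Finset.mul_sum, Finset.mul_sum, ← Finset.sum_sub_distrib, ← Finset.sum_sub_distrib]
    refine Finset.sum_congr rfl fun e _ => ?_
    simp only [hDn]; ring
  rw [expand]
  simp only [hDn]
  linarith

/-- The factor of a bit of the matched training samples (`Sum.inl`) or ghost samples (`Sum.inr`)
in the tilt. -/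
def tiltFactor {n : ℕ} (κ₁ κ₀ : ℝ) : Fin n ⊕ Fin n → Bool → ℝ
  | Sum.inl _, b => if b then 1 - κ₁ else 1 + κ₀
  | Sum.inr _, b => if b then 1 + κ₁ else 1 - κ₀

/-- The block of matched samples with label `c`. -/
def block {n C : ℕ} (w : Fin n ⊕ Fin n → Fin C) (T : Finset (Fin n)) (c : Fin C)
    (i : Fin n ⊕ Fin n) : Prop := Sum.elim id id i ∈ T ∧ w i = c

instance {n C : ℕ} (w : Fin n ⊕ Fin n → Fin C) (T : Finset (Fin n)) (c : Fin C) :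
    DecidablePred (block w T c) := fun i => by unfold block; infer_instance

lemma tiltFactor_pos {n : ℕ} {κ₁ κ₀ : ℝ} (h1 : |κ₁| < 1) (h0 : |κ₀| < 1) (i : Fin n ⊕ Fin n)
    (b : Bool) : 0 < tiltFactor κ₁ κ₀ i b := by
  rw [abs_lt] at h1 h0
  rcases i with j | j <;> cases b <;> simp [tiltFactor] <;> linarith

lemma prod_block {n C : ℕ} {M : Type*} [CommMonoid M] {w : Fin n ⊕ Fin n → Fin C}
    {T : Finset (Fin n)} (hT : ∀ j ∈ T, w (Sum.inl j) = w (Sum.inr j)) (c : Fin C)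
    (f : Fin n ⊕ Fin n → M) :
    ∏ i : {i // block w T c i}, f i =
      ∏ j ∈ T with w (Sum.inl j) = c, (f (Sum.inl j) * f (Sum.inr j)) := by
  rw [← Finset.prod_subtype (Finset.univ.filter (block w T c)) (by simp) f, Finset.prod_filter,
    Fintype.prod_sum_type, ← Finset.prod_mul_distrib, ← Finset.prod_subset
    (Finset.subset_univ (T.filter fun j => w (Sum.inl j) = c))]
  · refine Finset.prod_congr rfl fun j hj => ?_
    obtain ⟨hj1, hj2⟩ := Finset.mem_filter.1 hj
    simp [block, hj1, hj2, ← hT j hj1]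
  · intro j _ hj
    by_cases hjT : j ∈ T
    · have : w (Sum.inl j) ≠ c := fun h => hj (Finset.mem_filter.2 ⟨hjT, h⟩)
      simp [block, ← hT j hjT, this]
    · simp [block, hjT]

lemma sum_block {n C : ℕ} {w : Fin n ⊕ Fin n → Fin C}
    {T : Finset (Fin n)} (hT : ∀ j ∈ T, w (Sum.inl j) = w (Sum.inr j)) (c : Fin C)
    (f : Fin n ⊕ Fin n → ℝ) :
    ∑ i : {i // block w T c i}, f i =
      ∑ j ∈ T with w (Sum.inl j) = c, (f (Sum.inl j) + f (Sum.inr j)) :=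
  prod_block (M := Multiplicative ℝ) hT c f

open Polynomial in
/-- The average of the tilt over the arrangements of `m` ones in a matched class. -/
lemma sum_level_tilt_le {n C : ℕ} {w : Fin n ⊕ Fin n → Fin C} {T : Finset (Fin n)}
    (hT : ∀ j ∈ T, w (Sum.inl j) = w (Sum.inr j)) {κ₁ κ₀ : ℝ} (h1 : |κ₁| < 1) (h0 : |κ₀| < 1)
    (h10 : 0 ≤ κ₀ * κ₁) (c : Fin C) (m : ℕ) :
    ∑ x : {i // block w T c i} → Bool with ones x = m, ∏ i, tiltFactor κ₁ κ₀ i.1 (x i) ≤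
      tiltBound (T.filter fun j => w (Sum.inl j) = c).card (κ₀ * κ₁) *
        (Finset.univ.filter fun x : {i // block w T c i} → Bool => ones x = m).card := by
  set t := (T.filter fun j => w (Sum.inl j) = c).card with ht
  have hcard : Fintype.card {i // block w T c i} = 2 * t := by
    have := sum_block hT c (fun _ => (1 : ℝ))
    simp only [Finset.sum_const, Finset.card_univ, nsmul_eq_mul, mul_one] at this
    have h : (Fintype.card {i // block w T c i} : ℝ) = ((2 * t : ℕ) : ℝ) := by
      rw [this]; push_cast; ring
    exact_mod_cast h
  rw [card_level, hcard,
    sum_level_prod (fun (i : {i // block w T c i}) b => tiltFactor κ₁ κ₀ i.1 b),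
    prod_block hT c fun i => (Polynomial.C (tiltFactor κ₁ κ₀ i false)
      + Polynomial.C (tiltFactor κ₁ κ₀ i true) * X : ℝ[X])]
  have hq : κ₀ * κ₁ = |κ₀| * |κ₁| := by rw [← abs_mul, abs_of_nonneg h10]
  have key := coeff_quadratic_pow_le (abs_nonneg κ₁) h1.le (abs_nonneg κ₀) h0.le t m
  rw [← hq, sq_abs, sq_abs] at key
  refine le_trans (le_of_eq ?_) key
  congr 1
  rw [← Finset.prod_const]
  refine Finset.prod_congr rfl fun j _ => ?_
  simp only [tiltFactor, if_true, Bool.false_eq_true, if_false, map_add, map_sub, map_mul, map_one,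
    map_pow, map_ofNat]
  ring

lemma mean_log_tilt {n C : ℕ} {w : Fin n ⊕ Fin n → Fin C} {T : Finset (Fin n)}
    (hT : ∀ j ∈ T, w (Sum.inl j) = w (Sum.inr j)) {κ₁ κ₀ : ℝ} (h1 : |κ₁| < 1) (h0 : |κ₀| < 1)
    (p : Fin n ⊕ Fin n → ℝ) :
    ∑ e : Fin n ⊕ Fin n → Bool, bprod p e *
        log (∏ c, ∏ i : {i // block w T c i}, tiltFactor κ₁ κ₀ i.1 (e i.1)) =
      (∑ j ∈ T, p (Sum.inl j)) * log (1 - κ₁) + (T.card - ∑ j ∈ T, p (Sum.inl j)) * log (1 + κ₀)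
      + (∑ j ∈ T, p (Sum.inr j)) * log (1 + κ₁)
      + (T.card - ∑ j ∈ T, p (Sum.inr j)) * log (1 - κ₀) := by
  have hlog : ∀ e : Fin n ⊕ Fin n → Bool,
      log (∏ c, ∏ i : {i // block w T c i}, tiltFactor κ₁ κ₀ i.1 (e i.1)) =
      ∑ j ∈ T, (log (tiltFactor κ₁ κ₀ (Sum.inl j) (e (Sum.inl j)))
        + log (tiltFactor κ₁ κ₀ (Sum.inr j) (e (Sum.inr j)))) := by
    intro e
    rw [log_prod fun c _ => (Finset.prod_pos fun i _ => tiltFactor_pos h1 h0 _ _).ne']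
    rw [← Finset.sum_fiberwise T (fun j => w (Sum.inl j))]
    refine Finset.sum_congr rfl fun c _ => ?_
    rw [log_prod fun i _ => (tiltFactor_pos h1 h0 _ _).ne']
    exact sum_block hT c fun i => log (tiltFactor κ₁ κ₀ i (e i))
  simp_rw [hlog, Finset.mul_sum]
  rw [Finset.sum_comm]
  simp_rw [mul_add, Finset.sum_add_distrib]
  rw [Finset.sum_congr rfl fun j _ =>
    sum_bprod_eval p (Sum.inl j) fun b => log (tiltFactor κ₁ κ₀ (Sum.inl j) b),
    Finset.sum_congr rfl fun j _ =>
    sum_bprod_eval p (Sum.inr j) fun b => log (tiltFactor κ₁ κ₀ (Sum.inr j) b)]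
  simp only [tiltFactor, if_true, Bool.false_eq_true, if_false, Finset.sum_add_distrib,
    ← Finset.sum_mul, Finset.sum_sub_distrib, Finset.sum_const, nsmul_eq_mul, mul_one]
  ring

lemma hDn_self (x : ℝ) : hDn x x = 0 := by
  simp only [hDn, add_self_div_two]; ring

/-- Any mixing of the pairs whose total weight stays within the budget `n * labelShift w` of the
transport bounds `gap` from above. -/
lemma natCast_mul_gap_le {n C : ℕ} (hn : 0 < n) (w : Fin n ⊕ Fin n → Fin C)
    {η : Fin n → ℝ} (hη : ∀ j, η j ∈ Set.Icc (0 : ℝ) 1) (hsum : ∑ j, η j ≤ n * labelShift w)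
    (e : Fin n ⊕ Fin n → Bool) :
    n * (gap w e * log 2) ≤ n * hDn (mixErr η e) (mixErr (fun j => 1 - η j) e) := by
  have hn0 : (0 : ℝ) < n := by exact_mod_cast hn
  refine mul_le_mul_of_nonneg_left ?_ hn0.le
  set s := (∑ j, η j * (((e (Sum.inr j)).toNat : ℝ) - ((e (Sum.inl j)).toNat : ℝ))) / n with hs
  have e1 : mixErr η e = trainErr e + s := by
    rw [hs, mixErr, trainErr, ← add_div, ← Finset.sum_add_distrib]
    congr 1
    exact Finset.sum_congr rfl fun j _ => by ring
  have e2 : mixErr (fun j => 1 - η j) e = testErr e - s := by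
    rw [hs, mixErr, testErr, ← sub_div, ← Finset.sum_sub_distrib]
    congr 1
    exact Finset.sum_congr rfl fun j _ => by ring
  have hsε : |s| ≤ labelShift w := by
    rw [hs, abs_div, abs_of_pos hn0, div_le_iff₀ hn0, mul_comm]
    refine (Finset.abs_sum_le_sum_abs _ _).trans (le_trans (Finset.sum_le_sum fun j _ => ?_) hsum)
    rw [abs_mul, abs_of_nonneg (hη j).1]
    refine mul_le_of_le_one_right (hη j).1 ?_
    cases e (Sum.inl j) <;> cases e (Sum.inr j) <;> simp
  have h1 := mixErr_mem hη e
  have h2 := mixErr_mem (η := fun j => 1 - η j)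
    (fun j => ⟨by linarith [(hη j).2], by linarith [(hη j).1]⟩) e
  rw [e1] at h1 ⊢
  rw [e2] at h2 ⊢
  exact hD_sub_hC_le (trainErr_mem e) (testErr_mem e) hsε h1 h2

/-- The regret bound for labels which agree on the pairs `(inl j, inr j)` with `j ∈ T`. The
transport of `h_C` mixes the bits of the matched pairs partially and those of the other pairs
fully, and the tilt acts on the matched samples only. -/
lemma hasRegret_of_matching {n C : ℕ} (hn : 10 ≤ n) {w : Fin n ⊕ Fin n → Fin C}
    {T : Finset (Fin n)} (hT : ∀ j ∈ T, w (Sum.inl j) = w (Sum.inr j)) {u : ℝ}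
    (hu : (T.card : ℝ) + u = n) (hshift : labelShift w = u / n) {M : ℝ} (hM0 : 0 ≤ M)
    (hM : ∀ q : ℝ, 0 ≤ q → q ≤ 1 →
      ∑ c, log (tiltBound (T.filter fun j => w (Sum.inl j) = c).card q)
        - (2 * u * q + 2.38 * u * q ^ 2) ≤ M) :
    HasRegret w (1.32 + M) := by
  intro p q hp hq hq1 hex hac
  have hn0 : (0 : ℝ) < n := by exact_mod_cast (by omega : 0 < n)
  have hP := bprod_nonneg hp
  have hT1 : (T.card : ℝ) ≤ n := by exact_mod_cast (Finset.card_le_univ T).trans (by simp)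
  have hu0 : 0 ≤ u := by linarith
  have hnu : n * labelShift w = u := by rw [hshift]; field_simp
  rcases le_or_gt (T.card : ℝ) u with hut | hut
  · -- the transport allowed by `h_C` suffices to equalize the two error rates
    have h0 : ∑ e, bprod p e * (n * (gap w e * log 2)) ≤ 0 := by
      refine Finset.sum_nonpos fun e _ => mul_nonpos_of_nonneg_of_nonpos (hP e) ?_
      refine (natCast_mul_gap_le (by omega) w (η := fun _ => 1 / 2)
        (fun _ => ⟨by norm_num, by norm_num⟩) ?_ e).trans ?_
      · rw [hnu]; simp; linarith
      · norm_num [hDn_self]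
    have := relEntropy_nonneg hp hq hq1 hac
    linarith
  have ht0 : (0 : ℝ) < T.card := by linarith
  set t : ℝ := (T.card : ℝ) with ht
  have hγ : u / t < 1 := (div_lt_one ht0).2 hut
  have hγ0 : 0 ≤ u / t := div_nonneg hu0 ht0.le
  -- the weights use up the budget `u` of the transport: `u / 2` on the matched pairs and `u / 2` on
  -- the others
  set η : Fin n → ℝ := fun j => if j ∈ T then u / t / 2 else 1 / 2 with hηd
  have hη : ∀ j, η j ∈ Set.Icc (0 : ℝ) 1 := by
    intro j
    simp only [hηd]
    split_ifs
    · exact ⟨by linarith, by linarith⟩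
    · exact ⟨by norm_num, by norm_num⟩
  have hcompl : (Tᶜ.card : ℝ) = u := by
    rw [Finset.card_compl, Nat.cast_sub (Finset.card_le_univ T), Fintype.card_fin]
    linarith
  have hsplit : ∀ f : Fin n → ℝ, ∑ j, f j = ∑ j ∈ T, f j + ∑ j ∈ Tᶜ, f j := fun f =>
    (Finset.sum_add_sum_compl T f).symm
  have hηsum : ∑ j, η j ≤ n * labelShift w := by
    rw [hnu, hsplit, Finset.sum_congr rfl (g := fun _ => u / t / 2) (fun j hj => by simp [hηd, hj]),
      Finset.sum_congr (s₂ := Tᶜ) rfl (g := fun _ => (1 : ℝ) / 2)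
        (fun j hj => by simp [hηd, Finset.mem_compl.1 hj]), Finset.sum_const, Finset.sum_const,
      nsmul_eq_mul, nsmul_eq_mul, hcompl, ← ht]
    refine le_of_eq ?_
    field_simp
    ring
  have step1 : ∑ e, bprod p e * (n * (gap w e * log 2)) ≤
      ∑ e, bprod p e * (n * hDn (mixErr η e) (mixErr (fun j => 1 - η j) e)) :=
    Finset.sum_le_sum fun e _ =>
      mul_le_mul_of_nonneg_left (natCast_mul_gap_le (by omega) w hη hηsum e) (hP e)
  have step2 := mean_hDn_mixErr_le hn hη hp
  set A := ∑ j ∈ T, p (Sum.inl j) with hA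
  set B := ∑ j ∈ T, p (Sum.inr j) with hB
  set V := (∑ j ∈ Tᶜ, (p (Sum.inl j) + p (Sum.inr j))) / 2 with hV
  have hμ : ∀ η' : Fin n → ℝ, (∀ j ∈ Tᶜ, η' j = 1 / 2) → ∀ x, (∀ j ∈ T, η' j = x) →
      ∑ j, ((1 - η' j) * p (Sum.inl j) + η' j * p (Sum.inr j)) = (1 - x) * A + x * B + V := by
    intro η' h1 x h2
    rw [hsplit, Finset.sum_congr rfl (g := fun j => (1 - x) * p (Sum.inl j) + x * p (Sum.inr j))
      (fun j hj => by rw [h2 j hj]), Finset.sum_congr (s₂ := Tᶜ) rfl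
      (g := fun j => (p (Sum.inl j) + p (Sum.inr j)) / 2) (fun j hj => by rw [h1 j hj]; ring),
      Finset.sum_add_distrib, ← Finset.mul_sum, ← Finset.mul_sum, ← Finset.sum_div]
  have hμ1 := hμ η (fun j hj => by simp [hηd, Finset.mem_compl.1 hj]) (u / t / 2)
    (fun j hj => by simp [hηd, hj])
  have hμ2 := hμ (fun j => 1 - η j)
    (fun j hj => by simp only [hηd, Finset.mem_compl.1 hj, if_false]; norm_num) (1 - u / t / 2)
    (fun j hj => by simp [hηd, hj])
  simp only [sub_sub_cancel] at hμ2
  rw [hμ1, hμ2] at step2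
  have hAm : A ∈ Set.Icc 0 t := ⟨Finset.sum_nonneg fun j _ => (hp _).1,
    (Finset.sum_le_card_nsmul T _ 1 fun j _ => (hp _).2).trans (by simp [ht])⟩
  have hBm : B ∈ Set.Icc 0 t := ⟨Finset.sum_nonneg fun j _ => (hp _).1,
    (Finset.sum_le_card_nsmul T _ 1 fun j _ => (hp _).2).trans (by simp [ht])⟩
  have hVm : V ∈ Set.Icc 0 u := by
    refine ⟨div_nonneg (Finset.sum_nonneg fun j _ => add_nonneg (hp _).1 (hp _).1) (by norm_num), ?_⟩
    have := Finset.sum_le_card_nsmul Tᶜ (fun j => p (Sum.inl j) + p (Sum.inr j)) 2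
      fun j _ => by linarith [(hp (Sum.inl j)).2, (hp (Sum.inr j)).2]
    rw [nsmul_eq_mul, hcompl] at this
    rw [hV]; linarith
  -- the bound for a tilt which is positive up to an error `ε`
  refine le_of_forall_pos_le_add fun ε hε => ?_
  set x := ε / (2 * n) with hx
  have hx0 : 0 < x := by positivity
  have hη1 : exp (-x) < 1 := by
    rw [← exp_zero]; exact exp_lt_exp.2 (by linarith)
  obtain ⟨κ₁, κ₀, h1, h0, h10, htilt⟩ := exists_tilt (η := 1 - exp (-x)) hu0 hut hAm hBm hVm
    (by linarith) (by linarith [exp_pos (-x)])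
  rw [sub_sub_cancel, log_exp] at htilt
  have hBpos : 0 < ∏ c, tiltBound (T.filter fun j => w (Sum.inl j) = c).card (κ₀ * κ₁) :=
    Finset.prod_pos fun c _ => one_pos.trans_le (one_le_tiltBound _ h10)
  have hblocks := sum_mul_prod_blocks_le (block w T) (fun c c' i h h' => h.2.symm.trans h'.2)
    (q := q) (fun c x => ∏ i, tiltFactor κ₁ κ₀ i.1 (x i))
    (B := fun c => tiltBound (T.filter fun j => w (Sum.inl j) = c).card (κ₀ * κ₁)) hq
    (fun c x => Finset.prod_nonneg fun i _ => (tiltFactor_pos h1 h0 _ _).le)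
    (fun c => zero_le_one.trans (one_le_tiltBound _ h10))
    (fun τ hτ hfix e => hex τ (fun i => by
      by_cases hi : ∃ c, block w T c i
      · obtain ⟨c, hc⟩ := hi
        rw [((hτ c i).2 hc).2, hc.2]
      · rw [hfix i fun c hc => hi ⟨c, hc⟩]) e)
    (fun c m => sum_level_tilt_le hT h1 h0 h10 c m) Finset.univ
  rw [hq1, mul_one] at hblocks
  have hgibbs := sum_mul_log_le (P := bprod p) hP (sum_bprod p) hq hac
    (fun e => Finset.prod_nonneg fun c _ => Finset.prod_nonneg fun i _ =>
      (tiltFactor_pos h1 h0 _ _).le)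
    (fun e _ => (Finset.prod_pos fun c _ => Finset.prod_pos fun i _ =>
      tiltFactor_pos h1 h0 _ _).ne') hBpos hblocks
  rw [mean_log_tilt hT h1 h0,
    log_prod fun c _ => (one_pos.trans_le (one_le_tiltBound _ h10)).ne'] at hgibbs
  have hqle : κ₀ * κ₁ ≤ 1 := by
    rw [← abs_of_nonneg h10, abs_mul]
    exact mul_le_one₀ h0.le (abs_nonneg _) h1.le
  have hMq := hM _ h10 hqle
  have c1 : (1 - u / t / 2) * A + u / t / 2 * B + V = A + u / 2 * ((B - A) / t) + V := by
    field_simp; ring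
  have c2 : (1 - (1 - u / t / 2)) * A + (1 - u / t / 2) * B + V = B - u / 2 * ((B - A) / t) + V := by
    field_simp; ring
  simp only [sub_sub_cancel] at c2
  rw [c1, c2, ← hu] at step2
  have hxn : 2 * (t + u) * x = ε := by rw [hu, hx]; field_simp
  simp only [← hA, ← hB] at hgibbs
  rw [← hu] at step1 ⊢
  linarith

/-! ### Class counts and matchings -/

/-- The number of training samples with label `c`. -/
def trainCount {n C : ℕ} (w : Fin n ⊕ Fin n → Fin C) (c : Fin C) : ℕ :=
  (Finset.univ.filter fun j => w (Sum.inl j) = c).card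

/-- The number of ghost samples with label `c`. -/
def testCount {n C : ℕ} (w : Fin n ⊕ Fin n → Fin C) (c : Fin C) : ℕ :=
  (Finset.univ.filter fun j => w (Sum.inr j) = c).card

/-- The number of pairs which can be matched within the class `c`. -/
def matchCount {n C : ℕ} (w : Fin n ⊕ Fin n → Fin C) (c : Fin C) : ℕ :=
  min (trainCount w c) (testCount w c)

lemma sum_trainCount {n C : ℕ} (w : Fin n ⊕ Fin n → Fin C) : ∑ c, trainCount w c = n := by
  have := Finset.card_eq_sum_card_fiberwise (s := Finset.univ) (t := Finset.univ)
    (f := fun j : Fin n => w (Sum.inl j)) (by simp)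
  simp only [Finset.card_univ, Fintype.card_fin] at this
  exact this.symm

lemma sum_testCount {n C : ℕ} (w : Fin n ⊕ Fin n → Fin C) : ∑ c, testCount w c = n := by
  have := Finset.card_eq_sum_card_fiberwise (s := Finset.univ) (t := Finset.univ)
    (f := fun j : Fin n => w (Sum.inr j)) (by simp)
  simp only [Finset.card_univ, Fintype.card_fin] at this
  exact this.symm

lemma labelShift_eq {n C : ℕ} (hn : 0 < n) (w : Fin n ⊕ Fin n → Fin C) :
    labelShift w = (∑ c, |(trainCount w c : ℝ) - testCount w c|) / (2 * n) := by
  have hn0 : (0 : ℝ) < n := by exact_mod_cast hn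
  simp only [labelShift, empDistL1, empDist, Finset.sum_boole]
  rw [Finset.mul_sum, Finset.sum_div]
  refine Finset.sum_congr rfl fun c _ => ?_
  rw [← mul_sub, abs_mul, abs_of_pos (by positivity : (0 : ℝ) < 1 / n)]
  simp only [trainCount, testCount]
  field_simp

lemma labelShift_eq_sub {n C : ℕ} (hn : 0 < n) (w : Fin n ⊕ Fin n → Fin C) :
    labelShift w = (n - ((∑ c, matchCount w c : ℕ) : ℝ)) / n := by
  have hn0 : (0 : ℝ) < n := by exact_mod_cast hn
  rw [labelShift_eq hn]
  have h : ∀ c, |(trainCount w c : ℝ) - testCount w c| =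
      trainCount w c + testCount w c - 2 * (matchCount w c : ℝ) := by
    intro c
    simp only [matchCount]
    rcases le_total (trainCount w c) (testCount w c) with h | h
    · rw [min_eq_left h, abs_of_nonpos (by simpa using h)]; ring
    · rw [min_eq_right h, abs_of_nonneg (by simpa using h)]; ring
  simp_rw [h]
  rw [Finset.sum_sub_distrib, Finset.sum_add_distrib, ← Finset.mul_sum]
  have h1 : ∑ c, (trainCount w c : ℝ) = n := by exact_mod_cast sum_trainCount w
  have h2 : ∑ c, (testCount w c : ℝ) = n := by exact_mod_cast sum_testCount w
  rw [h1, h2]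
  push_cast
  field_simp
  ring

/-- Renumbering the ghost samples. -/
def ghostPerm {n : ℕ} (σ : Equiv.Perm (Fin n)) : Equiv.Perm (Fin n ⊕ Fin n) :=
  Equiv.sumCongr (Equiv.refl _) σ

@[simp] lemma ghostPerm_inr {n : ℕ} (σ : Equiv.Perm (Fin n)) (j : Fin n) :
    ghostPerm σ (Sum.inr j) = Sum.inr (σ j) := rfl

lemma trainCount_ghostPerm {n C : ℕ} (w : Fin n ⊕ Fin n → Fin C) (σ : Equiv.Perm (Fin n))
    (c : Fin C) : trainCount (w ∘ ghostPerm σ) c = trainCount w c := rfl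

lemma testCount_ghostPerm {n C : ℕ} (w : Fin n ⊕ Fin n → Fin C) (σ : Equiv.Perm (Fin n))
    (c : Fin C) : testCount (w ∘ ghostPerm σ) c = testCount w c := by
  simp only [testCount, Function.comp_apply, ghostPerm_inr]
  exact Finset.card_bij (fun j _ => σ j)
    (fun j hj => Finset.mem_filter.2 ⟨Finset.mem_univ _, (Finset.mem_filter.1 hj).2⟩)
    (fun _ _ _ _ h => σ.injective h)
    (fun j hj => ⟨σ.symm j, Finset.mem_filter.2 ⟨Finset.mem_univ _, by
      rw [σ.apply_symm_apply]; exact (Finset.mem_filter.1 hj).2⟩, by simp⟩)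

lemma labelShift_ghostPerm {n C : ℕ} (hn : 0 < n) (w : Fin n ⊕ Fin n → Fin C)
    (σ : Equiv.Perm (Fin n)) : labelShift (w ∘ ghostPerm σ) = labelShift w := by
  rw [labelShift_eq hn, labelShift_eq hn]
  simp only [trainCount_ghostPerm, testCount_ghostPerm]

/-- The regret does not depend on the numbering of the ghost samples. -/
lemma HasRegret.of_ghostPerm {n C : ℕ} (hn : 0 < n) {w : Fin n ⊕ Fin n → Fin C}
    (σ : Equiv.Perm (Fin n)) {M : ℝ} (h : HasRegret (w ∘ ghostPerm σ) M) : HasRegret w M := by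
  intro p q hp hq hq1 hex hac
  set φ := ghostPerm σ with hφ
  set E : (Fin n ⊕ Fin n → Bool) ≃ (Fin n ⊕ Fin n → Bool) := Equiv.arrowCongr φ.symm (Equiv.refl _)
  have hE : ∀ e, E e = e ∘ φ := fun e => rfl
  have hE' : ∀ e, E.symm e = e ∘ φ.symm := fun e => rfl
  have hb : ∀ e, bprod (p ∘ φ) (E e) = bprod p e := by
    intro e
    simp only [bprod, hE, Function.comp_apply]
    exact Equiv.prod_comp φ fun i => bw (p i) (e i)
  have hqE : ∀ e, q (E.symm (E e)) = q e := fun e => by rw [Equiv.symm_apply_apply]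
  have hgap : ∀ e, gap (w ∘ φ) (E e) = gap w e := by
    intro e
    have h1 : trainErr (E e) = trainErr e := rfl
    have h2 : testErr (E e) = testErr e := by
      simp only [testErr, hE, Function.comp_apply, hφ, ghostPerm_inr]
      rw [Equiv.sum_comp σ fun j => ((e (Sum.inr j)).toNat : ℝ)]
    simp only [gap, h1, h2, labelShift_ghostPerm hn, hφ]
  have key := h (p ∘ φ) (q ∘ E.symm) (fun i => hp _) (fun e => hq _)
    (by rw [← hq1]; exact E.symm.sum_comp q) ?_ ?_
  · rw [← E.sum_comp, ← E.sum_comp (fun e => bprod (p ∘ φ) e * log _)] at key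
    simp only [hb, hgap, Function.comp_apply, hqE] at key
    exact key
  · intro τ hτ e
    have := hex (φ.symm.trans (τ.trans φ)) (fun i => by
      have := hτ (φ.symm i)
      simpa using this) (E.symm e)
    rw [Function.comp_apply, Function.comp_apply, ← this]
    congr 1
    funext i
    simp [hE']
  · intro e he
    rw [← E.apply_symm_apply e, hb]
    exact hac _ he

/-- The ghost samples can be renumbered so that as many pairs as possible have equal labels. -/
lemma exists_matching {n C : ℕ} (w : Fin n ⊕ Fin n → Fin C) :
    ∃ σ : Equiv.Perm (Fin n), ∀ c, (Finset.univ.filter fun j =>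
      w (Sum.inl j) = w (Sum.inr (σ j)) ∧ w (Sum.inl j) = c).card = matchCount w c := by
  obtain ⟨σ, -, hσ⟩ := Finset.exists_max_image (Finset.univ : Finset (Equiv.Perm (Fin n)))
    (fun σ => (Finset.univ.filter fun j => w (Sum.inl j) = w (Sum.inr (σ j))).card) ⟨1, by simp⟩
  refine ⟨σ, fun c => ?_⟩
  set Mc := Finset.univ.filter fun j => w (Sum.inl j) = w (Sum.inr (σ j)) ∧ w (Sum.inl j) = c
    with hMc
  have h1 : Mc ⊆ Finset.univ.filter fun j => w (Sum.inl j) = c := fun j hj => by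
    simp only [hMc, Finset.mem_filter, Finset.mem_univ, true_and] at hj ⊢; exact hj.2
  have h2 : Mc ⊆ Finset.univ.filter fun j => w (Sum.inr (σ j)) = c := fun j hj => by
    simp only [hMc, Finset.mem_filter, Finset.mem_univ, true_and] at hj ⊢
    rw [← hj.1]; exact hj.2
  have htest : testCount w c = (Finset.univ.filter fun j => w (Sum.inr (σ j)) = c).card :=
    (testCount_ghostPerm w σ c).symm
  refine le_antisymm (le_min (Finset.card_le_card h1) (htest ▸ Finset.card_le_card h2)) ?_
  by_contra hlt
  push Not at hlt
  have l1 : Mc.card < trainCount w c := hlt.trans_le (min_le_left _ _)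
  have l2 : Mc.card < testCount w c := hlt.trans_le (min_le_right _ _)
  rw [htest] at l2
  -- swapping the partners of two unmatched samples of the class `c` adds a matched pair
  obtain ⟨a, ha, haM⟩ := Finset.exists_mem_notMem_of_card_lt_card l1
  obtain ⟨b, hb, hbM⟩ := Finset.exists_mem_notMem_of_card_lt_card l2
  simp only [hMc, Finset.mem_filter, Finset.mem_univ, true_and, not_and] at ha haM hb hbM
  have ha' : w (Sum.inl a) ≠ w (Sum.inr (σ a)) := fun h => haM h ha
  have hb' : w (Sum.inl b) ≠ w (Sum.inr (σ b)) := fun h => hbM h (h.trans hb)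
  have := hσ (σ * Equiv.swap a b) (Finset.mem_univ _)
  refine absurd this (not_le.2 (Finset.card_lt_card ?_))
  refine Finset.ssubset_iff_of_subset ?_ |>.2 ⟨a, ?_, ?_⟩
  · intro j hj
    simp only [Finset.mem_filter, Finset.mem_univ, true_and] at hj ⊢
    have ja : j ≠ a := fun h => ha' (h ▸ hj)
    have jb : j ≠ b := fun h => hb' (h ▸ hj)
    rw [Equiv.Perm.mul_apply, Equiv.swap_apply_of_ne_of_ne ja jb]
    exact hj
  · refine Finset.mem_filter.2 ⟨Finset.mem_univ _, ?_⟩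
    rw [Equiv.Perm.mul_apply, Equiv.swap_apply_left, ha, hb]
  · exact fun h => ha' (Finset.mem_filter.1 h).2

/-- The regret bound in terms of the class counts. -/
theorem hasRegret_tilt {n C : ℕ} (hn : 10 ≤ n) (w : Fin n ⊕ Fin n → Fin C) {u : ℝ}
    (hu : ((∑ c, matchCount w c : ℕ) : ℝ) + u = n) {M : ℝ} (hM0 : 0 ≤ M)
    (hM : ∀ q : ℝ, 0 ≤ q → q ≤ 1 →
      ∑ c, log (tiltBound (matchCount w c) q) - (2 * u * q + 2.38 * u * q ^ 2) ≤ M) :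
    HasRegret w (1.32 + M) := by
  obtain ⟨σ, hσ⟩ := exists_matching w
  refine HasRegret.of_ghostPerm (by omega) σ ?_
  set T := Finset.univ.filter fun j => w (Sum.inl j) = w (Sum.inr (σ j)) with hT
  have hcard : ∀ c, (T.filter fun j => (w ∘ ghostPerm σ) (Sum.inl j) = c).card = matchCount w c := by
    intro c
    rw [← hσ c, hT, Finset.filter_filter]
    rfl
  have hTc : T.card = ∑ c, matchCount w c := by
    rw [Finset.card_eq_sum_card_fiberwise (s := T) (t := Finset.univ)
      (f := fun j : Fin n => w (Sum.inl j)) (by simp)]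
    exact Finset.sum_congr rfl fun c _ => hcard c
  refine hasRegret_of_matching hn (T := T) (u := u) (fun j hj => (Finset.mem_filter.1 hj).2)
    (by rw [hTc]; exact hu) ?_ hM0 fun q hq0 hq1 => ?_
  · rw [labelShift_ghostPerm (by omega), labelShift_eq_sub (by omega)]
    congr 1; linarith
  · simp only [hcard]
    exact hM q hq0 hq1

/-! ### Binomial coefficients and entropy -/

/-- `log ((1 + 1 / m) ^ m)`. -/
def growth (m : ℕ) : ℝ := m * log ((m + 1 : ℝ) / m)

lemma growth_mono : Monotone growth := by
  refine monotone_nat_of_le_succ fun m => ?_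
  rcases Nat.eq_zero_or_pos m with rfl | hm
  · simp [growth]; exact log_nonneg (by norm_num)
  have hm0 : (0 : ℝ) < m := by exact_mod_cast hm
  have h := strictConcaveOn_log_Ioi.concaveOn.2 (x := ((m : ℝ) + 1) / m) (y := 1)
    (Set.mem_Ioi.2 (by positivity)) (Set.mem_Ioi.2 one_pos)
    (show (0 : ℝ) ≤ m / (m + 1) by positivity) (show (0 : ℝ) ≤ 1 / (m + 1) by positivity)
    (by field_simp)
  simp only [smul_eq_mul, log_one, mul_zero, add_zero] at h
  rw [show (m : ℝ) / (m + 1) * ((m + 1) / m) + 1 / (m + 1) * 1 = (m + 1 + 1) / (m + 1) by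
    field_simp] at h
  simp only [growth]
  push_cast
  have := mul_le_mul_of_nonneg_left h (show (0 : ℝ) ≤ m + 1 by positivity)
  refine le_trans (le_of_eq ?_) this
  field_simp

/-- The logarithm of the largest probability which a binomial law of size `N` gives to `m`. -/
def logPeak (N m : ℕ) : ℝ := log (N.choose m) - N * binEntropy ((m : ℝ) / N)

lemma natCast_mul_binEntropy {N m : ℕ} (hm : m ≤ N) :
    N * binEntropy ((m : ℝ) / N) = N * log N - m * log m - ((N - m : ℕ) : ℝ) * log ((N - m : ℕ) : ℝ) := by
  rcases Nat.eq_zero_or_pos N with rfl | hN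
  · simp [Nat.le_zero.1 hm]
  have hN0 : (0 : ℝ) < N := by exact_mod_cast hN
  have aux : ∀ j : ℕ, (j : ℝ) * log ((j : ℝ) / N) = j * log j - j * log N := by
    intro j
    rcases Nat.eq_zero_or_pos j with rfl | hj
    · simp
    · rw [log_div (by exact_mod_cast hj.ne') hN0.ne']; ring
  have h1 : (1 : ℝ) - m / N = ((N - m : ℕ) : ℝ) / N := by
    rw [Nat.cast_sub hm]; field_simp
  have e : N * binEntropy ((m : ℝ) / N) =
      -((m : ℝ) * log ((m : ℝ) / N)) - ((N - m : ℕ) : ℝ) * log (((N - m : ℕ) : ℝ) / N) := by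
    simp only [binEntropy, h1, log_inv]
    field_simp
    ring
  rw [e, aux, aux, Nat.cast_sub hm]
  ring

lemma logPeak_symm {N m : ℕ} (hm : m ≤ N) : logPeak N (N - m) = logPeak N m := by
  simp only [logPeak, Nat.choose_symm hm, natCast_mul_binEntropy hm,
    natCast_mul_binEntropy (Nat.sub_le N m), Nat.sub_sub_self hm]
  ring

lemma logPeak_succ {N m : ℕ} (hm : m + 1 ≤ N) :
    logPeak N (m + 1) = logPeak N m + growth m - growth (N - (m + 1)) := by
  have aux : ∀ j : ℕ, growth j = ((j : ℝ) + 1) * log (j + 1) - j * log j - log (j + 1) := by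
    intro j
    simp only [growth]
    rcases Nat.eq_zero_or_pos j with rfl | hj
    · simp
    · have : (0 : ℝ) < j := by exact_mod_cast hj
      rw [log_div (by positivity) (by positivity)]; ring
  have hc := Nat.choose_succ_right_eq N m
  have hc' : (N.choose (m + 1) : ℝ) * (m + 1) = N.choose m * ((N - m : ℕ) : ℝ) := by
    exact_mod_cast hc
  have p1 : (0 : ℝ) < N.choose (m + 1) := by exact_mod_cast Nat.choose_pos hm
  have p2 : (0 : ℝ) < N.choose m := by exact_mod_cast Nat.choose_pos (by omega)
  have p3 : (0 : ℝ) < ((N - m : ℕ) : ℝ) := by exact_mod_cast (by omega : 0 < N - m)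
  have hl := congrArg log hc'
  rw [log_mul p1.ne' (by positivity), log_mul p2.ne' p3.ne'] at hl
  obtain ⟨r, hr⟩ : ∃ r, N - m = r + 1 := ⟨N - m - 1, by omega⟩
  have hr' : N - (m + 1) = r := by omega
  simp only [logPeak, natCast_mul_binEntropy hm, natCast_mul_binEntropy (by omega : m ≤ N), hr', aux]
  rw [hr] at hl ⊢
  push_cast at hl ⊢
  linarith

/-- The largest binomial probability of `m` decreases up to the middle of the range. -/
lemma logPeak_antitone {N m k : ℕ} (hmk : m ≤ k) (hk : 2 * k ≤ N + 1) :
    logPeak N k ≤ logPeak N m := by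
  induction k, hmk using Nat.le_induction with
  | base => exact le_rfl
  | succ k hk' ih =>
    rw [logPeak_succ (by omega)]
    have := growth_mono (show k ≤ N - (k + 1) by omega)
    linarith [ih (by omega)]

lemma logPeak_one {N : ℕ} (hN : 1 ≤ N) : logPeak N 1 = - growth (N - 1) := by
  have h := logPeak_succ (N := N) (m := 0) hN
  have : logPeak N 0 = 0 := by simp [logPeak]
  simpa [this, growth] using h

/-- Away from the end points, the largest binomial probability is that of one success at most. -/
lemma logPeak_le {N k : ℕ} (h0 : 0 < k) (hk : k < N) : logPeak N k ≤ - growth (N - 1) := by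
  rw [← logPeak_one (by omega)]
  rcases le_total (2 * k) N with h | h
  · exact logPeak_antitone h0 (by omega)
  · rw [← logPeak_symm hk.le]
    exact logPeak_antitone (by omega) (by omega)

lemma logPeak_nonpos {N k : ℕ} (hk : k ≤ N) : logPeak N k ≤ 0 := by
  have h0 : logPeak N 0 = 0 := by simp [logPeak]
  rw [← h0]
  rcases le_total (2 * k) N with h | h
  · exact logPeak_antitone (Nat.zero_le _) (by omega)
  · rw [← logPeak_symm hk]
    exact logPeak_antitone (Nat.zero_le _) (by omega)

/-- `log (4 ^ t / (2 t choose t))`: minus the logarithm of the chance that `2 t` fair bits have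
exactly `t` ones. -/
def phi (t : ℕ) : ℝ := log (tiltBound t 1)

lemma tiltBound_one_mul_centralBinom (t : ℕ) : tiltBound t 1 * t.centralBinom = 4 ^ t := by
  induction t with
  | zero => simp [tiltBound]
  | succ t ih =>
    have h := Nat.succ_mul_centralBinom_succ t
    have h' : ((t : ℝ) + 1) * (t + 1).centralBinom = 2 * (2 * t + 1) * t.centralBinom := by
      exact_mod_cast h
    have h2 : ((t + 1).centralBinom : ℝ) = 2 * (2 * t + 1) * t.centralBinom / (t + 1) := by
      field_simp; linarith
    have hs : tiltBound (t + 1) 1 = tiltBound t 1 * (1 + 1 / (2 * t + 1)) := by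
      rw [tiltBound, Finset.prod_range_succ]; rfl
    rw [hs, h2, pow_succ, ← ih]
    field_simp
    ring

lemma logPeak_center (t : ℕ) : logPeak (2 * t) t = - phi t := by
  rcases Nat.eq_zero_or_pos t with rfl | ht
  · simp [logPeak, phi, tiltBound]
  have ht0 : (0 : ℝ) < t := by exact_mod_cast ht
  have hb : (0 : ℝ) < tiltBound t 1 := one_pos.trans_le (one_le_tiltBound t zero_le_one)
  have hc : (0 : ℝ) < t.centralBinom := by exact_mod_cast t.centralBinom_pos
  have h := congrArg log (tiltBound_one_mul_centralBinom t)
  rw [log_mul hb.ne' hc.ne', log_pow, show (4 : ℝ) = 2 ^ 2 by norm_num, log_pow] at h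
  have h2 : ((t : ℝ) / ((2 * t : ℕ) : ℝ)) = 2⁻¹ := by push_cast; field_simp
  simp only [logPeak, h2, binEntropy_two_inv, phi, ← Nat.centralBinom_eq_two_mul_choose]
  push_cast at h ⊢
  linarith

/-- Among the values of `logPeak (2 * t)` the central one is the smallest. -/
lemma neg_logPeak_le {t m : ℕ} (hm : m ≤ 2 * t) : - logPeak (2 * t) m ≤ phi t := by
  have := logPeak_center t
  rcases le_total m t with h | h
  · linarith [logPeak_antitone (N := 2 * t) h (by omega)]
  · have h2 := logPeak_symm hm
    linarith [logPeak_antitone (N := 2 * t) (m := 2 * t - m) (k := t) (by omega) (by omega)]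

/-! ### The entropy of the number of ones -/

lemma ones_le_card {ι : Type*} [Fintype ι] (x : ι → Bool) : ones x ≤ Fintype.card ι := by
  refine (Finset.sum_le_card_nsmul Finset.univ _ 1 fun i _ => Bool.toNat_le _).trans ?_
  simp

section Counts

variable {ι : Type*} [Fintype ι] [DecidableEq ι]

lemma sum_levels (F : (ι → Bool) → ℝ) :
    ∑ m ∈ Finset.range (Fintype.card ι + 1), ∑ x with ones x = m, F x = ∑ x, F x :=
  Finset.sum_fiberwise_of_maps_to
    (fun x _ => Finset.mem_range.2 (Nat.lt_succ_of_le (ones_le_card x))) F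

/-- The law of the number of ones. -/
def onesLaw (p : ι → ℝ) (m : ℕ) : ℝ := ∑ x : ι → Bool with ones x = m, bprod p x

/-- The entropy of the number of ones. -/
def onesEntropy (p : ι → ℝ) : ℝ := - ∑ x : ι → Bool, bprod p x * log (onesLaw p (ones x))

lemma onesLaw_nonneg {p : ι → ℝ} (hp : ∀ i, p i ∈ Set.Icc (0 : ℝ) 1) (m : ℕ) :
    0 ≤ onesLaw p m := Finset.sum_nonneg fun x _ => bprod_nonneg hp x

lemma bprod_le_onesLaw {p : ι → ℝ} (hp : ∀ i, p i ∈ Set.Icc (0 : ℝ) 1) (x : ι → Bool) :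
    bprod p x ≤ onesLaw p (ones x) :=
  Finset.single_le_sum (f := bprod p) (fun y _ => bprod_nonneg hp y)
    (Finset.mem_filter.2 ⟨Finset.mem_univ x, rfl⟩)

lemma onesLaw_pos {p : ι → ℝ} (hp : ∀ i, p i ∈ Set.Icc (0 : ℝ) 1) {x : ι → Bool}
    (hx : bprod p x ≠ 0) : 0 < onesLaw p (ones x) :=
  (lt_of_le_of_ne (bprod_nonneg hp x) hx.symm).trans_le (bprod_le_onesLaw hp x)

lemma sum_onesLaw (p : ι → ℝ) :
    ∑ m ∈ Finset.range (Fintype.card ι + 1), onesLaw p m = 1 := by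
  rw [← sum_bprod p, ← sum_levels]; rfl

lemma sum_onesLaw_le {p : ι → ℝ} (hp : ∀ i, p i ∈ Set.Icc (0 : ℝ) 1) (s : Finset ℕ) :
    ∑ m ∈ s, onesLaw p m ≤ 1 := by
  have h1 : ∑ m ∈ s, onesLaw p m ≤ ∑ m ∈ s ∪ Finset.range (Fintype.card ι + 1), onesLaw p m :=
    Finset.sum_le_sum_of_subset_of_nonneg Finset.subset_union_left
      fun m _ _ => onesLaw_nonneg hp m
  refine h1.trans (le_of_eq ?_)
  rw [← sum_onesLaw p]
  refine (Finset.sum_subset Finset.subset_union_right fun m _ hm => ?_).symm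
  refine Finset.sum_eq_zero fun x hx => ?_
  have := (Finset.mem_filter.1 hx).2
  exact absurd (Finset.mem_range.2 (Nat.lt_succ_of_le (this ▸ ones_le_card x))) hm

/-- The entropy of the number of ones is at most any cross entropy. -/
lemma onesEntropy_le_cross {p : ι → ℝ} (hp : ∀ i, p i ∈ Set.Icc (0 : ℝ) 1) {r : ℕ → ℝ}
    (hr : ∀ m, 0 ≤ r m) (hr1 : ∑ m ∈ Finset.range (Fintype.card ι + 1), r m ≤ 1)
    (hac : ∀ x : ι → Bool, bprod p x ≠ 0 → r (ones x) ≠ 0) :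
    onesEntropy p ≤ ∑ x : ι → Bool, bprod p x * - log (r (ones x)) := by
  have key := sum_mul_log_le (P := bprod p) (q := bprod p)
    (G := fun x => r (ones x) / onesLaw p (ones x)) (B := 1) (bprod_nonneg hp) (sum_bprod p)
    (bprod_nonneg hp) (fun _ h => h) (fun x => div_nonneg (hr _) (onesLaw_nonneg hp _))
    (fun x hx => div_ne_zero (hac x hx) (onesLaw_pos hp hx).ne') one_pos ?_
  · have h0 : ∑ x : ι → Bool, bprod p x * log (bprod p x / bprod p x) = 0 := by
      refine Finset.sum_eq_zero fun x _ => ?_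
      by_cases hx : bprod p x = 0
      · simp [hx]
      · simp [div_self hx]
    rw [h0, log_one, add_zero] at key
    have h1 : ∑ x : ι → Bool, bprod p x * log (r (ones x) / onesLaw p (ones x)) =
        onesEntropy p - ∑ x : ι → Bool, bprod p x * - log (r (ones x)) := by
      rw [onesEntropy, ← Finset.sum_neg_distrib, ← Finset.sum_sub_distrib]
      refine Finset.sum_congr rfl fun x _ => ?_
      by_cases hx : bprod p x = 0
      · simp [hx]
      · rw [log_div (hac x hx) (onesLaw_pos hp hx).ne']; ring
    linarith
  · rw [← sum_levels]
    refine le_trans (Finset.sum_le_sum fun m _ => ?_) hr1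
    have : ∑ x : ι → Bool with ones x = m, bprod p x * (r (ones x) / onesLaw p (ones x)) =
        onesLaw p m * (r m / onesLaw p m) := by
      rw [onesLaw, Finset.sum_mul]
      refine Finset.sum_congr rfl fun x hx => ?_
      rw [(Finset.mem_filter.1 hx).2]; rfl
    rw [this]
    by_cases h : onesLaw p m = 0
    · rw [h, zero_mul]; exact hr m
    · rw [mul_div_cancel₀ _ h]

lemma sum_bprod_log (p : ι → ℝ) :
    ∑ x : ι → Bool, bprod p x * log (bprod p x) = - ∑ i, binEntropy (p i) := by
  have h : ∀ x : ι → Bool, bprod p x * log (bprod p x) =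
      ∑ i, bprod p x * log (bw (p i) (x i)) := by
    intro x
    by_cases hx : bprod p x = 0
    · simp [hx]
    · have hne : ∀ i, bw (p i) (x i) ≠ 0 := fun i =>
        Finset.prod_ne_zero_iff.1 hx i (Finset.mem_univ i)
      rw [← Finset.mul_sum]
      congr 1
      exact log_prod fun i _ => hne i
  simp_rw [h]
  rw [Finset.sum_comm, ← Finset.sum_neg_distrib]
  refine Finset.sum_congr rfl fun i _ => ?_
  rw [sum_bprod_eval p i fun b => log (bw (p i) b)]
  simp only [bw_true, bw_false, binEntropy, log_inv]
  ring

/-- The difference between the entropy of independent bits and the mean entropy of their average. -/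
def bitsDefect (p : ι → ℝ) : ℝ :=
  ∑ i, binEntropy (p i) -
    ∑ x : ι → Bool, bprod p x * (Fintype.card ι * binEntropy ((ones x : ℝ) / Fintype.card ι))

/-- For independent bits, the entropy defect is bounded as for a binomial law. -/
lemma bitsDefect_le_defect {p : ι → ℝ} (hp : ∀ i, p i ∈ Set.Icc (0 : ℝ) 1)
    (hn : 3 ≤ Fintype.card ι) : bitsDefect p ≤ defect (Fintype.card ι) := by
  have hn0 : (0 : ℝ) < Fintype.card ι := by exact_mod_cast (by omega : 0 < Fintype.card ι)
  have h1 := entropy_defect hn (α := Bool) (fun i => bw (p i)) (fun _ b => (b.toNat : ℝ))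
    (fun i b => bw_nonneg (hp i).1 (hp i).2 b) (fun i => by simp)
    (fun _ b => by cases b <;> simp)
  refine le_trans (sub_le_sub ?_ (le_of_eq ?_)) h1
  · have := strictConcave_binEntropy.concaveOn.le_map_sum (t := Finset.univ)
      (w := fun _ : ι => 1 / (Fintype.card ι : ℝ)) (p := p) (fun _ _ => by positivity)
      (by simp; field_simp) (fun i _ => hp i)
    simp only [smul_eq_mul, ← Finset.mul_sum] at this
    have h2 : (∑ i, ∑ b, bw (p i) b * ((b.toNat : ℕ) : ℝ)) / (Fintype.card ι : ℝ) =
        1 / (Fintype.card ι : ℝ) * ∑ i, p i := by simp; ring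
    rw [h2]
    have := mul_le_mul_of_nonneg_left this hn0.le
    refine le_trans (le_of_eq ?_) this
    field_simp
  · refine Finset.sum_congr rfl fun x _ => ?_
    simp only [bprod, ones, Nat.cast_sum]

/-- The entropy of the bits is at most the entropy of their number of ones plus the mean logarithm of
the number of arrangements. -/
lemma bits_le_onesEntropy_add {p : ι → ℝ} (hp : ∀ i, p i ∈ Set.Icc (0 : ℝ) 1) :
    ∑ i, binEntropy (p i) ≤ onesEntropy p +
      ∑ x : ι → Bool, bprod p x * log ((Fintype.card ι).choose (ones x)) := by
  have hc : ∀ x : ι → Bool, (0 : ℝ) < (Fintype.card ι).choose (ones x) := fun x => by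
    exact_mod_cast Nat.choose_pos (ones_le_card x)
  have key := sum_mul_log_le (P := bprod p)
    (q := fun x => onesLaw p (ones x) / (Fintype.card ι).choose (ones x))
    (G := fun _ => 1) (B := 1) (bprod_nonneg hp) (sum_bprod p)
    (fun x => div_nonneg (onesLaw_nonneg hp _) (hc x).le) (fun x hx => ?_) (by simp) (by simp)
    one_pos ?_
  · simp only [log_one, mul_zero, Finset.sum_const_zero, add_zero] at key
    have h1 : ∀ x : ι → Bool, bprod p x *
        log (bprod p x / (onesLaw p (ones x) / (Fintype.card ι).choose (ones x))) =
        bprod p x * log (bprod p x) - bprod p x * log (onesLaw p (ones x))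
          + bprod p x * log ((Fintype.card ι).choose (ones x)) := by
      intro x
      by_cases hx : bprod p x = 0
      · simp [hx]
      · have h := onesLaw_pos hp hx
        rw [log_div hx (div_pos h (hc x)).ne', log_div h.ne' (hc x).ne']; ring
    simp_rw [h1, Finset.sum_add_distrib, Finset.sum_sub_distrib] at key
    rw [sum_bprod_log] at key
    simp only [onesEntropy]
    linarith
  · by_contra hne
    exact (div_pos (onesLaw_pos hp hne) (hc x)).ne' hx
  · rw [← sum_levels]
    refine le_trans (Finset.sum_le_sum fun m hm => ?_) (sum_onesLaw p).le
    have h2 : ∑ x : ι → Bool with ones x = m,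
        onesLaw p (ones x) / ((Fintype.card ι).choose (ones x) : ℝ) * 1 =
        ((Finset.univ.filter fun x : ι → Bool => ones x = m).card : ℝ) *
          (onesLaw p m / (Fintype.card ι).choose m) := by
      rw [← nsmul_eq_mul, ← Finset.sum_const]
      refine Finset.sum_congr rfl fun x hx => ?_
      rw [(Finset.mem_filter.1 hx).2, mul_one]
    have h3 : (0 : ℝ) < (Fintype.card ι).choose m := by
      exact_mod_cast Nat.choose_pos (Nat.lt_succ_iff.1 (Finset.mem_range.1 hm))
    rw [h2, card_level, mul_div_cancel₀ _ h3.ne']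

/-- The entropy defect is at most the entropy of the number of ones, less a multiple of the
probability of nonconstant bits: their levels have fewer arrangements than the entropy bound. -/
lemma bitsDefect_le_onesEntropy {p : ι → ℝ} (hp : ∀ i, p i ∈ Set.Icc (0 : ℝ) 1) :
    bitsDefect p ≤ onesEntropy p - growth (Fintype.card ι - 1) *
      ∑ x : ι → Bool with 0 < ones x ∧ ones x < Fintype.card ι, bprod p x := by
  have h1 := bits_le_onesEntropy_add hp
  have h2 : ∑ x : ι → Bool, bprod p x * logPeak (Fintype.card ι) (ones x) ≤
      - (growth (Fintype.card ι - 1) *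
      ∑ x : ι → Bool with 0 < ones x ∧ ones x < Fintype.card ι, bprod p x) := by
    rw [Finset.sum_filter, Finset.mul_sum, ← Finset.sum_neg_distrib]
    refine Finset.sum_le_sum fun x _ => ?_
    split_ifs with h
    · have := mul_le_mul_of_nonneg_left (logPeak_le h.1 h.2) (bprod_nonneg hp x)
      linarith
    · have := mul_nonpos_of_nonneg_of_nonpos (bprod_nonneg hp x) (logPeak_nonpos (ones_le_card x))
      linarith
  simp only [logPeak, mul_sub, Finset.sum_sub_distrib] at h2
  simp only [bitsDefect]
  linarith

end Counts

/-! ### Entropy defects of independent bits -/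

section Large

variable {ι : Type*} [Fintype ι] [DecidableEq ι]

lemma mean_ones_eq (p : ι → ℝ) : ∑ x : ι → Bool, bprod p x * (ones x : ℝ) = ∑ i, p i := by
  simp only [ones, Nat.cast_sum, Finset.mul_sum]
  rw [Finset.sum_comm]
  refine Finset.sum_congr rfl fun i _ => ?_
  rw [sum_bprod_eval p i fun b => (b.toNat : ℝ)]; simp

/-- Comparison of the number of ones with a geometric law of ratio `1 / 7`. -/
lemma onesEntropy_le_geometric {p : ι → ℝ} (hp : ∀ i, p i ∈ Set.Icc (0 : ℝ) 1) {d : ℕ → ℕ}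
    (hd : Set.InjOn d (Finset.range (Fintype.card ι + 1))) :
    onesEntropy p ≤ 1 / 6 + 2 * ∑ x : ι → Bool, bprod p x * (d (ones x) : ℝ) := by
  have h7 : log 7 ≤ 2 := by
    rw [log_le_iff_le_exp (by norm_num)]
    have := exp_one_gt_d9
    have h2 : exp 2 = exp 1 ^ 2 := by rw [← exp_nat_mul]; norm_num
    rw [h2]; nlinarith
  have h6 : - log (6 / 7 : ℝ) ≤ 1 / 6 := by
    rw [← log_inv]
    exact (log_le_sub_one_of_pos (by norm_num)).trans (by norm_num)
  have hgeo : ∑ m ∈ Finset.range (Fintype.card ι + 1), (6 / 7 : ℝ) * (1 / 7) ^ d m ≤ 1 := by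
    rw [← Finset.mul_sum, ← Finset.sum_image (f := fun k => (1 / 7 : ℝ) ^ k) hd]
    have := (summable_geometric_of_lt_one (r := (1 / 7 : ℝ)) (by norm_num)
      (by norm_num)).sum_le_tsum ((Finset.range (Fintype.card ι + 1)).image d)
      (fun _ _ => by positivity)
    rw [tsum_geometric_of_lt_one (by norm_num) (by norm_num)] at this
    linarith
  refine (onesEntropy_le_cross hp (r := fun m => (6 / 7 : ℝ) * (1 / 7) ^ d m)
    (fun m => by positivity) hgeo (fun x _ => by positivity)).trans ?_
  have hpt : ∀ x : ι → Bool, bprod p x * -log (6 / 7 * (1 / 7) ^ d (ones x)) ≤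
      bprod p x * (1 / 6) + 2 * (bprod p x * (d (ones x) : ℝ)) := by
    intro x
    rw [log_mul (by norm_num) (by positivity), log_pow, one_div, log_inv]
    have h0 := bprod_nonneg hp x
    have : -(log (6 / 7) + (d (ones x) : ℝ) * -log 7) ≤ 6⁻¹ + 2 * (d (ones x) : ℝ) := by
      have := mul_le_mul_of_nonneg_left h7 (Nat.cast_nonneg (α := ℝ) (d (ones x)))
      linarith
    have := mul_le_mul_of_nonneg_left this h0
    linarith
  refine (Finset.sum_le_sum fun x _ => hpt x).trans (le_of_eq ?_)
  rw [Finset.sum_add_distrib, ← Finset.sum_mul, sum_bprod, one_mul, ← Finset.mul_sum]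

/-- A probability close to one of a constant bit vector bounds the mean number of deviating bits. -/
lemma sum_le_of_prod_one_sub {p : ι → ℝ} (h : 0.845 ≤ ∏ i, (1 - p i))
    (hp : ∀ i, p i ∈ Set.Icc (0 : ℝ) 1) : ∑ i, p i ≤ 0.184 := by
  have hne : ∀ i, 1 - p i ≠ 0 := fun i =>
    Finset.prod_ne_zero_iff.1 (by linarith : ∏ i, (1 - p i) ≠ 0) i (Finset.mem_univ i)
  have hpos : ∀ i, 0 < 1 - p i := fun i => lt_of_le_of_ne (by linarith [(hp i).2]) (hne i).symm
  have h1 : ∑ i, p i ≤ - log (∏ i, (1 - p i)) := by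
    rw [log_prod fun i _ => hne i, ← Finset.sum_neg_distrib]
    refine Finset.sum_le_sum fun i _ => ?_
    have := log_le_sub_one_of_pos (hpos i)
    linarith
  have h2 : -log (∏ i, (1 - p i)) ≤ (0.845 : ℝ)⁻¹ - 1 := by
    have h3 := log_le_log (by norm_num) h
    have h4 := log_le_sub_one_of_pos (show (0 : ℝ) < (0.845)⁻¹ by norm_num)
    rw [log_inv] at h4
    linarith
  norm_num at h2 ⊢
  linarith

lemma growth_two_ge : (0.81 : ℝ) ≤ growth 2 := by
  have h := log_ratio_ge (x := 1 / 5) (by norm_num) (by norm_num)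
  rw [← log_div (by norm_num) (by norm_num)] at h
  norm_num at h
  simp only [growth]
  norm_num
  linarith

/-- Half of the entropy of the number of ones absorbs part of the entropy defect. This entropy is small
only if the bits are nearly constant, and then the defect is small as well. -/
lemma bitsDefect_sub_half_le {p : ι → ℝ} (hp : ∀ i, p i ∈ Set.Icc (0 : ℝ) 1)
    (hn : 3 ≤ Fintype.card ι) :
    bitsDefect p - onesEntropy p / 2 ≤ (defect (Fintype.card ι) - 0.11) / 2 := by
  have h1 := bitsDefect_le_defect hp hn
  have h2 := bitsDefect_le_onesEntropy hp
  have hg : (0.81 : ℝ) ≤ growth (Fintype.card ι - 1) :=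
    growth_two_ge.trans (growth_mono (by omega))
  set Pm := ∑ x : ι → Bool with 0 < ones x ∧ ones x < Fintype.card ι, bprod p x with hPm
  have hPm0 : 0 ≤ Pm := Finset.sum_nonneg fun x _ => bprod_nonneg hp x
  have h3 := mul_le_mul_of_nonneg_right hg hPm0
  -- if nonconstant bit vectors are probable, the mean of the bounds `h1` and `h2` suffices
  rcases le_total 0.11 (growth (Fintype.card ι - 1) * Pm) with hbig | hsmall
  · linarith
  -- otherwise all bits are equal with high probability
  have hH : onesEntropy p ≤ 0.55 := by
    set x0 : ι → Bool := fun _ => false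
    set x1 : ι → Bool := fun _ => true
    have hsub : (Finset.univ.filter fun x : ι → Bool => ¬ (0 < ones x ∧ ones x < Fintype.card ι)) ⊆
        {x0, x1} := by
      intro x hx
      have hx' := (Finset.mem_filter.1 hx).2
      have hle := ones_le_card x
      rcases Nat.eq_zero_or_pos (ones x) with h | h
      · have : x = x0 := by
          funext i
          have := Finset.sum_eq_zero_iff.1 h i (Finset.mem_univ i)
          simpa [x0] using this
        simp [this]
      · have h' : ones x = Fintype.card ι := by
          by_contra hne; exact hx' ⟨h, lt_of_le_of_ne hle hne⟩
        have : x = x1 := by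
          have h'' : ∑ i, (x i).toNat = ∑ _i : ι, 1 := by simpa [ones] using h'
          have := (Finset.sum_eq_sum_iff_of_le fun i _ => Bool.toNat_le (x i)).1 h''
          funext i
          simpa [x1] using this i (Finset.mem_univ i)
        simp [this]
    have htot : 1 ≤ Pm + (bprod p x0 + bprod p x1) := by
      rw [← sum_bprod p, ← Finset.sum_filter_add_sum_filter_not Finset.univ
        (fun x : ι → Bool => 0 < ones x ∧ ones x < Fintype.card ι)]
      refine add_le_add le_rfl ((Finset.sum_le_sum_of_subset_of_nonneg hsub
        fun x _ _ => bprod_nonneg hp x).trans (le_of_eq ?_))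
      refine Finset.sum_pair fun h => ?_
      have : Nonempty ι := Fintype.card_pos_iff.1 (by omega)
      have := congrFun h (Classical.arbitrary ι)
      simp [x0, x1] at this
    have hprod : bprod p x0 * bprod p x1 ≤ 1 / 64 := by
      simp only [bprod, x0, x1, bw_false, bw_true, ← Finset.prod_mul_distrib]
      calc ∏ i, (1 - p i) * p i ≤ ∏ _i : ι, (1 / 4 : ℝ) :=
            Finset.prod_le_prod (fun i _ => mul_nonneg (by linarith [(hp i).2]) (hp i).1)
              fun i _ => by nlinarith [sq_nonneg (2 * p i - 1)]
        _ = (1 / 4 : ℝ) ^ Fintype.card ι := by simp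
        _ ≤ (1 / 4 : ℝ) ^ 3 := pow_le_pow_of_le_one (by norm_num) (by norm_num) hn
        _ = 1 / 64 := by norm_num
    have b0 := bprod_nonneg hp x0
    have b1 := bprod_nonneg hp x1
    have hbig : 0.845 ≤ bprod p x0 ∨ 0.845 ≤ bprod p x1 := by
      by_contra hcon
      push Not at hcon
      obtain ⟨c0, c1⟩ := hcon
      set a := bprod p x0
      set b := bprod p x1
      have hab : 0.864 ≤ a + b := by norm_num at hsmall h3 ⊢; linarith
      nlinarith [mul_pos (sub_pos.2 c0) (sub_pos.2 c1)]
    rcases hbig with h | h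
    · have hs := sum_le_of_prod_one_sub (p := p) (by simpa [bprod, x0] using h) hp
      have := onesEntropy_le_geometric hp (d := id) (Set.injOn_id _)
      simp only [id, mean_ones_eq] at this
      norm_num at hs ⊢
      linarith
    · have hs := sum_le_of_prod_one_sub (p := fun i => 1 - p i) (by simpa [bprod, x1] using h)
        (fun i => ⟨by linarith [(hp i).2], by linarith [(hp i).1]⟩)
      have := onesEntropy_le_geometric hp (d := fun m => Fintype.card ι - m) (by
        intro a ha b hb hab
        simp only [Finset.coe_range, Set.mem_Iio] at ha hb hab
        omega)
      have hm : ∑ x : ι → Bool, bprod p x * ((Fintype.card ι - ones x : ℕ) : ℝ) =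
          ∑ i, (1 - p i) := by
        rw [Finset.sum_sub_distrib, ← mean_ones_eq p]
        have : ∀ x : ι → Bool, bprod p x * ((Fintype.card ι - ones x : ℕ) : ℝ) =
            bprod p x * Fintype.card ι - bprod p x * (ones x : ℝ) := by
          intro x; rw [Nat.cast_sub (ones_le_card x)]; ring
        simp_rw [this, Finset.sum_sub_distrib, ← Finset.sum_mul, sum_bprod]
        simp
      rw [hm] at this
      linarith
  have h4 : (0.66 : ℝ) ≤ defect (Fintype.card ι) := by
    unfold defect; split_ifs <;> norm_num
  have h5 : 0 ≤ growth (Fintype.card ι - 1) * Pm := by linarith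
  norm_num at hH h4 ⊢
  linarith

end Large

/-- An entropy bound for the probabilities `x`, `y` of the two constant values of a pair of independent
bits, which satisfy `√x + √y ≤ 1`. -/
lemma sum_neg_mul_log_le {x y s : ℝ} (hx : 0 ≤ x) (hy : 0 ≤ y) (hs : s = x + y)
    (h : √x + √y ≤ 1) : - (x * log x) - y * log y ≤ - (2 * (s * log s)) := by
  rcases eq_or_lt_of_le (show 0 ≤ s by linarith) with h0 | h0
  · have hx0 : x = 0 := by linarith
    have hy0 : y = 0 := by linarith
    rw [hs, hx0, hy0]; simp
  have aux : ∀ x : ℝ, 0 ≤ x → - (x * log x) ≤ 2 * (s * √x - x) - 2 * (x * log s) := by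
    intro x hx
    rcases eq_or_lt_of_le hx with h | h
    · simp [← h]
    · have hr : 0 < √x := sqrt_pos.2 h
      have h1 := log_le_sub_one_of_pos (div_pos h0 hr)
      rw [log_div h0.ne' hr.ne', log_sqrt hx] at h1
      have h2 := mul_le_mul_of_nonneg_left h1 hx
      have h3 : x * (s / √x - 1) = s * √x - x := by
        have : x / √x = √x := div_sqrt
        rw [mul_sub, mul_one, mul_div_assoc', mul_comm x s, mul_div_assoc, this]
      rw [h3] at h2
      linarith
  have a1 := aux x hx
  have a2 := aux y hy
  have := mul_le_mul_of_nonneg_left h h0.le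
  have e : s * log s = x * log s + y * log s := by
    conv_lhs => rw [hs]
    rw [hs]; ring
  rw [e]
  linarith

lemma sqrt_mul_le_half {a b : ℝ} (ha : 0 ≤ a) (hb : 0 ≤ b) : √(a * b) ≤ (a + b) / 2 := by
  rw [sqrt_le_iff]
  exact ⟨by linarith, by nlinarith [sq_nonneg (a - b)]⟩

lemma neg_mul_log_le {x c : ℝ} (hx : 0 ≤ x) (hc : 0 < c) :
    - (x * log x) ≤ x * log c⁻¹ + (c - x) := by
  rcases eq_or_lt_of_le hx with h | h
  · simp [← h, hc.le]
  · have h1 := log_le_sub_one_of_pos (div_pos hc h)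
    rw [log_div hc.ne' h.ne'] at h1
    have h2 := mul_le_mul_of_nonneg_left h1 hx
    rw [show x * (c / x - 1) = c - x by field_simp] at h2
    rw [log_inv]; linarith

lemma mul_mul_log_mul (a b : ℝ) : a * b * log (a * b) = a * b * log a + a * b * log b := by
  by_cases ha : a = 0
  · simp [ha]
  by_cases hb : b = 0
  · simp [hb]
  rw [log_mul ha hb]; ring

lemma onesLaw_eq_trialE {n : ℕ} (p : Fin n → ℝ) (m : ℕ) :
    onesLaw p m = trialE (List.ofFn p) (fun k => if k = m then 1 else 0) := by
  rw [← sum_bprod_ones, onesLaw, Finset.sum_filter]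
  simp

/-- Two bits need a separate computation, since `defect` bounds only three or more. -/
lemma bitsDefect_sub_half_le_two {p : Fin 2 → ℝ} (hp : ∀ i, p i ∈ Set.Icc (0 : ℝ) 1) :
    bitsDefect p - onesEntropy p / 2 ≤ 0.225 := by
  have h2 := bitsDefect_le_onesEntropy hp
  have hg : growth (Fintype.card (Fin 2) - 1) = log 2 := by
    simp [growth]; norm_num
  have hPm : ∑ x : Fin 2 → Bool with 0 < ones x ∧ ones x < Fintype.card (Fin 2), bprod p x =
      onesLaw p 1 := by
    rw [onesLaw]
    refine Finset.sum_congr (Finset.filter_congr fun x _ => ?_) fun _ _ => rfl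
    simp only [Fintype.card_fin]; omega
  rw [hg, hPm] at h2
  have hH : onesEntropy p = -(onesLaw p 0 * log (onesLaw p 0)) - onesLaw p 1 * log (onesLaw p 1)
      - onesLaw p 2 * log (onesLaw p 2) := by
    rw [onesEntropy, sum_bprod_ones p fun k => log (onesLaw p k)]
    have e0 : onesLaw p 0 = (1 - p 0) * (1 - p 1) := by
      rw [onesLaw_eq_trialE]; simp [trialE]
    have e1 : onesLaw p 1 = (1 - p 0) * p 1 + p 0 * (1 - p 1) := by
      rw [onesLaw_eq_trialE]; simp [trialE]
    have e2 : onesLaw p 2 = p 0 * p 1 := by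
      rw [onesLaw_eq_trialE]; simp [trialE]
    have : trialE (List.ofFn p) (fun k => log (onesLaw p k)) =
        (1 - p 0) * (1 - p 1) * log (onesLaw p 0) + ((1 - p 0) * p 1 + p 0 * (1 - p 1)) *
          log (onesLaw p 1) + p 0 * p 1 * log (onesLaw p 2) := by
      simp [trialE]; ring
    rw [this, ← e0, ← e1, ← e2]; ring
  have e0 : onesLaw p 0 = (1 - p 0) * (1 - p 1) := by
    rw [onesLaw_eq_trialE]; simp [trialE]
  have e2 : onesLaw p 2 = p 0 * p 1 := by
    rw [onesLaw_eq_trialE]; simp [trialE]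
  have hs : √(onesLaw p 0) + √(onesLaw p 2) ≤ 1 := by
    rw [e0, e2]
    have a := sqrt_mul_le_half (a := 1 - p 0) (b := 1 - p 1) (by linarith [(hp 0).2])
      (by linarith [(hp 1).2])
    have b := sqrt_mul_le_half (hp 0).1 (hp 1).1
    linarith
  have hsum : onesLaw p 0 + onesLaw p 1 + onesLaw p 2 = 1 := by
    have := sum_onesLaw p
    simpa [Finset.sum_range_succ] using this
  have hx := onesLaw_nonneg hp 0
  have hy := onesLaw_nonneg hp 2
  have hz := onesLaw_nonneg hp 1
  have hb := sum_neg_mul_log_le hx hy rfl hs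
  set s := onesLaw p 0 + onesLaw p 2 with hsd
  -- tangents of `-x log x` near the maximizer, where two ones or two zeros have probability `0.683`
  have n1 := neg_mul_log_le (c := 0.683) (show 0 ≤ s by linarith) (by norm_num)
  have n2 := neg_mul_log_le (c := 0.317) hz (by norm_num)
  have l1 : log (0.683 : ℝ)⁻¹ ≤ 0.383 := by
    have := log_one_add_le (x := (0.683 : ℝ)⁻¹ - 1) (by norm_num)
    rw [add_sub_cancel] at this
    exact this.trans (by norm_num)
  have l2 : log (0.317 : ℝ)⁻¹ ≤ 0.4575 + log 2 := by
    have := log_one_add_le (x := (0.317 : ℝ)⁻¹ / 2 - 1) (by norm_num)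
    rw [add_sub_cancel, log_div (by norm_num) (by norm_num)] at this
    have h' : ((0.317 : ℝ)⁻¹ / 2 - 1) * (6 + ((0.317 : ℝ)⁻¹ / 2 - 1)) /
      (6 + 4 * ((0.317 : ℝ)⁻¹ / 2 - 1)) ≤ 0.4575 := by norm_num
    linarith
  have l3 := log_two_gt_d9
  have m1 := mul_le_mul_of_nonneg_left l1 (show 0 ≤ s by linarith)
  have m2 := mul_le_mul_of_nonneg_left l2 hz
  have m3 := mul_le_mul_of_nonneg_left l3.le hz
  have hs1 : s = 1 - onesLaw p 1 := by linarith
  norm_num at m1 m2 m3 n1 n2 ⊢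
  nlinarith

/-- The loss, beyond `phi t`, of the exchangeable comparison for a class of `t` training and `t` ghost
samples. -/
def excess (t : ℕ) : ℝ :=
  if t = 0 then 0 else if t = 1 then 0.05 else if t = 2 then 0.45 else defect t - 0.11

lemma bitsDefect_sub_half_le_excess {t : ℕ} (ht : 2 ≤ t) {p : Fin t → ℝ}
    (hp : ∀ i, p i ∈ Set.Icc (0 : ℝ) 1) :
    bitsDefect p - onesEntropy p / 2 ≤ excess t / 2 := by
  rcases eq_or_lt_of_le ht with rfl | ht
  · have := bitsDefect_sub_half_le_two hp
    simp only [excess]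
    norm_num at this ⊢
    linarith
  · have := bitsDefect_sub_half_le hp (by rw [Fintype.card_fin]; omega)
    rw [Fintype.card_fin] at this
    simp only [excess, show t ≠ 0 by omega, show t ≠ 1 by omega, show t ≠ 2 by omega, if_false]
    exact this

/-! ### Joint convexity of `h_D` -/

/-- The contribution of the two weights `x`, `y` of one outcome to `h_D`. -/
def jsTerm (x y : ℝ) : ℝ := x * log (2 * x / (x + y)) + y * log (2 * y / (x + y))

lemma hDn_eq_jsTerm {x y : ℝ} (hx : x ∈ Set.Icc (0 : ℝ) 1) (hy : y ∈ Set.Icc (0 : ℝ) 1) :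
    hDn x y = jsTerm x y + jsTerm (1 - x) (1 - y) := by
  have aux : ∀ x y : ℝ, 0 ≤ x → 0 ≤ y → jsTerm x y =
      x * log x + y * log y - (x + y) * log ((x + y) / 2) := by
    intro x y hx hy
    have h1 : ∀ x y : ℝ, 0 ≤ x → 0 ≤ y → x * log (2 * x / (x + y)) =
        x * log x - x * log ((x + y) / 2) := by
      intro x y hx hy
      rcases eq_or_lt_of_le hx with h | h
      · simp [← h]
      · rw [show 2 * x / (x + y) = x / ((x + y) / 2) by field_simp,
          log_div h.ne' (by positivity)]; ring
    have h2 := h1 y x hy hx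
    rw [add_comm y x] at h2
    rw [jsTerm, h1 x y hx hy, h2]; ring
  rw [aux x y hx.1 hy.1, aux (1 - x) (1 - y) (by linarith [hx.2]) (by linarith [hy.2])]
  rw [show (1 - x + (1 - y)) / 2 = 1 - (x + y) / 2 by ring]
  simp only [hDn, binEntropy, log_inv]
  ring

lemma jsTerm_mul {c : ℝ} (hc : 0 < c) (x y : ℝ) : jsTerm (c * x) (c * y) = c * jsTerm x y := by
  have h : ∀ z : ℝ, 2 * (c * z) / (c * x + c * y) = 2 * z / (x + y) := by
    intro z
    rw [← mul_add, mul_left_comm, mul_div_mul_left _ _ hc.ne']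
  simp only [jsTerm, h]; ring

/-- The function `jsTerm` is convex and homogeneous: it lies above its linear tangents. -/
lemma linear_le_jsTerm {x y X Y : ℝ} (hx : 0 ≤ x) (hy : 0 ≤ y) (hX : 0 ≤ X) (hY : 0 ≤ Y)
    (hxX : X = 0 → x = 0) (hyY : Y = 0 → y = 0) :
    x * log (2 * X / (X + Y)) + y * log (2 * Y / (X + Y)) ≤ jsTerm x y := by
  have aux : ∀ x y X Y : ℝ, 0 ≤ x → 0 ≤ y → 0 ≤ X → 0 ≤ Y → (X = 0 → x = 0) →
      x * log (2 * X / (X + Y)) + (x - (x + y) * (X / (X + Y))) ≤ x * log (2 * x / (x + y)) := by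
    intro x y X Y hx hy hX hY hxX
    rcases eq_or_lt_of_le hx with h | h
    · rw [← h]
      have : 0 ≤ y * (X / (X + Y)) := by positivity
      simp; linarith
    · have hX0 : 0 < X := lt_of_le_of_ne hX fun h' => h.ne' (hxX h'.symm)
      have h1 := log_le_sub_one_of_pos
        (show 0 < (2 * X / (X + Y)) / (2 * x / (x + y)) by positivity)
      rw [log_div (by positivity) (by positivity)] at h1
      have h2 := mul_le_mul_of_nonneg_left h1 hx
      have e : x * ((2 * X / (X + Y)) / (2 * x / (x + y)) - 1) = (x + y) * (X / (X + Y)) - x := by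
        field_simp
      rw [e] at h2
      linarith
  have h1 := aux x y X Y hx hy hX hY hxX
  have h2 := aux y x Y X hy hx hY hX hyY
  rw [add_comm Y X, add_comm y x] at h2
  rw [jsTerm]
  by_cases h0 : X + Y = 0
  · have hX0 : X = 0 := by linarith
    have hY0 : Y = 0 := by linarith
    simp [hxX hX0, hyY hY0]
  · have e : X / (X + Y) + Y / (X + Y) = 1 := by field_simp
    have : (x + y) * (X / (X + Y)) + (x + y) * (Y / (X + Y)) = x + y := by
      rw [← mul_add, e, mul_one]
    linarith

lemma jsTerm_sum_le {κ : Type*} (s : Finset κ) {x y : κ → ℝ} (hx : ∀ c, 0 ≤ x c)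
    (hy : ∀ c, 0 ≤ y c) : jsTerm (∑ c ∈ s, x c) (∑ c ∈ s, y c) ≤ ∑ c ∈ s, jsTerm (x c) (y c) := by
  have h : jsTerm (∑ c ∈ s, x c) (∑ c ∈ s, y c) =
      ∑ c ∈ s, (x c * log (2 * (∑ c ∈ s, x c) / ((∑ c ∈ s, x c) + ∑ c ∈ s, y c)) +
        y c * log (2 * (∑ c ∈ s, y c) / ((∑ c ∈ s, x c) + ∑ c ∈ s, y c))) := by
    rw [Finset.sum_add_distrib, ← Finset.sum_mul, ← Finset.sum_mul]; rfl
  rw [h]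
  refine Finset.sum_le_sum fun c hc => linear_le_jsTerm (hx c) (hy c)
    (Finset.sum_nonneg fun c _ => hx c) (Finset.sum_nonneg fun c _ => hy c) (fun h0 => ?_)
    (fun h0 => ?_)
  · exact (Finset.sum_eq_zero_iff_of_nonneg fun c _ => hx c).1 h0 c hc
  · exact (Finset.sum_eq_zero_iff_of_nonneg fun c _ => hy c).1 h0 c hc

/-- Joint convexity of `h_D`, for counts `x c`, `y c` out of `t c`. -/
lemma mul_hDn_sum_le {κ : Type*} [Fintype κ] {x y t : κ → ℕ} (hx : ∀ c, x c ≤ t c)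
    (hy : ∀ c, y c ≤ t c) {n : ℕ} (ht : ∑ c, t c = n) :
    n * hDn (((∑ c, x c : ℕ) : ℝ) / n) (((∑ c, y c : ℕ) : ℝ) / n) ≤
      ∑ c, t c * hDn ((x c : ℝ) / t c) ((y c : ℝ) / t c) := by
  have key : ∀ (t x y : ℕ), x ≤ t → y ≤ t → (t : ℝ) * hDn ((x : ℝ) / t) ((y : ℝ) / t) =
      jsTerm x y + jsTerm (t - x) (t - y) := by
    intro t x y hx hy
    rcases Nat.eq_zero_or_pos t with h | h
    · subst h
      simp [Nat.le_zero.1 hx, Nat.le_zero.1 hy, jsTerm]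
    have h0 : (0 : ℝ) < t := by exact_mod_cast h
    rw [hDn_eq_jsTerm (div_mem_Icc hx) (div_mem_Icc hy), mul_add, ← jsTerm_mul h0, ← jsTerm_mul h0]
    congr 2 <;> field_simp
  rw [key n _ _ (by rw [← ht]; exact Finset.sum_le_sum fun c _ => hx c)
    (by rw [← ht]; exact Finset.sum_le_sum fun c _ => hy c)]
  simp_rw [fun c => key (t c) (x c) (y c) (hx c) (hy c), Finset.sum_add_distrib]
  have h1 := jsTerm_sum_le Finset.univ (x := fun c => (x c : ℝ)) (y := fun c => (y c : ℝ))
    (fun c => by positivity) (fun c => by positivity)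
  have h2 := jsTerm_sum_le Finset.univ (x := fun c => (t c : ℝ) - x c) (y := fun c => (t c : ℝ) - y c)
    (fun c => sub_nonneg.2 (by exact_mod_cast hx c)) (fun c => sub_nonneg.2 (by exact_mod_cast hy c))
  simp only [Finset.sum_sub_distrib] at h2
  have ht' : ∑ c, (t c : ℝ) = n := by exact_mod_cast ht
  rw [ht'] at h2
  push_cast
  exact add_le_add h1 h2

/-! ### Comparison with an exchangeable law within a balanced class -/

/-- The density of independent bits with respect to the exchangeable law with the same number
of ones, up to normalization. -/
def levelTilt {ι : Type*} [Fintype ι] [DecidableEq ι] (p : ι → ℝ) (x : ι → Bool) : ℝ :=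
  (Fintype.card ι).choose (ones x) * (bprod p x / onesLaw p (ones x))

lemma levelTilt_nonneg {ι : Type*} [Fintype ι] [DecidableEq ι] {p : ι → ℝ}
    (hp : ∀ i, p i ∈ Set.Icc (0 : ℝ) 1) (x : ι → Bool) : 0 ≤ levelTilt p x :=
  mul_nonneg (by positivity) (div_nonneg (bprod_nonneg hp x) (onesLaw_nonneg hp _))

lemma levelTilt_ne_zero {ι : Type*} [Fintype ι] [DecidableEq ι] {p : ι → ℝ}
    (hp : ∀ i, p i ∈ Set.Icc (0 : ℝ) 1) {x : ι → Bool} (hx : bprod p x ≠ 0) :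
    levelTilt p x ≠ 0 :=
  mul_ne_zero (by exact_mod_cast (Nat.choose_pos (ones_le_card x)).ne')
    (div_ne_zero hx (onesLaw_pos hp hx).ne')

/-- The sum of the density over a level. It is an inequality since the density is `0 / 0 = 0` at
levels of probability zero. -/
lemma sum_level_levelTilt_le {ι : Type*} [Fintype ι] [DecidableEq ι] (p : ι → ℝ) (m : ℕ) :
    ∑ x : ι → Bool with ones x = m, levelTilt p x ≤
      1 * (Finset.univ.filter fun x : ι → Bool => ones x = m).card := by
  have : ∑ x : ι → Bool with ones x = m, levelTilt p x =
      (Fintype.card ι).choose m * (onesLaw p m / onesLaw p m) := by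
    rw [mul_div_assoc', onesLaw, Finset.mul_sum, Finset.sum_div]
    refine Finset.sum_congr rfl fun x hx => ?_
    rw [levelTilt, (Finset.mem_filter.1 hx).2, mul_div_assoc]; rfl
  rw [this, card_level, one_mul]
  exact mul_le_of_le_one_right (by positivity) (div_self_le_one _)

lemma sum_bprod_restrict {ι : Type*} [Fintype ι] [DecidableEq ι] (p : ι → ℝ) (s : ι → Prop)
    [DecidablePred s] (f : ({i // s i} → Bool) → ℝ) :
    ∑ e : ι → Bool, bprod p e * f (fun i => e i) =
      ∑ x : {i // s i} → Bool, bprod (fun i : {i // s i} => p i) x * f x := by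
  set E := Equiv.piEquivPiSubtypeProd s (fun _ => Bool)
  rw [← E.symm.sum_comp, Fintype.sum_prod_type]
  refine Finset.sum_congr rfl fun x _ => ?_
  have hb : ∀ y, bprod p (E.symm (x, y)) = bprod (fun i : {i // s i} => p i) x *
      bprod (fun i : {i // ¬ s i} => p i) y := by
    intro y
    simp only [bprod]
    rw [← Fintype.prod_subtype_mul_prod_subtype s]
    congr 1
    · refine Finset.prod_congr rfl fun i _ => ?_
      simp [E, Equiv.piEquivPiSubtypeProd, i.2]
    · refine Finset.prod_congr rfl fun i _ => ?_
      simp [E, Equiv.piEquivPiSubtypeProd, i.2]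
  have hf : ∀ y, (fun i : {i // s i} => E.symm (x, y) i) = x := by
    intro y; funext i
    simp [E, Equiv.piEquivPiSubtypeProd, i.2]
  simp_rw [hb, hf]
  rw [← Finset.sum_mul, ← Finset.mul_sum, sum_bprod, mul_one]

lemma ones_comp_equiv {α β : Type*} [Fintype α] [Fintype β] (ψ : α ≃ β) (y : β → Bool) :
    ones (y ∘ ψ) = ones y := ψ.sum_comp fun i => (y i).toNat

lemma bprod_comp_equiv {α β : Type*} [Fintype α] [Fintype β] (ψ : α ≃ β) (p : β → ℝ)
    (y : β → Bool) : bprod (p ∘ ψ) (y ∘ ψ) = bprod p y := ψ.prod_comp fun i => bw (p i) (y i)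

lemma sum_comp_equiv {α β : Type*} [Fintype α] [Fintype β] [DecidableEq α] [DecidableEq β]
    (ψ : α ≃ β) (F : (α → Bool) → ℝ) : ∑ x, F x = ∑ y : β → Bool, F (y ∘ ψ) :=
  ((Equiv.arrowCongr ψ.symm (Equiv.refl Bool)).sum_comp F).symm

lemma onesLaw_comp_equiv {α β : Type*} [Fintype α] [Fintype β] [DecidableEq α] [DecidableEq β]
    (ψ : α ≃ β) (p : β → ℝ) (m : ℕ) : onesLaw (p ∘ ψ) m = onesLaw p m := by
  simp only [onesLaw, Finset.sum_filter]
  rw [sum_comp_equiv ψ]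
  simp only [ones_comp_equiv, bprod_comp_equiv]

lemma levelTilt_comp_equiv {α β : Type*} [Fintype α] [Fintype β] [DecidableEq α] [DecidableEq β]
    (ψ : α ≃ β) (p : β → ℝ) (y : β → Bool) : levelTilt (p ∘ ψ) (y ∘ ψ) = levelTilt p y := by
  simp only [levelTilt, ones_comp_equiv, bprod_comp_equiv, onesLaw_comp_equiv,
    Fintype.card_congr ψ]

lemma sum_bprod_sum {α β : Type*} [Fintype α] [Fintype β] [DecidableEq α] [DecidableEq β]
    (p : α ⊕ β → ℝ) (F : (α → Bool) → (β → Bool) → ℝ) :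
    ∑ x : α ⊕ β → Bool, bprod p x * F (x ∘ Sum.inl) (x ∘ Sum.inr) =
      ∑ a, ∑ b, bprod (p ∘ Sum.inl) a * bprod (p ∘ Sum.inr) b * F a b := by
  rw [← (Equiv.sumArrowEquivProdArrow α β Bool).symm.sum_comp, Fintype.sum_prod_type]
  refine Finset.sum_congr rfl fun a _ => Finset.sum_congr rfl fun b _ => ?_
  simp only [bprod, Fintype.prod_sum_type]
  rfl

lemma ones_sum {α β : Type*} [Fintype α] [Fintype β] (x : α ⊕ β → Bool) :
    ones x = ones (x ∘ Sum.inl) + ones (x ∘ Sum.inr) := Fintype.sum_sum_type _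

lemma sum_bprod_inl {α β : Type*} [Fintype α] [Fintype β] [DecidableEq α] [DecidableEq β]
    (p : α ⊕ β → ℝ) (f : (α → Bool) → ℝ) :
    ∑ x : α ⊕ β → Bool, bprod p x * f (x ∘ Sum.inl) = ∑ a, bprod (p ∘ Sum.inl) a * f a := by
  rw [sum_bprod_sum p fun a _ => f a]
  refine Finset.sum_congr rfl fun a _ => ?_
  simp_rw [mul_right_comm, ← Finset.mul_sum]
  rw [sum_bprod, mul_one]

lemma sum_bprod_inr {α β : Type*} [Fintype α] [Fintype β] [DecidableEq α] [DecidableEq β]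
    (p : α ⊕ β → ℝ) (f : (β → Bool) → ℝ) :
    ∑ x : α ⊕ β → Bool, bprod p x * f (x ∘ Sum.inr) = ∑ b, bprod (p ∘ Sum.inr) b * f b := by
  rw [sum_bprod_sum p fun _ b => f b, Finset.sum_comm]
  refine Finset.sum_congr rfl fun b _ => ?_
  simp_rw [mul_assoc, ← Finset.sum_mul]
  rw [sum_bprod, one_mul]

/-- Adding independent bits does not lower the entropy of the number of ones. -/
lemma onesEntropy_inl_le {α β : Type*} [Fintype α] [Fintype β] [DecidableEq α] [DecidableEq β]
    {p : α ⊕ β → ℝ} (hp : ∀ i, p i ∈ Set.Icc (0 : ℝ) 1) :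
    onesEntropy (p ∘ Sum.inl) ≤ onesEntropy p := by
  have hA : ∀ i, (p ∘ Sum.inl) i ∈ Set.Icc (0 : ℝ) 1 := fun i => hp _
  have hB : ∀ i, (p ∘ Sum.inr) i ∈ Set.Icc (0 : ℝ) 1 := fun i => hp _
  have h1 : onesEntropy p = ∑ b, bprod (p ∘ Sum.inr) b *
      ∑ a, bprod (p ∘ Sum.inl) a * - log (onesLaw p (ones a + ones b)) := by
    have := sum_bprod_sum p fun a b => - log (onesLaw p (ones a + ones b))
    simp only [← ones_sum] at this
    rw [onesEntropy, ← Finset.sum_neg_distrib]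
    simp only [mul_neg] at this
    rw [this, Finset.sum_comm]
    refine Finset.sum_congr rfl fun b _ => ?_
    rw [Finset.mul_sum]
    exact Finset.sum_congr rfl fun a _ => by ring
  rw [h1]
  have h2 : onesEntropy (p ∘ Sum.inl) =
      ∑ b : β → Bool, bprod (p ∘ Sum.inr) b * onesEntropy (p ∘ Sum.inl) := by
    rw [← Finset.sum_mul, sum_bprod, one_mul]
  rw [h2]
  refine Finset.sum_le_sum fun b _ => ?_
  by_cases hb : bprod (p ∘ Sum.inr) b = 0
  · simp [hb]
  refine mul_le_mul_of_nonneg_left ?_ (bprod_nonneg hB b)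
  -- given the bits `b`, compare with the law of the total, shifted by their number of ones
  refine onesEntropy_le_cross hA (r := fun m => onesLaw p (m + ones b))
    (fun m => onesLaw_nonneg hp _) ?_ fun a ha => ?_
  · have := sum_onesLaw_le hp ((Finset.range (Fintype.card α + 1)).image fun m => m + ones b)
    rwa [Finset.sum_image fun x _ y _ h => Nat.add_right_cancel h] at this
  · set x : α ⊕ β → Bool := Sum.elim a b with hx
    have hbx : bprod p x ≠ 0 := by
      have : bprod p x = bprod (p ∘ Sum.inl) a * bprod (p ∘ Sum.inr) b := by
        simp [bprod, Fintype.prod_sum_type, hx]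
      rw [this]; exact mul_ne_zero ha hb
    have := (onesLaw_pos hp hbx).ne'
    rwa [ones_sum] at this

lemma onesEntropy_comp_equiv {α β : Type*} [Fintype α] [Fintype β] [DecidableEq α]
    [DecidableEq β] (ψ : α ≃ β) (p : β → ℝ) : onesEntropy (p ∘ ψ) = onesEntropy p := by
  rw [onesEntropy, sum_comp_equiv ψ]
  simp only [ones_comp_equiv, bprod_comp_equiv, onesLaw_comp_equiv]; rfl

lemma onesEntropy_inr_le {α β : Type*} [Fintype α] [Fintype β] [DecidableEq α] [DecidableEq β]
    {p : α ⊕ β → ℝ} (hp : ∀ i, p i ∈ Set.Icc (0 : ℝ) 1) :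
    onesEntropy (p ∘ Sum.inr) ≤ onesEntropy p := by
  have := onesEntropy_inl_le (p := p ∘ Equiv.sumComm β α) (fun i => hp _)
  rwa [onesEntropy_comp_equiv] at this

lemma onesEntropy_nonneg {ι : Type*} [Fintype ι] [DecidableEq ι] {p : ι → ℝ}
    (hp : ∀ i, p i ∈ Set.Icc (0 : ℝ) 1) : 0 ≤ onesEntropy p := by
  rw [onesEntropy, ← Finset.sum_neg_distrib]
  refine Finset.sum_nonneg fun x _ => ?_
  have h1 : onesLaw p (ones x) ≤ 1 := by
    have := sum_onesLaw_le hp {ones x}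
    simpa using this
  have := log_nonpos (onesLaw_nonneg hp (ones x)) h1
  have := mul_nonpos_of_nonneg_of_nonpos (bprod_nonneg hp x) this
  linarith

/-- The contribution of a class of `t` training and `t` ghost samples to the regret. -/
def classTerm {t : ℕ} (p : Fin t ⊕ Fin t → ℝ) : ℝ :=
  ∑ x : Fin t ⊕ Fin t → Bool, bprod p x *
    (t * hDn ((ones (x ∘ Sum.inr) : ℝ) / t) ((ones (x ∘ Sum.inl) : ℝ) / t) - log (levelTilt p x))

/-- The contribution of a class in terms of entropies. -/
lemma classTerm_eq {t : ℕ} {p : Fin t ⊕ Fin t → ℝ} (hp : ∀ i, p i ∈ Set.Icc (0 : ℝ) 1) :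
    classTerm p = ∑ x : Fin t ⊕ Fin t → Bool, bprod p x * - logPeak (2 * t) (ones x)
      + bitsDefect (p ∘ Sum.inl) + bitsDefect (p ∘ Sum.inr) - onesEntropy p := by
  have hcard : Fintype.card (Fin t ⊕ Fin t) = 2 * t := by simp; ring
  have hpt : ∀ x : Fin t ⊕ Fin t → Bool, bprod p x *
      (t * hDn ((ones (x ∘ Sum.inr) : ℝ) / t) ((ones (x ∘ Sum.inl) : ℝ) / t) - log (levelTilt p x)) =
      bprod p x * - logPeak (2 * t) (ones x)
      - bprod p x * (t * binEntropy ((ones (x ∘ Sum.inl) : ℝ) / t))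
      - bprod p x * (t * binEntropy ((ones (x ∘ Sum.inr) : ℝ) / t))
      - bprod p x * log (bprod p x) + bprod p x * log (onesLaw p (ones x)) := by
    intro x
    by_cases hx : bprod p x = 0
    · simp [hx]
    have hc : ((2 * t).choose (ones x) : ℝ) ≠ 0 := by
      rw [← hcard]; exact_mod_cast (Nat.choose_pos (ones_le_card x)).ne'
    have hL := (onesLaw_pos hp hx).ne'
    rw [levelTilt, hcard, log_mul hc (div_ne_zero hx hL), log_div hx hL, hDn, logPeak]
    have : ((ones (x ∘ Sum.inr) : ℝ) / t + (ones (x ∘ Sum.inl) : ℝ) / t) / 2 =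
        (ones x : ℝ) / (2 * t : ℕ) := by
      rw [ones_sum]; push_cast; rw [← add_div, div_div, mul_comm 2 (t : ℝ), add_comm]
    rw [this]
    push_cast
    ring
  simp only [classTerm, hpt, Finset.sum_add_distrib, Finset.sum_sub_distrib]
  rw [sum_bprod_inl p fun a => t * binEntropy ((ones a : ℝ) / t),
    sum_bprod_inr p fun b => t * binEntropy ((ones b : ℝ) / t), sum_bprod_log,
    Fintype.sum_sum_type]
  simp only [bitsDefect, onesEntropy, Fintype.card_fin, Function.comp_apply]
  ring

lemma bitsDefect_one (p : Fin 1 → ℝ) : bitsDefect p = binEntropy (p 0) := by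
  have : ∀ x : Fin 1 → Bool, binEntropy ((ones x : ℝ)) = 0 := by
    intro x
    have h := ones_le_card x
    simp only [Fintype.card_fin] at h
    interval_cases ones x <;> simp
  simp [bitsDefect, this]

/-- A class of one training and one ghost sample, where `bitsDefect` is a single binary entropy. -/
lemma classTerm_one_le {p : Fin 1 ⊕ Fin 1 → ℝ} (hp : ∀ i, p i ∈ Set.Icc (0 : ℝ) 1) :
    classTerm p ≤ phi 1 + excess 1 := by
  rw [classTerm_eq hp, bitsDefect_one, bitsDefect_one]
  set a := p (Sum.inl 0) with ha
  set b := p (Sum.inr 0) with hb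
  have ha01 : a ∈ Set.Icc (0 : ℝ) 1 := hp _
  have hb01 : b ∈ Set.Icc (0 : ℝ) 1 := hp _
  have hsum : ∀ g : ℕ → ℝ, ∑ x : Fin 1 ⊕ Fin 1 → Bool, bprod p x * g (ones x) =
      (1 - a) * (1 - b) * g 0 + (a * (1 - b) + b * (1 - a)) * g 1 + a * b * g 2 := by
    intro g
    rw [sum_comp_equiv finSumFinEquiv]
    have := sum_bprod_ones (p ∘ (finSumFinEquiv (m := 1) (n := 1)).symm) g
    have h2 : ∀ y : Fin (1 + 1) → Bool, bprod p (y ∘ finSumFinEquiv (m := 1) (n := 1)) =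
        bprod (p ∘ (finSumFinEquiv (m := 1) (n := 1)).symm) y := by
      intro y
      rw [← bprod_comp_equiv (finSumFinEquiv (m := 1) (n := 1))]
      congr 1
      funext i; simp
    simp only [ones_comp_equiv, h2, this]
    have e0 : (finSumFinEquiv (m := 1) (n := 1)).symm 0 = Sum.inl 0 := rfl
    have e1 : (finSumFinEquiv (m := 1) (n := 1)).symm 1 = Sum.inr 0 := rfl
    have : List.ofFn (p ∘ (finSumFinEquiv (m := 1) (n := 1)).symm) = [a, b] := by
      simp [List.ofFn_succ, e0, ha, hb]
      exact congrArg p e1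
    rw [this]
    simp [trialE]; ring
  have hlaw : ∀ m, onesLaw p m = (1 - a) * (1 - b) * (if 0 = m then 1 else 0)
      + (a * (1 - b) + b * (1 - a)) * (if 1 = m then 1 else 0)
      + a * b * (if 2 = m then 1 else 0) := by
    intro m
    rw [← hsum fun k => if k = m then 1 else 0, onesLaw, Finset.sum_filter]
    simp
  have l0 : onesLaw p 0 = (1 - a) * (1 - b) := by rw [hlaw]; simp
  have l1 : onesLaw p 1 = a * (1 - b) + b * (1 - a) := by rw [hlaw]; simp
  have l2 : onesLaw p 2 = a * b := by rw [hlaw]; simp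
  have hE : onesEntropy p = - ((1 - a) * (1 - b) * log ((1 - a) * (1 - b)) +
      (a * (1 - b) + b * (1 - a)) * log (a * (1 - b) + b * (1 - a)) + a * b * log (a * b)) := by
    rw [onesEntropy, hsum fun k => log (onesLaw p k), l0, l1, l2]
  have q0 : logPeak (2 * 1) 0 = 0 := by simp [logPeak]
  have q1 : logPeak (2 * 1) 1 = - log 2 := by rw [logPeak_center]; simp [phi, tiltBound]; norm_num
  have q2 : logPeak (2 * 1) 2 = 0 := by simp [logPeak]
  rw [hsum fun k => - logPeak (2 * 1) k, q0, q1, q2, hE]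
  simp only [Function.comp_apply, ← ha, ← hb]
  have hx : 0 ≤ a * (1 - b) := mul_nonneg ha01.1 (by linarith [hb01.2])
  have hy : 0 ≤ b * (1 - a) := mul_nonneg hb01.1 (by linarith [ha01.2])
  have hs := sum_neg_mul_log_le hx hy rfl (by
    have h1 := sqrt_mul_le_half ha01.1 (show 0 ≤ 1 - b by linarith [hb01.2])
    have h2 := sqrt_mul_le_half hb01.1 (show 0 ≤ 1 - a by linarith [ha01.2])
    linarith)
  have e1 := mul_mul_log_mul (1 - a) (1 - b)
  have e2 := mul_mul_log_mul a (1 - b)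
  have e3 := mul_mul_log_mul b (1 - a)
  have e4 := mul_mul_log_mul a b
  have ea : binEntropy a = - (a * log a) - (1 - a) * log (1 - a) := by
    simp only [binEntropy, log_inv]; ring
  have eb : binEntropy b = - (b * log b) - (1 - b) * log (1 - b) := by
    simp only [binEntropy, log_inv]; ring
  -- a tangent of `-x log x` near the maximizer
  have hsp := neg_mul_log_le (c := 0.7358) (add_nonneg hx hy) (by norm_num)
  have lc : log (0.7358 : ℝ)⁻¹ ≤ 0.3075 := by
    have := log_one_add_le (x := (0.7358 : ℝ)⁻¹ - 1) (by norm_num)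
    rw [add_sub_cancel] at this
    exact this.trans (by norm_num)
  have hphi : phi 1 = log 2 := by simp [phi, tiltBound]; norm_num
  have hexc : excess 1 = 0.05 := by simp [excess]
  have lt := log_two_gt_d9
  have lt' := log_two_lt_d9
  have hπ1 : a * (1 - b) + b * (1 - a) ≤ 1 := by nlinarith [ha01.1, hb01.1, ha01.2, hb01.2]
  have hπ0 := add_nonneg hx hy
  have m1 := mul_le_mul_of_nonneg_left lc hπ0
  have m2 := mul_le_mul_of_nonneg_left lt'.le hπ0
  rw [hphi, hexc, ea, eb]
  set s := a * (1 - b) + b * (1 - a) with hs_def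
  have key : -(a * log a) - (1 - a) * log (1 - a) + (-(b * log b) - (1 - b) * log (1 - b)) =
      -((1 - a) * (1 - b) * log ((1 - a) * (1 - b))) - a * (1 - b) * log (a * (1 - b))
      - b * (1 - a) * log (b * (1 - a)) - a * b * log (a * b) := by
    rw [e1, e2, e3, e4]; ring
  have fin : s * log 2 + (- (2 * (s * log s)) + s * log s) ≤ log 2 + 0.05 := by
    norm_num at m1 m2 hsp lt ⊢
    linarith
  linarith

/-- The regret within a balanced class. -/
lemma classTerm_le {t : ℕ} {p : Fin t ⊕ Fin t → ℝ} (hp : ∀ i, p i ∈ Set.Icc (0 : ℝ) 1) :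
    classTerm p ≤ phi t + excess t := by
  by_cases h1 : t = 1
  · subst h1; exact classTerm_one_le hp
  rw [classTerm_eq hp]
  have hA := onesEntropy_inl_le hp
  have hB := onesEntropy_inr_le hp
  have hphi : ∑ x : Fin t ⊕ Fin t → Bool, bprod p x * - logPeak (2 * t) (ones x) ≤ phi t := by
    have hcard : Fintype.card (Fin t ⊕ Fin t) = 2 * t := by simp; ring
    calc _ ≤ ∑ x : Fin t ⊕ Fin t → Bool, bprod p x * phi t :=
          Finset.sum_le_sum fun x _ => mul_le_mul_of_nonneg_left
            (neg_logPeak_le (hcard ▸ ones_le_card x)) (bprod_nonneg hp x)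
      _ = phi t := by rw [← Finset.sum_mul, sum_bprod, one_mul]
  have hhalf : ∀ r : Fin t → ℝ, (∀ i, r i ∈ Set.Icc (0 : ℝ) 1) →
      bitsDefect r - onesEntropy r / 2 ≤ excess t / 2 := by
    intro r hr
    rcases Nat.eq_zero_or_pos t with h0 | h0
    · subst h0
      have : bitsDefect r = 0 := by simp [bitsDefect]
      have h2 := onesEntropy_nonneg hr
      simp only [this, excess, if_true]; linarith
    · exact bitsDefect_sub_half_le_excess (by omega) hr
  have a := hhalf (p ∘ Sum.inl) fun i => hp _
  have b := hhalf (p ∘ Sum.inr) fun i => hp _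
  linarith

/-! ### The regret of balanced labels -/

/-- The samples of the class `c`, for pairs with common labels `v`. -/
def pairClass {n C : ℕ} (v : Fin n → Fin C) (c : Fin C) (i : Fin n ⊕ Fin n) : Prop :=
  v (Sum.elim id id i) = c

instance {n C : ℕ} (v : Fin n → Fin C) (c : Fin C) : DecidablePred (pairClass v c) :=
  fun i => by unfold pairClass; infer_instance

/-- The number of pairs with label `c`. -/
def pairCount {n C : ℕ} (v : Fin n → Fin C) (c : Fin C) : ℕ :=
  (Finset.univ.filter fun j => v j = c).card

/-- A numbering of the pairs with label `c`. -/
def pairEnum {n C : ℕ} (v : Fin n → Fin C) (c : Fin C) : {j // v j = c} ≃ Fin (pairCount v c) :=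
  Fintype.equivFinOfCardEq (Fintype.card_subtype _)

/-- A numbering of the samples of the class `c` which respects the two halves. -/
def classEnum {n C : ℕ} (v : Fin n → Fin C) (c : Fin C) :
    {i // pairClass v c i} ≃ Fin (pairCount v c) ⊕ Fin (pairCount v c) :=
  (Equiv.subtypeSum (p := pairClass v c)).trans
    (Equiv.sumCongr (pairEnum v c) (pairEnum v c))

lemma sum_pairEnum {n C : ℕ} (v : Fin n → Fin C) (f : Fin n → ℕ) :
    ∑ c, ∑ k, f ((pairEnum v c).symm k) = ∑ j, f j := by
  have : ∀ c, ∑ k, f ((pairEnum v c).symm k) = ∑ j with v j = c, f j := by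
    intro c
    rw [(pairEnum v c).symm.sum_comp fun j : {j // v j = c} => f j]
    exact (Finset.sum_subtype (Finset.univ.filter fun j => v j = c) (by simp) f).symm
  simp_rw [this]
  exact Finset.sum_fiberwise Finset.univ v f

/-- The bits of the class `c`, renumbered. -/
def classBits {n C : ℕ} (v : Fin n → Fin C) (c : Fin C) (e : Fin n ⊕ Fin n → Bool) :
    Fin (pairCount v c) ⊕ Fin (pairCount v c) → Bool :=
  fun k => e ((classEnum v c).symm k)

lemma natCast_mul_hDn_le {n C : ℕ} (v : Fin n → Fin C) (e : Fin n ⊕ Fin n → Bool) :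
    n * hDn (testErr e) (trainErr e) ≤
      ∑ c, pairCount v c * hDn ((ones (classBits v c e ∘ Sum.inr) : ℝ) / pairCount v c)
        ((ones (classBits v c e ∘ Sum.inl) : ℝ) / pairCount v c) := by
  have h1 : ∑ c, pairCount v c = n := by
    have := Finset.card_eq_sum_card_fiberwise (s := Finset.univ) (t := Finset.univ)
      (f := v) (by simp)
    simp only [Finset.card_univ, Fintype.card_fin] at this
    exact this.symm
  have key := mul_hDn_sum_le (x := fun c => ones (classBits v c e ∘ Sum.inr))
    (y := fun c => ones (classBits v c e ∘ Sum.inl)) (t := pairCount v)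
    (fun c => ones_le _) (fun c => ones_le _) h1
  have h2 : ∑ c, ones (classBits v c e ∘ Sum.inr) = ∑ j, (e (Sum.inr j)).toNat :=
    sum_pairEnum v fun j => (e (Sum.inr j)).toNat
  have h3 : ∑ c, ones (classBits v c e ∘ Sum.inl) = ∑ j, (e (Sum.inl j)).toNat :=
    sum_pairEnum v fun j => (e (Sum.inl j)).toNat
  rw [h2, h3] at key
  simp only [testErr, trainErr]
  push_cast at key
  exact key

/-- The restriction of a family of parameters to the class `c`. -/
def classParam {n C : ℕ} (v : Fin n → Fin C) (c : Fin C) (p : Fin n ⊕ Fin n → ℝ) :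
    {i // pairClass v c i} → ℝ := fun i => p i

/-- The term of the class `c` in the joint convexity bound of `h_D`. -/
def classDiv {n C : ℕ} (v : Fin n → Fin C) (c : Fin C) (e : Fin n ⊕ Fin n → Bool) : ℝ :=
  pairCount v c * hDn ((ones (classBits v c e ∘ Sum.inr) : ℝ) / pairCount v c)
    ((ones (classBits v c e ∘ Sum.inl) : ℝ) / pairCount v c)

/-- The bits of a class only involve the parameters of that class. -/
lemma mean_classDiv_sub {n C : ℕ} (v : Fin n → Fin C) (c : Fin C) (p : Fin n ⊕ Fin n → ℝ) :
    ∑ e, bprod p e * classDiv v c e -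
      ∑ e, bprod p e * log (levelTilt (classParam v c p) (fun i => e i)) =
      classTerm (fun k => p ((classEnum v c).symm k)) := by
  rw [← Finset.sum_sub_distrib]
  have h1 := sum_bprod_restrict p (pairClass v c) fun x =>
    pairCount v c * hDn ((ones ((x ∘ (classEnum v c).symm) ∘ Sum.inr) : ℝ) / pairCount v c)
      ((ones ((x ∘ (classEnum v c).symm) ∘ Sum.inl) : ℝ) / pairCount v c)
      - log (levelTilt (classParam v c p) x)
  rw [sum_comp_equiv (classEnum v c)] at h1
  have h4 : classParam v c p = (fun k => p ((classEnum v c).symm k)) ∘ (classEnum v c) := by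
    funext i; simp [classParam]
  refine Eq.trans (Finset.sum_congr rfl fun e _ => ?_) (h1.trans (Finset.sum_congr rfl fun y _ => ?_))
  · rw [mul_sub]; rfl
  · have h3 : (y ∘ (classEnum v c)) ∘ (classEnum v c).symm = y := by funext k; simp
    have h5 : bprod (fun i : {i // pairClass v c i} => p i) (y ∘ classEnum v c) =
        bprod (fun k => p ((classEnum v c).symm k)) y := by
      rw [← bprod_comp_equiv (classEnum v c), ← h4]; rfl
    rw [h3, h5, h4, levelTilt_comp_equiv]

/-- The regret bound when the two halves have the same class counts: a comparison within each
class with the exchangeable law of the same number of errors. -/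
theorem hasRegret_balanced {n C : ℕ} (hn : 0 < n) (w : Fin n ⊕ Fin n → Fin C)
    (hw : ∀ c, trainCount w c = testCount w c) :
    HasRegret w (∑ c, (phi (trainCount w c) + excess (trainCount w c))) := by
  obtain ⟨σ, hσ⟩ := exists_matching w
  refine HasRegret.of_ghostPerm hn σ ?_
  set w' := w ∘ ghostPerm σ with hw'
  set v : Fin n → Fin C := fun j => w (Sum.inl j) with hv
  have hall : ∀ j, w (Sum.inl j) = w (Sum.inr (σ j)) := by
    have hc : ∑ c, (Finset.univ.filter fun j =>
        w (Sum.inl j) = w (Sum.inr (σ j)) ∧ w (Sum.inl j) = c).card = n := by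
      refine Eq.trans (Finset.sum_congr rfl fun c _ => ?_) (sum_trainCount w)
      rw [hσ c, matchCount, ← hw c, min_self]
    have h2 := Finset.card_eq_sum_card_fiberwise
      (s := Finset.univ.filter fun j => w (Sum.inl j) = w (Sum.inr (σ j))) (t := Finset.univ)
      (f := fun j : Fin n => w (Sum.inl j)) (by simp)
    simp only [Finset.filter_filter] at h2
    rw [hc] at h2
    have h3 := (Finset.card_eq_iff_eq_univ _).1 (h2.trans (Fintype.card_fin n).symm)
    intro j
    have : j ∈ Finset.univ.filter fun j => w (Sum.inl j) = w (Sum.inr (σ j)) := by rw [h3]; simp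
    exact (Finset.mem_filter.1 this).2
  have hw'v : ∀ i, w' i = v (Sum.elim id id i) := by
    rintro (j | j)
    · rfl
    · exact (hall j).symm
  have hcount : ∀ c, pairCount v c = trainCount w c := fun c => rfl
  intro p q hp hq hq1 hex hac
  have hn0 : (0 : ℝ) < n := by exact_mod_cast hn
  have hP := bprod_nonneg hp
  have hpc : ∀ c i, classParam v c p i ∈ Set.Icc (0 : ℝ) 1 := fun c i => hp i
  -- the exchangeable comparison, class by class
  have hblocks := sum_mul_prod_blocks_le (pairClass v) (fun c c' i h h' => h.symm.trans h')
    (q := q) (fun c x => levelTilt (classParam v c p) x)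
    (B := fun _ => 1) hq (fun c x => levelTilt_nonneg (hpc c) x)
    (fun _ => zero_le_one)
    (fun τ hτ _ e => hex τ (fun i => by
      rw [hw'v, hw'v]
      exact (hτ _ i).2 rfl) e)
    (fun c m => sum_level_levelTilt_le _ m) Finset.univ
  rw [hq1, mul_one, Finset.prod_const_one] at hblocks
  have hrestrict : ∀ c (e : Fin n ⊕ Fin n → Bool), bprod p e ≠ 0 →
      bprod (classParam v c p) (fun i => e i) ≠ 0 := fun c e he =>
    Finset.prod_ne_zero_iff.2 fun i _ => Finset.prod_ne_zero_iff.1 he i (Finset.mem_univ _)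
  have hgibbs := sum_mul_log_le (P := bprod p) hP (sum_bprod p) hq hac
    (fun e => Finset.prod_nonneg fun c _ => levelTilt_nonneg (hpc c) _)
    (fun e he => Finset.prod_ne_zero_iff.2 fun c _ =>
      levelTilt_ne_zero (hpc c) (hrestrict c e he)) one_pos hblocks
  rw [log_one, add_zero] at hgibbs
  have hlog : ∀ e, bprod p e * log (∏ c, levelTilt (classParam v c p)
      (fun i => e i)) = ∑ c, bprod p e *
        log (levelTilt (classParam v c p) (fun i => e i)) := by
    intro e
    by_cases he : bprod p e = 0
    · simp [he]
    · rw [log_prod fun c _ => levelTilt_ne_zero (hpc c) (hrestrict c e he),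
        Finset.mul_sum]
  simp_rw [hlog] at hgibbs
  rw [Finset.sum_comm] at hgibbs
  have hgap : ∀ e, n * (gap w' e * log 2) ≤
      ∑ c, classDiv v c e := by
    intro e
    refine le_trans (mul_le_mul_of_nonneg_left ?_ hn0.le) (natCast_mul_hDn_le v e)
    have hs : 0 ≤ labelShift w' := by rw [labelShift_eq hn]; positivity
    have := hD_sub_hC_le (s := 0) (trainErr_mem e) (testErr_mem e) (by simpa using hs)
      (by simpa using trainErr_mem e) (by simpa using testErr_mem e)
    rw [add_zero, sub_zero, hDn_comm] at this
    exact this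
  have hfinal : ∑ e, bprod p e * (n * (gap w' e * log 2)) ≤
      ∑ c, ∑ e, bprod p e * classDiv v c e := by
    rw [Finset.sum_comm]
    simp_rw [← Finset.mul_sum]
    exact Finset.sum_le_sum fun e _ => mul_le_mul_of_nonneg_left (hgap e) (hP e)
  have hsum : ∑ c, ∑ e, bprod p e * classDiv v c e ≤
      ∑ c, ∑ e, bprod p e *
        log (levelTilt (classParam v c p) (fun i => e i)) +
      ∑ c, (phi (trainCount w c) + excess (trainCount w c)) := by
    rw [← Finset.sum_add_distrib]
    refine Finset.sum_le_sum fun c _ => ?_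
    have := classTerm_le (p := fun k => p ((classEnum v c).symm k)) fun k => hp _
    rw [← mean_classDiv_sub v c p, hcount] at this
    linarith
  linarith

/-! ### Block counts of a uniform bit vector -/

section Blocks

variable {ι κ : Type*} [Fintype ι] [DecidableEq ι] [Fintype κ] [DecidableEq κ]

/-- The number of ones of `e` among the indices with label `c`. -/
def blockOnes (w : ι → κ) (e : ι → Bool) (c : κ) : ℕ := ∑ i with w i = c, (e i).toNat

/-- The number of indices with label `c`. -/
def blockCard (w : ι → κ) (c : κ) : ℕ := (Finset.univ.filter fun i => w i = c).card

lemma sum_blockCard (w : ι → κ) : ∑ c, blockCard w c = Fintype.card ι := by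
  have := Finset.card_eq_sum_card_fiberwise (s := Finset.univ) (t := Finset.univ)
      (f := w) (by simp)
  rw [← Finset.card_univ]; exact this.symm

lemma sum_blockOnes (w : ι → κ) (e : ι → Bool) : ∑ c, blockOnes w e c = ones e :=
  Finset.sum_fiberwise Finset.univ w fun i => (e i).toNat

lemma blockOnes_le (w : ι → κ) (e : ι → Bool) (c : κ) : blockOnes w e c ≤ blockCard w c := by
  rw [blockOnes, blockCard, Finset.card_eq_sum_ones]
  exact Finset.sum_le_sum fun i _ => Bool.toNat_le _

/-- The numbers of ones in the blocks of a uniform bit vector are independent and binomial. -/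
lemma sum_prod_blockOnes {R : Type*} [CommSemiring R] (w : ι → κ) (f : κ → ℕ → R) :
    ∑ e : ι → Bool, ∏ c, f c (blockOnes w e c) =
      ∏ c, ∑ k ∈ Finset.range (blockCard w c + 1), ((blockCard w c).choose k : R) * f c k := by
  have h1 : ∀ c, ∑ k ∈ Finset.range (blockCard w c + 1), ((blockCard w c).choose k : R) * f c k =
      ∑ x : {i // w i = c} → Bool, f c (ones x) := by
    intro c
    have hc : Fintype.card {i // w i = c} = blockCard w c := Fintype.card_subtype _
    rw [← Finset.sum_fiberwise_of_maps_to (s := Finset.univ)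
      (t := Finset.range (blockCard w c + 1)) (g := fun x : {i // w i = c} → Bool => ones x)
      (fun x _ => by
        rw [Finset.mem_range, ← hc]; exact Nat.lt_succ_of_le (ones_le_card x))]
    refine Finset.sum_congr rfl fun k _ => ?_
    rw [Finset.sum_congr rfl (g := fun _ => f c k) fun x hx => by rw [(Finset.mem_filter.1 hx).2],
      Finset.sum_const, nsmul_eq_mul]
    have hcard : (Finset.univ.filter fun x : {i // w i = c} → Bool => ones x = k).card =
        (blockCard w c).choose k := by
      rw [← hc]; exact_mod_cast card_level (ι := {i // w i = c}) k
    rw [hcard]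
  simp_rw [h1]
  rw [Finset.prod_univ_sum, Fintype.piFinset_univ]
  let φ : (ι → Bool) ≃ (∀ c, {i // w i = c} → Bool) :=
    ((Equiv.sigmaFiberEquiv w).arrowCongr (Equiv.refl Bool)).symm.trans
      (Equiv.piCurry fun c (_ : {i // w i = c}) => Bool)
  refine Fintype.sum_equiv φ _ _ fun e => Finset.prod_congr rfl fun c _ => ?_
  congr 1
  rw [blockOnes, Finset.sum_subtype (Finset.univ.filter fun i => w i = c) (p := fun i => w i = c)
    (by simp) fun i => (e i).toNat]
  rfl

open Polynomial in
/-- If the coefficients of `p` are at most `A` and those of `q` are nonnegative, the coefficients of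
`p * q` are at most `A` times the value of `q` at `1`. -/
lemma coeff_mul_le {p q : ℝ[X]} {A : ℝ} (hp : ∀ k, p.coeff k ≤ A) (hA : 0 ≤ A)
    (hq : ∀ k, 0 ≤ q.coeff k) (n : ℕ) : (p * q).coeff n ≤ A * q.eval 1 := by
  rw [coeff_mul, Finset.Nat.sum_antidiagonal_eq_sum_range_succ
    (fun i j => p.coeff i * q.coeff j), ← Finset.sum_range_reflect]
  have h1 : ∑ j ∈ Finset.range (n + 1), p.coeff (n + 1 - 1 - j) * q.coeff (n - (n + 1 - 1 - j)) ≤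
      ∑ j ∈ Finset.range (n + 1), A * q.coeff j := by
    refine Finset.sum_le_sum fun j hj => ?_
    have : n - (n + 1 - 1 - j) = j := by have := Finset.mem_range.1 hj; omega
    rw [this]
    exact mul_le_mul_of_nonneg_right (hp _) (hq _)
  refine h1.trans ?_
  rw [← Finset.mul_sum, eval_eq_sum_range' (n := max (n + 1) (q.natDegree + 1)) (by omega)]
  simp only [one_pow, mul_one]
  exact mul_le_mul_of_nonneg_left (Finset.sum_le_sum_of_subset_of_nonneg
    (Finset.range_mono (le_max_left _ _)) fun k _ _ => hq k) hA

open Polynomial in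
/-- The sum over the bit vectors with `n` ones is a coefficient of the product of the generating
polynomials of the blocks. -/
lemma sum_level_prod_blockOnes (w : ι → κ) (f : κ → ℕ → ℝ) (n : ℕ) :
    ∑ e : ι → Bool with ones e = n, ∏ c, f c (blockOnes w e c) =
      (∏ c, ∑ k ∈ Finset.range (blockCard w c + 1),
        (((blockCard w c).choose k : ℕ) : ℝ[X]) * (Polynomial.C (f c k) * X ^ k)).coeff n := by
  rw [← sum_prod_blockOnes w fun c k => Polynomial.C (f c k) * X ^ k, finsetSum_coeff,
    Finset.sum_filter]
  refine Finset.sum_congr rfl fun e _ => ?_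
  rw [Finset.prod_mul_distrib, ← map_prod, Finset.prod_pow_eq_pow_sum, sum_blockOnes,
    coeff_C_mul, coeff_X_pow]
  simp [eq_comm]

open Polynomial in
/-- Conditioning a uniform bit vector on its number of ones: one block is controlled by its most
likely value, the other blocks are then free. -/
lemma sum_level_prod_le (w : ι → κ) {f : κ → ℕ → ℝ} (hf : ∀ c k, 0 ≤ f c k) (n : ℕ) (c₁ : κ)
    {A : ℝ} (hA : ∀ k ≤ blockCard w c₁, ((blockCard w c₁).choose k : ℝ) * f c₁ k ≤ A) :
    ∑ e : ι → Bool with ones e = n, ∏ c, f c (blockOnes w e c) ≤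
      A * ∏ c ∈ Finset.univ.erase c₁,
        ∑ k ∈ Finset.range (blockCard w c + 1), ((blockCard w c).choose k : ℝ) * f c k := by
  have hA0 : 0 ≤ A := le_trans (mul_nonneg (Nat.cast_nonneg _) (hf c₁ 0)) (hA 0 (Nat.zero_le _))
  set P : κ → ℝ[X] := fun c => ∑ k ∈ Finset.range (blockCard w c + 1),
        (((blockCard w c).choose k : ℕ) : ℝ[X]) * (Polynomial.C (f c k) * X ^ k) with hP
  have hcoeff : ∀ c k, (P c).coeff k =
      if k < blockCard w c + 1 then ((blockCard w c).choose k : ℝ) * f c k else 0 := by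
    intro c k
    rw [hP]
    simp only [finsetSum_coeff, ← C_eq_natCast, coeff_C_mul, coeff_X_pow]
    simp [Finset.sum_ite_eq, Finset.mem_range]
  have hP0 : ∀ c k, 0 ≤ (P c).coeff k := fun c k => by
    rw [hcoeff]; split_ifs
    · exact mul_nonneg (Nat.cast_nonneg _) (hf c k)
    · exact le_rfl
  have hprod0 : ∀ (s : Finset κ) k, 0 ≤ (∏ c ∈ s, P c).coeff k := by
    intro s
    induction s using Finset.induction_on with
    | empty => intro k; simp only [Finset.prod_empty, coeff_one]; split_ifs <;> norm_num
    | insert c s hc ih =>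
      intro k
      rw [Finset.prod_insert hc, coeff_mul]
      exact Finset.sum_nonneg fun x _ => mul_nonneg (hP0 _ _) (ih _)
  rw [sum_level_prod_blockOnes, ← Finset.mul_prod_erase Finset.univ _ (Finset.mem_univ c₁)]
  refine (coeff_mul_le (A := A) (fun k => ?_) hA0 (hprod0 _) n).trans (le_of_eq ?_)
  · rw [hcoeff]; split_ifs with h
    · exact hA k (by omega)
    · exact hA0
  · rw [eval_prod]
    simp [hP, eval_finsetSum]

end Blocks

/-! ### Weights of the classes -/

/-- The odd harmonic sum `∑_{i < t} 1 / (2 i + 1)`. -/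
def oddSum (t : ℕ) : ℝ := ∑ i ∈ Finset.range t, 1 / (2 * (i : ℝ) + 1)

/-- The probability `C(2t, t) / 4 ^ t` that a uniform vector of `2 t` bits has `t` ones. -/
def centralProb (t : ℕ) : ℝ := t.centralBinom / 4 ^ t

lemma centralProb_pos (t : ℕ) : 0 < centralProb t := by
  have := Nat.centralBinom_pos t
  unfold centralProb; positivity

lemma centralProb_zero : centralProb 0 = 1 := by simp [centralProb]

lemma centralProb_succ (t : ℕ) :
    centralProb (t + 1) = centralProb t * ((2 * t + 1) / (2 * t + 2)) := by
  have h : ((t : ℝ) + 1) * (t + 1).centralBinom = 2 * (2 * t + 1) * t.centralBinom := by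
    exact_mod_cast Nat.succ_mul_centralBinom_succ t
  have h2 : ((t + 1).centralBinom : ℝ) = 2 * (2 * t + 1) * t.centralBinom / (t + 1) := by
    field_simp; linarith
  rw [centralProb, centralProb, h2, pow_succ]
  field_simp
  ring

lemma phi_eq (t : ℕ) : phi t = - log (centralProb t) := by
  have h := tiltBound_one_mul_centralBinom t
  have h0 : (t.centralBinom : ℝ) ≠ 0 := by exact_mod_cast t.centralBinom_ne_zero
  rw [phi, ← log_inv, centralProb, inv_div, ← h, mul_div_assoc, div_self h0, mul_one]

/-- A rational upper bound for `exp (3/8 * oddSum t)`. -/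
def expOddRat : ℕ → ℚ
  | 0 => 1
  | 1 => 1455 / 1000
  | (t + 2) => expOddRat (t + 1) * ((32 * (t + 1) + 19) / (32 * (t + 1) + 13))

/-- A rational upper bound for `exp (3/8 * oddSum t)`, as a real number. -/
def expOdd (t : ℕ) : ℝ := expOddRat t

lemma expOdd_zero : expOdd 0 = 1 := by simp [expOdd, expOddRat]

lemma expOdd_one : expOdd 1 = 1.455 := by norm_num [expOdd, expOddRat]

lemma expOdd_succ {t : ℕ} (ht : 1 ≤ t) :
    expOdd (t + 1) = expOdd t * ((32 * t + 19) / (32 * t + 13)) := by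
  obtain ⟨t, rfl⟩ := Nat.exists_eq_add_of_le' ht
  simp only [expOdd, expOddRat]
  push_cast; ring

lemma one_le_expOdd (t : ℕ) : 1 ≤ expOdd t := by
  induction t with
  | zero => rw [expOdd_zero]
  | succ t ih =>
    rcases Nat.eq_zero_or_pos t with rfl | ht
    · rw [zero_add, expOdd_one]; norm_num
    · rw [expOdd_succ ht]
      refine one_le_mul_of_one_le_of_one_le ih ?_
      rw [one_le_div (by positivity)]; linarith

lemma expOdd_mono : Monotone expOdd := by
  refine monotone_nat_of_le_succ fun t => ?_
  rcases Nat.eq_zero_or_pos t with rfl | ht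
  · rw [zero_add, expOdd_one, expOdd_zero]; norm_num
  · rw [expOdd_succ ht]
    refine le_mul_of_one_le_right (zero_le_one.trans (one_le_expOdd t)) ?_
    rw [one_le_div (by positivity)]; linarith

lemma exp_le_pade {x : ℝ} (h0 : 0 ≤ x) (h2 : x < 2) : exp x ≤ (2 + x) / (2 - x) := by
  have hd : 0 < 2 - x := by linarith
  rw [← le_log_iff_exp_le (by positivity)]
  have h := le_log_one_add_of_nonneg (x := 2 * x / (2 - x)) (by positivity)
  have e1 : 1 + 2 * x / (2 - x) = (2 + x) / (2 - x) := by field_simp; ring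
  have e2 : 2 * (2 * x / (2 - x)) / (2 * x / (2 - x) + 2) = x := by field_simp; ring
  rwa [e1, e2] at h

lemma exp_three_eighths : exp (3 / 8) ^ 8 = exp 1 ^ 3 := by
  rw [← exp_nat_mul, ← exp_nat_mul]; norm_num

lemma exp_three_eighths_le : exp (3 / 8) ≤ 1.455 := by
  refine le_of_pow_le_pow_left₀ (n := 8) (by norm_num) (by norm_num) ?_
  rw [exp_three_eighths]
  exact (pow_le_pow_left₀ (exp_pos 1).le exp_one_lt_d9.le 3).trans (by norm_num)

lemma exp_neg_three_eighths_le : exp (-(3 / 8)) ≤ 0.6873 := by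
  rw [exp_neg, inv_le_comm₀ (exp_pos _) (by norm_num)]
  refine le_of_pow_le_pow_left₀ (n := 8) (by norm_num) (exp_pos _).le ?_
  rw [exp_three_eighths]
  exact le_trans (by norm_num) (pow_le_pow_left₀ (by norm_num) exp_one_gt_d9.le 3)

lemma exp_oddSum_le (t : ℕ) : exp (3 / 8 * oddSum t) ≤ expOdd t := by
  induction t with
  | zero => simp [oddSum, expOdd_zero]
  | succ t ih =>
    rw [oddSum, Finset.sum_range_succ, ← oddSum, mul_add, exp_add]
    rcases Nat.eq_zero_or_pos t with rfl | ht
    · simp only [oddSum, Finset.range_zero, Finset.sum_empty, mul_zero, exp_zero, one_mul, zero_add,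
        expOdd_one, Nat.cast_zero]
      norm_num
      exact exp_three_eighths_le.trans (by norm_num)
    · rw [expOdd_succ ht]
      have ht' : (1 : ℝ) ≤ t := by exact_mod_cast ht
      refine mul_le_mul ih ?_ (exp_pos _).le (zero_le_one.trans (one_le_expOdd t))
      refine (exp_le_pade (by positivity) ?_).trans (le_of_eq ?_)
      · rw [mul_one_div, div_lt_iff₀ (by positivity)]; linarith
      · have : (2 : ℝ) - 3 / 8 * (1 / (2 * t + 1)) ≠ 0 := by
          have : (1 : ℝ) / (2 * t + 1) ≤ 1 := by
            rw [div_le_one (by positivity)]; linarith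
          linarith
        rw [div_eq_div_iff this (by positivity)]
        field_simp; ring

/-- A decay rate which is supermultiplicative, so that it can be shared among the classes. -/
def decay (t : ℕ) : ℝ := (1 + (t : ℝ) / 25) ^ (-(1 / 8 : ℝ))

lemma decay_pos (t : ℕ) : 0 < decay t := rpow_pos_of_pos (by positivity) _

lemma decay_pow (t : ℕ) : decay t ^ 8 * (1 + (t : ℝ) / 25) = 1 := by
  have h : (0 : ℝ) < 1 + (t : ℝ) / 25 := by positivity
  rw [decay, ← rpow_natCast, ← rpow_mul h.le]
  norm_num
  rw [rpow_neg_one, inv_mul_cancel₀ h.ne']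

lemma le_mul_decay {x A : ℝ} {t : ℕ} (hA : 0 ≤ A) (h : x ^ 8 * (1 + (t : ℝ) / 25) ≤ A ^ 8) :
    x ≤ A * decay t := by
  refine le_of_pow_le_pow_left₀ (n := 8) (by norm_num) (mul_nonneg hA (decay_pos t).le) ?_
  have h0 : (0 : ℝ) < 1 + (t : ℝ) / 25 := by positivity
  refine le_of_mul_le_mul_right ?_ h0
  rw [mul_pow, mul_assoc, decay_pow, mul_one]
  exact h

lemma decay_zero : decay 0 = 1 := by simp [decay]

lemma decay_mul_le (s t : ℕ) : decay s * decay t ≤ decay (s + t) := by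
  refine (le_mul_decay zero_le_one ?_).trans (one_mul _).le
  have hs := decay_pow s
  have ht := decay_pow t
  have h0 : (0 : ℝ) ≤ decay s ^ 8 * decay t ^ 8 := by have := decay_pos s; have := decay_pos t; positivity
  have h1 : (1 : ℝ) + ((s + t : ℕ) : ℝ) / 25 ≤ (1 + (s : ℝ) / 25) * (1 + (t : ℝ) / 25) := by
    push_cast
    have : (0 : ℝ) ≤ (s : ℝ) / 25 * ((t : ℝ) / 25) := by positivity
    linarith
  calc (decay s * decay t) ^ 8 * (1 + ((s + t : ℕ) : ℝ) / 25)
      ≤ (decay s ^ 8 * decay t ^ 8) * ((1 + (s : ℝ) / 25) * (1 + (t : ℝ) / 25)) := by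
        rw [mul_pow]; exact mul_le_mul_of_nonneg_left h1 h0
    _ = (decay s ^ 8 * (1 + (s : ℝ) / 25)) * (decay t ^ 8 * (1 + (t : ℝ) / 25)) := by ring
    _ = 1 ^ 8 := by rw [hs, ht]; norm_num

lemma decay_antitone : Antitone decay := by
  intro s t hst
  refine (le_mul_decay zero_le_one ?_).trans (one_mul _).le
  rw [one_pow]
  refine le_trans ?_ (decay_pow t).le
  refine mul_le_mul_of_nonneg_left ?_ (pow_nonneg (decay_pos t).le 8)
  have : (s : ℝ) ≤ t := by exact_mod_cast hst
  linarith

lemma prod_decay_le {κ : Type*} (s : Finset κ) (h : κ → ℕ) :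
    ∏ c ∈ s, decay (h c) ≤ decay (∑ c ∈ s, h c) := by
  classical
  induction s using Finset.induction_on with
  | empty => simp [decay_zero]
  | insert c s hc ih =>
    rw [Finset.prod_insert hc, Finset.sum_insert hc]
    exact (mul_le_mul_of_nonneg_left ih (decay_pos _).le).trans (decay_mul_le _ _)

/-- One step of a comparison of a sequence with ratios `r` with `decay`. -/
lemma step_decay {x A r : ℝ} {t : ℕ} (hx : 0 ≤ x) (hA : 0 ≤ A) (hr : 0 < r)
    (hr1 : 1 / (25 + t : ℝ) ≤ 8 * (1 / r - 1)) (h : x ≤ A * decay t) :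
    x * r ≤ A * decay (t + 1) := by
  refine le_mul_decay hA ?_
  have hpos : (0 : ℝ) < 25 + t := by positivity
  have h0 : (0 : ℝ) < 1 + (t : ℝ) / 25 := by positivity
  have h1 : x ^ 8 * (1 + (t : ℝ) / 25) ≤ A ^ 8 := by
    calc x ^ 8 * (1 + (t : ℝ) / 25) ≤ (A * decay t) ^ 8 * (1 + (t : ℝ) / 25) :=
          mul_le_mul_of_nonneg_right (pow_le_pow_left₀ hx h 8) h0.le
      _ = A ^ 8 * (decay t ^ 8 * (1 + (t : ℝ) / 25)) := by ring
      _ = A ^ 8 := by rw [decay_pow, mul_one]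
  have h2 : 1 + 1 / (25 + t : ℝ) ≤ (1 / r) ^ 8 := by
    have hb := one_add_mul_le_pow (a := 1 / r - 1) (by have : 0 < 1 / r := by positivity
                                                       linarith) 8
    push_cast at hb
    have e : 1 + (1 / r - 1) = 1 / r := by ring
    rw [e] at hb
    linarith
  have h3 : r ^ 8 * (1 + 1 / (25 + t : ℝ)) ≤ 1 := by
    calc r ^ 8 * (1 + 1 / (25 + t : ℝ)) ≤ r ^ 8 * (1 / r) ^ 8 :=
          mul_le_mul_of_nonneg_left h2 (by positivity)
      _ = 1 := by rw [← mul_pow, mul_one_div_cancel hr.ne', one_pow]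
  have e : (1 : ℝ) + ((t + 1 : ℕ) : ℝ) / 25 = (1 + (t : ℝ) / 25) * (1 + 1 / (25 + t : ℝ)) := by
    push_cast; field_simp; ring
  rw [e]
  calc (x * r) ^ 8 * ((1 + (t : ℝ) / 25) * (1 + 1 / (25 + t : ℝ)))
      = (x ^ 8 * (1 + (t : ℝ) / 25)) * (r ^ 8 * (1 + 1 / (25 + t : ℝ))) := by ring
    _ ≤ A ^ 8 * 1 := mul_le_mul h1 h3 (by positivity) (by positivity)
    _ = A ^ 8 := mul_one _

/-- The most likely value of the tilted weight of a class with `2 t` samples. -/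
def evenPeak (t : ℕ) : ℝ := centralProb t * expOdd t

/-- The most likely value of the tilted weight of a class with `2 t - 1` samples. -/
def oddPeak (t : ℕ) : ℝ := centralProb t * (expOdd (t - 1) * 0.6873)

lemma evenPeak_pos (t : ℕ) : 0 < evenPeak t :=
  mul_pos (centralProb_pos t) (zero_lt_one.trans_le (one_le_expOdd t))

/-- A bound of `evenPeak` by a multiple of `decay` persists for larger classes. -/
lemma evenPeak_le {A : ℝ} (hA : 0 ≤ A) {r t : ℕ} (hr : 1 ≤ r) (hrt : r ≤ t)
    (h : evenPeak r ≤ A * decay r) : evenPeak t ≤ A * decay t := by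
  induction t, hrt using Nat.le_induction with
  | base => exact h
  | succ t hrt ih =>
    have ht : 1 ≤ t := hr.trans hrt
    have ht' : (1 : ℝ) ≤ t := by exact_mod_cast ht
    have e : evenPeak (t + 1) =
        evenPeak t * ((2 * t + 1) / (2 * t + 2) * ((32 * t + 19) / (32 * t + 13))) := by
      rw [evenPeak, evenPeak, centralProb_succ, expOdd_succ ht]; ring
    rw [e]
    refine step_decay (evenPeak_pos t).le hA (by positivity) ?_ ih
    have e2 : 8 * (1 / ((2 * t + 1) / (2 * t + 2) * ((32 * t + 19) / (32 * t + 13))) - 1) =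
        8 * (20 * t + 7) / ((2 * t + 1) * (32 * t + 19) : ℝ) := by field_simp; ring
    rw [e2, div_le_div_iff₀ (by positivity) (by positivity)]
    nlinarith

lemma oddPeak_le (t : ℕ) (ht : 1 ≤ t) : oddPeak t ≤ 0.3787 * decay t := by
  have h1 : oddPeak 1 ≤ 0.3787 * decay 1 := by
    refine le_mul_decay (by norm_num) ?_
    norm_num [oddPeak, centralProb, expOdd_zero, Nat.centralBinom, Nat.choose]
  have h2 : oddPeak 2 ≤ 0.3787 * decay 2 := by
    refine le_mul_decay (by norm_num) ?_
    norm_num [oddPeak, centralProb, expOdd_one, Nat.centralBinom, Nat.choose]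
  rcases (by omega : t = 1 ∨ 2 ≤ t) with rfl | ht2
  · exact h1
  clear ht
  induction t, ht2 using Nat.le_induction with
  | base => exact h2
  | succ t ht ih =>
    obtain ⟨k, rfl⟩ := Nat.exists_eq_add_of_le' ht
    have e : oddPeak (k + 2 + 1) = oddPeak (k + 2) *
        ((2 * (k + 2 : ℕ) + 1) / (2 * (k + 2 : ℕ) + 2) *
          ((32 * (k + 1 : ℕ) + 19) / (32 * (k + 1 : ℕ) + 13))) := by
      rw [oddPeak, oddPeak, centralProb_succ (k + 2)]
      have : expOdd (k + 2 + 1 - 1) = expOdd (k + 2 - 1) *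
          ((32 * (k + 1 : ℕ) + 19) / (32 * (k + 1 : ℕ) + 13)) := expOdd_succ (by omega)
      rw [this]; ring
    rw [e]
    refine step_decay ?_ (by norm_num) (by positivity) ?_ ih
    · exact mul_nonneg (centralProb_pos _).le
        (mul_nonneg (zero_le_one.trans (one_le_expOdd _)) (by norm_num))
    · have e2 : 8 * (1 / ((2 * (k + 2 : ℕ) + 1) / (2 * (k + 2 : ℕ) + 2) *
          ((32 * (k + 1 : ℕ) + 19) / (32 * (k + 1 : ℕ) + 13))) - 1) =
          8 * (20 * k + 15) / ((2 * k + 5) * (32 * k + 51) : ℝ) := by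
        push_cast; field_simp; ring
      rw [e2, div_le_div_iff₀ (by positivity) (by positivity)]
      push_cast
      have : (0 : ℝ) ≤ k := Nat.cast_nonneg k
      nlinarith

/-- The weight `exp (3/8 * (oddSum t - D))` of a class with `k` samples out of `N` in one half,
`t` of which are matched and `D` unmatched, with the exponential replaced by a rational bound. -/
def classWeightRat (N k : ℕ) : ℚ :=
  expOddRat (min k (N - k)) * (6873 / 10000) ^ (max k (N - k) - min k (N - k))

/-- The same weight, as a real number. -/
def classWeight (N k : ℕ) : ℝ :=
  expOdd (min k (N - k)) * 0.6873 ^ (max k (N - k) - min k (N - k))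

lemma classWeight_nonneg (N k : ℕ) : 0 ≤ classWeight N k :=
  mul_nonneg (zero_le_one.trans (one_le_expOdd _)) (by positivity)

lemma exp_le_classWeight (N k : ℕ) :
    exp (3 / 8 * (oddSum (min k (N - k)) - ((max k (N - k) - min k (N - k) : ℕ) : ℝ))) ≤
      classWeight N k := by
  rw [mul_sub, sub_eq_add_neg, exp_add, classWeight]
  refine mul_le_mul (exp_oddSum_le _) ?_ (exp_pos _).le (zero_le_one.trans (one_le_expOdd _))
  rw [show -(3 / 8 * ((max k (N - k) - min k (N - k) : ℕ) : ℝ)) =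
    ((max k (N - k) - min k (N - k) : ℕ) : ℝ) * (-(3 / 8)) by ring, exp_nat_mul]
  exact pow_le_pow_left₀ (exp_pos _).le exp_neg_three_eighths_le _

lemma choose_half (N : ℕ) : (N.choose (N / 2) : ℝ) ≤ 2 ^ N * centralProb ((N + 1) / 2) := by
  rcases Nat.even_or_odd' N with ⟨t, rfl | rfl⟩
  · rw [Nat.mul_div_cancel_left t two_pos, show (2 * t + 1) / 2 = t by omega, centralProb, pow_mul]
    norm_num
    rw [mul_div_cancel₀ _ (by positivity), Nat.centralBinom_eq_two_mul_choose]
  · rw [show (2 * t + 1) / 2 = t by omega, show (2 * t + 1 + 1) / 2 = t + 1 by omega, centralProb]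
    have h : (t + 1).centralBinom = 2 * (2 * t + 1).choose t := by
      rw [Nat.centralBinom_eq_two_mul_choose, show 2 * (t + 1) = (2 * t + 1) + 1 by ring,
        Nat.choose_succ_succ, show (2 * t + 1).choose (t + 1) = (2 * t + 1).choose t from
          Nat.choose_symm_of_eq_add (by ring)]
      ring
    rw [h, show (4 : ℝ) ^ (t + 1) = 2 ^ (2 * t + 1) * 2 by
      rw [show (4 : ℝ) = 2 ^ 2 by norm_num, ← pow_mul]; ring]
    push_cast
    rw [mul_div_mul_comm, ]
    field_simp
    exact le_rfl

lemma choose_mul_classWeight_le (N k : ℕ) :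
    (N.choose k : ℝ) * classWeight N k ≤ 2 ^ N * evenPeak ((N + 1) / 2) := by
  have h1 : (N.choose k : ℝ) ≤ N.choose (N / 2) := by exact_mod_cast Nat.choose_le_middle k N
  have h2 : classWeight N k ≤ expOdd ((N + 1) / 2) * 1 := by
    refine mul_le_mul (expOdd_mono (by omega)) (pow_le_one₀ (by norm_num) (by norm_num))
      (by positivity) (zero_le_one.trans (one_le_expOdd _))
  calc (N.choose k : ℝ) * classWeight N k
      ≤ (2 ^ N * centralProb ((N + 1) / 2)) * (expOdd ((N + 1) / 2) * 1) :=
        mul_le_mul (h1.trans (choose_half N)) h2 (classWeight_nonneg _ _)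
          (mul_nonneg (by positivity) (centralProb_pos _).le)
    _ = _ := by rw [evenPeak]; ring

lemma choose_mul_classWeight_le_odd {N : ℕ} (hN : Odd N) {k : ℕ} (hk : k ≤ N) :
    (N.choose k : ℝ) * classWeight N k ≤ 2 ^ N * oddPeak ((N + 1) / 2) := by
  have h1 : (N.choose k : ℝ) ≤ N.choose (N / 2) := by exact_mod_cast Nat.choose_le_middle k N
  obtain ⟨m, rfl⟩ := hN
  have h2 : classWeight (2 * m + 1) k ≤ expOdd ((2 * m + 1 + 1) / 2 - 1) * 0.6873 := by
    refine mul_le_mul (expOdd_mono (by omega)) ?_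
      (by positivity) (zero_le_one.trans (one_le_expOdd _))
    refine (pow_le_pow_of_le_one (by norm_num) (by norm_num)
      (show 1 ≤ max k (2 * m + 1 - k) - min k (2 * m + 1 - k) by omega)).trans (by norm_num)
  calc ((2 * m + 1).choose k : ℝ) * classWeight (2 * m + 1) k
      ≤ (2 ^ (2 * m + 1) * centralProb ((2 * m + 1 + 1) / 2)) *
          (expOdd ((2 * m + 1 + 1) / 2 - 1) * 0.6873) :=
        mul_le_mul (h1.trans (choose_half _)) h2 (classWeight_nonneg _ _)
          (mul_nonneg (by positivity) (centralProb_pos _).le)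
    _ = _ := by rw [oddPeak]; ring

/-- Two geometric series around the middle of the range. The second term on the left is the remainder of
both series, which makes the induction step an equality. -/
lemma sum_pow_dist_le (N : ℕ) :
    ∑ k ∈ Finset.range (N + 1), (0.6873 : ℝ) ^ (max k (N - k) - min k (N - k)) +
      2 * 0.6873 ^ (N + 2) / (1 - 0.6873 ^ 2) ≤ 2.79062 := by
  induction N using Nat.twoStepInduction with
  | zero => norm_num
  | one => norm_num [Finset.sum_range_succ]
  | more N ih _ =>
    rw [Finset.sum_range_succ, Finset.sum_range_succ']
    have e : ∀ k ∈ Finset.range (N + 1), (0.6873 : ℝ) ^ (max (k + 1) (N + 2 - (k + 1)) -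
        min (k + 1) (N + 2 - (k + 1))) = 0.6873 ^ (max k (N - k) - min k (N - k)) := by
      intro k hk
      have := Finset.mem_range.1 hk
      congr 1; omega
    rw [Finset.sum_congr rfl e]
    simp only [Nat.sub_zero, Nat.zero_le, sup_of_le_right, inf_of_le_left, Nat.sub_self,
      sup_of_le_left, inf_of_le_right]
    refine le_trans (le_of_eq ?_) ih
    have : (0.6873 : ℝ) ^ (N + 2 + 2) = 0.6873 ^ (N + 2) * 0.6873 ^ 2 := by ring
    rw [this]
    field_simp
    ring

/-- The weights of the small classes, by a finite computation. The eighth power clears the root in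
`decay`. -/
lemma sum_classWeight_rat : ∀ N < 33,
    (∑ k ∈ Finset.range (N + 1), (N.choose k : ℚ) * classWeightRat N k) ^ 8 *
      (1 + (((N + 1) / 2 : ℕ) : ℚ) / 25) ≤ (2 ^ N) ^ 8 := by
  decide +kernel

lemma classWeight_eq_rat (N k : ℕ) : classWeight N k = (classWeightRat N k : ℚ) := by
  rw [classWeight, classWeightRat, expOdd]; push_cast; norm_num

/-- The mean of the tilted weight of a class over a uniform split is at most `decay`. -/
lemma sum_classWeight_le (N : ℕ) :
    ∑ k ∈ Finset.range (N + 1), (N.choose k : ℝ) * classWeight N k ≤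
      2 ^ N * decay ((N + 1) / 2) := by
  -- small classes by computation; for large ones the peak of the weight times geometric series
  rcases lt_or_ge N 33 with hN | hN
  · refine le_mul_decay (by positivity) ?_
    simp_rw [classWeight_eq_rat]
    have h := (Rat.cast_le (K := ℝ)).2 (sum_classWeight_rat N hN)
    rw [Rat.cast_mul, Rat.cast_pow, Rat.cast_sum] at h
    simp only [Rat.cast_mul, Rat.cast_add, Rat.cast_div, Rat.cast_pow, Rat.cast_natCast,
      Rat.cast_ofNat, Rat.cast_one] at h
    exact h
  · have hbase : evenPeak 17 ≤ (1 / 2.79062) * decay 17 := by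
      refine le_mul_decay (by norm_num) ?_
      have h1 : evenPeak 17 = ((17 : ℕ).centralBinom / 4 ^ 17) * ((expOddRat 17 : ℚ) : ℝ) := rfl
      rw [h1]
      norm_num [expOddRat, Nat.centralBinom, Nat.choose]
    have h1 := evenPeak_le (A := 1 / 2.79062) (by norm_num) (r := 17) (t := (N + 1) / 2)
      (by norm_num) (by omega) hbase
    have h2 : ∀ k ∈ Finset.range (N + 1), (N.choose k : ℝ) * classWeight N k ≤
        2 ^ N * evenPeak ((N + 1) / 2) * 0.6873 ^ (max k (N - k) - min k (N - k)) := by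
      intro k _
      have h1 : (N.choose k : ℝ) ≤ N.choose (N / 2) := by exact_mod_cast Nat.choose_le_middle k N
      rw [classWeight, evenPeak]
      calc (N.choose k : ℝ) * (expOdd (min k (N - k)) *
            0.6873 ^ (max k (N - k) - min k (N - k)))
          ≤ (2 ^ N * centralProb ((N + 1) / 2)) * (expOdd ((N + 1) / 2) *
            0.6873 ^ (max k (N - k) - min k (N - k))) := by
            refine mul_le_mul (h1.trans (choose_half N)) ?_
              (mul_nonneg (zero_le_one.trans (one_le_expOdd _)) (by positivity))
              (mul_nonneg (by positivity) (centralProb_pos _).le)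
            exact mul_le_mul_of_nonneg_right (expOdd_mono (by omega)) (by positivity)
        _ = _ := by ring
    refine (Finset.sum_le_sum h2).trans ?_
    rw [← Finset.mul_sum, mul_assoc]
    refine mul_le_mul_of_nonneg_left ?_ (by positivity)
    have h3 := sum_pow_dist_le N
    have h4 : (0 : ℝ) ≤ 2 * 0.6873 ^ (N + 2) / (1 - 0.6873 ^ 2) := by
      apply div_nonneg (by positivity); norm_num
    calc evenPeak ((N + 1) / 2) *
          ∑ k ∈ Finset.range (N + 1), (0.6873 : ℝ) ^ (max k (N - k) - min k (N - k))
        ≤ (1 / 2.79062 * decay ((N + 1) / 2)) * 2.79062 :=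
          mul_le_mul h1 (by linarith) (Finset.sum_nonneg fun k _ => by positivity)
            (mul_nonneg (by norm_num) (decay_pos _).le)
      _ = decay ((N + 1) / 2) := by ring

/-! ### Splits of the pool -/

section

lemma centralProb_sq_mul_le {n : ℕ} (hn : 10 ≤ n) :
    centralProb 10 ^ 2 * 10 ≤ centralProb n ^ 2 * n := by
  induction n, hn using Nat.le_induction with
  | base => norm_num
  | succ n hn ih =>
    refine ih.trans ?_
    rw [centralProb_succ, mul_pow, mul_assoc]
    refine mul_le_mul_of_nonneg_left ?_ (by positivity)
    rw [div_pow, div_mul_eq_mul_div, le_div_iff₀ (by positivity)]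
    push_cast
    nlinarith [(Nat.cast_nonneg n : (0 : ℝ) ≤ n)]

lemma centralProb_ten : centralProb 10 = 184756 / 1048576 := by
  norm_num [centralProb, Nat.centralBinom, Nat.choose]

/-- The factor `1 / centralProb n` lost by conditioning on a balanced split, which grows like
`√n`, is compensated by a shift of the exponent by `log (n / 10)` and by the decay rate. -/
lemma exp_mul_decay_le {n : ℕ} (hn : 10 ≤ n) :
    exp (-(3 / 8 * log (n / 10))) * decay n ≤ 6.3643 * centralProb n := by
  have hn' : (10 : ℝ) ≤ n := by exact_mod_cast hn
  have hn0 : (0 : ℝ) < n := by linarith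
  have hc := centralProb_pos n
  refine le_of_pow_le_pow_left₀ (n := 8) (by norm_num) (by positivity) ?_
  have h1 : exp (-(3 / 8 * log (n / 10))) ^ 8 = (10 / n) ^ 3 := by
    rw [← exp_nat_mul, show ((8 : ℕ) : ℝ) * -(3 / 8 * log (n / 10)) = ((3 : ℕ) : ℝ) * log (10 / n) by
      rw [show (10 : ℝ) / n = ((n : ℝ) / 10)⁻¹ by rw [inv_div], log_inv]; push_cast; ring, exp_nat_mul,
      exp_log (by positivity)]
  have h2 : decay n ^ 8 = 25 / (25 + n) := by
    have := decay_pow n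
    have h0 : (1 : ℝ) + n / 25 ≠ 0 := by positivity
    rw [eq_div_of_mul_eq h0 this]
    field_simp
  have h3 : centralProb 10 ^ 2 * (10 / n) ≤ centralProb n ^ 2 := by
    rw [← mul_div_assoc, div_le_iff₀ hn0]
    exact centralProb_sq_mul_le hn
  have h4 : (centralProb 10 ^ 2 * (10 / n)) ^ 4 ≤ centralProb n ^ 8 := by
    have := pow_le_pow_left₀ (by have := centralProb_pos 10; positivity) h3 4
    rw [← pow_mul] at this
    exact this
  rw [mul_pow, mul_pow, h1, h2]
  refine le_trans ?_ (mul_le_mul_of_nonneg_left h4 (by norm_num))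
  rw [centralProb_ten, mul_pow, ← mul_assoc, show ((10 : ℝ) / n) ^ 4 = (10 / n) ^ 3 * (10 / n) by ring,
    mul_comm (_ * _) ((10 / (n : ℝ)) ^ 3 * _), mul_assoc]
  refine mul_le_mul_of_nonneg_left ?_ (by positivity)
  rw [div_mul_eq_mul_div, div_le_div_iff₀ (by positivity) hn0]
  norm_num
  nlinarith

section Split

variable {ι κ : Type*} [Fintype ι] [DecidableEq ι] [Fintype κ] [DecidableEq κ]

/-- The number of indices with label `c` which can be matched across the split `e`. -/
def splitMatch (w : ι → κ) (e : ι → Bool) (c : κ) : ℕ :=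
  min (blockOnes w e c) (blockCard w c - blockOnes w e c)

/-- The imbalance of the label `c` under the split `e`. -/
def splitDiff (w : ι → κ) (e : ι → Bool) (c : κ) : ℕ :=
  max (blockOnes w e c) (blockCard w c - blockOnes w e c) - splitMatch w e c

/-- The total odd harmonic sum of the matched samples. -/
def splitOddSum (w : ι → κ) (e : ι → Bool) : ℝ := ∑ c, oddSum (splitMatch w e c)

/-- The total imbalance of a split. -/
def splitImbalance (w : ι → κ) (e : ι → Bool) : ℕ := ∑ c, splitDiff w e c

lemma two_mul_splitMatch_add (w : ι → κ) (e : ι → Bool) (c : κ) :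
    2 * splitMatch w e c + splitDiff w e c = blockCard w c := by
  have := blockOnes_le w e c
  unfold splitDiff splitMatch
  omega

lemma two_mul_sum_splitMatch_add (w : ι → κ) (e : ι → Bool) :
    2 * ∑ c, splitMatch w e c + splitImbalance w e = Fintype.card ι := by
  rw [splitImbalance, Finset.mul_sum, ← Finset.sum_add_distrib, ← sum_blockCard w]
  exact Finset.sum_congr rfl fun c _ => two_mul_splitMatch_add w e c

/-- The exponential moment, at `3 / 8`, of the score `splitOddSum - splitImbalance - log (n / 10)`
over the splits of the pool into two halves of size `n`. -/
lemma sum_exp_score_le (w : ι → κ) {n : ℕ} (hn : 10 ≤ n) (hι : Fintype.card ι = 2 * n) (c₁ : κ)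
    {A : ℝ} (hA0 : 0 ≤ A) (hA : ∀ k ≤ blockCard w c₁,
      ((blockCard w c₁).choose k : ℝ) * classWeight (blockCard w c₁) k ≤
        2 ^ blockCard w c₁ * (A * decay ((blockCard w c₁ + 1) / 2))) :
    ∑ e : ι → Bool with ones e = n,
        exp (3 / 8 * (splitOddSum w e - splitImbalance w e - log (n / 10))) ≤
      (2 * n).choose n * (6.3643 * A) := by
  have h1 : ∀ e : ι → Bool, exp (3 / 8 * (splitOddSum w e - splitImbalance w e - log (n / 10))) ≤
      exp (-(3 / 8 * log (n / 10))) * ∏ c, classWeight (blockCard w c) (blockOnes w e c) := by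
    intro e
    have : 3 / 8 * (splitOddSum w e - splitImbalance w e - log (n / 10)) =
        -(3 / 8 * log (n / 10)) +
          ∑ c, 3 / 8 * (oddSum (splitMatch w e c) - (splitDiff w e c : ℝ)) := by
      rw [← Finset.mul_sum, Finset.sum_sub_distrib, splitOddSum, splitImbalance]
      push_cast; ring
    rw [this, exp_add, exp_sum]
    refine mul_le_mul_of_nonneg_left ?_ (exp_pos _).le
    exact Finset.prod_le_prod (fun c _ => (exp_pos _).le) fun c _ => exp_le_classWeight _ _
  refine (Finset.sum_le_sum fun e _ => h1 e).trans ?_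
  rw [← Finset.mul_sum]
  have h2 := sum_level_prod_le w (f := fun c k => classWeight (blockCard w c) k)
    (fun c k => classWeight_nonneg _ _) n c₁ hA
  have h3 : ∏ c ∈ Finset.univ.erase c₁, ∑ k ∈ Finset.range (blockCard w c + 1),
      ((blockCard w c).choose k : ℝ) * classWeight (blockCard w c) k ≤
      ∏ c ∈ Finset.univ.erase c₁, 2 ^ blockCard w c * decay ((blockCard w c + 1) / 2) :=
    Finset.prod_le_prod (fun c _ => Finset.sum_nonneg fun k _ =>
      mul_nonneg (Nat.cast_nonneg _) (classWeight_nonneg _ _)) fun c _ => sum_classWeight_le _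
  have h4 : (2 ^ blockCard w c₁ * (A * decay ((blockCard w c₁ + 1) / 2))) *
      ∏ c ∈ Finset.univ.erase c₁, 2 ^ blockCard w c * decay ((blockCard w c + 1) / 2) ≤
      4 ^ n * (A * decay n) := by
    have e1 : (2 ^ blockCard w c₁ * (A * decay ((blockCard w c₁ + 1) / 2))) *
      ∏ c ∈ Finset.univ.erase c₁, 2 ^ blockCard w c * decay ((blockCard w c + 1) / 2) =
        A * ∏ c, 2 ^ blockCard w c * decay ((blockCard w c + 1) / 2) := by
      rw [← Finset.mul_prod_erase Finset.univ _ (Finset.mem_univ c₁)]; ring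
    rw [e1, Finset.prod_mul_distrib, Finset.prod_pow_eq_pow_sum, sum_blockCard, hι, pow_mul]
    norm_num
    rw [mul_left_comm]
    refine mul_le_mul_of_nonneg_left (mul_le_mul_of_nonneg_left ?_ hA0) (by positivity)
    refine (prod_decay_le _ _).trans (decay_antitone ?_)
    have h5 := sum_blockCard w
    have h6 : ∑ c, blockCard w c ≤ ∑ c, 2 * ((blockCard w c + 1) / 2) :=
      Finset.sum_le_sum fun c _ => by omega
    rw [← Finset.mul_sum] at h6
    omega
  have hpos : 0 ≤ 2 ^ blockCard w c₁ * (A * decay ((blockCard w c₁ + 1) / 2)) :=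
    mul_nonneg (by positivity) (mul_nonneg hA0 (decay_pos _).le)
  have h5 := h2.trans ((mul_le_mul_of_nonneg_left h3 hpos).trans h4)
  refine (mul_le_mul_of_nonneg_left h5 (exp_pos _).le).trans ?_
  have h6 := exp_mul_decay_le hn
  have h7 : (4 : ℝ) ^ n * centralProb n = (2 * n).choose n := by
    rw [centralProb, Nat.centralBinom_eq_two_mul_choose]; field_simp
  calc exp (-(3 / 8 * log (n / 10))) * (4 ^ n * (A * decay n))
      = 4 ^ n * A * (exp (-(3 / 8 * log (n / 10))) * decay n) := by ring
    _ ≤ 4 ^ n * A * (6.3643 * centralProb n) := mul_le_mul_of_nonneg_left h6 (by positivity)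
    _ = (4 ^ n * centralProb n) * (6.3643 * A) := by ring
    _ = _ := by rw [h7]

/-- The number of splits which halve every class. -/
lemma card_balanced (w : ι → κ) {h : κ → ℕ} (hw : ∀ c, blockCard w c = 2 * h c) {n : ℕ}
    (hι : Fintype.card ι = 2 * n) :
    (((Finset.univ.filter fun e : ι → Bool => ones e = n).filter
      fun e => ∀ c, blockOnes w e c = h c).card : ℝ) =
      (2 * n).choose n * ((∏ c, centralProb (h c)) / centralProb n) := by
  have hsum : ∑ c, h c = n := by
    have := sum_blockCard w
    simp_rw [hw, ← Finset.mul_sum, hι] at this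
    omega
  have h1 := sum_prod_blockOnes (R := ℝ) w fun c k => if k = h c then 1 else 0
  have h2 : ∀ c, ∑ k ∈ Finset.range (blockCard w c + 1),
      ((blockCard w c).choose k : ℝ) * (if k = h c then 1 else 0) = 4 ^ h c * centralProb (h c) := by
    intro c
    simp only [mul_ite, mul_one, mul_zero, Finset.sum_ite_eq', Finset.mem_range]
    rw [if_pos (by have := hw c; omega), hw, centralProb, Nat.centralBinom_eq_two_mul_choose]
    field_simp
  simp_rw [h2, Finset.prod_mul_distrib, Finset.prod_pow_eq_pow_sum, hsum] at h1
  have h3 : (((Finset.univ.filter fun e : ι → Bool => ones e = n).filter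
      fun e => ∀ c, blockOnes w e c = h c).card : ℝ) =
      ∑ e : ι → Bool, ∏ c, (if blockOnes w e c = h c then (1 : ℝ) else 0) := by
    rw [Finset.filter_filter, Finset.card_filter]
    push_cast
    refine Finset.sum_congr rfl fun e _ => ?_
    by_cases he : ∀ c, blockOnes w e c = h c
    · have h4 : ones e = n := by
        rw [← sum_blockOnes w e, ← hsum]; exact Finset.sum_congr rfl fun c _ => he c
      rw [if_pos ⟨h4, he⟩, Finset.prod_congr rfl fun c _ => if_pos (he c), Finset.prod_const_one]
    · obtain ⟨c, hc⟩ := not_forall.1 he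
      rw [if_neg fun hh => he hh.2]
      exact (Finset.prod_eq_zero (Finset.mem_univ c) (if_neg hc)).symm
  have h7 : (4 : ℝ) ^ n * centralProb n = (2 * n).choose n := by
    rw [centralProb, Nat.centralBinom_eq_two_mul_choose]; field_simp
  have := centralProb_pos n
  rw [h3, h1, ← h7]
  field_simp

end Split

/-- The least regret bound for the labels `w`. -/
def regret {n C : ℕ} (w : Fin n ⊕ Fin n → Fin C) : ℝ := sInf {M | HasRegret w M}

/-- The set of regret bounds is bounded below: compare the law of constantly zero bits with
itself. -/
lemma bddBelow_hasRegret {n C : ℕ} (w : Fin n ⊕ Fin n → Fin C) :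
    BddBelow {M | HasRegret w M} := by
  set p : Fin n ⊕ Fin n → ℝ := fun _ => 0 with hp
  have hp01 : ∀ i, p i ∈ Set.Icc (0 : ℝ) 1 := fun i => by simp [hp]
  refine ⟨∑ e, bprod p e * (n * (gap w e * log 2)), fun M hM => ?_⟩
  have h := hM p (bprod p) hp01 (bprod_nonneg hp01) (sum_bprod p)
    (fun τ _ e => (Equiv.prod_comp τ fun i => bw 0 (e i) :)) (fun e he => he)
  have h0 : ∑ e, bprod p e * log (bprod p e / bprod p e) = 0 := by
    refine Finset.sum_eq_zero fun e _ => ?_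
    rcases eq_or_ne (bprod p e) 0 with h | h
    · rw [h, zero_mul]
    · rw [div_self h, log_one, mul_zero]
  rw [h0] at h
  linarith

lemma regret_le {n C : ℕ} {w : Fin n ⊕ Fin n → Fin C} {M : ℝ} (h : HasRegret w M) :
    regret w ≤ M := csInf_le (bddBelow_hasRegret w) h

lemma log_tiltBound_le (t : ℕ) {q : ℝ} (hq : 0 ≤ q) : log (tiltBound t q) ≤ q * oddSum t := by
  rw [tiltBound, log_prod fun i _ => by positivity, oddSum, Finset.mul_sum]
  refine Finset.sum_le_sum fun i _ => ?_
  have : (0 : ℝ) < 1 + q / (2 * i + 1) := by positivity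
  refine (log_le_sub_one_of_pos this).trans (le_of_eq ?_)
  ring

/-- The indicator of the training samples. -/
def trainBits (n : ℕ) : Fin n ⊕ Fin n → Bool := Sum.elim (fun _ => true) fun _ => false

lemma ones_trainBits (n : ℕ) : ones (trainBits n) = n := by
  simp [ones, trainBits]

open Classical in
/-- A permutation of the pool which turns the given set of `n` samples into the training set. -/
def splitPerm {n : ℕ} (e : Fin n ⊕ Fin n → Bool) : Equiv.Perm (Fin n ⊕ Fin n) :=
  if h : ones e = ones (trainBits n) then (exists_perm_of_ones_eq h).choose else 1

lemma comp_splitPerm {n : ℕ} {e : Fin n ⊕ Fin n → Bool} (he : ones e = n) :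
    e ∘ splitPerm e = trainBits n := by
  have h : ones e = ones (trainBits n) := he.trans (ones_trainBits n).symm
  rw [splitPerm, dif_pos h]
  exact (exists_perm_of_ones_eq h).choose_spec

variable {n C : ℕ}

lemma trainCount_splitPerm (w : Fin n ⊕ Fin n → Fin C) {e : Fin n ⊕ Fin n → Bool}
    (he : ones e = n) (c : Fin C) : trainCount (w ∘ splitPerm e) c = blockOnes w e c := by
  have h := comp_splitPerm he
  rw [blockOnes, Finset.sum_filter, ← Equiv.sum_comp (splitPerm e), Fintype.sum_sum_type]
  have hl : ∀ j : Fin n, e (splitPerm e (Sum.inl j)) = true := fun j => congrFun h (Sum.inl j)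
  have hr : ∀ j : Fin n, e (splitPerm e (Sum.inr j)) = false := fun j => congrFun h (Sum.inr j)
  simp only [hl, hr, trainCount, Finset.card_filter]
  simp

lemma testCount_splitPerm (w : Fin n ⊕ Fin n → Fin C) {e : Fin n ⊕ Fin n → Bool}
    (he : ones e = n) (c : Fin C) :
    testCount (w ∘ splitPerm e) c = blockCard w c - blockOnes w e c := by
  have h1 : trainCount (w ∘ splitPerm e) c + testCount (w ∘ splitPerm e) c = blockCard w c := by
    rw [blockCard, Finset.card_filter, ← Equiv.sum_comp (splitPerm e), Fintype.sum_sum_type,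
      trainCount, testCount, Finset.card_filter, Finset.card_filter]
    rfl
  rw [← h1, trainCount_splitPerm w he, Nat.add_sub_cancel_left]

lemma matchCount_splitPerm (w : Fin n ⊕ Fin n → Fin C) {e : Fin n ⊕ Fin n → Bool}
    (he : ones e = n) (c : Fin C) : matchCount (w ∘ splitPerm e) c = splitMatch w e c := by
  rw [matchCount, trainCount_splitPerm w he, testCount_splitPerm w he, splitMatch]

/-- The regret of a split, from a bound of the exponent which is uniform in the strength `q` of the
tilt. -/
lemma regret_le_of_forall (hn : 10 ≤ n) (w : Fin n ⊕ Fin n → Fin C) {e : Fin n ⊕ Fin n → Bool}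
    (he : ones e = n) {M : ℝ} (hM0 : 0 ≤ M)
    (hM : ∀ q : ℝ, 0 ≤ q → q ≤ 1 →
      q * (splitOddSum w e - splitImbalance w e) - 1.19 * splitImbalance w e * q ^ 2 ≤ M) :
    regret (w ∘ splitPerm e) ≤ 1.32 + M := by
  refine regret_le (hasRegret_tilt hn _ (u := (splitImbalance w e : ℝ) / 2) ?_ hM0 fun q h0 h1 => ?_)
  · have h := two_mul_sum_splitMatch_add w e
    simp only [matchCount_splitPerm w he]
    rw [Fintype.card_sum, Fintype.card_fin] at h
    have h' : (2 : ℝ) * (∑ c, splitMatch w e c : ℕ) + splitImbalance w e = n + n := by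
      exact_mod_cast h
    linarith
  · refine le_trans ?_ (hM q h0 h1)
    have : ∑ c, log (tiltBound (matchCount (w ∘ splitPerm e) c) q) ≤ q * splitOddSum w e := by
      rw [splitOddSum, Finset.mul_sum]
      refine Finset.sum_le_sum fun c _ => ?_
      rw [matchCount_splitPerm w he]
      exact log_tiltBound_le _ h0
    linarith

/-- The regret of a split whose score is at most `M`. -/
lemma regret_le_of_score (hn : 10 ≤ n) (w : Fin n ⊕ Fin n → Fin C) {e : Fin n ⊕ Fin n → Bool}
    (he : ones e = n) {M : ℝ} (hM0 : 0 ≤ M) (hM : splitOddSum w e - splitImbalance w e ≤ M) :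
    regret (w ∘ splitPerm e) ≤ 1.32 + M := by
  refine regret_le_of_forall hn w he hM0 fun q h0 h1 => ?_
  have : 0 ≤ 1.19 * splitImbalance w e * q ^ 2 := by positivity
  nlinarith

/-- The regret of a split whose imbalance is at least four. -/
lemma regret_le_of_imbalance (hn : 10 ≤ n) (w : Fin n ⊕ Fin n → Fin C)
    {e : Fin n ⊕ Fin n → Bool} (he : ones e = n) {y : ℝ} (hy : 0 ≤ y)
    (hS : splitOddSum w e ≤ 4 + y) (hD : 4 ≤ splitImbalance w e) :
    regret (w ∘ splitPerm e) ≤ 1.32 + y ^ 2 / 19.04 := by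
  refine regret_le_of_forall hn w he (by positivity) fun q h0 h1 => ?_
  have hD' : (4 : ℝ) ≤ splitImbalance w e := by exact_mod_cast hD
  have h2 : q * (splitOddSum w e - splitImbalance w e) ≤ q * y :=
    mul_le_mul_of_nonneg_left (by linarith) h0
  have h3 : 1.19 * 4 * q ^ 2 ≤ 1.19 * splitImbalance w e * q ^ 2 := by
    refine mul_le_mul_of_nonneg_right ?_ (sq_nonneg q); linarith
  rw [le_div_iff₀ (by norm_num)]
  -- the quadratic in `q` is largest at `q = y / 9.52`
  nlinarith [sq_nonneg (y - 9.52 * q)]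

lemma sq_le_exp {z : ℝ} (hz : 0 ≤ z) : z ^ 2 ≤ 3.85 * exp (3 / 8 * z) := by
  have h1 : 3 / 16 * z * exp 1 ≤ exp (3 / 16 * z) := by
    have := add_one_le_exp (3 / 16 * z - 1)
    rw [sub_add_cancel, exp_sub, le_div_iff₀ (exp_pos _)] at this
    exact this
  have h2 : 3 / 16 * z * 2.718281 ≤ exp (3 / 16 * z) :=
    (mul_le_mul_of_nonneg_left (by linarith [exp_one_gt_d9]) (by positivity)).trans h1
  have h3 : exp (3 / 8 * z) = exp (3 / 16 * z) ^ 2 := by rw [← exp_nat_mul]; congr 1; push_cast; ring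
  rw [h3]
  have h4 := pow_le_pow_left₀ (by positivity) h2 2
  nlinarith [sq_nonneg z]

/-- The regret of an unbalanced split is controlled by the exponential of its score. -/
lemma regret_le_exp (hn : 10 ≤ n) (w : Fin n ⊕ Fin n → Fin C) {e : Fin n ⊕ Fin n → Bool}
    (he : ones e = n) {D : ℕ} (hD0 : 0 < D) (hD : D ≤ splitImbalance w e) :
    regret (w ∘ splitPerm e) ≤ 1.32 + (log (n / 10) + 3.85 / (4.76 * D) *
      exp (3 / 8 * (splitOddSum w e - splitImbalance w e - log (n / 10)))) := by
  have hτ : 0 ≤ log ((n : ℝ) / 10) := by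
    apply log_nonneg; rw [le_div_iff₀ (by norm_num)]; simpa using (by exact_mod_cast hn : (10 : ℝ) ≤ n)
  have hD0' : (0 : ℝ) < D := by exact_mod_cast hD0
  have hD' : (D : ℝ) ≤ splitImbalance w e := by exact_mod_cast hD
  refine regret_le_of_forall hn w he (by positivity) fun q h0 h1 => ?_
  set z := splitOddSum w e - splitImbalance w e - log ((n : ℝ) / 10) with hz
  have e1 : splitOddSum w e - splitImbalance w e = z + log ((n : ℝ) / 10) := by rw [hz]; ring
  rw [e1]
  have h2 : q * log ((n : ℝ) / 10) ≤ log ((n : ℝ) / 10) := mul_le_of_le_one_left hτ h1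
  have h3 : 1.19 * D * q ^ 2 ≤ 1.19 * splitImbalance w e * q ^ 2 := by
    refine mul_le_mul_of_nonneg_right ?_ (sq_nonneg q); linarith
  have h4 : q * z - 1.19 * D * q ^ 2 ≤ 3.85 / (4.76 * D) * exp (3 / 8 * z) := by
    rcases le_total z 0 with hz0 | hz0
    · have : 0 ≤ 3.85 / (4.76 * D) * exp (3 / 8 * z) := by positivity
      have h5 : 0 ≤ 1.19 * (D : ℝ) * q ^ 2 := by positivity
      have h6 : q * z ≤ 0 := mul_nonpos_of_nonneg_of_nonpos h0 hz0
      linarith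
    · rw [div_mul_eq_mul_div, le_div_iff₀ (by positivity)]
      refine le_trans ?_ (sq_le_exp hz0)
      -- the quadratic in `q` is largest at `q = z / (2.38 D)`
      nlinarith [sq_nonneg (z - 2.38 * D * q)]
  linarith

lemma splitMatch_of_balanced {w : Fin n ⊕ Fin n → Fin C} {h : Fin C → ℕ}
    (hw : ∀ c, blockCard w c = 2 * h c) {e : Fin n ⊕ Fin n → Bool} (he : ∀ c, blockOnes w e c = h c)
    (c : Fin C) : splitMatch w e c = h c := by
  rw [splitMatch, he, hw]; omega

lemma splitImbalance_of_balanced {w : Fin n ⊕ Fin n → Fin C} {h : Fin C → ℕ}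
    (hw : ∀ c, blockCard w c = 2 * h c) {e : Fin n ⊕ Fin n → Bool} (he : ∀ c, blockOnes w e c = h c) :
    splitImbalance w e = 0 := by
  refine Finset.sum_eq_zero fun c _ => ?_
  have := two_mul_splitMatch_add w e c
  rw [splitMatch_of_balanced hw he, hw] at this
  omega

/-- The regret of a split which halves every class. -/
lemma regret_le_balanced (hn : 10 ≤ n) {w : Fin n ⊕ Fin n → Fin C} {h : Fin C → ℕ}
    (hw : ∀ c, blockCard w c = 2 * h c) {e : Fin n ⊕ Fin n → Bool} (hen : ones e = n)
    (he : ∀ c, blockOnes w e c = h c) : regret (w ∘ splitPerm e) ≤ 1.32 + ∑ c, phi (h c) := by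
  have hphi : ∀ c, 0 ≤ phi (h c) := fun c => log_nonneg (one_le_tiltBound _ zero_le_one)
  have hm : ∀ c, matchCount (w ∘ splitPerm e) c = h c := fun c => by
    rw [matchCount_splitPerm w hen, splitMatch_of_balanced hw he]
  refine regret_le (hasRegret_tilt hn _ (u := 0) ?_ (Finset.sum_nonneg fun c _ => hphi c)
    fun q h0 h1 => ?_)
  · have hs := sum_trainCount (w ∘ splitPerm e)
    simp only [trainCount_splitPerm w hen, he] at hs
    simp only [hm, hs, add_zero]
  · simp only [hm, mul_zero, zero_mul, add_zero, sub_zero]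
    refine Finset.sum_le_sum fun c _ => ?_
    rw [phi]
    refine log_le_log (zero_lt_one.trans_le (one_le_tiltBound _ h0)) ?_
    exact Finset.prod_le_prod (fun i _ => by positivity) fun i _ => by gcongr

/-- The regret of a halving split, by the exchangeable comparison within each class. -/
lemma regret_le_balanced_excess (hn : 10 ≤ n) {w : Fin n ⊕ Fin n → Fin C} {h : Fin C → ℕ}
    (hw : ∀ c, blockCard w c = 2 * h c) {e : Fin n ⊕ Fin n → Bool} (hen : ones e = n)
    (he : ∀ c, blockOnes w e c = h c) :
    regret (w ∘ splitPerm e) ≤ ∑ c, (phi (h c) + excess (h c)) := by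
  have h1 : ∀ c, trainCount (w ∘ splitPerm e) c = h c := fun c => by
    rw [trainCount_splitPerm w hen, he]
  have h2 : ∀ c, testCount (w ∘ splitPerm e) c = h c := fun c => by
    rw [testCount_splitPerm w hen, he, hw]; omega
  have := regret_le (hasRegret_balanced (by omega) (w ∘ splitPerm e) fun c => by rw [h1, h2])
  simpa only [h1] using this

end

/-! ### The mean regret: odd classes and general bounds -/

section

/-- The function `x (K - log x)` is increasing as long as `log x ≤ K - 1`. -/
lemma mul_sub_log_le {x y K : ℝ} (hx : 0 < x) (hxy : x ≤ y) (hy : log y ≤ K - 1) :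
    x * (K - log x) ≤ y * (K - log y) := by
  have hy0 : 0 < y := hx.trans_le hxy
  have h1 : x * (log y - log x) ≤ y - x := by
    rw [← log_div hy0.ne' hx.ne']
    have := log_le_sub_one_of_pos (div_pos hy0 hx)
    calc x * log (y / x) ≤ x * (y / x - 1) := mul_le_mul_of_nonneg_left this hx.le
      _ = y - x := by field_simp
  nlinarith

/-- A numerical bound for `-log y`, from the dyadic logarithm and the cubic bound near `1`. -/
lemma neg_log_le {y : ℝ} (hy : 0 < y) (k : ℕ) : -log y ≤ k * 0.6931471808 +
    ((1 / (y * 2 ^ k) - 1) - (1 / (y * 2 ^ k) - 1) ^ 2 / 2 + (1 / (y * 2 ^ k) - 1) ^ 3 / 3) := by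
  have h1 : -log y = k * log 2 + log (1 / (y * 2 ^ k)) := by
    rw [one_div, log_inv, log_mul hy.ne' (by positivity), log_pow]; ring
  rw [h1]
  have h2 := log_le_cubic (u := 1 / (y * 2 ^ k)) (by positivity)
  have h3 : (k : ℝ) * log 2 ≤ k * 0.6931471808 :=
    mul_le_mul_of_nonneg_left log_two_lt_d9.le (Nat.cast_nonneg k)
  linarith

lemma log_ten_ge : 2.30258 ≤ log 10 := by
  have h1 : 3 * log 10 = 10 * log 2 - log 1.024 := by
    rw [show (1.024 : ℝ) = 2 ^ 10 / 10 ^ 3 by norm_num, log_div (by norm_num) (by norm_num), log_pow,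
      log_pow]
    push_cast; ring
  have h2 := log_le_cubic (u := 1.024) (by norm_num)
  have := log_two_gt_d9
  norm_num at h2
  linarith

lemma phi_ten_le : phi 10 ≤ 1.7362 := by
  have h1 : 2 * phi 10 = 5 * log 2 + log ((1048576 / 184756) ^ 2 / 2 ^ 5) := by
    have e : log ((1048576 / 184756 : ℝ) ^ 2 / 2 ^ 5) =
        2 * log (1048576 / 184756) - 5 * log 2 := by
      rw [log_div (by norm_num) (by norm_num), log_pow, log_pow]; push_cast; ring
    rw [phi_eq, centralProb_ten, ← log_inv, inv_div, e]
    ring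
  have h2 := log_le_cubic (u := (1048576 / 184756) ^ 2 / 2 ^ 5) (by norm_num)
  have := log_two_lt_d9
  norm_num at h2 h1
  linarith

lemma phi_le {n : ℕ} (hn : 10 ≤ n) : phi n ≤ 1.7362 + log (n / 10) / 2 := by
  have hn' : (10 : ℝ) ≤ n := by exact_mod_cast hn
  have h := centralProb_sq_mul_le hn
  have hc := centralProb_pos n
  have h10 := centralProb_pos 10
  have h1 := log_le_log (by positivity) h
  rw [log_mul (by positivity) (by positivity), log_mul (by positivity) (by positivity), log_pow,
    log_pow] at h1
  have h2 := phi_ten_le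
  rw [phi_eq] at h2 ⊢
  rw [log_div (by positivity) (by norm_num)]
  push_cast at h1
  linarith

lemma centralProb_le_succ {m₀ m : ℕ} (hm : m₀ ≤ m) :
    centralProb m ≤ (2 * m₀ + 2) / (2 * m₀ + 1) * centralProb (m + 1) := by
  have hc := centralProb_pos m
  have hm' : (m₀ : ℝ) ≤ m := by exact_mod_cast hm
  rw [centralProb_succ, mul_left_comm]
  refine le_mul_of_one_le_right hc.le ?_
  rw [div_mul_div_comm, one_le_div (by positivity)]
  nlinarith

/-- Log-convexity of `centralProb`: a product of two values grows when the arguments are spread. -/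
lemma centralProb_mul_le {j a b : ℕ} (hja : j ≤ a) (hjb : j ≤ b) :
    centralProb a * centralProb b ≤ centralProb j * centralProb (a + b - j) := by
  wlog hab : a ≤ b generalizing a b
  · rw [mul_comm, Nat.add_comm]
    exact this hjb hja (by omega)
  clear hjb
  induction a, hja using Nat.le_induction generalizing b with
  | base => rw [Nat.add_sub_cancel_left]
  | succ a hja ih =>
    have h := ih (b := b + 1) (by omega)
    rw [show a + (b + 1) - j = a + 1 + b - j by omega] at h
    refine le_trans ?_ h
    have ha := centralProb_pos a
    have hb := centralProb_pos b
    rw [centralProb_succ, centralProb_succ b, mul_right_comm, ← mul_assoc]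
    refine mul_le_mul_of_nonneg_left ?_ (by positivity)
    rw [div_le_div_iff₀ (by positivity) (by positivity)]
    have : (a : ℝ) + 1 ≤ b := by exact_mod_cast hab
    nlinarith

lemma centralProb_one : centralProb 1 = 1 / 2 := by norm_num [centralProb, Nat.centralBinom]

/-- Among the class sizes with a given sum, the chance of halving every class is largest when all
classes but one are as small as possible. -/
lemma prod_centralProb_le {κ : Type*} (s : Finset κ) (h : κ → ℕ) (hh : ∀ c ∈ s, 1 ≤ h c) :
    ∀ m k, s.card = k + 1 → ∑ c ∈ s, h c = m + k →
      1 ≤ m ∧ ∏ c ∈ s, centralProb (h c) ≤ (1 / 2) ^ k * centralProb m := by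
  classical
  induction s using Finset.induction_on with
  | empty => intro m k hk; simp at hk
  | insert c s hc ih =>
    intro m k hk hm
    rw [Finset.card_insert_of_notMem hc] at hk
    rw [Finset.sum_insert hc] at hm
    rw [Finset.prod_insert hc]
    have hc1 := hh c (Finset.mem_insert_self c s)
    rcases Nat.eq_zero_or_pos k with rfl | hk0
    · have : s = ∅ := Finset.card_eq_zero.1 (by omega)
      subst this
      have : h c = m := by simpa using hm
      subst this
      exact ⟨hc1, by simp⟩
    · obtain ⟨k, rfl⟩ := Nat.exists_eq_add_of_le' hk0
      have hcard : s.card ≤ ∑ c ∈ s, h c := by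
        rw [Finset.card_eq_sum_ones]
        exact Finset.sum_le_sum fun c' hc' => hh c' (Finset.mem_insert_of_mem hc')
      obtain ⟨h1, h2⟩ := ih (fun c' hc' => hh c' (Finset.mem_insert_of_mem hc'))
        (∑ c ∈ s, h c - k) k (by omega) (by omega)
      refine ⟨by omega, ?_⟩
      have h3 := centralProb_mul_le hc1 h1
      rw [centralProb_one, show h c + (∑ c ∈ s, h c - k) - 1 = m by omega] at h3
      calc centralProb (h c) * ∏ c ∈ s, centralProb (h c)
          ≤ centralProb (h c) * ((1 / 2) ^ k * centralProb (∑ c ∈ s, h c - k)) :=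
            mul_le_mul_of_nonneg_left h2 (centralProb_pos _).le
        _ = (1 / 2) ^ k * (centralProb (h c) * centralProb (∑ c ∈ s, h c - k)) := by ring
        _ ≤ (1 / 2) ^ k * (1 / 2 * centralProb m) := mul_le_mul_of_nonneg_left h3 (by positivity)
        _ = _ := by ring

lemma half_pow_mul_centralProb_le (m i : ℕ) :
    (1 / 2) ^ i * centralProb m ≤ centralProb (m + i) := by
  induction i with
  | zero => simp
  | succ i ih =>
    rw [← add_assoc, centralProb_succ, pow_succ, mul_right_comm]
    refine mul_le_mul ih ?_ (by norm_num) (centralProb_pos _).le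
    rw [div_le_div_iff₀ (by norm_num) (by positivity)]
    linarith [(Nat.cast_nonneg (m + i) : (0 : ℝ) ≤ (m + i : ℕ))]

/-- `oddSum` is concave: it lies below its tangents. -/
lemma oddSum_le_tangent (m t : ℕ) : oddSum t ≤ oddSum m + ((t : ℝ) - m) / (2 * m + 1) := by
  rcases le_total m t with h | h
  · induction t, h using Nat.le_induction with
    | base => simp
    | succ t ht ih =>
      have e : oddSum (t + 1) = oddSum t + 1 / (2 * (t : ℝ) + 1) := by
        rw [oddSum, Finset.sum_range_succ, ← oddSum]
      have h1 : 1 / (2 * (t : ℝ) + 1) ≤ 1 / (2 * m + 1) := by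
        have : (m : ℝ) ≤ t := by exact_mod_cast ht
        exact one_div_le_one_div_of_le (by positivity) (by linarith)
      have e2 : ((t + 1 : ℕ) - (m : ℝ)) / (2 * m + 1) =
          ((t : ℝ) - m) / (2 * m + 1) + 1 / (2 * m + 1) := by push_cast; ring
      rw [e, e2]; linarith
  · induction h using Nat.decreasingInduction with
    | self => simp
    | of_succ t ht ih =>
      have e : oddSum (t + 1) = oddSum t + 1 / (2 * (t : ℝ) + 1) := by
        rw [oddSum, Finset.sum_range_succ, ← oddSum]
      have h1 : 1 / (2 * (m : ℝ) + 1) ≤ 1 / (2 * t + 1) := by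
        have : (t : ℝ) ≤ m := by exact_mod_cast ht.le
        exact one_div_le_one_div_of_le (by positivity) (by linarith)
      have e2 : ((t + 1 : ℕ) - (m : ℝ)) / (2 * m + 1) =
          ((t : ℝ) - m) / (2 * m + 1) + 1 / (2 * m + 1) := by push_cast; ring
      rw [e, e2] at ih; linarith

lemma one_le_oddSum {t : ℕ} (ht : 1 ≤ t) : 1 ≤ oddSum t := by
  obtain ⟨t, rfl⟩ := Nat.exists_eq_add_of_le' ht
  rw [oddSum, Finset.sum_range_succ']
  have : (0 : ℝ) ≤ ∑ k ∈ Finset.range t, 1 / (2 * ((k + 1 : ℕ) : ℝ) + 1) :=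
    Finset.sum_nonneg fun i _ => by positivity
  norm_num at this ⊢
  linarith

lemma oddSum_le_log {t : ℕ} (ht : 1 ≤ t) : oddSum t ≤ 1 + log t / 2 := by
  induction t, ht using Nat.le_induction with
  | base => norm_num [oddSum]
  | succ t ht ih =>
    have ht' : (0 : ℝ) < t := by exact_mod_cast ht
    rw [oddSum, Finset.sum_range_succ, ← oddSum]
    have h1 := le_log_one_add_of_nonneg (x := 1 / (t : ℝ)) (by positivity)
    have e1 : 2 * (1 / (t : ℝ)) / (1 / t + 2) = 2 * (1 / (2 * t + 1)) := by field_simp; ring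
    have e2 : log (1 + 1 / (t : ℝ)) = log ((t + 1 : ℕ) : ℝ) - log t := by
      rw [← log_div (by positivity) ht'.ne']; congr 1; push_cast; field_simp
    rw [e1, e2] at h1
    linarith

variable {n C : ℕ}

/-- A class of odd size leaves an imbalance of at least two in every split, so that the exponential
moment of the score suffices. -/
lemma sum_regret_le_of_odd (hn : 10 ≤ n) (w : Fin n ⊕ Fin n → Fin C) {c₁ : Fin C}
    (hc : Odd (blockCard w c₁)) :
    ∑ e : Fin n ⊕ Fin n → Bool with ones e = n, regret (w ∘ splitPerm e) ≤
      (2 * n).choose n * log n := by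
  have hcard : Fintype.card (Fin n ⊕ Fin n) = 2 * n := by simp [two_mul]
  have hE : ((Finset.univ.filter fun e : Fin n ⊕ Fin n → Bool => ones e = n).card : ℝ) =
      (2 * n).choose n := by rw [card_level, hcard]
  have hA := sum_exp_score_le w hn hcard c₁ (A := 0.3787) (by norm_num) fun k hk => by
    refine (choose_mul_classWeight_le_odd hc hk).trans ?_
    obtain ⟨m, hm⟩ := hc
    exact mul_le_mul_of_nonneg_left (oddPeak_le _ (by omega)) (by positivity)
  have h1 : ∀ e ∈ Finset.univ.filter fun e : Fin n ⊕ Fin n → Bool => ones e = n,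
      regret (w ∘ splitPerm e) ≤ (1.32 + log (n / 10)) + 3.85 / 9.52 *
        exp (3 / 8 * (splitOddSum w e - splitImbalance w e - log (n / 10))) := by
    intro e he
    have hD : 2 ≤ splitImbalance w e := by
      have h2 := two_mul_sum_splitMatch_add w e
      have h3 := two_mul_splitMatch_add w e c₁
      have h4 : splitDiff w e c₁ ≤ splitImbalance w e :=
        Finset.single_le_sum (fun _ _ => Nat.zero_le _) (Finset.mem_univ c₁)
      obtain ⟨m, hm⟩ := hc
      rw [hcard] at h2
      omega
    have := regret_le_exp hn w (Finset.mem_filter.1 he).2 two_pos hD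
    norm_num at this ⊢
    linarith
  refine (Finset.sum_le_sum h1).trans ?_
  rw [Finset.sum_add_distrib, Finset.sum_const, nsmul_eq_mul, hE, ← Finset.mul_sum]
  have h2 := log_ten_ge
  have hn' : (10 : ℝ) ≤ n := by exact_mod_cast hn
  have h3 : log (n : ℝ) = log 10 + log (n / 10) := by
    rw [log_div (by positivity) (by norm_num)]; ring
  have hpos : (0 : ℝ) < (2 * n).choose n := by exact_mod_cast Nat.choose_pos (by omega)
  rw [h3]
  have h4 := mul_le_mul_of_nonneg_left hA (show (0 : ℝ) ≤ 3.85 / 9.52 by norm_num)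
  nlinarith

section Even

variable {w : Fin n ⊕ Fin n → Fin C} {h : Fin C → ℕ}

lemma sum_half (hw : ∀ c, blockCard w c = 2 * h c) : ∑ c, h c = n := by
  have := sum_blockCard w
  simp_rw [hw, ← Finset.mul_sum] at this
  simp at this
  omega

/-- A split which does not halve every class leaves at least two even classes unhalved, each with an
imbalance of at least two. -/
lemma four_le_imbalance (hw : ∀ c, blockCard w c = 2 * h c) {e : Fin n ⊕ Fin n → Bool}
    (he : ones e = n) (hb : ¬ ∀ c, blockOnes w e c = h c) : 4 ≤ splitImbalance w e := by
  obtain ⟨c₀, hc₀⟩ := not_forall.1 hb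
  have hsum : ∑ c, blockOnes w e c = ∑ c, h c := by rw [sum_blockOnes, he, sum_half hw]
  obtain ⟨c₁, hne, hc₁⟩ : ∃ c₁, c₁ ≠ c₀ ∧ blockOnes w e c₁ ≠ h c₁ := by
    by_contra! hcon
    rw [← Finset.add_sum_erase Finset.univ _ (Finset.mem_univ c₀),
      ← Finset.add_sum_erase Finset.univ h (Finset.mem_univ c₀),
      Finset.sum_congr rfl fun c hc => hcon c (Finset.ne_of_mem_erase hc)] at hsum
    exact hc₀ (Nat.add_right_cancel hsum)
  have h2 : ∀ c, blockOnes w e c ≠ h c → 2 ≤ splitDiff w e c := by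
    intro c hc
    have h1 := hw c
    have h2 := blockOnes_le w e c
    unfold splitDiff splitMatch
    omega
  have h3 : ∑ c ∈ {c₁, c₀}, splitDiff w e c ≤ splitImbalance w e :=
    Finset.sum_le_sum_of_subset (Finset.subset_univ _)
  rw [Finset.sum_pair hne] at h3
  have := h2 c₀ hc₀
  have := h2 c₁ hc₁
  omega

/-- Splitting the mean regret between the splits which halve every class and the others. -/
lemma sum_regret_le_of_even (hw : ∀ c, blockCard w c = 2 * h c) {b T g₀ : ℝ}
    {g : (Fin n ⊕ Fin n → Bool) → ℝ}
    (hg : ∀ e, ones e = n → (∀ c, blockOnes w e c = h c) → g e = g₀)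
    (hT : ∀ e, ones e = n → (∀ c, blockOnes w e c = h c) → regret (w ∘ splitPerm e) ≤ T)
    (hb : ∀ e, ones e = n → (¬ ∀ c, blockOnes w e c = h c) →
      regret (w ∘ splitPerm e) ≤ b + g e) :
    ∑ e : Fin n ⊕ Fin n → Bool with ones e = n, regret (w ∘ splitPerm e) ≤
      (2 * n).choose n * (b + (∏ c, centralProb (h c)) / centralProb n * (T - b - g₀)) +
        ∑ e : Fin n ⊕ Fin n → Bool with ones e = n, g e := by
  have hcard : Fintype.card (Fin n ⊕ Fin n) = 2 * n := by simp [two_mul]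
  have hE : ((Finset.univ.filter fun e : Fin n ⊕ Fin n → Bool => ones e = n).card : ℝ) =
      (2 * n).choose n := by rw [card_level, hcard]
  have hB : (((Finset.univ.filter fun e : Fin n ⊕ Fin n → Bool => ones e = n).filter
      fun e => ∀ c, blockOnes w e c = h c).card : ℝ) =
      (2 * n).choose n * ((∏ c, centralProb (h c)) / centralProb n) := by
    convert card_balanced w hw hcard
  have h1 : ∀ e ∈ Finset.univ.filter fun e : Fin n ⊕ Fin n → Bool => ones e = n,
      regret (w ∘ splitPerm e) ≤
        b + g e + if ∀ c, blockOnes w e c = h c then T - b - g₀ else 0 := by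
    intro e he
    have he' := (Finset.mem_filter.1 he).2
    split_ifs with hc
    · rw [hg e he' hc]; linarith [hT e he' hc]
    · rw [add_zero]; exact hb e he' hc
  refine (Finset.sum_le_sum h1).trans (le_of_eq ?_)
  rw [Finset.sum_add_distrib, Finset.sum_add_distrib, Finset.sum_const, nsmul_eq_mul, hE,
    ← Finset.sum_filter, Finset.sum_const, nsmul_eq_mul, hB]
  ring

lemma splitOddSum_of_balanced (hw : ∀ c, blockCard w c = 2 * h c) {e : Fin n ⊕ Fin n → Bool}
    (he : ∀ c, blockOnes w e c = h c) : splitOddSum w e = ∑ c, oddSum (h c) :=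
  Finset.sum_congr rfl fun c _ => by rw [splitMatch_of_balanced hw he]

/-- The sum of the `phi` over the classes, through the chance of halving every class. -/
lemma sum_phi_eq (n : ℕ) (h : Fin C → ℕ) :
    ∑ c, phi (h c) = phi n - log ((∏ c, centralProb (h c)) / centralProb n) := by
  have hn := centralProb_pos n
  have hp : ∀ c, centralProb (h c) ≠ 0 := fun c => (centralProb_pos _).ne'
  rw [log_div (Finset.prod_ne_zero_iff.2 fun c _ => hp c) hn.ne', log_prod fun c _ => hp c]
  simp only [phi_eq, Finset.sum_neg_distrib]
  ring

/-- A bound of the mean regret by the exponential moment of the score. The moment runs over all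
splits, and the halving ones, which have no imbalance, are taken out of it. -/
lemma sum_regret_le_exp (hn : 10 ≤ n) (hw : ∀ c, blockCard w c = 2 * h c) {c₁ : Fin C} {A : ℝ}
    (hA0 : 0 ≤ A) (hA : evenPeak (h c₁) ≤ A * decay (h c₁)) :
    ∑ e : Fin n ⊕ Fin n → Bool with ones e = n, regret (w ∘ splitPerm e) ≤
      (2 * n).choose n * (1.32 + log (n / 10) + 1.28693 * A +
        (∏ c, centralProb (h c)) / centralProb n *
          (phi n - log ((∏ c, centralProb (h c)) / centralProb n) - log (n / 10) -
            3.85 / 19.04 * exp (3 / 8 * (∑ c, oddSum (h c) - log (n / 10))))) := by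
  have hcard : Fintype.card (Fin n ⊕ Fin n) = 2 * n := by simp [two_mul]
  have h1 := sum_regret_le_of_even hw (b := 1.32 + log (n / 10)) (T := 1.32 + ∑ c, phi (h c))
    (g₀ := 3.85 / 19.04 * exp (3 / 8 * (∑ c, oddSum (h c) - log (n / 10))))
    (g := fun e => 3.85 / 19.04 *
      exp (3 / 8 * (splitOddSum w e - splitImbalance w e - log (n / 10))))
    (fun e _ hb => by
      simp only [splitOddSum_of_balanced hw hb, splitImbalance_of_balanced hw hb, Nat.cast_zero,
        sub_zero])
    (fun e he hb => regret_le_balanced hn hw he hb)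
    (fun e he hb => by
      have := regret_le_exp hn w he (by norm_num : 0 < 4) (four_le_imbalance hw he hb)
      norm_num at this ⊢
      linarith)
  have h2 := sum_exp_score_le w hn hcard c₁ hA0 fun k hk => by
    refine (choose_mul_classWeight_le _ _).trans ?_
    rw [hw, show (2 * h c₁ + 1) / 2 = h c₁ by omega]
    exact mul_le_mul_of_nonneg_left hA (by positivity)
  rw [← Finset.mul_sum, sum_phi_eq n h] at h1
  have hpos : (0 : ℝ) < (2 * n).choose n := by exact_mod_cast Nat.choose_pos (by omega)
  have h3 : 3.85 / 19.04 * ((2 * n).choose n * (6.3643 * A)) ≤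
      ((2 * n).choose n : ℝ) * (1.28693 * A) := by
    have : 0 ≤ ((2 * n).choose n : ℝ) * A := by positivity
    nlinarith
  have h4 := mul_le_mul_of_nonneg_left h2 (show (0 : ℝ) ≤ 3.85 / 19.04 by norm_num)
  refine h1.trans ?_
  have e1 : ∀ N b x L P τ g : ℝ, N * (b + τ + x * (b + (P - L) - (b + τ) - g)) + N * (1.28693 * A) =
      N * (b + τ + 1.28693 * A + x * (P - L - τ - g)) := fun _ _ _ _ _ _ _ => by ring
  rw [← e1]
  linarith

/-- A bound of the mean regret by the largest score of an unbalanced split. -/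
lemma sum_regret_le_max (hn : 10 ≤ n) (hw : ∀ c, blockCard w c = 2 * h c) {y : ℝ} (hy : 0 ≤ y)
    (hS : ∀ e, ones e = n → 4 ≤ splitImbalance w e → splitOddSum w e ≤ 4 + y) :
    ∑ e : Fin n ⊕ Fin n → Bool with ones e = n, regret (w ∘ splitPerm e) ≤
      (2 * n).choose n * (1.32 + y ^ 2 / 19.04 + (∏ c, centralProb (h c)) / centralProb n *
        (phi n - log ((∏ c, centralProb (h c)) / centralProb n))) := by
  have h1 := sum_regret_le_of_even hw (b := 1.32 + y ^ 2 / 19.04) (T := 1.32 + ∑ c, phi (h c))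
    (g₀ := 0) (g := fun _ => 0) (fun _ _ _ => rfl)
    (fun e he hb => regret_le_balanced hn hw he hb)
    (fun e he hb => by
      have h4 := four_le_imbalance hw he hb
      rw [add_zero]
      exact regret_le_of_imbalance hn w he hy (hS e he h4) h4)
  rw [Finset.sum_const_zero, add_zero, sum_phi_eq n h] at h1
  refine h1.trans (mul_le_mul_of_nonneg_left ?_ (Nat.cast_nonneg _))
  have hx : 0 ≤ (∏ c, centralProb (h c)) / centralProb n :=
    div_nonneg (Finset.prod_nonneg fun c _ => (centralProb_pos _).le) (centralProb_pos n).le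
  have : 0 ≤ (∏ c, centralProb (h c)) / centralProb n * (y ^ 2 / 19.04) := by positivity
  nlinarith

/-- A bound of the mean regret when no unbalanced split has a positive score, up to the shift
`log (n / 10)`; the halving splits are treated by the exchangeable comparison. -/
lemma sum_regret_le_excess (hn : 10 ≤ n) (hw : ∀ c, blockCard w c = 2 * h c)
    (hS : ∀ e, ones e = n → 4 ≤ splitImbalance w e →
      splitOddSum w e - splitImbalance w e ≤ log (n / 10)) :
    ∑ e : Fin n ⊕ Fin n → Bool with ones e = n, regret (w ∘ splitPerm e) ≤
      (2 * n).choose n * (1.32 + log (n / 10) + (∏ c, centralProb (h c)) / centralProb n *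
        (phi n + ∑ c, excess (h c) - 1.32 - log (n / 10) -
          log ((∏ c, centralProb (h c)) / centralProb n))) := by
  have hτ : 0 ≤ log ((n : ℝ) / 10) := by
    apply log_nonneg; rw [le_div_iff₀ (by norm_num)]; simpa using (by exact_mod_cast hn : (10 : ℝ) ≤ n)
  have h1 := sum_regret_le_of_even hw (b := 1.32 + log (n / 10))
    (T := ∑ c, (phi (h c) + excess (h c)))
    (g₀ := 0) (g := fun _ => 0) (fun _ _ _ => rfl)
    (fun e he hb => regret_le_balanced_excess hn hw he hb)
    (fun e he hb => by
      have h4 := four_le_imbalance hw he hb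
      rw [add_zero]
      exact regret_le_of_score hn w he hτ (hS e he h4))
  rw [Finset.sum_const_zero, add_zero, Finset.sum_add_distrib, sum_phi_eq n h] at h1
  refine h1.trans (le_of_eq ?_)
  ring

end Even

end

/-! ### The mean regret for one or two classes -/

section

lemma mul_sub_log_le_of_le {x Y a K b : ℝ} (hx : 0 < x) (hxY : x ≤ Y) (ha : a ≤ K) (hYK : Y ≤ K)
    (hb : -log Y ≤ b) : x * (a - log x) ≤ Y * (K + b) := by
  have hY : 0 < Y := hx.trans_le hxY
  have h1 := mul_sub_log_le (K := K) hx hxY (by linarith [log_le_sub_one_of_pos hY])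
  have h2 : x * (a - log x) ≤ x * (K - log x) := mul_le_mul_of_nonneg_left (by linarith) hx.le
  have h3 : Y * (K - log Y) ≤ Y * (K + b) := mul_le_mul_of_nonneg_left (by linarith) hY.le
  linarith

lemma log_div_ten_ge {n : ℕ} {a : ℝ} (ha : 0 ≤ a) (hn : 10 * (1 + a) ≤ n) :
    2 * a / (a + 2) ≤ log (n / 10) := by
  refine (le_log_one_add_of_nonneg ha).trans (log_le_log (by linarith) ?_)
  rw [le_div_iff₀ (by norm_num)]; linarith

lemma log_five_le : log 5 ≤ 2 := by
  rw [log_le_iff_le_exp (by norm_num), show (2 : ℝ) = (2 : ℕ) * 1 by norm_num, exp_nat_mul]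
  nlinarith [exp_one_gt_d9]

lemma log_eq_log_ten_add {n : ℕ} (hn : 10 ≤ n) : log (n : ℝ) = log 10 + log (n / 10) := by
  have : (0 : ℝ) < n := by exact_mod_cast (by omega : 0 < n)
  rw [log_div this.ne' (by norm_num)]; ring

lemma log_div_ten_nonneg {n : ℕ} (hn : 10 ≤ n) : 0 ≤ log ((n : ℝ) / 10) := by
  apply log_nonneg; rw [le_div_iff₀ (by norm_num)]
  simpa using (by exact_mod_cast hn : (10 : ℝ) ≤ n)

/-- For two classes the score of every unbalanced split, whose imbalance is at least `4`, is at most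
zero. -/
lemma oddSum_add_le {n a b : ℕ} (hn : 10 ≤ n) (hab : a + b ≤ n) :
    oddSum a + oddSum b ≤ 4 + log (n / 10) := by
  have hτ := log_div_ten_nonneg hn
  have h5 := log_five_le
  have h2 : log 2 ≤ 1 := log_two_lt_d9.le.trans (by norm_num)
  have h10 : log 10 = log 2 + log 5 := by rw [← log_mul] <;> norm_num
  have hn0 : (0 : ℝ) < n := by exact_mod_cast (by omega : 0 < n)
  have hone : ∀ t ≤ n, oddSum t ≤ 4 + log ((n : ℝ) / 10) := by
    intro t ht
    rcases Nat.eq_zero_or_pos t with rfl | ht0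
    · simp [oddSum]; linarith
    · have h1 := oddSum_le_log ht0
      have h3 : log (t : ℝ) ≤ log n := log_le_log (by exact_mod_cast ht0) (by exact_mod_cast ht)
      rw [log_eq_log_ten_add hn] at h3
      linarith
  rcases Nat.eq_zero_or_pos a with rfl | ha
  · have := hone b (by omega)
    simpa [oddSum] using this
  rcases Nat.eq_zero_or_pos b with rfl | hb
  · have := hone a (by omega)
    simpa [oddSum] using this
  have ha' : (0 : ℝ) < a := by exact_mod_cast ha
  have hb' : (0 : ℝ) < b := by exact_mod_cast hb
  have hab' : (a : ℝ) + b ≤ n := by exact_mod_cast hab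
  have h3 : log a + log b ≤ 2 * (log 5 + log ((n : ℝ) / 10)) := by
    rw [← log_mul ha'.ne' hb'.ne', ← log_mul (by norm_num) (by positivity),
      show (2 : ℝ) * log (5 * (n / 10)) = (2 : ℕ) * log (5 * (n / 10)) by norm_num, ← log_pow]
    refine log_le_log (by positivity) ?_
    nlinarith [sq_nonneg ((a : ℝ) - b)]
  linarith [oddSum_le_log ha, oddSum_le_log hb]

lemma excess_le {t : ℕ} (ht : 3 ≤ t) : excess t ≤ 0.6 := by
  rw [excess, if_neg (by omega), if_neg (by omega), if_neg (by omega), defect]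
  split_ifs <;> norm_num

lemma centralProb_two : centralProb 2 = 3 / 8 := by
  norm_num [centralProb, Nat.centralBinom, Nat.choose]

lemma centralProb_three : centralProb 3 = 5 / 16 := by
  norm_num [centralProb, Nat.centralBinom, Nat.choose]

lemma centralProb_sub_le {n : ℕ} (hn : 10 ≤ n) :
    centralProb (n - 1) ≤ 20 / 19 * centralProb n ∧
    centralProb (n - 2) ≤ 20 / 19 * (18 / 17) * centralProb n ∧
    centralProb (n - 3) ≤ 20 / 19 * (18 / 17) * (16 / 15) * centralProb n ∧
    centralProb (n - 4) ≤ 20 / 19 * (18 / 17) * (16 / 15) * (14 / 13) * centralProb n := by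
  obtain ⟨m, rfl⟩ := Nat.exists_eq_add_of_le' hn
  have h1 := centralProb_le_succ (show 9 ≤ m + 9 by omega)
  have h2 := centralProb_le_succ (show 8 ≤ m + 8 by omega)
  have h3 := centralProb_le_succ (show 7 ≤ m + 7 by omega)
  have h4 := centralProb_le_succ (show 6 ≤ m + 6 by omega)
  norm_num at h1 h2 h3 h4
  rw [show m + 10 - 1 = m + 9 by omega, show m + 10 - 2 = m + 8 by omega,
    show m + 10 - 3 = m + 7 by omega, show m + 10 - 4 = m + 6 by omega]
  refine ⟨?_, ?_, ?_, ?_⟩ <;> linarith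

/-- The powers of `z` decrease faster than `centralProb`. -/
lemma pow_le_mul_centralProb {n : ℕ} (hn : 10 ≤ n) {z : ℝ} (hz0 : 0 ≤ z) (hz : z ≤ 0.9) :
    z ^ n ≤ z ^ 10 / centralProb 10 * centralProb n := by
  have h10 := centralProb_pos 10
  induction n, hn using Nat.le_induction with
  | base => rw [div_mul_cancel₀ _ h10.ne']
  | succ m hm ih =>
    rw [pow_succ, centralProb_succ m, ← mul_assoc]
    refine mul_le_mul ih ?_ hz0 (mul_nonneg (by positivity) (centralProb_pos _).le)
    refine hz.trans ?_
    have : (10 : ℝ) ≤ m := by exact_mod_cast hm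
    rw [le_div_iff₀ (by positivity)]; linarith

variable {n C : ℕ} {w : Fin n ⊕ Fin n → Fin C} {h : Fin C → ℕ}

/-- The classes which occur; `h c` is half the size of the class `c`. -/
def support (h : Fin C → ℕ) : Finset (Fin C) := Finset.univ.filter fun c => h c ≠ 0

lemma one_le_of_mem_support {c : Fin C} (hc : c ∈ support h) : 1 ≤ h c :=
  Nat.one_le_iff_ne_zero.2 (Finset.mem_filter.1 hc).2

lemma eq_zero_of_notMem_support {c : Fin C} (hc : c ∉ support h) : h c = 0 := by
  by_contra h0; exact hc (Finset.mem_filter.2 ⟨Finset.mem_univ _, h0⟩)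

lemma sum_support {M : Type*} [AddCommMonoid M] (f : ℕ → M) (hf : f 0 = 0) :
    ∑ c, f (h c) = ∑ c ∈ support h, f (h c) :=
  (Finset.sum_subset (Finset.subset_univ _) fun c _ hc => by
    rw [eq_zero_of_notMem_support hc, hf]).symm

lemma prod_support : ∏ c, centralProb (h c) = ∏ c ∈ support h, centralProb (h c) :=
  (Finset.prod_subset (Finset.subset_univ _) fun c _ hc => by
    rw [eq_zero_of_notMem_support hc, centralProb_zero]).symm

/-- The chance of halving every class, for at least `k + 1` classes. -/
lemma prod_centralProb_le_of_card (hw : ∀ c, blockCard w c = 2 * h c) {k : ℕ}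
    (hk : k + 1 ≤ (support h).card) :
    ∏ c, centralProb (h c) ≤ (1 / 2) ^ k * centralProb (n - k) := by
  have hsum : ∑ c ∈ support h, h c = n := by
    rw [← sum_support (fun x => x) rfl]; exact sum_half hw
  have hle : (support h).card ≤ n := by
    rw [Finset.card_eq_sum_ones, ← hsum]
    exact Finset.sum_le_sum fun c hc => one_le_of_mem_support hc
  rw [prod_support]
  set K := (support h).card - 1 with hK
  have h1 := (prod_centralProb_le (support h) h (fun c hc => one_le_of_mem_support hc)
    (n - K) K (by omega) (by omega)).2
  refine h1.trans ?_
  have h2 := half_pow_mul_centralProb_le (n - K) (K - k)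
  rw [show n - K + (K - k) = n - k by omega] at h2
  calc (1 / 2) ^ K * centralProb (n - K)
      = (1 / 2) ^ k * ((1 / 2) ^ (K - k) * centralProb (n - K)) := by
        rw [← mul_assoc, ← pow_add, show k + (K - k) = K by omega]
    _ ≤ _ := mul_le_mul_of_nonneg_left h2 (by positivity)

/-- The chance of halving every class, when the classes are small. -/
lemma prod_centralProb_le_pow (hn : 10 ≤ n) (hw : ∀ c, blockCard w c = 2 * h c) {z : ℝ}
    (hz0 : 0 ≤ z) (hz : z ≤ 0.9) (hh : ∀ c, centralProb (h c) ≤ z ^ h c) :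
    ∏ c, centralProb (h c) ≤ z ^ 10 / centralProb 10 * centralProb n := by
  have h1 : ∏ c, centralProb (h c) ≤ z ^ n := by
    refine (Finset.prod_le_prod (fun c _ => (centralProb_pos _).le) fun c _ => hh c).trans ?_
    rw [Finset.prod_pow_eq_pow_sum, sum_half hw]
  exact h1.trans (pow_le_mul_centralProb hn hz0 hz)

lemma sum_splitMatch_le {e : Fin n ⊕ Fin n → Bool}
    (hD : 4 ≤ splitImbalance w e) : ∑ c ∈ support h, splitMatch w e c + 2 ≤ n := by
  have h1 := two_mul_sum_splitMatch_add w e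
  simp only [Fintype.card_sum, Fintype.card_fin] at h1
  have h2 : ∑ c ∈ support h, splitMatch w e c ≤ ∑ c, splitMatch w e c :=
    Finset.sum_le_sum_of_subset (Finset.subset_univ _)
  omega

lemma splitOddSum_eq_support (hw : ∀ c, blockCard w c = 2 * h c) (e : Fin n ⊕ Fin n → Bool) :
    splitOddSum w e = ∑ c ∈ support h, oddSum (splitMatch w e c) := by
  refine (Finset.sum_subset (Finset.subset_univ _) fun c _ hc => ?_).symm
  have h1 := two_mul_splitMatch_add w e c
  rw [hw, eq_zero_of_notMem_support hc] at h1
  rw [show splitMatch w e c = 0 by omega]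
  simp [oddSum]

/-- Concavity of `oddSum`: `splitOddSum` is largest when the matched samples are spread equally
over the classes. -/
lemma splitOddSum_le_tangent (hw : ∀ c, blockCard w c = 2 * h c) {e : Fin n ⊕ Fin n → Bool}
    (hD : 4 ≤ splitImbalance w e) (m : ℕ) :
    splitOddSum w e ≤ (support h).card * oddSum m +
      ((n : ℝ) - 2 - (support h).card * m) / (2 * m + 1) := by
  rw [splitOddSum_eq_support hw]
  refine (Finset.sum_le_sum fun c _ => oddSum_le_tangent m (splitMatch w e c)).trans ?_
  rw [Finset.sum_add_distrib, Finset.sum_const, nsmul_eq_mul, ← Finset.sum_div,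
    Finset.sum_sub_distrib, Finset.sum_const, nsmul_eq_mul]
  have h1 : ((∑ c ∈ support h, splitMatch w e c : ℕ) : ℝ) + 2 ≤ n := by
    exact_mod_cast sum_splitMatch_le (h := h) hD
  push_cast at h1
  gcongr
  linarith

lemma exists_largest (hn : 10 ≤ n) (hw : ∀ c, blockCard w c = 2 * h c) :
    ∃ c₁, (∀ c, h c ≤ h c₁) ∧ n ≤ (support h).card * h c₁ := by
  have hs := sum_half hw
  have hne : (Finset.univ : Finset (Fin C)).Nonempty := by
    by_contra hcon
    rw [Finset.not_nonempty_iff_eq_empty.1 hcon] at hs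
    simp at hs; omega
  obtain ⟨c₁, -, hc₁⟩ := Finset.exists_max_image Finset.univ h hne
  refine ⟨c₁, fun c => hc₁ c (Finset.mem_univ c), ?_⟩
  rw [sum_support (fun x => x) rfl] at hs
  rw [← hs, ← smul_eq_mul]
  exact Finset.sum_le_card_nsmul _ _ _ fun c _ => hc₁ c (Finset.mem_univ c)

/-- The mean regret over the splits of the pool is at most `log n`. -/
def MeanRegretLe (w : Fin n ⊕ Fin n → Fin C) : Prop :=
  ∑ e : Fin n ⊕ Fin n → Bool with ones e = n, regret (w ∘ splitPerm e) ≤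
      (2 * n).choose n * log n

lemma meanRegretLe_of_le {Z : ℝ} (hZ : ∑ e : Fin n ⊕ Fin n → Bool with ones e = n,
    regret (w ∘ splitPerm e) ≤ (2 * n).choose n * Z) (h : Z ≤ log n) : MeanRegretLe w :=
  hZ.trans (mul_le_mul_of_nonneg_left h (Nat.cast_nonneg _))

lemma halving_pos : 0 < (∏ c, centralProb (h c)) / centralProb n :=
  div_pos (Finset.prod_pos fun c _ => centralProb_pos _) (centralProb_pos _)

/-- For a single class every split is halving, and the regret is `phi n` up to a constant, of order
`log n / 2`. -/
lemma meanRegretLe_one (hn : 10 ≤ n) (hw : ∀ c, blockCard w c = 2 * h c)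
    (hs : (support h).card = 1) : MeanRegretLe w := by
  obtain ⟨a, ha⟩ := Finset.card_eq_one.1 hs
  have hsum := sum_half hw
  rw [sum_support (fun x => x) rfl, ha, Finset.sum_singleton] at hsum
  have hx : (∏ c, centralProb (h c)) / centralProb n = 1 := by
    rw [prod_support, ha, Finset.prod_singleton, hsum, div_self (centralProb_pos n).ne']
  have key := sum_regret_le_excess hn hw fun e he hD => by
    exfalso
    have hb : ∀ c, blockOnes w e c = h c := by
      by_contra hcon
      have h0 : ∀ c, c ≠ a → blockOnes w e c = 0 := by
        intro c hc
        have h1 := blockOnes_le w e c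
        have h2 := eq_zero_of_notMem_support (h := h) (c := c) (by rw [ha]; simpa using hc)
        rw [hw, h2] at h1
        omega
      refine hcon fun c => ?_
      by_cases hc : c = a
      · subst hc
        have h1 := sum_blockOnes w e
        rw [Finset.sum_eq_single c (fun c' _ hc' => h0 c' hc') (by simp), he] at h1
        omega
      · rw [h0 c hc, eq_zero_of_notMem_support (h := h) (by rw [ha]; simpa using hc)]
    rw [splitImbalance_of_balanced hw hb] at hD
    omega
  refine meanRegretLe_of_le key ?_
  rw [hx, log_one, sum_support excess (by simp [excess]), ha, Finset.sum_singleton, hsum,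
    log_eq_log_ten_add hn]
  have h1 : excess n = 0.55 := by
    rw [excess, if_neg (by omega), if_neg (by omega), if_neg (by omega), defect, if_pos hn]
    norm_num
  rw [h1]
  linarith [phi_le hn, log_ten_ge, log_div_ten_nonneg hn]

/-- For two classes no unbalanced split has a positive score. The chance of a halving split depends on
the size of the smaller class. -/
lemma meanRegretLe_two (hn : 10 ≤ n) (hw : ∀ c, blockCard w c = 2 * h c)
    (hs : (support h).card = 2) : MeanRegretLe w := by
  obtain ⟨a, b, hab, hsup⟩ := Finset.card_eq_two.1 hs
  wlog hle : h a ≤ h b generalizing a b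
  · exact this b a hab.symm (by rw [hsup, Finset.pair_comm]) (by omega)
  have hsum := sum_half hw
  rw [sum_support (fun x => x) rfl, hsup, Finset.sum_pair hab] at hsum
  have ha1 : 1 ≤ h a := one_le_of_mem_support (by rw [hsup]; simp)
  have hcn := centralProb_pos n
  have hx0 := halving_pos (n := n) (h := h)
  have hx : (∏ c, centralProb (h c)) / centralProb n =
      centralProb (h a) * centralProb (h b) / centralProb n := by
    rw [prod_support, hsup, Finset.prod_pair hab]
  have key := sum_regret_le_excess hn hw fun e he hD => by
    have h1 := sum_splitMatch_le (h := h) hD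
    rw [splitOddSum_eq_support hw, hsup, Finset.sum_pair hab]
    rw [hsup, Finset.sum_pair hab] at h1
    have h2 := oddSum_add_le hn (a := splitMatch w e a) (b := splitMatch w e b) (by omega)
    have h3 : (4 : ℝ) ≤ splitImbalance w e := by exact_mod_cast hD
    linarith
  refine meanRegretLe_of_le key ?_
  rw [sum_support excess (by simp [excess]), hsup, Finset.sum_pair hab, log_eq_log_ten_add hn]
  obtain ⟨c1, c2, c3, -⟩ := centralProb_sub_le hn
  have hphi := phi_le hn
  have h10 := log_ten_ge
  have hτ := log_div_ten_nonneg hn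
  have hb3 : excess (h b) ≤ 0.6 := excess_le (by omega)
  set τ := log ((n : ℝ) / 10) with hτdef
  set x := (∏ c, centralProb (h c)) / centralProb n with hxdef
  rcases (by omega : h a = 1 ∨ h a = 2 ∨ 3 ≤ h a) with h1 | h1 | h1
  · have hxY : x ≤ 10 / 19 := by
      rw [hx, div_le_iff₀ hcn, h1, show h b = n - 1 by omega, centralProb_one]
      linarith
    have he : excess (h a) = 0.05 := by rw [h1]; simp [excess]
    have hb := neg_log_le (y := 10 / 19) (by norm_num) 1
    norm_num at hb
    have := mul_sub_log_le_of_le (a := phi n + (excess (h a) + excess (h b)) - 1.32 - τ)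
      (K := 1.0662) (b := 0.643) hx0 hxY (by linarith) (by norm_num) (by linarith)
    norm_num at this ⊢
    linarith
  · have hxY : x ≤ 0.41797 := by
      rw [hx, div_le_iff₀ hcn, h1, show h b = n - 2 by omega, centralProb_two]
      linarith
    have he : excess (h a) = 0.45 := by rw [h1]; simp [excess]
    have hb := neg_log_le (y := 0.41797) (by norm_num) 1
    norm_num at hb
    have := mul_sub_log_le_of_le (a := phi n + (excess (h a) + excess (h b)) - 1.32 - τ)
      (K := 1.4662) (b := 0.8728) hx0 hxY (by linarith) (by norm_num) (by norm_num; linarith)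
    norm_num at this ⊢
    linarith
  · have hxY : x ≤ 0.37152 := by
      rw [hx, div_le_iff₀ hcn]
      refine (centralProb_mul_le h1 (h1.trans hle)).trans ?_
      rw [hsum, centralProb_three]
      linarith
    have he : excess (h a) ≤ 0.6 := excess_le h1
    have hb := neg_log_le (y := 0.37152) (by norm_num) 1
    norm_num at hb
    have := mul_sub_log_le_of_le (a := phi n + (excess (h a) + excess (h b)) - 1.32 - τ)
      (K := 1.6162) (b := 0.9935) hx0 hxY (by linarith) (by norm_num) (by norm_num; linarith)
    norm_num at this ⊢
    linarith

end

/-! ### The mean regret for three or more classes -/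

section

lemma evenPeak_one_le : evenPeak 1 ≤ 0.7311 * decay 1 := by
  refine le_mul_decay (by norm_num) ?_
  norm_num [evenPeak, centralProb_one, expOdd, expOddRat]

lemma evenPeak_two_le : evenPeak 2 ≤ 0.62436 * decay 2 := by
  refine le_mul_decay (by norm_num) ?_
  norm_num [evenPeak, centralProb_two, expOdd, expOddRat]

lemma evenPeak_three_le : evenPeak 3 ≤ 0.5634 * decay 3 := by
  refine le_mul_decay (by norm_num) ?_
  norm_num [evenPeak, centralProb_three, expOdd, expOddRat]

lemma evenPeak_thirteen_le : evenPeak 13 ≤ 0.3819 * decay 13 := by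
  refine le_mul_decay (by norm_num) ?_
  norm_num [evenPeak, centralProb, expOdd, expOddRat, Nat.centralBinom, Nat.choose]

lemma evenPeak_twentyFive_le : evenPeak 25 ≤ 0.3237 * decay 25 := by
  refine le_mul_decay (by norm_num) ?_
  norm_num [evenPeak, centralProb, expOdd, expOddRat, Nat.centralBinom, Nat.choose]

lemma exp_fifteen_eighths_ge : 6.5 ≤ exp (15 / 8) := by
  refine le_of_pow_le_pow_left₀ (n := 8) (by norm_num) (exp_pos _).le ?_
  have : exp (15 / 8) ^ 8 = exp 1 ^ 15 := by rw [← exp_nat_mul, ← exp_nat_mul]; norm_num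
  rw [this]
  exact le_trans (by norm_num) (pow_le_pow_left₀ (by norm_num) exp_one_gt_d9.le 15)

variable {n C : ℕ} {w : Fin n ⊕ Fin n → Fin C} {h : Fin C → ℕ}

/-- For three classes the score is bounded by concavity when `n` is small. When `n` is large, the largest
class is large as well, and the exponential moment of the score is small. -/
lemma meanRegretLe_three (hn : 10 ≤ n) (hw : ∀ c, blockCard w c = 2 * h c)
    (hs : (support h).card = 3) : MeanRegretLe w := by
  have hn' : (10 : ℝ) ≤ n := by exact_mod_cast hn
  have hcn := centralProb_pos n
  have hx0 := halving_pos (n := n) (h := h)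
  have hphi := phi_le hn
  have h10 := log_ten_ge
  have hτ := log_div_ten_nonneg hn
  have hxY : (∏ c, centralProb (h c)) / centralProb n ≤ 0.2787 := by
    rw [div_le_iff₀ hcn]
    refine (prod_centralProb_le_of_card hw (k := 2) (by omega)).trans ?_
    linarith [(centralProb_sub_le hn).2.1]
  have hb : -log 0.2787 ≤ 1.2785 := by
    have hb := neg_log_le (y := 0.2787) (by norm_num) 2
    norm_num at hb ⊢
    linarith
  set τ := log ((n : ℝ) / 10) with hτdef
  set x := (∏ c, centralProb (h c)) / centralProb n with hxdef
  have hdet : ∀ (m : ℕ) (y : ℝ), 0 ≤ y →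
      (3 : ℝ) * oddSum m + ((n : ℝ) - 2 - 3 * m) / (2 * m + 1) ≤ 4 + y →
      y ^ 2 / 19.04 ≤ 0.142 + 0.86 * τ → MeanRegretLe w := by
    intro m y hy hS hM
    refine meanRegretLe_of_le (sum_regret_le_max hn hw hy fun e he hD => ?_) ?_
    · have := splitOddSum_le_tangent (h := h) hw hD m
      rw [hs] at this
      push_cast at this
      linarith
    · have := mul_sub_log_le_of_le (a := phi n) (K := 1.7362 + τ / 2) (b := 1.2785) hx0 hxY hphi
        (by linarith) hb
      rw [log_eq_log_ten_add hn]
      linarith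
  rcases le_or_gt n 17 with h1 | h1
  · have h1' : (n : ℝ) ≤ 17 := by exact_mod_cast h1
    refine hdet 5 1.37 (by norm_num) ?_ (by norm_num; linarith)
    norm_num [oddSum, Finset.sum_range_succ]; linarith
  rcases le_or_gt n 50 with h2 | h2
  · have h1' : (18 : ℝ) ≤ n := by exact_mod_cast h1
    have h2' : (n : ℝ) ≤ 50 := by exact_mod_cast h2
    have := log_div_ten_ge (n := n) (a := 0.8) (by norm_num) (by linarith)
    refine hdet 16 3.2 (by norm_num) ?_ (by norm_num at this ⊢; linarith)
    norm_num [oddSum, Finset.sum_range_succ]; linarith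
  rcases lt_or_ge n 100 with h3 | h3
  · have h2' : (51 : ℝ) ≤ n := by exact_mod_cast h2
    have h3' : (n : ℝ) ≤ 100 := by exact_mod_cast h3.le
    have := log_div_ten_ge (n := n) (a := 4.1) (by norm_num) (by linarith)
    refine hdet 32 4.2 (by norm_num) ?_ (by norm_num at this ⊢; linarith)
    norm_num [oddSum, Finset.sum_range_succ]; linarith
  · obtain ⟨c₁, -, hc₁⟩ := exists_largest hn hw
    rw [hs] at hc₁
    have hA := evenPeak_le (r := 25) (t := h c₁) (by norm_num) (by norm_num) (by omega)
      evenPeak_twentyFive_le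
    refine meanRegretLe_of_le (sum_regret_le_exp hn hw (by norm_num) hA) ?_
    have hτ2 : 2.30258 ≤ τ := h10.trans (log_le_log (by norm_num) (by
      have : (100 : ℝ) ≤ n := by exact_mod_cast h3
      linarith))
    have := mul_sub_log_le_of_le (a := phi n - τ) (K := 0.59) (b := 1.2785) hx0 hxY (by linarith)
      (by norm_num) hb
    have hexp : 0 ≤ x * (3.85 / 19.04 * exp (3 / 8 * (∑ c, oddSum (h c) - τ))) := by positivity
    rw [log_eq_log_ten_add hn]
    norm_num at this hexp ⊢
    linarith

/-- For four classes the argument of `meanRegretLe_three` applies, with other numbers. -/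
lemma meanRegretLe_four (hn : 10 ≤ n) (hw : ∀ c, blockCard w c = 2 * h c)
    (hs : (support h).card = 4) : MeanRegretLe w := by
  have hn' : (10 : ℝ) ≤ n := by exact_mod_cast hn
  have hcn := centralProb_pos n
  have hx0 := halving_pos (n := n) (h := h)
  have hphi := phi_le hn
  have h10 := log_ten_ge
  have hτ := log_div_ten_nonneg hn
  have hxY : (∏ c, centralProb (h c)) / centralProb n ≤ 0.1487 := by
    rw [div_le_iff₀ hcn]
    refine (prod_centralProb_le_of_card hw (k := 3) (by omega)).trans ?_
    linarith [(centralProb_sub_le hn).2.2.1]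
  have hb : -log 0.1487 ≤ 1.907 := by
    have hb := neg_log_le (y := 0.1487) (by norm_num) 3
    norm_num at hb ⊢
    linarith
  set τ := log ((n : ℝ) / 10) with hτdef
  set x := (∏ c, centralProb (h c)) / centralProb n with hxdef
  have hdet : ∀ (m : ℕ) (y : ℝ), 0 ≤ y →
      (4 : ℝ) * oddSum m + ((n : ℝ) - 2 - 4 * m) / (2 * m + 1) ≤ 4 + y →
      y ^ 2 / 19.04 ≤ 0.4408 + 0.9256 * τ → MeanRegretLe w := by
    intro m y hy hS hM
    refine meanRegretLe_of_le (sum_regret_le_max hn hw hy fun e he hD => ?_) ?_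
    · have := splitOddSum_le_tangent (h := h) hw hD m
      rw [hs] at this
      push_cast at this
      linarith
    · have := mul_sub_log_le_of_le (a := phi n) (K := 1.7362 + τ / 2) (b := 1.907) hx0 hxY hphi
        (by linarith) hb
      rw [log_eq_log_ten_add hn]
      linarith
  rcases le_or_gt n 17 with h1 | h1
  · have h1' : (n : ℝ) ≤ 17 := by exact_mod_cast h1
    refine hdet 4 2.6 (by norm_num) ?_ (by norm_num; linarith)
    norm_num [oddSum, Finset.sum_range_succ]; linarith
  rcases le_or_gt n 37 with h2 | h2
  · have h1' : (18 : ℝ) ≤ n := by exact_mod_cast h1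
    have h2' : (n : ℝ) ≤ 37 := by exact_mod_cast h2
    have := log_div_ten_ge (n := n) (a := 0.8) (by norm_num) (by linarith)
    refine hdet 9 4.28 (by norm_num) ?_ (by norm_num at this ⊢; linarith)
    norm_num [oddSum, Finset.sum_range_succ]; linarith
  rcases lt_or_ge n 50 with h3 | h3
  · have h2' : (38 : ℝ) ≤ n := by exact_mod_cast h2
    have h3' : (n : ℝ) ≤ 50 := by exact_mod_cast h3.le
    have := log_div_ten_ge (n := n) (a := 2.8) (by norm_num) (by linarith)
    refine hdet 12 5 (by norm_num) ?_ (by norm_num at this ⊢; linarith)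
    norm_num [oddSum, Finset.sum_range_succ]; linarith
  · obtain ⟨c₁, -, hc₁⟩ := exists_largest hn hw
    rw [hs] at hc₁
    have hA := evenPeak_le (r := 13) (t := h c₁) (by norm_num) (by norm_num) (by omega)
      evenPeak_thirteen_le
    refine meanRegretLe_of_le (sum_regret_le_exp hn hw (by norm_num) hA) ?_
    have hτ2 := log_div_ten_ge (n := n) (a := 4) (by norm_num) (by
      have : (50 : ℝ) ≤ n := by exact_mod_cast h3
      linarith)
    norm_num at hτ2
    have := mul_sub_log_le_of_le (a := phi n - τ) (K := 1.07) (b := 1.907) hx0 hxY (by linarith)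
      (by norm_num) hb
    have hexp : 0 ≤ x * (3.85 / 19.04 * exp (3 / 8 * (∑ c, oddSum (h c) - τ))) := by positivity
    rw [log_eq_log_ten_add hn]
    norm_num at this hexp ⊢
    linarith

/-- For five or more classes the exponential moment of the score suffices. The constants depend on the
size of the largest class: small classes weaken the bound of the moment but make halving splits
rarer. -/
lemma meanRegretLe_five (hn : 10 ≤ n) (hw : ∀ c, blockCard w c = 2 * h c)
    (hs : 5 ≤ (support h).card) : MeanRegretLe w := by
  have hcn := centralProb_pos n
  have hx0 := halving_pos (n := n) (h := h)
  have hphi := phi_le hn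
  have h10 := log_ten_ge
  have hτ := log_div_ten_nonneg hn
  obtain ⟨c₁, hmax, -⟩ := exists_largest hn hw
  set τ := log ((n : ℝ) / 10) with hτdef
  set x := (∏ c, centralProb (h c)) / centralProb n with hxdef
  -- the balanced splits are counted in the exponential moment, and are taken out of it again
  have hexp : 1.3143 * (1 - 3 / 8 * τ) ≤
      3.85 / 19.04 * exp (3 / 8 * (∑ c, oddSum (h c) - τ)) := by
    have h5 : (5 : ℝ) ≤ ∑ c, oddSum (h c) := by
      rw [sum_support oddSum (by simp [oddSum])]
      have h1 : ((support h).card : ℝ) ≤ ∑ c ∈ support h, oddSum (h c) := by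
        rw [Finset.card_eq_sum_ones]; push_cast
        exact Finset.sum_le_sum fun c hc => one_le_oddSum (one_le_of_mem_support hc)
      exact le_trans (by exact_mod_cast hs) h1
    have h1 : exp (15 / 8) * exp (-(3 / 8 * τ)) ≤ exp (3 / 8 * (∑ c, oddSum (h c) - τ)) := by
      rw [← exp_add]; exact exp_le_exp.2 (by linarith)
    have h2 : 1 - 3 / 8 * τ ≤ exp (-(3 / 8 * τ)) := by
      linarith [add_one_le_exp (-(3 / 8 * τ))]
    have h3 := mul_le_mul_of_nonneg_right exp_fifteen_eighths_ge (exp_pos (-(3 / 8 * τ))).le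
    norm_num at h3 ⊢
    linarith [exp_pos (-(3 / 8 * τ))]
  have key : ∀ A Y b : ℝ, 0 ≤ A → evenPeak (h c₁) ≤ A * decay (h c₁) → x ≤ Y → Y ≤ 0.4219 →
      -log Y ≤ b → 1.28693 * A + Y * (0.4219 + b) ≤ 0.98258 → MeanRegretLe w := by
    intro A Y b hA0 hA hxY hY hb hfin
    refine meanRegretLe_of_le (sum_regret_le_exp hn hw hA0 hA) ?_
    have := mul_sub_log_le_of_le
      (a := phi n - τ - 3.85 / 19.04 * exp (3 / 8 * (∑ c, oddSum (h c) - τ)))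
      (K := 0.4219) (b := b) hx0 hxY (by linarith) hY hb
    rw [log_eq_log_ten_add hn]
    linarith
  rcases (by omega : h c₁ ≤ 1 ∨ h c₁ = 2 ∨ 3 ≤ h c₁) with h1 | h1 | h1
  · have h1' : h c₁ = 1 := by
      obtain ⟨c, hc⟩ := Finset.card_pos.1 (show 0 < (support h).card by omega)
      have := one_le_of_mem_support hc
      have := hmax c
      omega
    have hb := neg_log_le (y := 0.0056) (by norm_num) 7
    norm_num at hb
    refine key 0.7311 0.0056 5.2 (by norm_num) (by rw [h1']; exact evenPeak_one_le) ?_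
      (by norm_num) (by norm_num; linarith) (by norm_num)
    rw [hxdef, div_le_iff₀ hcn]
    refine (prod_centralProb_le_pow hn hw (z := 1 / 2) (by norm_num) (by norm_num)
      fun c => ?_).trans ?_
    · have := (hmax c).trans h1
      rcases (by omega : h c = 0 ∨ h c = 1) with h2 | h2 <;> rw [h2]
      · simp [centralProb_zero]
      · simp [centralProb_one]
    · rw [centralProb_ten]
      exact mul_le_mul_of_nonneg_right (by norm_num) hcn.le
  · have hb := neg_log_le (y := 0.0422) (by norm_num) 5
    norm_num at hb
    refine key 0.62436 0.0422 3.18 (by norm_num) (by rw [h1]; exact evenPeak_two_le) ?_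
      (by norm_num) (by norm_num; linarith) (by norm_num)
    rw [hxdef, div_le_iff₀ hcn]
    refine (prod_centralProb_le_pow hn hw (z := 0.6124) (by norm_num) (by norm_num)
      fun c => ?_).trans ?_
    · have := (hmax c).trans h1.le
      rcases (by omega : h c = 0 ∨ h c = 1 ∨ h c = 2) with h2 | h2 | h2 <;> rw [h2]
      · simp [centralProb_zero]
      · norm_num [centralProb_one]
      · norm_num [centralProb_two]
    · rw [centralProb_ten]
      exact mul_le_mul_of_nonneg_right (by norm_num) hcn.le
  · have hb := neg_log_le (y := 0.0801) (by norm_num) 4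
    norm_num at hb
    refine key 0.5634 0.0801 2.53 (by norm_num)
      (evenPeak_le (by norm_num) (by norm_num) h1 evenPeak_three_le) ?_
      (by norm_num) (by norm_num; linarith) (by norm_num)
    rw [hxdef, div_le_iff₀ hcn]
    refine (prod_centralProb_le_of_card hw (k := 4) (by omega)).trans ?_
    linarith [(centralProb_sub_le hn).2.2.2]

/-- Averaged over the splits of the pool into two halves, the regret is at most `log n`. -/
theorem mean_regret_le (hn : 10 ≤ n) (w : Fin n ⊕ Fin n → Fin C) :
    ∑ e : Fin n ⊕ Fin n → Bool with ones e = n, regret (w ∘ splitPerm e) ≤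
      (2 * n).choose n * log n := by
  by_cases hodd : ∃ c, Odd (blockCard w c)
  · obtain ⟨c, hc⟩ := hodd
    exact sum_regret_le_of_odd hn w hc
  · have hev : ∀ c, ∃ k, blockCard w c = 2 * k := fun c => by
      obtain ⟨k, hk⟩ := Nat.not_odd_iff_even.1 (not_exists.1 hodd c)
      exact ⟨k, by omega⟩
    choose h hw using hev
    have h0 : (support h).card ≠ 0 := by
      intro h0
      have hs := sum_half hw
      rw [sum_support (fun x => x) rfl, Finset.card_eq_zero.1 h0] at hs
      simp at hs; omega
    rcases (by omega : (support h).card = 1 ∨ (support h).card = 2 ∨ (support h).card = 3 ∨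
      (support h).card = 4 ∨ 5 ≤ (support h).card) with h1 | h1 | h1 | h1 | h1
    · exact meanRegretLe_one hn hw h1
    · exact meanRegretLe_two hn hw h1
    · exact meanRegretLe_three hn hw h1
    · exact meanRegretLe_four hn hw h1
    · exact meanRegretLe_five hn hw h1

end

/-! ### Reduction to error bits -/

/-- The relative entropy on a finite type. -/
lemma toReal_klDiv_fintype {α : Type*} [Fintype α] [MeasurableSpace α] [MeasurableSingletonClass α]
    {μ ν : Measure α} [IsProbabilityMeasure μ] [IsProbabilityMeasure ν] (hμν : μ ≪ ν) :
    (klDiv μ ν).toReal = ∑ a, μ.real {a} * log (μ.real {a} / ν.real {a}) := by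
  rw [toReal_klDiv_of_measure_eq hμν (by simp), integral_fintype Integrable.of_finite]
  refine Finset.sum_congr rfl fun a _ => ?_
  rw [smul_eq_mul]
  rcases eq_or_ne (ν {a}) 0 with h0 | h0
  · have : μ.real {a} = 0 := by rw [Measure.real, hμν h0, ENNReal.toReal_zero]
    rw [this, zero_mul, zero_mul]
  · congr 2
    have h1 : μ {a} = μ.rnDeriv ν a * ν {a} := by
      conv_lhs => rw [← Measure.withDensity_rnDeriv_eq μ ν hμν]
      rw [withDensity_apply _ (measurableSet_singleton a), lintegral_singleton]
    rw [llr, Measure.real, Measure.real, h1, ENNReal.toReal_mul]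
    rw [mul_div_cancel_right₀]
    exact (ENNReal.toReal_pos h0 (measure_ne_top ν _)).ne'

/-- The errors of the predictions `yhat` for the labels `w`. -/
def errBits {ι : Type*} {C : ℕ} (w yhat : ι → Fin C) : ι → Bool := fun i => decide (yhat i ≠ w i)

section Decoder

variable {ι β : Type*} [Fintype ι] [MeasurableSpace β] {C : ℕ}

/-- The error probability of the decoder for the label `c`, given the latent variable. -/
def errProb (D : Kernel β (Fin C)) (c : Fin C) (u : β) : ℝ := (D u).real {c' | c' ≠ c}

lemma measurable_errProb (D : Kernel β (Fin C)) (c : Fin C) : Measurable (errProb D c) :=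
  (D.measurable_coe (Set.toFinite _).measurableSet).ennreal_toReal

lemma errProb_mem (D : Kernel β (Fin C)) [IsMarkovKernel D] (c : Fin C) (u : β) :
    errProb D c u ∈ Set.Icc (0 : ℝ) 1 := ⟨measureReal_nonneg, measureReal_le_one⟩

lemma measurable_bw {f : β → ℝ} (hf : Measurable f) (b : Bool) : Measurable fun u => bw (f u) b := by
  cases b
  · exact measurable_const.sub hf
  · exact hf

/-- The error bits of independent predictions are independent Bernoulli variables. -/
lemma pi_errBits (D : Kernel β (Fin C)) [IsMarkovKernel D] (w : ι → Fin C) (u : ι → β)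
    (e : ι → Bool) : (Measure.pi fun i => D (u i)).real (errBits w ⁻¹' {e}) =
      bprod (fun i => errProb D (w i) (u i)) e := by
  have h1 : errBits w ⁻¹' {e} = Set.univ.pi fun i => {c | decide (c ≠ w i) = e i} := by
    ext y
    simp only [Set.mem_preimage, Set.mem_singleton_iff, Set.mem_univ_pi, errBits, funext_iff,
      Set.mem_ofPred_eq]
  rw [h1, Measure.real, Measure.pi_pi, ENNReal.toReal_prod, bprod]
  refine Finset.prod_congr rfl fun i _ => ?_
  cases e i
  · have : {c | decide (c ≠ w i) = false} = {c | c ≠ w i}ᶜ := by ext c; simp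
    rw [this]
    exact probReal_compl_eq_one_sub (Set.toFinite _).measurableSet
  · have : {c | decide (c ≠ w i) = true} = {c | c ≠ w i} := by ext c; simp
    rw [this]
    rfl

variable [DecidableEq ι]

lemma integrable_bprod_errProb (D : Kernel β (Fin C)) [IsMarkovKernel D] (w : ι → Fin C)
    (P : Measure (ι → β)) [IsProbabilityMeasure P] (e : ι → Bool) :
    Integrable (fun u => bprod (fun i => errProb D (w i) (u i)) e) P := by
  have hb : ∀ u : ι → β, ∀ e, 0 ≤ bprod (fun i => errProb D (w i) (u i)) e := fun u =>
    bprod_nonneg fun i => errProb_mem D (w i) (u i)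
  refine Integrable.of_bound (C := 1) ?_ (Filter.Eventually.of_forall fun u => ?_)
  · refine Measurable.aestronglyMeasurable ?_
    exact Finset.measurable_fun_prod _ fun i _ =>
      measurable_bw ((measurable_errProb D (w i)).comp (measurable_pi_apply i)) _
  · rw [norm_of_nonneg (hb u e), ← sum_bprod fun i => errProb D (w i) (u i)]
    exact Finset.single_le_sum (fun e _ => hb u e) (Finset.mem_univ e)

lemma integral_bprod_errProb (D : Kernel β (Fin C)) [IsMarkovKernel D] (w : ι → Fin C)
    (ρ : ι → Measure β) [∀ i, IsProbabilityMeasure (ρ i)] (e : ι → Bool) :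
    ∫ u, bprod (fun i => errProb D (w i) (u i)) e ∂(Measure.pi ρ) =
      bprod (fun i => ∫ u, errProb D (w i) u ∂(ρ i)) e := by
  have h := integral_fintype_prod_eq_prod (μ := ρ) (fun i u => bw (errProb D (w i) u) (e i))
  refine h.trans (Finset.prod_congr rfl fun i _ => ?_)
  cases e i
  · have hi : Integrable (errProb D (w i)) (ρ i) :=
      Integrable.of_bound (C := 1) (measurable_errProb D (w i)).aestronglyMeasurable
        (Filter.Eventually.of_forall fun u => by
          rw [norm_of_nonneg (errProb_mem D (w i) u).1]; exact (errProb_mem D (w i) u).2)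
    change ∫ u, (1 - errProb D (w i) u) ∂(ρ i) = 1 - ∫ u, errProb D (w i) u ∂(ρ i)
    rw [integral_sub (integrable_const _) hi]
    simp
  · rfl

/-- The law of the error bits, for latent variables of law `P`. -/
def errLaw (κ : Kernel (ι → β) (ι → Fin C)) (w : ι → Fin C) (P : Measure (ι → β)) :
    Measure (ι → Bool) := (κ ∘ₘ P).map (errBits w)

lemma measurable_errBits (w : ι → Fin C) : Measurable (errBits w) := measurable_of_finite _

instance (κ : Kernel (ι → β) (ι → Fin C)) [IsMarkovKernel κ] (w : ι → Fin C)
    (P : Measure (ι → β)) [IsProbabilityMeasure P] : IsProbabilityMeasure (errLaw κ w P) :=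
  Measure.isProbabilityMeasure_map (measurable_errBits w).aemeasurable

variable {D : Kernel β (Fin C)} [IsMarkovKernel D] {κ : Kernel (ι → β) (ι → Fin C)}
  [IsMarkovKernel κ]

/-- The error bits are a mixture of independent bits, over the law of the latent variables. -/
lemma errLaw_real (hκ : ∀ u, κ u = Measure.pi fun i => D (u i)) (w : ι → Fin C)
    (P : Measure (ι → β)) [IsProbabilityMeasure P] (e : ι → Bool) :
    (errLaw κ w P).real {e} = ∫ u, bprod (fun i => errProb D (w i) (u i)) e ∂P := by
  have hm := measurable_errBits w (measurableSet_singleton e)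
  rw [Measure.real, errLaw, Measure.map_apply (measurable_errBits w) (measurableSet_singleton e),
    Measure.bind_apply hm κ.aemeasurable, ← integral_toReal (κ.measurable_coe hm).aemeasurable
      (Filter.Eventually.of_forall fun u => measure_lt_top _ _)]
  refine integral_congr_ae (Filter.Eventually.of_forall fun u => ?_)
  change (κ u).real (errBits w ⁻¹' {e}) = _
  rw [hκ]
  exact pi_errBits D w u e

/-- A symmetric prior gives exchangeable error bits: permuting the latent variables by a permutation
which preserves the labels permutes the error probabilities. -/
lemma labelExchangeable_errLaw (hκ : ∀ u, κ u = Measure.pi fun i => D (u i)) {w : ι → Fin C}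
    {Q : Measure (ι → β)} [IsProbabilityMeasure Q]
    (hQ : ∀ τ : Equiv.Perm ι, (∀ i, w i = w (τ i)) → Q.map (fun u i => u (τ i)) = Q) :
    LabelExchangeable w fun e => (errLaw κ w Q).real {e} := by
  intro τ hτ e
  have hinv : ∀ i, w i = w (τ.symm i) := fun i => by
    have := hτ (τ.symm i)
    rwa [Equiv.apply_symm_apply] at this
  simp only [errLaw_real hκ]
  conv_rhs => rw [← hQ τ.symm hinv]
  rw [integral_map (measurable_pi_lambda _ fun i => measurable_pi_apply _).aemeasurable ?_]
  · refine integral_congr_ae (Filter.Eventually.of_forall fun u => ?_)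
    refine Eq.trans ?_ (Equiv.prod_comp τ
      fun i => bw (errProb D (w i) (u (τ.symm i))) (e i))
    refine Finset.prod_congr rfl fun i _ => ?_
    simp only [Equiv.symm_apply_apply, hτ, Function.comp]
  · refine Measurable.aestronglyMeasurable ?_
    exact Finset.measurable_fun_prod _ fun i _ =>
      measurable_bw ((measurable_errProb D (w i)).comp (measurable_pi_apply i)) _

lemma integral_errBits (hκ : ∀ u, κ u = Measure.pi fun i => D (u i)) (w : ι → Fin C)
    (P : Measure (ι → β)) [IsProbabilityMeasure P] (f : (ι → Bool) → ℝ) :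
    ∫ u, ∫ y, f (errBits w y) ∂(κ u) ∂P = ∑ e, (errLaw κ w P).real {e} * f e := by
  have h1 : ∀ u, ∫ y, f (errBits w y) ∂(κ u) =
      ∑ e, bprod (fun i => errProb D (w i) (u i)) e * f e := by
    intro u
    have hp : IsProbabilityMeasure ((κ u).map (errBits w)) :=
      Measure.isProbabilityMeasure_map (measurable_errBits w).aemeasurable
    rw [← integral_map (measurable_errBits w).aemeasurable
      (measurable_of_finite f).aestronglyMeasurable, integral_fintype Integrable.of_finite]
    refine Finset.sum_congr rfl fun e _ => ?_
    rw [← pi_errBits, ← hκ, Measure.real, Measure.map_apply (measurable_errBits w)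
      (measurableSet_singleton e)]
    rfl
  simp_rw [h1]
  rw [integral_finsetSum _ fun e _ => (integrable_bprod_errProb D w P e).mul_const _]
  refine Finset.sum_congr rfl fun e _ => ?_
  rw [integral_mul_const, errLaw_real hκ]

end Decoder

/-- The regret bound for error bits transfers to latent variables, by the data processing
inequality for the decoder. -/
lemma HasRegret.integral_le {n C : ℕ} {β : Type*} [MeasurableSpace β] {w : Fin n ⊕ Fin n → Fin C}
    {M : ℝ} (hM : HasRegret w M) {D : Kernel β (Fin C)} [IsMarkovKernel D]
    {κ : Kernel (Fin n ⊕ Fin n → β) (Fin n ⊕ Fin n → Fin C)} [IsMarkovKernel κ]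
    (hκ : ∀ u, κ u = Measure.pi fun i => D (u i))
    (ρ : Fin n ⊕ Fin n → Measure β) [∀ i, IsProbabilityMeasure (ρ i)]
    {Q : Measure (Fin n ⊕ Fin n → β)} [IsProbabilityMeasure Q]
    (hQ : ∀ τ : Equiv.Perm (Fin n ⊕ Fin n), (∀ i, w i = w (τ i)) →
      Q.map (fun u i => u (τ i)) = Q)
    (hkl : klDiv (Measure.pi ρ) Q ≠ ∞) :
    n * log 2 * ∫ u, ∫ y, gap w (errBits w y) ∂(κ u) ∂(Measure.pi ρ) ≤
      (klDiv (Measure.pi ρ) Q).toReal + M := by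
  have hle : klDiv (errLaw κ w (Measure.pi ρ)) (errLaw κ w Q) ≤ klDiv (Measure.pi ρ) Q :=
    (klDiv_map_le _ _ (measurable_errBits w)).trans (klDiv_comp_right_le _ _ κ)
  have hac : errLaw κ w (Measure.pi ρ) ≪ errLaw κ w Q :=
    (klDiv_ne_top_iff.1 (ne_top_of_le_ne_top hkl hle)).1
  have hP : ∀ e, (errLaw κ w (Measure.pi ρ)).real {e} =
      bprod (fun i => ∫ u, errProb D (w i) u ∂(ρ i)) e := fun e => by
    rw [errLaw_real hκ, integral_bprod_errProb]
  have hp : ∀ i, ∫ u, errProb D (w i) u ∂(ρ i) ∈ Set.Icc (0 : ℝ) 1 := by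
    intro i
    refine ⟨integral_nonneg fun u => (errProb_mem D (w i) u).1, ?_⟩
    have h1 : ∫ u, errProb D (w i) u ∂(ρ i) ≤ ∫ _, (1 : ℝ) ∂(ρ i) :=
      integral_mono_of_nonneg (Filter.Eventually.of_forall fun u => (errProb_mem D (w i) u).1)
        (integrable_const _) (Filter.Eventually.of_forall fun u => (errProb_mem D (w i) u).2)
    simpa using h1
  have h := hM (fun i => ∫ u, errProb D (w i) u ∂(ρ i)) (fun e => (errLaw κ w Q).real {e}) hp
    (fun e => measureReal_nonneg) ?_ (labelExchangeable_errLaw hκ hQ) ?_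
  · have hkl2 := toReal_klDiv_fintype hac
    simp only [hP] at hkl2
    rw [← hkl2] at h
    have h3 : (klDiv (errLaw κ w (Measure.pi ρ)) (errLaw κ w Q)).toReal ≤
      (klDiv (Measure.pi ρ) Q).toReal := ENNReal.toReal_mono hkl hle
    rw [integral_errBits hκ]
    simp only [hP]
    refine le_trans (le_of_eq ?_) (h.trans (by linarith))
    rw [Finset.mul_sum]
    exact Finset.sum_congr rfl fun e _ => by ring
  · have := sum_measureReal_singleton (μ := errLaw κ w Q) Finset.univ
    rw [this]; simp
  · intro e he
    rw [← hP]
    have : errLaw κ w Q {e} = 0 := by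
      rwa [measureReal_eq_zero_iff] at he
    rw [Measure.real, hac this, ENNReal.toReal_zero]

/-! ### Averaging over the labels -/

/-- The bound of `hasRegret_tilt` is uniform in `q ≤ 1`, so that the regret is finite. -/
lemma exists_hasRegret {n C : ℕ} (hn : 10 ≤ n) (w : Fin n ⊕ Fin n → Fin C) :
    ∃ M, HasRegret w M := by
  have hle : ∑ c, matchCount w c ≤ n :=
    (Finset.sum_le_sum fun c _ => min_le_left _ _).trans (sum_trainCount w).le
  have hle' : ((∑ c, matchCount w c : ℕ) : ℝ) ≤ n := by exact_mod_cast hle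
  refine ⟨_, hasRegret_tilt hn w (u := n - (∑ c, matchCount w c : ℕ)) (by ring)
    (M := ∑ c, log (tiltBound (matchCount w c) 1))
    (Finset.sum_nonneg fun c _ => log_nonneg (one_le_tiltBound _ zero_le_one)) fun q h0 h1 => ?_⟩
  have h2 : ∑ c, log (tiltBound (matchCount w c) q) ≤
      ∑ c, log (tiltBound (matchCount w c) 1) := by
    refine Finset.sum_le_sum fun c _ => ?_
    refine log_le_log (zero_lt_one.trans_le (one_le_tiltBound _ h0)) ?_
    exact Finset.prod_le_prod (fun i _ => by positivity) fun i _ => by gcongr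
  have h3 : 0 ≤ (n : ℝ) - (∑ c, matchCount w c : ℕ) := by linarith
  have : 0 ≤ 2 * ((n : ℝ) - (∑ c, matchCount w c : ℕ)) * q +
    2.38 * ((n : ℝ) - (∑ c, matchCount w c : ℕ)) * q ^ 2 := by positivity
  linarith

/-- The infimum defining the regret is attained. -/
lemma hasRegret_regret {n C : ℕ} (hn : 10 ≤ n) (w : Fin n ⊕ Fin n → Fin C) :
    HasRegret w (regret w) := by
  intro p q hp hq hq1 hex hac
  rw [← sub_le_iff_le_add']
  refine le_csInf (exists_hasRegret hn w) fun M hM => ?_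
  have := hM p q hp hq hq1 hex hac
  linarith

/-- Independent, identically distributed labels are exchangeable. -/
lemma integral_comp_perm {ι : Type*} [Fintype ι] {C : ℕ} (ν : Measure (Fin C))
    [IsProbabilityMeasure ν] (σ : Equiv.Perm ι) (f : (ι → Fin C) → ℝ) :
    ∫ v, f (v ∘ σ) ∂(Measure.pi fun _ : ι => ν) = ∫ v, f v ∂(Measure.pi fun _ : ι => ν) := by
  classical
  have hm : Measurable fun v : ι → Fin C => v ∘ σ := measurable_of_finite _
  have hmap : (Measure.pi fun _ : ι => ν).map (fun v => v ∘ σ) = Measure.pi fun _ : ι => ν := by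
    refine (Measure.pi_eq fun s hs => ?_).symm
    rw [Measure.map_apply hm (MeasurableSet.univ_pi hs)]
    have : (fun v : ι → Fin C => v ∘ σ) ⁻¹' (Set.univ.pi s) =
        Set.univ.pi fun i => s (σ.symm i) := by
      ext v
      simp only [Set.mem_preimage, Set.mem_univ_pi, Function.comp]
      exact ⟨fun h i => by simpa using h (σ.symm i), fun h i => by simpa using h (σ i)⟩
    rw [this, Measure.pi_pi]
    exact Equiv.prod_comp σ.symm fun i => ν (s i)
  conv_rhs => rw [← hmap]
  rw [integral_map hm.aemeasurable (measurable_of_finite f).aestronglyMeasurable]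

/-- For independent, identically distributed labels, the mean regret is at most `log n`. -/
lemma integral_regret_le {n C : ℕ} (hn : 10 ≤ n) (ν : Measure (Fin C)) [IsProbabilityMeasure ν] :
    ∫ v, regret v ∂(Measure.pi fun _ : Fin n ⊕ Fin n => ν) ≤ log n := by
  set E := Finset.univ.filter fun e : Fin n ⊕ Fin n → Bool => ones e = n
  have hE : (E.card : ℝ) = (2 * n).choose n := by
    have h := card_level (ι := Fin n ⊕ Fin n) n
    rwa [Fintype.card_sum, Fintype.card_fin, ← two_mul] at h
  have hpos : (0 : ℝ) < (2 * n).choose n := by exact_mod_cast Nat.choose_pos (by omega)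
  have h1 : ∫ v, ∑ e ∈ E, regret (v ∘ splitPerm e) ∂(Measure.pi fun _ : Fin n ⊕ Fin n => ν) =
      (2 * n).choose n * ∫ v, regret v ∂(Measure.pi fun _ : Fin n ⊕ Fin n => ν) := by
    rw [integral_finsetSum _ fun e _ => Integrable.of_finite, ← hE, ← nsmul_eq_mul,
      ← Finset.sum_const]
    exact Finset.sum_congr rfl fun e _ => integral_comp_perm ν (splitPerm e) regret
  have h2 : ∫ v, ∑ e ∈ E, regret (v ∘ splitPerm e) ∂(Measure.pi fun _ : Fin n ⊕ Fin n => ν) ≤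
      ∫ _, (2 * n).choose n * log n ∂(Measure.pi fun _ : Fin n ⊕ Fin n => ν) :=
    integral_mono Integrable.of_finite (integrable_const _) fun v => mean_regret_le hn v
  rw [h1, integral_const, probReal_univ, one_smul] at h2
  exact le_of_mul_le_mul_left h2 hpos

section Labels

variable {K C n : ℕ} {𝒳 : Fin K → Type*} [∀ k, MeasurableSpace (𝒳 k)]
  {𝒲e : Fin K → Type*} [∀ k, MeasurableSpace (𝒲e k)] {𝒲d : Type*} [MeasurableSpace 𝒲d]

/-- The labels of the pooled data. -/
def poolLabels (ω : Dataset 𝒳 C n × Dataset 𝒳 C n × (∀ k, 𝒲e k) × 𝒲d) : Fin n ⊕ Fin n → Fin C :=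
  fun i => (pool ω.2.1 ω.1 i).2

lemma measurable_poolLabels :
    Measurable (poolLabels : Dataset 𝒳 C n × Dataset 𝒳 C n × (∀ k, 𝒲e k) × 𝒲d → _) := by
  have h := measurable_pool (n := n)
    (Ω := Dataset 𝒳 C n × Dataset 𝒳 C n × (∀ k, 𝒲e k) × 𝒲d)
    (f := fun ω => ω.2.1) (g := fun ω => ω.1) (by fun_prop) (by fun_prop)
  exact measurable_pi_lambda _ fun i => ((measurable_pi_apply i).comp h).snd

instance (μ : Measure ((∀ k, 𝒳 k) × Fin C)) [IsProbabilityMeasure μ]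
    (algo : Kernel (Dataset 𝒳 C n) ((∀ k, 𝒲e k) × 𝒲d)) [IsMarkovKernel algo] :
    IsProbabilityMeasure (dataModelLaw μ algo) := by
  unfold dataModelLaw; infer_instance

/-- The pooled labels are independent and identically distributed. -/
lemma map_poolLabels (μ : Measure ((∀ k, 𝒳 k) × Fin C)) [IsProbabilityMeasure μ]
    (algo : Kernel (Dataset 𝒳 C n) ((∀ k, 𝒲e k) × 𝒲d)) [IsMarkovKernel algo] :
    (dataModelLaw μ algo).map poolLabels = Measure.pi fun _ => μ.map Prod.snd := by
  have : IsProbabilityMeasure (μ.map Prod.snd) :=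
    Measure.isProbabilityMeasure_map measurable_snd.aemeasurable
  refine (Measure.pi_eq fun s hs => ?_).symm
  rw [Measure.map_apply measurable_poolLabels (MeasurableSet.univ_pi hs)]
  have hset : (poolLabels : Dataset 𝒳 C n × Dataset 𝒳 C n × (∀ k, 𝒲e k) × 𝒲d → _) ⁻¹'
      (Set.univ.pi s) = (Set.univ.pi fun j => Prod.snd ⁻¹' s (Sum.inr j)) ×ˢ
        (Prod.fst ⁻¹' (Set.univ.pi fun j => Prod.snd ⁻¹' s (Sum.inl j))) := by
    ext ω
    simp only [Set.mem_preimage, Set.mem_univ_pi, Set.mem_prod, Sum.forall, poolLabels, pool,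
      Sum.elim_inl, Sum.elim_inr]
    exact and_comm
  have hB : MeasurableSet (Set.univ.pi fun j : Fin n =>
      (Prod.snd ⁻¹' s (Sum.inl j) : Set ((∀ k, 𝒳 k) × Fin C))) :=
    MeasurableSet.univ_pi fun j => measurable_snd (hs _)
  rw [hset, dataModelLaw, Measure.prod_prod, ← Measure.fst_apply hB, Measure.fst_compProd,
    Measure.pi_pi, Measure.pi_pi, Fintype.prod_sum_type, mul_comm]
  simp_rw [Measure.map_apply measurable_snd (hs _)]

/-- The mean regret of the labels of the training and ghost sets is at most `log n`. -/
lemma integral_regret_poolLabels_le (hn : 10 ≤ n) (μ : Measure ((∀ k, 𝒳 k) × Fin C))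
    [IsProbabilityMeasure μ] (algo : Kernel (Dataset 𝒳 C n) ((∀ k, 𝒲e k) × 𝒲d))
    [IsMarkovKernel algo] :
    ∫ ω, regret (poolLabels ω) ∂(dataModelLaw μ algo) ≤ log n := by
  have : IsProbabilityMeasure (μ.map Prod.snd) :=
    Measure.isProbabilityMeasure_map measurable_snd.aemeasurable
  rw [← integral_map measurable_poolLabels.aemeasurable
    (measurable_of_finite regret).aestronglyMeasurable, map_poolLabels]
  exact integral_regret_le hn _

lemma testErr_errBits (ω : Dataset 𝒳 C n × Dataset 𝒳 C n × (∀ k, 𝒲e k) × 𝒲d)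
    (yhat : Fin n ⊕ Fin n → Fin C) :
    testErr (errBits (poolLabels ω) yhat) =
      empRisk (labels ω.1) fun i => yhat (Sum.inr i) := by
  rw [testErr, empRisk, one_div, inv_mul_eq_div]
  congr 1
  refine Finset.sum_congr rfl fun i _ => ?_
  simp only [errBits, poolLabels, pool, labels, Sum.elim_inr]
  split_ifs with h <;> simp [h]

lemma trainErr_errBits (ω : Dataset 𝒳 C n × Dataset 𝒳 C n × (∀ k, 𝒲e k) × 𝒲d)
    (yhat : Fin n ⊕ Fin n → Fin C) :
    trainErr (errBits (poolLabels ω) yhat) =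
      empRisk (labels ω.2.1) fun i => yhat (Sum.inl i) := by
  rw [trainErr, empRisk, one_div, inv_mul_eq_div]
  congr 1
  refine Finset.sum_congr rfl fun i _ => ?_
  simp only [errBits, poolLabels, pool, labels, Sum.elim_inl]
  split_ifs with h <;> simp [h]

end Labels

lemma integrable_integral_of_compProd {α β : Type*} [MeasurableSpace α] [MeasurableSpace β]
    {P : Measure α} [SFinite P] {κ : Kernel α β} [IsSFiniteKernel κ] {f : α × β → ℝ}
    (hf : Integrable f (P ⊗ₘ κ)) : Integrable (fun a => ∫ b, f (a, b) ∂(κ a)) P := by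
  rw [Measure.compProd] at hf
  exact hf.integral_compProd

section Joint

variable {K C n d : ℕ} {𝒳 : Fin K → Type*} [∀ k, MeasurableSpace (𝒳 k)]
  {𝒲e : Fin K → Type*} [∀ k, MeasurableSpace (𝒲e k)] {𝒲d : Type*} [MeasurableSpace 𝒲d]
  (μ : Measure ((∀ k, 𝒳 k) × Fin C)) [IsProbabilityMeasure μ]
  (algo : Kernel (Dataset 𝒳 C n) ((∀ k, 𝒲e k) × 𝒲d)) [IsMarkovKernel algo]
  (enc : ∀ k, Kernel (𝒳 k × 𝒲e k) (EuclideanSpace ℝ (Fin d))) [∀ k, IsMarkovKernel (enc k)]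
  (dec : Kernel (Latent K d × 𝒲d) (Fin C)) [IsMarkovKernel dec]

instance : IsMarkovKernel (latentKernel (C := C) (n := n) (𝒲d := 𝒲d) enc) := by
  unfold latentKernel; infer_instance

instance : IsProbabilityMeasure (jointLaw μ algo enc dec) := by
  unfold jointLaw; infer_instance

/-- Every function of the labels and the predictions is integrable. -/
lemma integrable_jointLaw (f : (Fin n ⊕ Fin n → Fin C) → (Fin n ⊕ Fin n → Fin C) → ℝ) :
    Integrable (fun ω => f (poolLabels ω.1.1) ω.2) (jointLaw μ algo enc dec) := by
  have hm : Measurable fun ω : ((Dataset 𝒳 C n × Dataset 𝒳 C n × (∀ k, 𝒲e k) × 𝒲d) ×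
      (Fin n ⊕ Fin n → Latent K d)) × (Fin n ⊕ Fin n → Fin C) => (poolLabels ω.1.1, ω.2) :=
    (measurable_poolLabels.comp (measurable_fst.comp measurable_fst)).prodMk measurable_snd
  have := Measure.isProbabilityMeasure_map (μ := jointLaw μ algo enc dec) hm.aemeasurable
  have h : Integrable (fun z => f z.1 z.2)
    ((jointLaw μ algo enc dec).map fun ω => (poolLabels ω.1.1, ω.2)) := Integrable.of_finite
  exact h.comp_measurable hm

/-- The decoder with the model of `ω`. -/
def decoderAt (ω : Dataset 𝒳 C n × Dataset 𝒳 C n × (∀ k, 𝒲e k) × 𝒲d) :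
    Kernel (Fin n ⊕ Fin n → Latent K d) (Fin n ⊕ Fin n → Fin C) :=
  (samplewise (Fin n ⊕ Fin n) dec).comap (fun u => (u, ω.2.2.2)) (by fun_prop)

instance (ω : Dataset 𝒳 C n × Dataset 𝒳 C n × (∀ k, 𝒲e k) × 𝒲d) :
    IsMarkovKernel (decoderAt dec ω) := by
  unfold decoderAt; infer_instance

/-- Integration over the data and the model, then over the latent variables, then over the predictions;
the integrability is part of the claim. -/
lemma integral_jointLaw (f : (Fin n ⊕ Fin n → Fin C) → (Fin n ⊕ Fin n → Fin C) → ℝ) :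
    Integrable (fun ω => ∫ u, ∫ y, f (poolLabels ω) y ∂(decoderAt dec ω u) ∂(latentKernel enc ω))
        (dataModelLaw μ algo) ∧
      ∫ ω, f (poolLabels ω.1.1) ω.2 ∂(jointLaw μ algo enc dec) =
        ∫ ω, ∫ u, ∫ y, f (poolLabels ω) y ∂(decoderAt dec ω u) ∂(latentKernel enc ω)
          ∂(dataModelLaw μ algo) := by
  have h := integrable_jointLaw μ algo enc dec f
  unfold jointLaw at h ⊢
  have h1 := integrable_integral_of_compProd h
  refine ⟨integrable_integral_of_compProd h1, ?_⟩
  rw [Measure.integral_compProd h, Measure.integral_compProd h1]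
  rfl

end Joint

lemma ofReal_integral_le {Ω : Type*} [MeasurableSpace Ω] {P : Measure Ω} {f : Ω → ℝ}
    (hf : Integrable f P) : ENNReal.ofReal (∫ ω, f ω ∂P) ≤ ∫⁻ ω, ENNReal.ofReal (f ω) ∂P := by
  rw [integral_eq_lintegral_pos_part_sub_lintegral_neg_part hf]
  refine (ENNReal.ofReal_le_ofReal (sub_le_self _ ENNReal.toReal_nonneg)).trans ?_
  exact ENNReal.ofReal_toReal_le

/-- The bound for the expectation of `h_D - h_C`. -/
theorem ofReal_integral_gap_le {K C n d : ℕ} (hn : 10 ≤ n)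
    {𝒳 : Fin K → Type*} [∀ k, MeasurableSpace (𝒳 k)]
    {𝒲e : Fin K → Type*} [∀ k, MeasurableSpace (𝒲e k)] {𝒲d : Type*} [MeasurableSpace 𝒲d]
    (μ : Measure ((∀ k, 𝒳 k) × Fin C)) [IsProbabilityMeasure μ]
    (algo : Kernel (Dataset 𝒳 C n) ((∀ k, 𝒲e k) × 𝒲d)) [IsMarkovKernel algo]
    (enc : ∀ k, Kernel (𝒳 k × 𝒲e k) (EuclideanSpace ℝ (Fin d))) [∀ k, IsMarkovKernel (enc k)]
    (dec : Kernel (Latent K d × 𝒲d) (Fin C)) [IsMarkovKernel dec]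
    (Q : Kernel ((Fin n ⊕ Fin n → Fin C) × (Fin n ⊕ Fin n → ∀ k, 𝒳 k) × (∀ k, 𝒲e k))
      (Fin n ⊕ Fin n → Latent K d)) [IsMarkovKernel Q] (hQ : IsSymmetricPrior Q) :
    ENNReal.ofReal (n * ∫ ω, gap (poolLabels ω.1.1) (errBits (poolLabels ω.1.1) ω.2)
        ∂(jointLaw μ algo enc dec)) ≤
      MDL μ algo enc Q + ENNReal.ofReal (logb 2 n) := by
  have hlog2 : 0 < log 2 := log_pos one_lt_two
  obtain ⟨hint, heq⟩ := integral_jointLaw μ algo enc dec fun w y => gap w (errBits w y)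
  set G : (Dataset 𝒳 C n × Dataset 𝒳 C n × (∀ k, 𝒲e k) × 𝒲d) → ℝ := fun ω =>
    ∫ u, ∫ y, gap (poolLabels ω) (errBits (poolLabels ω) y) ∂(decoderAt dec ω u)
      ∂(latentKernel enc ω) with hG
  have hreg : Integrable (fun ω => regret (poolLabels ω)) (dataModelLaw μ algo) := by
    have := Measure.isProbabilityMeasure_map (μ := dataModelLaw μ algo)
      measurable_poolLabels.aemeasurable
    have h : Integrable regret ((dataModelLaw μ algo).map poolLabels) := Integrable.of_finite
    exact h.comp_measurable measurable_poolLabels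
  have hpt : ∀ ω, ENNReal.ofReal (n * G ω - regret (poolLabels ω) / log 2) ≤
      klDiv (latentKernel enc ω)
        (Q (fun i => (pool ω.2.1 ω.1 i).2, fun i => (pool ω.2.1 ω.1 i).1, ω.2.2.1)) /
        ENNReal.ofReal (log 2) := by
    intro ω
    -- an infinite relative entropy bounds everything
    by_cases htop : klDiv (latentKernel enc ω)
        (Q (fun i => (pool ω.2.1 ω.1 i).2, fun i => (pool ω.2.1 ω.1 i).1, ω.2.2.1)) = ∞
    · rw [htop, ENNReal.top_div_of_ne_top ENNReal.ofReal_ne_top]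
      exact le_top
    have h := (hasRegret_regret hn (poolLabels ω)).integral_le
      (D := dec.comap (fun u => (u, ω.2.2.2)) (by fun_prop)) (κ := decoderAt dec ω)
      (fun u => rfl) (fun i => encoder enc ((pool ω.2.1 ω.1 i).1, ω.2.2.1))
      (Q := Q (fun i => (pool ω.2.1 ω.1 i).2, fun i => (pool ω.2.1 ω.1 i).1, ω.2.2.1))
      (hQ _ _ _) htop
    rw [← ENNReal.ofReal_toReal htop, ← ENNReal.ofReal_div_of_pos hlog2]
    refine ENNReal.ofReal_le_ofReal ?_
    rw [le_div_iff₀ hlog2, sub_mul, div_mul_cancel₀ _ hlog2.ne', sub_le_iff_le_add]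
    refine le_trans (le_of_eq ?_) h
    rw [mul_right_comm]
    rfl
  have hf : Integrable (fun ω => n * G ω - regret (poolLabels ω) / log 2) (dataModelLaw μ algo) :=
    (hint.const_mul _).sub (hreg.div_const _)
  have h1 : ENNReal.ofReal (∫ ω, (n * G ω - regret (poolLabels ω) / log 2) ∂(dataModelLaw μ algo))
      ≤ MDL μ algo enc Q := (ofReal_integral_le hf).trans (lintegral_mono hpt)
  rw [integral_sub (hint.const_mul _) (hreg.div_const _), integral_const_mul, integral_div] at h1
  have h2 : (∫ ω, regret (poolLabels ω) ∂(dataModelLaw μ algo)) / log 2 ≤ logb 2 n :=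
    div_le_div_of_nonneg_right (integral_regret_poolLabels_le hn μ algo) hlog2.le
  rw [heq]
  calc ENNReal.ofReal (n * ∫ ω, G ω ∂(dataModelLaw μ algo))
      ≤ ENNReal.ofReal ((n * ∫ ω, G ω ∂(dataModelLaw μ algo) -
        (∫ ω, regret (poolLabels ω) ∂(dataModelLaw μ algo)) / log 2) + logb 2 n) :=
        ENNReal.ofReal_le_ofReal (by linarith)
    _ ≤ _ := ENNReal.ofReal_add_le
    _ ≤ _ := add_le_add_left h1 _

end MultiView
end

theorem theorem2 {K C n d : ℕ} (hn : 10 ≤ n)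
    {𝒳 : Fin K → Type*} [∀ k, MeasurableSpace (𝒳 k)]
    {𝒲e : Fin K → Type*} [∀ k, MeasurableSpace (𝒲e k)]
    {𝒲d : Type*} [MeasurableSpace 𝒲d]
    (μ : MeasureTheory.Measure ((∀ k, 𝒳 k) × Fin C)) [MeasureTheory.IsProbabilityMeasure μ]
    (algo : ProbabilityTheory.Kernel (MultiView.Dataset 𝒳 C n) ((∀ k, 𝒲e k) × 𝒲d))
    [ProbabilityTheory.IsMarkovKernel algo]
    (enc : ∀ k, ProbabilityTheory.Kernel (𝒳 k × 𝒲e k) (EuclideanSpace ℝ (Fin d)))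
    [∀ k, ProbabilityTheory.IsMarkovKernel (enc k)]
    (dec : ProbabilityTheory.Kernel (MultiView.Latent K d × 𝒲d) (Fin C))
    [ProbabilityTheory.IsMarkovKernel dec]
    (Q : ProbabilityTheory.Kernel
      ((Fin n ⊕ Fin n → Fin C) × (Fin n ⊕ Fin n → ∀ k, 𝒳 k) × (∀ k, 𝒲e k))
      (Fin n ⊕ Fin n → MultiView.Latent K d))
    [ProbabilityTheory.IsMarkovKernel Q] (hQ : MultiView.IsSymmetricPrior Q) :
    ENNReal.ofReal
        (∫ ω, MultiView.hD
            (MultiView.empRisk (MultiView.labels ω.1.1.1) (fun i => ω.2 (Sum.inr i)))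
            (MultiView.empRisk (MultiView.labels ω.1.1.2.1) (fun i => ω.2 (Sum.inl i)))
          ∂(MultiView.jointLaw μ algo enc dec)) ≤
      (MultiView.MDL μ algo enc Q + ENNReal.ofReal (Real.logb 2 n)) / (n : ENNReal) +
        ENNReal.ofReal
          (∫ ω, MultiView.hC
              (MultiView.empRisk (MultiView.labels ω.1.1.2.1) (fun i => ω.2 (Sum.inl i)))
              (MultiView.empRisk (MultiView.labels ω.1.1.1) (fun i => ω.2 (Sum.inr i)))
              (1 / 2 * MultiView.empDistL1 (MultiView.labels ω.1.1.2.1)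
                (MultiView.labels ω.1.1.1))
            ∂(MultiView.jointLaw μ algo enc dec)) := by
  have hn0 : (0 : ℝ) < n := by exact_mod_cast (by omega : 0 < n)
  have hgap := MultiView.ofReal_integral_gap_le hn μ algo enc dec Q hQ
  have hD := MultiView.integrable_jointLaw μ algo enc dec fun w y =>
    MultiView.hD (MultiView.testErr (MultiView.errBits w y))
      (MultiView.trainErr (MultiView.errBits w y))
  have hC := MultiView.integrable_jointLaw μ algo enc dec fun w y =>
    MultiView.hC (MultiView.trainErr (MultiView.errBits w y))
      (MultiView.testErr (MultiView.errBits w y)) (MultiView.labelShift w)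
  simp only [MultiView.gap] at hgap
  rw [MeasureTheory.integral_sub hD hC] at hgap
  simp only [MultiView.testErr_errBits, MultiView.trainErr_errBits] at hgap
  set A := ∫ ω, MultiView.hD
            (MultiView.empRisk (MultiView.labels ω.1.1.1) (fun i => ω.2 (Sum.inr i)))
            (MultiView.empRisk (MultiView.labels ω.1.1.2.1) (fun i => ω.2 (Sum.inl i)))
          ∂(MultiView.jointLaw μ algo enc dec)
  set B := ∫ ω, MultiView.hC
              (MultiView.empRisk (MultiView.labels ω.1.1.2.1) (fun i => ω.2 (Sum.inl i)))
              (MultiView.empRisk (MultiView.labels ω.1.1.1) (fun i => ω.2 (Sum.inr i)))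
              (1 / 2 * MultiView.empDistL1 (MultiView.labels ω.1.1.2.1)
                (MultiView.labels ω.1.1.1))
            ∂(MultiView.jointLaw μ algo enc dec)
  have hAB : ENNReal.ofReal (n * (A - B)) ≤
    MultiView.MDL μ algo enc Q + ENNReal.ofReal (Real.logb 2 n) := hgap
  calc ENNReal.ofReal A = ENNReal.ofReal (n * (A - B) / n + B) := by
        rw [mul_div_cancel_left₀ _ hn0.ne', sub_add_cancel]
    _ ≤ ENNReal.ofReal (n * (A - B) / n) + ENNReal.ofReal B := ENNReal.ofReal_add_le
    _ = ENNReal.ofReal (n * (A - B)) / n + ENNReal.ofReal B := by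
        rw [ENNReal.ofReal_div_of_pos hn0, ENNReal.ofReal_natCast]
    _ ≤ _ := by gcongr
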